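/- **Setting.** Let $f_0\in\mathbb C[x_1,\dots,x_n]$ be quasihomogeneous of type $(d;w_1,\dots,w_n)$ with positive integer weights and with an isolated singularity at $0$; put $w=\min_i w_i$ and write $|\alpha|=\sum_i w_i\alpha_i=\deg x^\alpha$. Let $\{x^\alpha\}_{\alpha\in B}$ be a monomial basis of the Milnor algebra $\mathbb C\{x\}/(\partial f_0/\partial x_1,\dots,\partial f_0/\partial x_n)$ and let $m_1,\dots,m_k$ be its upper monomials, $\{m_1,\dots,m_k\}=\{x^\alpha\mid \alpha\in B,\ |\alpha|>d\}$, numbered so that $m_k$ has the largest degree. Assume $k\ge 1$. Let $A_-=\mathbb C[t_1,\dots,t_k]$ with $\deg t_i=d-\deg m_i<0$, $T_-=\operatorname{Spec}A_-$, and $F(x,t)=f_0(x)+\sum_{i=1}^k t_im_i$, $F_t=F(\cdot,t)$. Let $A_-\{x\}$ be the ring of power series in $x$ with coefficients in $A_-$ that converge near $\{0\}\times T_-$, and let $s=\left[\frac{(n-1)d-2\sum w_i}{w}\right]$. *Tjurina strata.* For $m\in\mathbb Q$ let $H^m$ be the ideal generated by all quasihomogeneous polynomials in $x$ of degree $\ge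 mw$. Let $\tau_m(t)=\dim_{\mathbb C}\mathbb C\{x\}/(F_t,\partial F_t/\partial x_1,\dots,\partial F_t/\partial x_n,H^m)$, $\mu_m=\dim_{\mathbb C}\mathbb C\{x\}/(\partial f_0/\partial x_1,\dots,\partial f_0/\partial x_n,H^m)$, and $T^m=A_-\{x\}/(F,\partial F/\partial x_1,\dots,\partial F/\partial x_n,H^m)$. Put $\underline\tau(t)=(\tau_{d/w+1}(t),\dots,\tau_{d/w+s+1}(t))$, $\underline\mu=(\mu_{d/w+1},\dots,\mu_{d/w+s+1})$ and $\Sigma=\{\underline\mu-\underline\tau(t)\mid t\in\mathbb C^k\}\subset\mathbb N^{s+1}$. Let $T_-=\bigcup_{\underline r\in\Sigma}U_{\underline r}$ be the flattening stratification of the $A_-$-modules $T^{d/w+1},\dots,T^{d/w+s+1}$, where these modules have ranks $\underline\mu-\underline r$ on $U_{\underline r}$. Here the flattening stratification of finitely presented $A_-$-modules $M_i$ consists of the non-empty locally closed subschemes $U_{\underline e}\subset T_-$, indexed by rank vectors $\underline e$, such that a morphism $S\to T_-$ factors through $U_{\underline e}$ if and only if the pull-back of each $M_i$ to $S$ is flat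 of rank $e_i$. *Lie algebras.* Let $\mathcal L$ be the kernel of the Kodaira–Spencer map $\operatorname{Der}_{\mathbb C}A_-\to (x)A_-\{x\}/\big((F)+(x)(\partial F/\partial x_1,\dots,\partial F/\partial x_n)\big)$, $\delta\mapsto[\sum_i\delta(t_i)m_i]$, and let $L_+$ be the set of all vector fields in $\mathcal L$ of degree $\ge w$. Let $n_1,\dots,n_k\in A_-\{x\}$ be homogeneous elements such that, with $n_iF=\sum_jh_{ij}m_j$ in $A_-\{x\}/(\partial F/\partial x_1,\dots,\partial F/\partial x_n)$ and $\delta_i=\sum_jh_{ij}\,\partial/\partial t_j$, one has $h_{ij}=h_{k-j+1,k-i+1}$, each $\delta_i$ is homogeneous of degree $\deg n_i$, $\mathcal L=\sum_iA_-\delta_i$, and $\delta_1=\sum_i\deg(t_i)\,t_i\,\partial/\partial t_i$. (Part of the claim is that such $n_i$ exist.) Let $F^i(A_-)$ be the vector space generated by the quasihomogeneous polynomials of degree $>-(i+1)w$, and let $Z_i(L_+)$ be the Lie algebra generated by the homogeneous $\delta\in L_+$ with $\deg\delta\ge r_i:=\min\{\deg\delta_j\mid t_{k+1-j}\in F^{s-i}(A_-)\}$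 (with $\min\emptyset=\infty$, so that $Z_i(L_+)=0$ in that case). Finally let $d:A_-\to\operatorname{Hom}_{\mathbb C}(L_+,A_-)$, $d(a)(\delta)=\delta(a)$, and let $\pi_i:\operatorname{Hom}_{\mathbb C}(L_+,A_-)\to\operatorname{Hom}_{\mathbb C}(Z_i(L_+),A_-)$ be the restriction. **Lemma.** The flattening stratification $\{U_{\underline r}\}_{\underline r\in\Sigma}$ exists, and a point $t\in\mathbb C^k$ lies in $U_{\underline r}$ if and only if $\underline\tau(t)=\underline\mu-\underline r$. Moreover: 1. $(0,\dots,0)\in\Sigma$ and $(0,\dots,0,1)\in\Sigma$. As subschemes of $T_-$, $U_{(0,\dots,0)}=\{0\}$ is a smooth (reduced) point and $U_{(0,\dots,0,1)}$ is defined by $t_1=\cdots=t_{k-1}=0$, $t_k\ne0$. 2. Let $\bar\Sigma=\Sigma\setminus\{(0,\dots,0)\}$ and, for $\underline r\in\bar\Sigma$, put $\widetilde U_{\underline r}=U_{\underline r}$ if $\underline r\ne(0,\dots,0,1)$, and $\widetilde U_{(0,\dots,0,1)}=U_{(0,\dots,0,1)}\cup U_{(0,\dots,0)}$, that is, the axis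 $t_1=\cdots=t_{k-1}=0$. Then $\{\widetilde U_{\underline r}\}_{\underline r\in\bar\Sigma}$ is the flattening stratification of the family consisting of all the modules $\operatorname{Hom}_{\mathbb C}(L_+,A_-)/A_-\,dF^i(A_-)$, $i=1,2,\dots$, and $\operatorname{Hom}_{\mathbb C}(Z_j(L_+),A_-)/\pi_j(A_-\,dA_-)$, $j=1,\dots,s$, taken together. -/

import Mathlib

open CategoryTheory AlgebraicGeometry Topology TensorProduct

noncomputable section

namespace SQH

/-! ### Convergent power series -/

/-- Compact families of points at which the elements of a coefficient ring can be evaluated: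
`pts R` is the set of evaluations belonging to the radius `R`. -/
class EvalPoints (A : Type) [CommRing A] where
  pts : ℝ → Set (A →+* ℂ)
  bdd : ∀ (R : ℝ) (a : A), ∃ C : ℝ, ∀ φ ∈ pts R, ‖φ a‖ ≤ C

/-- Complex numbers are evaluated at the only point of `Spec ℂ`. -/
instance : EvalPoints ℂ where
  pts _ := {RingHom.id ℂ}
  bdd _ a := ⟨‖a‖, by rintro φ rfl; rfl⟩

/-- Polynomials in `t` are evaluated on the closed polydiscs `|t_i| ≤ R`. -/
instance (k : ℕ) : EvalPoints (MvPolynomial (Fin k) ℂ) where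
  pts R := {φ | ∃ t : Fin k → ℂ, ‖t‖ ≤ R ∧ φ = MvPolynomial.eval t}
  bdd R a := by
    have hc : IsCompact (Metric.closedBall (0 : Fin k → ℂ) R) := isCompact_closedBall _ _
    obtain ⟨C, hC⟩ := hc.exists_bound_of_continuousOn
      (f := fun t => MvPolynomial.eval t a) (MvPolynomial.continuous_eval a).continuousOn
    refine ⟨C, ?_⟩
    rintro φ ⟨t, ht, rfl⟩
    exact hC t (by simpa using ht)

/-- The formal power series `g = ∑ c_α x^α` over `A` converges near `x = 0`, along the whole
base: for every radius `R` there is `r > 0` such that `∑ c_α x^α` converges normally on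
`pts R × {|x_i| ≤ r}`. -/
def IsConvergent {n : ℕ} {A : Type} [CommRing A] [EvalPoints A]
    (g : MvPowerSeries (Fin n) A) : Prop :=
  ∀ R : ℝ, ∃ r : ℝ, 0 < r ∧ ∃ b : (Fin n →₀ ℕ) → ℝ, Summable b ∧
    ∀ α, ∀ φ ∈ EvalPoints.pts (A := A) R,
      ‖φ (MvPowerSeries.coeff α g)‖ * r ^ α.degree ≤ b α

section Closure

variable {n : ℕ} {A : Type} [CommRing A] [EvalPoints A]

lemma IsConvergent.of_finite {g : MvPowerSeries (Fin n) A}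
    (hg : {α | MvPowerSeries.coeff α g ≠ 0}.Finite) : IsConvergent g := by
  classical
  intro R
  choose C hC using fun a : A => EvalPoints.bdd R a
  refine ⟨1, one_pos, fun α => if MvPowerSeries.coeff α g = 0 then 0
    else C (MvPowerSeries.coeff α g), ?_, ?_⟩
  · refine summable_of_hasFiniteSupport (hg.subset ?_)
    intro α hα h0
    exact hα (by simp [h0])
  · intro α φ hφ
    by_cases h : MvPowerSeries.coeff α g = 0
    · simp [h]
    · simpa [h] using hC _ φ hφ

lemma IsConvergent.add {g h : MvPowerSeries (Fin n) A} (hg : IsConvergent g)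
    (hh : IsConvergent h) : IsConvergent (g + h) := by
  intro R
  obtain ⟨r₁, hr₁, b₁, hb₁, H₁⟩ := hg R
  obtain ⟨r₂, hr₂, b₂, hb₂, H₂⟩ := hh R
  refine ⟨min r₁ r₂, lt_min hr₁ hr₂, _, hb₁.add hb₂, ?_⟩
  intro α φ hφ
  have h0 : (0 : ℝ) ≤ min r₁ r₂ := (lt_min hr₁ hr₂).le
  calc ‖φ (MvPowerSeries.coeff α (g + h))‖ * min r₁ r₂ ^ α.degree
      ≤ (‖φ (MvPowerSeries.coeff α g)‖ + ‖φ (MvPowerSeries.coeff α h)‖)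
          * min r₁ r₂ ^ α.degree := by
        rw [map_add, map_add]; gcongr; exact norm_add_le _ _
    _ = ‖φ (MvPowerSeries.coeff α g)‖ * min r₁ r₂ ^ α.degree
          + ‖φ (MvPowerSeries.coeff α h)‖ * min r₁ r₂ ^ α.degree := by ring
    _ ≤ ‖φ (MvPowerSeries.coeff α g)‖ * r₁ ^ α.degree
          + ‖φ (MvPowerSeries.coeff α h)‖ * r₂ ^ α.degree := by
        gcongr
        · exact min_le_left _ _
        · exact min_le_right _ _
    _ ≤ b₁ α + b₂ α := add_le_add (H₁ α φ hφ) (H₂ α φ hφ)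

lemma IsConvergent.mul {g h : MvPowerSeries (Fin n) A} (hg : IsConvergent g)
    (hh : IsConvergent h) : IsConvergent (g * h) := by
  intro R
  obtain ⟨r₁, hr₁, b₁, hb₁, H₁⟩ := hg R
  obtain ⟨r₂, hr₂, b₂, hb₂, H₂⟩ := hh R
  have hab : Summable fun x : (Fin n →₀ ℕ) × (Fin n →₀ ℕ) => |b₁ x.1| * |b₂ x.2| :=
    hb₁.abs.mul_of_nonneg hb₂.abs (fun _ => abs_nonneg _) (fun _ => abs_nonneg _)
  have hs : Summable fun α : Fin n →₀ ℕ =>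
      ∑ p ∈ Finset.HasAntidiagonal.antidiagonal α, |b₁ p.1| * |b₂ p.2| :=
    summable_sum_mul_antidiagonal_of_summable_mul
      (f := fun α => |b₁ α|) (g := fun α => |b₂ α|) hab
  refine ⟨min r₁ r₂, lt_min hr₁ hr₂,
    fun α => ∑ p ∈ Finset.HasAntidiagonal.antidiagonal α, |b₁ p.1| * |b₂ p.2|, hs, ?_⟩
  intro α φ hφ
  have h0 : (0 : ℝ) ≤ min r₁ r₂ := (lt_min hr₁ hr₂).le
  rw [MvPowerSeries.coeff_mul, map_sum]
  set ρ : ℝ := min r₁ r₂ with hρ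
  have hρ1 : ρ ≤ r₁ := min_le_left _ _
  have hρ2 : ρ ≤ r₂ := min_le_right _ _
  have key : ∀ p ∈ Finset.HasAntidiagonal.antidiagonal α,
      ‖φ (MvPowerSeries.coeff p.1 g * MvPowerSeries.coeff p.2 h)‖ * ρ ^ α.degree ≤
        |b₁ p.1| * |b₂ p.2| := by
    intro p hp
    have hd : α.degree = p.1.degree + p.2.degree := by
      rw [← Finset.HasAntidiagonal.mem_antidiagonal.mp hp, map_add]
    have h1 : ‖φ (MvPowerSeries.coeff p.1 g)‖ * ρ ^ p.1.degree ≤ |b₁ p.1| :=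
      (mul_le_mul_of_nonneg_left (pow_le_pow_left₀ h0 hρ1 _) (norm_nonneg _)).trans
        ((H₁ p.1 φ hφ).trans (le_abs_self _))
    have h2 : ‖φ (MvPowerSeries.coeff p.2 h)‖ * ρ ^ p.2.degree ≤ |b₂ p.2| :=
      (mul_le_mul_of_nonneg_left (pow_le_pow_left₀ h0 hρ2 _) (norm_nonneg _)).trans
        ((H₂ p.2 φ hφ).trans (le_abs_self _))
    rw [hd, pow_add, map_mul, norm_mul, mul_mul_mul_comm]
    exact mul_le_mul h1 h2 (mul_nonneg (norm_nonneg _) (pow_nonneg h0 _)) (abs_nonneg _)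
  refine (mul_le_mul_of_nonneg_right (norm_sum_le _ _) (pow_nonneg h0 _)).trans ?_
  rw [Finset.sum_mul]
  exact Finset.sum_le_sum key

lemma isConvergent_C (a : A) : IsConvergent (MvPowerSeries.C a : MvPowerSeries (Fin n) A) := by
  classical
  refine .of_finite ((Set.finite_singleton (0 : Fin n →₀ ℕ)).subset fun α hα => ?_)
  by_contra h
  rw [Set.mem_singleton_iff] at h
  exact hα (by rw [MvPowerSeries.coeff_C, if_neg h])

lemma isConvergent_X (i : Fin n) : IsConvergent (MvPowerSeries.X i : MvPowerSeries (Fin n) A) := by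
  classical
  refine .of_finite ((Set.finite_singleton (Finsupp.single i 1)).subset fun α hα => ?_)
  by_contra h
  rw [Set.mem_singleton_iff] at h
  exact hα (by rw [MvPowerSeries.coeff_X, if_neg h])

end Closure

/-- The convergent power series form a subalgebra of all formal power series. -/
def convSubalgebra (n : ℕ) (A : Type) [CommRing A] [EvalPoints A] :
    Subalgebra A (MvPowerSeries (Fin n) A) where
  carrier := {g | IsConvergent g}
  mul_mem' hg hh := hg.mul hh
  add_mem' hg hh := hg.add hh
  algebraMap_mem' a := isConvergent_C a

/-- The ring `A{x}` of convergent power series in `x = (x_1, …, x_n)`.  For `A = ℂ` this is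
`ℂ{x}`; for `A = ℂ[t]` it consists of the power series in `x` with coefficients in `ℂ[t]` that
converge in a neighbourhood of `{0} × T_-`, where `T_- = Spec ℂ[t]`. -/
def Conv (n : ℕ) (A : Type) [CommRing A] [EvalPoints A] : Type := convSubalgebra n A

instance (n : ℕ) (A : Type) [CommRing A] [EvalPoints A] : CommRing (Conv n A) :=
  inferInstanceAs (CommRing (convSubalgebra n A))

instance (n : ℕ) (A : Type) [CommRing A] [EvalPoints A] : Algebra A (Conv n A) :=
  inferInstanceAs (Algebra A (convSubalgebra n A))

/-- The inclusion of `A{x}` into the ring of formal power series. -/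
def Conv.toSeries {n : ℕ} {A : Type} [CommRing A] [EvalPoints A] :
    Conv n A →ₐ[A] MvPowerSeries (Fin n) A :=
  (convSubalgebra n A).val

/-- A polynomial in `x` as a convergent power series. -/
def toConv (n : ℕ) (A : Type) [CommRing A] [EvalPoints A] :
    MvPolynomial (Fin n) A →ₐ[A] Conv n A :=
  MvPolynomial.aeval (S₁ := Conv n A) fun i =>
    (⟨MvPowerSeries.X i, isConvergent_X i⟩ : convSubalgebra n A)

/-- The ideal of `A{x}` generated by the partial derivatives `∂g/∂x_i`. -/
def jacobianIdeal {n : ℕ} {A : Type} [CommRing A] [EvalPoints A] (g : MvPolynomial (Fin n) A) :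
    Ideal (Conv n A) :=
  Ideal.span (Set.range fun i => toConv n A (MvPolynomial.pderiv i g))

/-- The ideal of `A{x}` generated by all quasihomogeneous polynomials (in `x`, for the weights
`w`) of degree `≥ c`. -/
def degIdeal {n : ℕ} (A : Type) [CommRing A] [EvalPoints A] (w : Fin n → ℕ) (c : ℚ) :
    Ideal (Conv n A) :=
  Ideal.span {g | ∃ (p : MvPolynomial (Fin n) A) (e : ℕ),
    c ≤ (e : ℚ) ∧ p.IsWeightedHomogeneous w e ∧ g = toConv n A p}

/-! ### Flattening stratifications -/

section Flattening

variable {A : Type} [CommRing A]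

/-- The morphism `Spec B ⟶ Spec A` given by `φ` factors through the subscheme `U` of `Spec A`. -/
def Factors (U : Over (Spec (CommRingCat.of A))) {B : Type} [CommRing B] (φ : A →+* B) : Prop :=
  ∃ g : Spec (CommRingCat.of B) ⟶ U.left, g ≫ U.hom = Spec.map (CommRingCat.ofHom φ)

/-- The locally closed subschemes `U l` (`l : Λ`) of `Spec A` are the strata of the flattening
stratification of the (finitely presented) `A`-modules `M i` (`i : ι`), where `M i` has rank
`rk l i` on `U l`: they are non-empty, they cover `Spec A`, different strata belong to different
ranks, and `U l` is universal among the schemes over `Spec A` to which all `M i` pull back to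
flat modules, of rank `rk l i`. -/
structure IsFlatteningStratification {Λ ι : Type} (U : Λ → Over (Spec (CommRingCat.of A)))
    (M : ι → ModuleCat.{0} A) (rk : Λ → ι → ℕ) : Prop where
  immersion : ∀ l, IsImmersion (U l).hom
  nonempty : ∀ l, Nonempty (U l).left
  cover : ∀ p : Spec (CommRingCat.of A), ∃ l, p ∈ Set.range (U l).hom
  rk_injective : Function.Injective rk
  universal : ∀ (l : Λ) (B : Type) [CommRing B] [Algebra A B],
    Factors (U l) (algebraMap A B) ↔
      ∀ i, Module.Flat B (B ⊗[A] M i) ∧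
        ∀ p : PrimeSpectrum B, Module.rankAtStalk (R := B) (B ⊗[A] M i) p = rk l i

end Flattening

/-! ### The semiuniversal family of negative weight -/

/-- A quasihomogeneous polynomial `f₀` of type `(d; w_1, …, w_n)` with isolated singularity, a
monomial basis `x^α`, `α ∈ B`, of its Milnor algebra and the upper monomials
`m_1, …, m_k` of this basis (those of degree `> d`), indexed by `Fin k` such that the last one has
the largest degree. -/
structure Setup (n k : ℕ) where
  d : ℕ
  w : Fin n → ℕ
  w_pos : ∀ i, 0 < w i
  f₀ : MvPolynomial (Fin n) ℂ
  f₀_quasihomogeneous : f₀.IsWeightedHomogeneous w d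
  f₀_isolated : ∀ᶠ x in 𝓝[≠] (0 : Fin n → ℂ), ∃ i,
    MvPolynomial.eval x (MvPolynomial.pderiv i f₀) ≠ 0
  B : Finset (Fin n →₀ ℕ)
  B_linearIndependent : LinearIndependent ℂ fun α : B =>
    Ideal.Quotient.mk (jacobianIdeal f₀) (toConv n ℂ (MvPolynomial.monomial α.1 1))
  B_span : Submodule.span ℂ (Set.range fun α : B =>
    Ideal.Quotient.mk (jacobianIdeal f₀) (toConv n ℂ (MvPolynomial.monomial α.1 1))) = ⊤
  m : Fin k → (Fin n →₀ ℕ)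
  m_injective : Function.Injective m
  m_range : ∀ α, α ∈ Set.range m ↔ α ∈ B ∧ d < Finsupp.weight w α
  m_last : ∀ i j : Fin k, j.val + 1 = k →
    Finsupp.weight w (m i) ≤ Finsupp.weight w (m j)

/-- The coordinate ring `A_- = ℂ[t_1, …, t_k]` of `T_-`. -/
abbrev Aneg (k : ℕ) : Type := MvPolynomial (Fin k) ℂ

namespace Setup

variable {n k : ℕ} (D : Setup n k)

/-- `w = min {w_1, …, w_n}`. -/
def wmin : ℕ := ⨅ i, D.w i

/-- The weight `w(t_i) = d - deg m_i` of `t_i`. -/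
def wt (i : Fin k) : ℤ := (D.d : ℤ) - (Finsupp.weight D.w (D.m i) : ℕ)

/-- `F(x,t) = f₀(x) + ∑ t_i m_i`, as a polynomial in `x` over `A_-`. -/
def F : MvPolynomial (Fin n) (Aneg k) :=
  MvPolynomial.map MvPolynomial.C D.f₀ +
    ∑ i, MvPolynomial.monomial (D.m i) (MvPolynomial.X i)

/-- `F_t(x) = F(x,t)` for a fixed point `t ∈ T_- = ℂ^k`. -/
def Fat (t : Fin k → ℂ) : MvPolynomial (Fin n) ℂ :=
  MvPolynomial.map (MvPolynomial.eval t) D.F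

/-- The number `s = [((n-1)d - 2 ∑ w_i) / w]`. -/
def s : ℕ := ((((n : ℤ) - 1) * D.d - 2 * ∑ i, (D.w i : ℤ)) / (D.wmin : ℤ)).toNat

/-! ### The Hilbert function of the Tjurina algebra -/

/-- The ideal `H^m` of `A{x}`, generated by the quasihomogeneous polynomials of degree `≥ m w`;
the index `m` is a rational number. -/
def H (A : Type) [CommRing A] [EvalPoints A] (m : ℚ) : Ideal (Conv n A) :=
  degIdeal A D.w (m * D.wmin)

/-- `τ_m(t) = dim ℂ{x} / (F_t, ∂F_t/∂x_1, …, ∂F_t/∂x_n, H^m)`. -/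
def tau (m : ℚ) (t : Fin k → ℂ) : ℕ :=
  Module.finrank ℂ (Conv n ℂ ⧸
    (Ideal.span {toConv n ℂ (D.Fat t)} ⊔ jacobianIdeal (D.Fat t) ⊔ D.H ℂ m))

/-- `μ_m = dim ℂ{x} / (∂f₀/∂x_1, …, ∂f₀/∂x_n, H^m)`. -/
def mu (m : ℚ) : ℕ :=
  Module.finrank ℂ (Conv n ℂ ⧸ (jacobianIdeal D.f₀ ⊔ D.H ℂ m))

/-- The relevant indices `d/w + 1, …, d/w + s + 1`. -/
def idx (i : Fin (D.s + 1)) : ℚ := (D.d : ℚ) / D.wmin + ((i : ℕ) + 1 : ℕ)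

/-- `μ - τ(t) = r` for the vectors of values at the indices `d/w + 1, …, d/w + s + 1`. -/
def HasJump (t : Fin k → ℂ) (r : Fin (D.s + 1) → ℕ) : Prop :=
  ∀ i, D.tau (D.idx i) t + r i = D.mu (D.idx i)

/-- The set `Σ` of all vectors `μ - τ(t)`, `t ∈ T_-`. -/
def Sig : Set (Fin (D.s + 1) → ℕ) := {r | ∃ t, D.HasJump t r}

/-- The vector `(0, …, 0, 1)`. -/
def rOne : Fin (D.s + 1) → ℕ := Pi.single (Fin.last D.s) 1

/-- The `A_-`-module `T^m = A_-{x} / (F, ∂F/∂x_1, …, ∂F/∂x_n, H^m)`. -/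
def T (m : ℚ) : ModuleCat.{0} (Aneg k) :=
  ModuleCat.of (Aneg k) (Conv n (Aneg k) ⧸
    (Ideal.span {toConv n (Aneg k) D.F} ⊔ jacobianIdeal D.F ⊔ D.H (Aneg k) m))

/-! ### The Kodaira–Spencer map and the Lie algebras -/

/-- The upper monomial `m_i` as an element of `A_-{x}`. -/
def mono (i : Fin k) : Conv n (Aneg k) :=
  toConv n (Aneg k) (MvPolynomial.monomial (D.m i) 1)

/-- The ideal `(F) + (x)(∂F/∂x_1, …, ∂F/∂x_n)` of `A_-{x}`. -/
def ksIdeal : Ideal (Conv n (Aneg k)) :=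
  Ideal.span {toConv n (Aneg k) D.F} ⊔
    Ideal.span (Set.range fun i => toConv n (Aneg k) (MvPolynomial.X i)) * jacobianIdeal D.F

/-- The Kodaira–Spencer map `δ ↦ class(δ F) = class(∑ δ(t_i) m_i)`.  Its values lie in
`(x)A_-{x} / ((F) + (x)(∂F/∂x))`. -/
def kodairaSpencer :
    Derivation ℂ (Aneg k) (Aneg k) →ₗ[Aneg k] (Conv n (Aneg k) ⧸ D.ksIdeal) where
  toFun δ := ∑ i, δ (MvPolynomial.X i) • Ideal.Quotient.mk D.ksIdeal (D.mono i)
  map_add' δ ε := by simp [add_smul, Finset.sum_add_distrib]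
  map_smul' a δ := by simp [mul_smul, Finset.smul_sum]

/-- The kernel `𝓛` of the Kodaira–Spencer map. -/
def calL : Submodule (Aneg k) (Derivation ℂ (Aneg k) (Aneg k)) :=
  LinearMap.ker D.kodairaSpencer

/-- The vector field `δ` is homogeneous of degree `e`. -/
def HomogVF (δ : Derivation ℂ (Aneg k) (Aneg k)) (e : ℤ) : Prop :=
  ∀ j, (δ (MvPolynomial.X j)).IsWeightedHomogeneous D.wt (e + D.wt j)

/-- `L_+`: all vector fields of `𝓛` of degree `≥ w`, that is, all monomials of the coefficient
`δ(t_j)` have degree at least `w + deg t_j`. -/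
def Lplus : Submodule ℂ (Derivation ℂ (Aneg k) (Aneg k)) where
  carrier := {δ | δ ∈ D.calL ∧ ∀ j, ∀ β : Fin k →₀ ℕ,
    MvPolynomial.coeff β (δ (MvPolynomial.X j)) ≠ 0 →
      (D.wmin : ℤ) + D.wt j ≤ Finsupp.weight D.wt β}
  zero_mem' := ⟨D.calL.zero_mem, fun j β h => absurd (by simp) h⟩
  add_mem' := by
    rintro δ ε ⟨h₁, h₂⟩ ⟨h₃, h₄⟩
    refine ⟨D.calL.add_mem h₁ h₃, fun j β h => ?_⟩
    by_cases h0 : MvPolynomial.coeff β (δ (MvPolynomial.X j)) = 0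
    · refine h₄ j β fun h1 => h ?_
      simp [h0, h1]
    · exact h₂ j β h0
  smul_mem' := by
    rintro c δ ⟨h₁, h₂⟩
    refine ⟨?_, fun j β h => h₂ j β fun h0 => h ?_⟩
    · have h := D.calL.smul_mem (MvPolynomial.C c) h₁
      have e : (MvPolynomial.C c : Aneg k) • δ = c • δ := by
        ext j
        simp [MvPolynomial.smul_eq_C_mul]
      rwa [e] at h
    · simp [h0]

/-- `F^i(A_-)`: the vector space generated by the quasihomogeneous polynomials of degree
`> -(i+1)w`. -/
def Fil (i : ℤ) : Submodule ℂ (Aneg k) :=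
  Submodule.span ℂ {p | ∃ e : ℤ, -(i + 1) * (D.wmin : ℤ) < e ∧ p.IsWeightedHomogeneous D.wt e}

/-- The Milnor algebra `I = A_-{x} / (∂F/∂x_1, …, ∂F/∂x_n)` of the family. -/
abbrev Mil : Type := Conv n (Aneg k) ⧸ jacobianIdeal D.F

/-- The vector field `∑_j h_{ij} ∂/∂t_j`. -/
def rowVF (h : Matrix (Fin k) (Fin k) (Aneg k)) (i : Fin k) :
    Derivation ℂ (Aneg k) (Aneg k) :=
  MvPolynomial.mkDerivation ℂ (h i)

/-- Homogeneous elements `n_1, …, n_k` of `A_-{x}` (of degrees `ν_1, …, ν_k`) such that, writing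
`n_i F = ∑_j h_{ij} m_j` in the Milnor algebra of the family and `δ_i = ∑_j h_{ij} ∂/∂t_j`, the
matrix `h` satisfies `h_{ij} = h_{k-j+1,k-i+1}`, the `δ_i` are homogeneous of degree `ν_i` and
generate `𝓛`, and `δ_1` is the Euler vector field. -/
structure IsSymmetricSystem [NeZero k] (N : Fin k → Conv n (Aneg k)) (ν : Fin k → ℤ)
    (h : Matrix (Fin k) (Fin k) (Aneg k)) : Prop where
  homogeneous : ∀ i α, (MvPowerSeries.coeff α (Conv.toSeries (N i))).IsWeightedHomogeneous D.wt
    (ν i - (Finsupp.weight D.w α : ℕ))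
  mul_F : ∀ i, (Ideal.Quotient.mk (jacobianIdeal D.F) (N i * toConv n (Aneg k) D.F) : D.Mil) =
    ∑ j, h i j • Ideal.Quotient.mk (jacobianIdeal D.F) (D.mono j)
  symmetric : ∀ i j, h i j = h j.rev i.rev
  homogVF : ∀ i, D.HomogVF (rowVF h i) (ν i)
  generate : Submodule.span (Aneg k) (Set.range (rowVF h)) = D.calL
  euler : rowVF h 0 = MvPolynomial.mkDerivation ℂ fun j => (D.wt j : Aneg k) * MvPolynomial.X j

/-- `Z_i(L_+)`: the Lie algebra generated by the homogeneous `δ ∈ L_+` of degree `≥ r_i`, where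
`r_i = min {deg δ_j | t_{k+1-j} ∈ F^{s-i}(A_-)}` and `deg δ_j = ν_j` (if there is no such `j`,
then `r_i = ∞` and `Z_i(L_+) = 0`). -/
def Z (ν : Fin k → ℤ) (i : ℕ) : Submodule ℂ (Derivation ℂ (Aneg k) (Aneg k)) :=
  (LieSubalgebra.lieSpan ℂ (Derivation ℂ (Aneg k) (Aneg k))
    {δ | δ ∈ D.Lplus ∧ ∃ e : ℤ, D.HomogVF δ e ∧
      ∃ j : Fin k, (MvPolynomial.X j.rev : Aneg k) ∈ D.Fil ((D.s : ℤ) - i) ∧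
        ν j ≤ e}).toSubmodule

end Setup

/-- The differential `d : A_- → Hom_ℂ(W, A_-)`, `d(a)(δ) = δ(a)`. -/
def diff {k : ℕ} (W : Submodule ℂ (Derivation ℂ (Aneg k) (Aneg k))) (a : Aneg k) :
    W →ₗ[ℂ] Aneg k where
  toFun δ := δ.1 a
  map_add' _ _ := rfl
  map_smul' _ _ := rfl

/-- The `A_-`-module `Hom_ℂ(W, A_-) / A_- d(S)`.  If `W` lies in `L_+` and `π` is the restriction
`Hom_ℂ(L_+, A_-) → Hom_ℂ(W, A_-)`, then `π ∘ d` is the differential of `W`, so that `A_- d(S)` is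
`π(A_- d(S))`. -/
def homMod {k : ℕ} (W : Submodule ℂ (Derivation ℂ (Aneg k) (Aneg k))) (S : Set (Aneg k)) :
    ModuleCat.{0} (Aneg k) :=
  ModuleCat.of (Aneg k) ((W →ₗ[ℂ] Aneg k) ⧸ Submodule.span (Aneg k) (diff W '' S))

namespace Setup

variable {n k : ℕ} (D : Setup n k)

/-- The modules `Hom_ℂ(L_+, A_-) / A_- dF^i(A_-)`, `i = 1, 2, …`, and
`Hom_ℂ(Z_j(L_+), A_-) / π_j(A_- dA_-)`, `j = 1, …, s`. -/
def homFamily (ν : Fin k → ℤ) : ℕ ⊕ Fin D.s → ModuleCat.{0} (Aneg k) :=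
  Sum.elim (fun i => homMod D.Lplus (D.Fil ((i + 1 : ℕ) : ℤ)))
    (fun j => homMod (D.Z ν (j.val + 1)) Set.univ)

end Setup

/-! ### Explicit subschemes of `T_-` -/

/-- The reduced point `0` of `T_- = Spec A_-`. -/
def originSub (k : ℕ) : Over (Spec (CommRingCat.of (Aneg k))) :=
  Over.mk (Spec.map (CommRingCat.ofHom (MvPolynomial.eval (0 : Fin k → ℂ))))

/-- The ideal `(t_1, …, t_{k-1})`. -/
def axisIdeal (k : ℕ) : Ideal (Aneg k) :=
  Ideal.span {p | ∃ i : Fin k, i.val + 1 < k ∧ p = MvPolynomial.X i}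

/-- The closed subscheme `t_1 = ⋯ = t_{k-1} = 0` of `T_-`. -/
def axisSub (k : ℕ) : Over (Spec (CommRingCat.of (Aneg k))) :=
  Over.mk (Spec.map (CommRingCat.ofHom (Ideal.Quotient.mk (axisIdeal k))))

/-- The locally closed subscheme `t_1 = ⋯ = t_{k-1} = 0`, `t_k ≠ 0` of `T_-`. -/
def puncturedAxisSub (k : ℕ) [NeZero k] : Over (Spec (CommRingCat.of (Aneg k))) :=
  Over.mk (Spec.map (CommRingCat.ofHom
    (algebraMap (Aneg k) (Localization.Away
      (Ideal.Quotient.mk (axisIdeal k) (MvPolynomial.X (Fin.rev 0)))))))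

open Classical in
/-- The merged strata: `Ũ_r = U_r` for `r ≠ (0, …, 0, 1)`, and `Ũ_{(0, …, 0, 1)}` is the axis
`t_1 = ⋯ = t_{k-1} = 0`, the union of `t_1 = ⋯ = t_{k-1} = 0 ≠ t_k` and the origin. -/
def mergedStrata {n k : ℕ} (D : Setup n k)
    (U : D.Sig → Over (Spec (CommRingCat.of (Aneg k))))
    (r : (D.Sig \ {0} : Set (Fin (D.s + 1) → ℕ))) : Over (Spec (CommRingCat.of (Aneg k))) :=
  if r.1 = D.rOne then axisSub k else U ⟨r.1, r.2.1⟩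

end SQH

end

open CategoryTheory AlgebraicGeometry Topology TensorProduct

noncomputable section

set_option linter.unusedSectionVars false

namespace SQH

/-! ### Matrices of constant rank -/

section ConstRank

variable {m n l : Type} [Fintype m] [Fintype n] [Fintype l] {B : Type} [CommRing B]

/-! All modules in question are cokernels of matrices cut out of a single k × k matrix `h` over A_-,
whose rows are the generators δ_l of 𝓛. Both stratifications prescribe ranks of blocks of `h`, and
the proof compares these blocks.

Milnor algebra. The monomial basis makes ℂ{x}/(∂f₀) finite-dimensional, so the partial derivatives
of f₀ have only Koszul syzygies, and the socle is spanned by the Hessian (`isCompleteIntersection`).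
Since F_t - f₀ has weights > d, comparing leading parts shows that over every ℂ-algebra the Milnor
algebra of F_t is free on the same monomials x^α (`independent_modulo`, `isReducible_monomial`,
`bijective_mkQ_basisPoly`). By Euler's formula and deg t_j < 0, a multiple of F reduces to upper
monomials only, and the coefficient vectors that occur are exactly those of 𝓛 (`mem_calL_iff`).
Hence the module T^m with m = d/w + i + 1 is the cokernel of `h` restricted to the columns with deg
m_j < d + (i+1)w (`isRowCokernel_tjGen`). With the other columns replaced by zero this is
`jumpMatrix h φ i`.

Flatness. The cokernel of a matrix is flat of given rank after base change if and only if the matrix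
has a generalized inverse and constant rank, equivalently if the minors of size r + 1 vanish and
those of size r generate the unit ideal (`IsRowCokernel.flat_rank_iff`, `constRank_iff_minorRank`).
This gives locally closed strata. By the Nullstellensatz every rank vector at a prime already occurs
at a closed point (`exists_mem_Sig`), so that Σ indexes all strata.

Symmetry. The coefficient of the socle monomial is a perfect pairing on the Milnor algebra of the
family: its Gram determinant is homogeneous and nonzero at t = 0, hence a nonzero constant. Elements
dual to the upper monomials serve as the n_i, and d·h_ij becomes the socle coefficient of n_i
n_{k+1-j} F, whence the symmetry (`exists_isSymmetricSystem`).

Hom modules. The generators of degree ≥ w are all the δ_l except the Euler field δ_1, because the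
socle degree exceeds every other deg m_j by at least w. So Hom(L_+, A_-)/A_- dF^i is presented by
the level-i columns of `h` without the Euler row. The space Z_j(L_+) corresponds to a set of rows,
and symmetry turns these rows into the columns of level s - j; thus the Z-modules see `jumpMatrix h
φ i` for i = 0, …, s - 1. For this 𝓛 must be closed under brackets (`lie_mem_calL`).

Comparison. By degree, an entry of a row l ≠ 0 at level i lies in the ideal of the variables of
level i - 1 (`map_eq_zero`). At the first level i₀ with r_{i₀} ≠ 0 only the Euler row survives, its
entries generate the unit ideal, and at all levels ≥ i₀ it splits off and contributes exactly one to
the rank (`exists_mulVec_eq`, `constRank_succ_iff`). If i₀ < s, the two sets of rank conditions are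
therefore equivalent (`inHomStratum_iff`). The remaining vectors are 0 and (0, …, 0, 1): on the last
axis nothing but the Euler row is left, so the Hom family sees the whole axis as one stratum
(`inHomStratum_rOne_iff`). -/

/-- The matrix `E` has a generalized inverse, and rank `r` at all points of `Spec B`. -/
structure ConstRank (E : Matrix m n B) (r : ℕ) : Prop where
  regular : ∃ G : Matrix n m B, E * G * E = E
  rank_eq : ∀ p : PrimeSpectrum B,
    (E.map (algebraMap B p.asIdeal.ResidueField)).rank = r

lemma ConstRank.transpose {E : Matrix m n B} {r : ℕ} (h : ConstRank E r) :
    ConstRank E.transpose r := by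
  obtain ⟨G, hG⟩ := h.regular
  refine ⟨⟨G.transpose, ?_⟩, fun p => ?_⟩
  · rw [← Matrix.transpose_mul, ← Matrix.transpose_mul, ← Matrix.mul_assoc, hG]
  · rw [Matrix.transpose_map, Matrix.rank_transpose, h.rank_eq p]

lemma constRank_transpose_iff {E : Matrix m n B} {r : ℕ} :
    ConstRank E.transpose r ↔ ConstRank E r :=
  ⟨fun h => by simpa using h.transpose, fun h => h.transpose⟩

/-- Each matrix is a left multiple of the other, so the row modules agree, and a generalized inverse
of one yields one of the other. This allows a change of generating relations even if the numbers of
generators differ. -/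
lemma ConstRank.of_rows {E₁ : Matrix m n B} {E₂ : Matrix l n B} {C : Matrix m l B}
    {C' : Matrix l m B} (h₁ : E₁ = C * E₂) (h₂ : E₂ = C' * E₁) {r : ℕ} (h : ConstRank E₂ r) :
    ConstRank E₁ r := by
  obtain ⟨G, hG⟩ := h.regular
  refine ⟨⟨G * C', ?_⟩, fun p => ?_⟩
  · calc E₁ * (G * C') * E₁ = E₁ * G * (C' * E₁) := by simp only [Matrix.mul_assoc]
      _ = C * (E₂ * G * E₂) := by rw [← h₂]; conv_lhs => rw [h₁]
                                  simp only [Matrix.mul_assoc]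
      _ = E₁ := by rw [hG, ← h₁]
  · rw [← h.rank_eq p]
    apply le_antisymm
    · conv_lhs => rw [h₁]
      rw [Matrix.map_mul]
      exact Matrix.rank_mul_le_right _ _
    · conv_lhs => rw [h₂]
      rw [Matrix.map_mul]
      exact Matrix.rank_mul_le_right _ _

lemma constRank_iff_of_rows {E₁ : Matrix m n B} {E₂ : Matrix l n B} {C : Matrix m l B}
    {C' : Matrix l m B} (h₁ : E₁ = C * E₂) (h₂ : E₂ = C' * E₁) {r : ℕ} :
    ConstRank E₁ r ↔ ConstRank E₂ r :=
  ⟨fun h => h.of_rows h₂ h₁, fun h => h.of_rows h₁ h₂⟩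

lemma constRank_iff_of_cols {E₁ : Matrix n m B} {E₂ : Matrix n l B} {C : Matrix l m B}
    {C' : Matrix m l B} (h₁ : E₁ = E₂ * C) (h₂ : E₂ = E₁ * C') {r : ℕ} :
    ConstRank E₁ r ↔ ConstRank E₂ r := by
  rw [← constRank_transpose_iff (E := E₁), ← constRank_transpose_iff (E := E₂)]
  exact constRank_iff_of_rows (C := C.transpose) (C' := C'.transpose)
    (by rw [← Matrix.transpose_mul, ← h₁]) (by rw [← Matrix.transpose_mul, ← h₂])

lemma constRank_submatrix_iff {m' n' : Type} [Fintype m'] [Fintype n'] (E : Matrix m n B)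
    (e : m' ≃ m) (f : n' ≃ n) {r : ℕ} : ConstRank (E.submatrix e f) r ↔ ConstRank E r := by
  have key : ∀ {m n m' n' : Type} [Fintype m] [Fintype n] [Fintype m'] [Fintype n']
      (E : Matrix m n B) (e : m' ≃ m) (f : n' ≃ n), ConstRank E r →
      ConstRank (E.submatrix e f) r := by
    intro m n m' n' _ _ _ _ E e f h
    obtain ⟨G, hG⟩ := h.regular
    refine ⟨⟨G.submatrix f e, ?_⟩, fun p => ?_⟩
    · rw [Matrix.submatrix_mul_equiv, Matrix.submatrix_mul_equiv, hG]
    · rw [← Matrix.submatrix_map, Matrix.rank_submatrix, h.rank_eq p]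
  refine ⟨fun h => ?_, key E e f⟩
  have := key _ e.symm f.symm h
  simpa using this

lemma constRank_zero : ConstRank (0 : Matrix m n B) 0 :=
  ⟨⟨0, by simp⟩, fun p => by
    rw [Matrix.map_zero _ (map_zero _)]; exact Matrix.rank_zero⟩

/-- Splitting off a row `i₀` which is unimodular modulo the other rows. -/
lemma constRank_succ_iff [DecidableEq m] (E : Matrix m n B) (i₀ : m) (y : n → B)
    (hy : E.mulVec y = Pi.single i₀ 1) (r : ℕ) :
    ConstRank E (r + 1) ↔ ConstRank (E.updateRow i₀ 0) r := by
  classical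
  set E' := E.updateRow i₀ 0 with hE'
  set e : n → B := E i₀ with he
  have hEe : E = E' + Matrix.vecMulVec (Pi.single i₀ 1) e := by
    ext i j
    by_cases h : i = i₀
    · subst h; simp [hE', he, Matrix.vecMulVec_apply]
    · simp [hE', Matrix.vecMulVec_apply, h]
  set P : Matrix m m B := Matrix.diagonal fun i => if i = i₀ then 0 else 1 with hP
  have hPE : E' = P * E := by
    ext i j
    by_cases h : i = i₀
    · subst h; simp [hE', hP, Matrix.diagonal_mul]
    · simp [hE', hP, Matrix.diagonal_mul, h]
  have hPP : P * E' = E' := by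
    ext i j
    by_cases h : i = i₀
    · subst h; simp [hE', hP, Matrix.diagonal_mul]
    · simp [hE', hP, Matrix.diagonal_mul, h]
  -- Right multiplication by `Q` subtracts `E y = e_{i₀}` times the row `e`; it clears the row `i₀`
  -- without touching the others.
  set Q : Matrix n n B := 1 - Matrix.vecMulVec y e with hQ
  have hEQ : E * Q = E' := by
    rw [hQ, Matrix.mul_sub, Matrix.mul_one, Matrix.mul_vecMulVec, hy]
    conv_lhs => rw [hEe]
    simp
  have hreg : (∃ G : Matrix n m B, E * G * E = E) ↔ ∃ G : Matrix n m B, E' * G * E' = E' := by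
    constructor
    · rintro ⟨G, hG⟩
      refine ⟨G, ?_⟩
      calc E' * G * E' = P * (E * G * E) * Q := by
            conv_lhs => rw [← hEQ]
                        arg 1
                        rw [hEQ, hPE]
            simp only [Matrix.mul_assoc]
        _ = E' := by rw [hG, Matrix.mul_assoc, hEQ, hPP]
    · rintro ⟨G, hG⟩
      -- The first summand inverts the matrix without the row `i₀`, the second inverts that row by
      -- means of `y`.
      refine ⟨Q * G * P + Matrix.vecMulVec y (Pi.single i₀ 1), ?_⟩
      calc E * (Q * G * P + Matrix.vecMulVec y (Pi.single i₀ 1)) * E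
          = (E * Q) * G * (P * E) + Matrix.vecMulVec (E.mulVec y) (Pi.single i₀ 1) * E := by
            rw [Matrix.mul_add, Matrix.add_mul, Matrix.mul_vecMulVec]
            simp only [Matrix.mul_assoc]
        _ = E' + Matrix.vecMulVec (Pi.single i₀ 1) e := by
            rw [hEQ, ← hPE, hG, hy, Matrix.vecMulVec_mul]
            congr 2
            ext j; simp [he]
        _ = E := hEe.symm
  have hrank : ∀ p : PrimeSpectrum B, (E.map (algebraMap B p.asIdeal.ResidueField)).rank =
      (E'.map (algebraMap B p.asIdeal.ResidueField)).rank + 1 := by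
    intro p
    set φ := algebraMap B p.asIdeal.ResidueField
    -- The column space of `E` is the column space of `E'` plus the line of `e_{i₀}`, which meets
    -- the former in 0 because the row `i₀` of `E'` vanishes.
    have hr : LinearMap.range (E.map φ).mulVecLin =
        LinearMap.range (E'.map φ).mulVecLin ⊔ Submodule.span _ {Pi.single i₀ 1} := by
      apply le_antisymm
      · rintro _ ⟨v, rfl⟩
        have : E.map φ = E'.map φ + Matrix.vecMulVec (Pi.single i₀ 1) (φ ∘ e) := by
          conv_lhs => rw [hEe]
          ext i j
          by_cases h : i = i₀
          · subst h; simp [Matrix.vecMulVec_apply]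
          · simp [Matrix.vecMulVec_apply, h]
        rw [Matrix.mulVecLin_apply, this, Matrix.add_mulVec, Matrix.vecMulVec_mulVec]
        refine Submodule.add_mem_sup ⟨v, rfl⟩ ?_
        rw [Submodule.mem_span_singleton]
        exact ⟨_, (op_smul_eq_smul _ _).symm⟩
      · refine sup_le ?_ ?_
        · rintro _ ⟨v, rfl⟩
          refine ⟨(Q.map φ).mulVec v, ?_⟩
          rw [Matrix.mulVecLin_apply, Matrix.mulVecLin_apply, Matrix.mulVec_mulVec,
            ← Matrix.map_mul, hEQ]
        · rw [Submodule.span_singleton_le_iff_mem]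
          refine ⟨φ ∘ y, ?_⟩
          rw [Matrix.mulVecLin_apply]
          have := RingHom.map_mulVec φ E y
          ext i
          rw [← this, hy]
          by_cases h : i = i₀
          · subst h; simp
          · simp [h]
    rw [Matrix.rank, Matrix.rank, hr, Submodule.finrank_sup_span_singleton]
    rintro ⟨v, hv⟩
    have := congrFun hv i₀
    rw [Matrix.mulVecLin_apply, Matrix.mulVec, dotProduct] at this
    simp [hE'] at this
  constructor
  · intro h
    exact ⟨hreg.1 h.regular, fun p => by have := h.rank_eq p; rw [hrank p] at this; omega⟩
  · intro h
    exact ⟨hreg.2 h.regular, fun p => by rw [hrank p, h.rank_eq p]⟩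

end ConstRank

/-! ### Minors -/

section Minors

variable {m n : Type} [Fintype m] [Fintype n]

lemma exists_rows_of_le_rank {K : Type} [Field K] (E : Matrix m n K) {r : ℕ} (h : r ≤ E.rank) :
    ∃ f : Fin r → m, LinearIndependent K fun i => E (f i) := by
  rw [Matrix.rank_eq_finrank_span_row] at h
  obtain ⟨v, hv, -, hl⟩ := Submodule.exists_fun_fin_finrank_span_eq K (Set.range E.row)
  choose f hf using hv
  refine ⟨fun i => f (Fin.castLE h i), ?_⟩
  have : (fun i => E (f (Fin.castLE h i))) = v ∘ Fin.castLE h := by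
    ext i; exact congrFun (hf _) _
  rw [this]
  exact hl.comp _ (Fin.castLE_injective h)

lemma exists_det_ne_zero_of_le_rank {K : Type} [Field K] (E : Matrix m n K) {r : ℕ}
    (h : r ≤ E.rank) : ∃ (f : Fin r → m) (g : Fin r → n), (E.submatrix f g).det ≠ 0 := by
  obtain ⟨f, hf⟩ := exists_rows_of_le_rank E h
  have h1 : (E.submatrix f id).rank = r := by
    have := LinearIndependent.rank_matrix (M := E.submatrix f id) hf
    simpa using this
  obtain ⟨g, hg⟩ := exists_rows_of_le_rank (E.submatrix f id).transpose (r := r)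
    (by rw [Matrix.rank_transpose, h1])
  refine ⟨f, g, ?_⟩
  have h2 : IsUnit ((E.submatrix f id).transpose.submatrix g id) :=
    Matrix.linearIndependent_rows_iff_isUnit.1 hg
  rw [Matrix.isUnit_iff_isUnit_det] at h2
  rw [← Matrix.det_transpose]
  exact h2.ne_zero

lemma le_rank_of_det_ne_zero {K : Type} [Field K] (E : Matrix m n K) {r : ℕ}
    (f : Fin r → m) (g : Fin r → n) (h : (E.submatrix f g).det ≠ 0) : r ≤ E.rank := by
  have := Matrix.rank_submatrix_le E f g
  rw [Matrix.rank_of_det_ne_zero h] at this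
  simpa using this

variable {B : Type} [CommRing B]

/-- All minors of `E` of size `r + 1` vanish, and those of size `r` generate the unit ideal. -/
def MinorRank (E : Matrix m n B) (r : ℕ) : Prop :=
  (∀ (f : Fin (r + 1) → m) (g : Fin (r + 1) → n), (E.submatrix f g).det = 0) ∧
    Ideal.span {b | ∃ (f : Fin r → m) (g : Fin r → n), b = (E.submatrix f g).det} = ⊤

lemma rank_eq_iff_minors {K : Type} [Field K] (E : Matrix m n K) (r : ℕ) :
    E.rank = r ↔ (∀ (f : Fin (r + 1) → m) (g : Fin (r + 1) → n), (E.submatrix f g).det = 0) ∧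
      ∃ (f : Fin r → m) (g : Fin r → n), (E.submatrix f g).det ≠ 0 := by
  constructor
  · rintro rfl
    refine ⟨fun f g => ?_, exists_det_ne_zero_of_le_rank E le_rfl⟩
    by_contra h
    have := le_rank_of_det_ne_zero E f g h
    omega
  · rintro ⟨h1, f, g, h2⟩
    refine le_antisymm ?_ (le_rank_of_det_ne_zero E f g h2)
    by_contra h
    obtain ⟨f, g, h3⟩ := exists_det_ne_zero_of_le_rank E (r := r + 1) (by omega)
    exact h3 (h1 f g)

/-- The Schur complement of an `r`-minor is a multiple of a bordered minor. -/
lemma det_pow_mul_schur (E : Matrix m n B) {r : ℕ} (f : Fin r → m) (g : Fin r → n)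
    (i : m) (j : n) :
    ∃ (f' : Fin (r + 1) → m) (g' : Fin (r + 1) → n),
      (E.submatrix f' g').det * (E.submatrix f g).det ^ r =
      (E.submatrix f g).det ^ r * ((E.submatrix f g).det * E i j -
        (E.submatrix id g * (E.submatrix f g).adjugate * E.submatrix f id) i j) := by
  set P := E.submatrix f g with hP
  set d := P.det with hd
  let f₁ : Fin r ⊕ Unit → m := Sum.elim f fun _ => i
  let g₁ : Fin r ⊕ Unit → n := Sum.elim g fun _ => j
  let e : Fin (r + 1) ≃ Fin r ⊕ Unit :=
    (finSumFinEquiv (m := r) (n := 1)).symm.trans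
      (Equiv.sumCongr (Equiv.refl _) (Equiv.ofUnique (Fin 1) Unit))
  refine ⟨f₁ ∘ e, g₁ ∘ e, ?_⟩
  have h1 : (E.submatrix (f₁ ∘ e) (g₁ ∘ e)).det = (E.submatrix f₁ g₁).det := by
    rw [← Matrix.submatrix_submatrix, Matrix.det_submatrix_equiv_self]
  set Q : Matrix (Fin r) Unit B := E.submatrix f fun _ => j with hQ
  set R : Matrix Unit (Fin r) B := E.submatrix (fun _ => i) g with hR
  set S : Matrix Unit Unit B := E.submatrix (fun _ => i) fun _ => j with hS
  have h2 : E.submatrix f₁ g₁ = Matrix.fromBlocks P Q R S := by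
    ext a b
    rcases a with a | a <;> rcases b with b | b <;> rfl
  -- Block elimination with the adjugate in place of the inverse. No minor has to be invertible, at
  -- the price of the factor `d ^ r` in the identity.
  have h3 : Matrix.fromBlocks P Q R S *
      Matrix.fromBlocks P.adjugate (-(P.adjugate * Q)) 0 (d • (1 : Matrix Unit Unit B)) =
      Matrix.fromBlocks (d • (1 : Matrix (Fin r) (Fin r) B)) 0 (R * P.adjugate)
        (d • S - R * P.adjugate * Q) := by
    rw [Matrix.fromBlocks_multiply]
    congr 1
    · rw [Matrix.mul_adjugate]; simp [hd]
    · rw [Matrix.mul_neg, ← Matrix.mul_assoc, Matrix.mul_adjugate]; simp [hd]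
    · simp
    · rw [Matrix.mul_neg, ← Matrix.mul_assoc]; simp [sub_eq_neg_add]
  have h4 := congrArg Matrix.det h3
  rw [Matrix.det_mul, Matrix.det_fromBlocks_zero₂₁, Matrix.det_fromBlocks_zero₁₂,
    Matrix.det_smul, Matrix.det_smul, Matrix.det_one, Matrix.det_one] at h4
  have h5 : P.adjugate.det * d = d ^ r := by
    have := congrArg Matrix.det (Matrix.mul_adjugate P)
    rw [Matrix.det_mul, Matrix.det_smul, Matrix.det_one, Fintype.card_fin] at this
    rw [mul_comm]; simpa using this
  have h6 : (d • S - R * P.adjugate * Q).det = d * E i j -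
      (E.submatrix id g * P.adjugate * E.submatrix f id) i j := by
    rw [Matrix.det_unique]
    simp [hS, hR, hQ, Matrix.mul_apply]
  rw [h1, h2, ← h6]
  simp only [Fintype.card_unit, pow_one, mul_one, Fintype.card_fin] at h4
  rw [h5] at h4
  exact h4

/-- The multipliers `b` for which `b • E = E * G * E` is solvable are closed under linear
combinations. For an `r`-minor the Schur complement is killed by the `r`-th power of the minor,
since the bordered minors vanish; so its power of exponent `r + 1` is such a multiplier. These
powers still generate the unit ideal. -/
lemma MinorRank.regular {E : Matrix m n B} {r : ℕ} (h : MinorRank E r) :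
    ∃ G : Matrix n m B, E * G * E = E := by
  classical
  set S : Set B := {b | ∃ (f : Fin r → m) (g : Fin r → n), b = (E.submatrix f g).det}
  have h1 : Ideal.span ((fun x : B => x ^ (r + 1)) '' S) = ⊤ := Ideal.span_pow_eq_top _ h.2 _
  have key : ∀ b ∈ Ideal.span ((fun x : B => x ^ (r + 1)) '' S),
      ∃ G : Matrix n m B, E * G * E = b • E := by
    intro b hb
    induction hb using Submodule.span_induction with
    | mem x hx =>
      obtain ⟨_, ⟨f, g, rfl⟩, rfl⟩ := hx
      set P := E.submatrix f g with hP
      refine ⟨P.det ^ r • ((1 : Matrix n n B).submatrix id g * P.adjugate *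
        (1 : Matrix m m B).submatrix f id), ?_⟩
      have h2 : E * ((1 : Matrix n n B).submatrix id g * P.adjugate *
        (1 : Matrix m m B).submatrix f id) * E =
          E.submatrix id g * P.adjugate * E.submatrix f id := by
        have a1 : E * (1 : Matrix n n B).submatrix id g = E.submatrix id g := by
          ext i j; simp [Matrix.mul_apply, Matrix.one_apply]
        have a2 : (1 : Matrix m m B).submatrix f id * E = E.submatrix f id := by
          ext i j; simp [Matrix.mul_apply, Matrix.one_apply]
        rw [← a1, ← a2]; simp only [Matrix.mul_assoc]
      rw [Matrix.mul_smul, Matrix.smul_mul, h2]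
      ext i j
      obtain ⟨f', g', h3⟩ := det_pow_mul_schur E f g i j
      rw [h.1 f' g', zero_mul, eq_comm, ← hP] at h3
      simp only [Matrix.smul_apply, smul_eq_mul]
      linear_combination -h3
    | zero => exact ⟨0, by simp⟩
    | add x y _ _ hx hy =>
      obtain ⟨G, hG⟩ := hx
      obtain ⟨G', hG'⟩ := hy
      exact ⟨G + G', by rw [Matrix.mul_add, Matrix.add_mul, hG, hG', add_smul]⟩
    | smul a x _ hx =>
      obtain ⟨G, hG⟩ := hx
      exact ⟨a • G, by rw [Matrix.mul_smul, Matrix.smul_mul, hG, smul_eq_mul, mul_smul]⟩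
  obtain ⟨G, hG⟩ := key 1 (by rw [h1]; trivial)
  exact ⟨G, by simpa using hG⟩

lemma minorRank_map {C : Type} [CommRing C] (φ : B →+* C) {E : Matrix m n B} {r : ℕ}
    (h : MinorRank E r) : MinorRank (E.map φ) r := by
  refine ⟨fun f g => ?_, ?_⟩
  · rw [Matrix.submatrix_map]
    have := congrArg φ (h.1 f g)
    rwa [RingHom.map_det, map_zero] at this
  · rw [eq_top_iff, ← Ideal.map_top φ, ← h.2, Ideal.map_span]
    refine Ideal.span_mono ?_
    rintro _ ⟨_, ⟨f, g, rfl⟩, rfl⟩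
    exact ⟨f, g, by rw [RingHom.map_det]; rfl⟩

lemma minorRank_field_iff {K : Type} [Field K] (E : Matrix m n K) (r : ℕ) :
    MinorRank E r ↔ E.rank = r := by
  rw [rank_eq_iff_minors, MinorRank]
  refine and_congr_right fun _ => ?_
  constructor
  · intro h
    by_contra hc
    push Not at hc
    have : Ideal.span {b | ∃ (f : Fin r → m) (g : Fin r → n), b = (E.submatrix f g).det} = ⊥ := by
      rw [Ideal.span_eq_bot]
      rintro _ ⟨f, g, rfl⟩
      exact hc f g
    rw [this] at h
    exact bot_ne_top h
  · rintro ⟨f, g, h⟩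
    exact Ideal.eq_top_of_isUnit_mem _ (Ideal.subset_span ⟨f, g, rfl⟩) (isUnit_iff_ne_zero.2 h)

lemma MinorRank.constRank {E : Matrix m n B} {r : ℕ} (h : MinorRank E r) : ConstRank E r :=
  ⟨h.regular, fun _ => (minorRank_field_iff _ _).1 (minorRank_map _ h)⟩

lemma det_mul_eq_zero_of_lt {r : ℕ} (X : Matrix (Fin (r + 1)) (Fin r) B)
    (Y : Matrix (Fin r) (Fin (r + 1)) B) : (X * Y).det = 0 := by
  let X' : Matrix (Fin (r + 1)) (Fin (r + 1)) B := Matrix.of fun i j => Fin.lastCases (motive := fun _ => B) 0 (fun a => X i a) j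
  let Y' : Matrix (Fin (r + 1)) (Fin (r + 1)) B :=
    Matrix.of fun i j => Fin.lastCases (motive := fun _ => B) 0 (fun a => Y a j) i
  have : X * Y = X' * Y' := by
    ext i j
    rw [Matrix.mul_apply, Matrix.mul_apply, Fin.sum_univ_castSucc]
    simp [X', Y']
  rw [this, Matrix.det_mul, Matrix.det_eq_zero_of_column_eq_zero (Fin.last r), zero_mul]
  intro i; simp [X']

/-- Ranks at residue fields do not see nilpotents; the generalized inverse makes up for this.
Locally some `r`-minor is a unit, and `E₁` minus its part `c • Z` through the corresponding rows is
a matrix `D` with zero residue which again has a generalized inverse. This forces `D = 0`, so `E₁`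
factors through a free module of rank `r`. -/
lemma ConstRank.minors_eq_zero {E : Matrix m n B} {r : ℕ} (h : ConstRank E r)
    (f : Fin (r + 1) → m) (g : Fin (r + 1) → n) : (E.submatrix f g).det = 0 := by
  classical
  refine eq_zero_of_localization _ fun J hJ => ?_
  let p : PrimeSpectrum B := ⟨J, hJ.isPrime⟩
  set L := Localization.AtPrime J
  set φ := algebraMap B L with hφ
  set ψ := algebraMap L J.ResidueField with hψ
  have hcomp : algebraMap B J.ResidueField = ψ.comp φ := IsScalarTower.algebraMap_eq _ _ _
  have hr : ((E.map φ).map ψ).rank = r := by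
    have := h.rank_eq p
    rw [Matrix.map_map]
    rw [show (algebraMap B p.asIdeal.ResidueField) = ψ.comp φ from hcomp] at this
    exact this
  obtain ⟨hz, f₀, g₀, hne⟩ := (rank_eq_iff_minors _ _).1 hr
  set E₁ := E.map φ with hE₁
  set P := E₁.submatrix f₀ g₀ with hP
  have hunit : IsUnit P.det := by
    rw [Matrix.submatrix_map, ← RingHom.mapMatrix_apply, ← RingHom.map_det] at hne
    by_contra hc
    exact hne ((IsLocalRing.residue_eq_zero_iff _).2 hc)
  obtain ⟨u, hu⟩ := hunit
  set c : L := (↑u⁻¹ : L) with hc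
  have hcd : c * P.det = 1 := by rw [← hu]; simp [hc]
  set Z := E₁.submatrix id g₀ * P.adjugate * E₁.submatrix f₀ id with hZ
  set D := E₁ - c • Z with hD
  have hDm : ∀ i j, ψ (D i j) = 0 := by
    intro i j
    obtain ⟨f', g', h3⟩ := det_pow_mul_schur (E₁.map ψ) f₀ g₀ i j
    rw [hz f' g', zero_mul, eq_comm, mul_eq_zero] at h3
    have h4 := h3.resolve_left (pow_ne_zero _ hne)
    have h5 : ψ (P.det * E₁ i j - Z i j) = 0 := by
      rw [map_sub, map_mul]
      convert h4 using 2
      · congr 1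
        rw [RingHom.map_det]; rfl
      · rw [hZ]
        rw [← Matrix.map_apply (f := ψ), Matrix.map_mul, Matrix.map_mul,
          show P.adjugate.map ψ = (P.map ψ).adjugate from RingHom.map_adjugate ψ P]
        rfl
    have h6 : D i j = c * (P.det * E₁ i j - Z i j) := by
      rw [hD, Matrix.sub_apply, Matrix.smul_apply, smul_eq_mul]
      linear_combination - (E₁ i j) * hcd
    rw [h6, map_mul, h5, mul_zero]
  obtain ⟨G, hG⟩ := h.regular
  set G₁ := G.map φ with hG₁
  have hEG : E₁ * G₁ * E₁ = E₁ := by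
    rw [hE₁, hG₁, ← Matrix.map_mul, ← Matrix.map_mul, hG]
  have hrow : Z = E₁.submatrix id g₀ * P.adjugate * (1 : Matrix m m L).submatrix f₀ id * E₁ := by
    have a2 : (1 : Matrix m m L).submatrix f₀ id * E₁ = E₁.submatrix f₀ id := by
      ext i j; simp [Matrix.mul_apply, Matrix.one_apply]
    rw [Matrix.mul_assoc _ _ E₁, a2]
  have hcol : Z = E₁ * ((1 : Matrix n n L).submatrix id g₀ * P.adjugate *
      E₁.submatrix f₀ id) := by
    have a1 : E₁ * (1 : Matrix n n L).submatrix id g₀ = E₁.submatrix id g₀ := by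
      ext i j; simp [Matrix.mul_apply, Matrix.one_apply]
    rw [← Matrix.mul_assoc, ← Matrix.mul_assoc, a1]
  have hDg : D.submatrix id g₀ = 0 := by
    have : Z.submatrix id g₀ = P.det • E₁.submatrix id g₀ := by
      have : Z.submatrix id g₀ = E₁.submatrix id g₀ * P.adjugate * P := by
        ext i j; simp [hZ, hP, Matrix.mul_apply]
      rw [this, Matrix.mul_assoc, Matrix.adjugate_mul, Matrix.mul_smul, Matrix.mul_one]
    have h2 : D.submatrix id g₀ = E₁.submatrix id g₀ - c • Z.submatrix id g₀ := rfl
    rw [h2, this, smul_smul, hcd, one_smul, sub_self]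
  set X := c • (E₁.submatrix id g₀ * P.adjugate * (1 : Matrix m m L).submatrix f₀ id) with hX
  set Y := c • ((1 : Matrix n n L).submatrix id g₀ * P.adjugate * E₁.submatrix f₀ id) with hY
  have hDX : D = (1 - X) * E₁ := by
    rw [hD, Matrix.sub_mul, Matrix.one_mul, hX, Matrix.smul_mul, ← hrow]
  have hDY : D = E₁ * (1 - Y) := by
    rw [hD, Matrix.mul_sub, Matrix.mul_one, hY, Matrix.mul_smul, ← hcol]
  have hDY0 : D * Y = 0 := by
    have a1 : D * (1 : Matrix n n L).submatrix id g₀ = D.submatrix id g₀ := by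
      ext i j; simp [Matrix.mul_apply, Matrix.one_apply]
    rw [hY, Matrix.mul_smul, ← Matrix.mul_assoc, ← Matrix.mul_assoc, a1, hDg]; simp
  -- `D` is obtained from `E₁` by multiplication on either side, and `D * Y = 0`, so the generalized
  -- inverse of `E₁` also works for `D`.
  have hDGD : D * G₁ * D = D := by
    calc D * G₁ * D = (1 - X) * (E₁ * G₁ * E₁) * (1 - Y) := by
          conv_lhs => rw [hDY]
                      arg 1
                      rw [← hDY, hDX]
          simp only [Matrix.mul_assoc]
      _ = D * (1 - Y) := by rw [hEG, ← hDX]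
      _ = D := by rw [Matrix.mul_sub, Matrix.mul_one, hDY0, sub_zero]
  -- Over the residue field `1 - D * G₁` is the identity. Being invertible and annihilating `D`, it
  -- gives `D = 0`.
  have hdet : IsUnit (1 - D * G₁).det := by
    by_contra hc
    have := (IsLocalRing.residue_eq_zero_iff _).2 hc
    change ψ _ = 0 at this
    have h0 : ψ.mapMatrix (D * G₁) = 0 := by
      have : D.map ψ = 0 := by ext i j; exact hDm i j
      rw [RingHom.mapMatrix_apply, Matrix.map_mul, this, Matrix.zero_mul]
    rw [RingHom.map_det, map_sub, map_one, h0, sub_zero, Matrix.det_one] at this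
    exact one_ne_zero this
  have hD0 : D = 0 := by
    have h1 : (1 - D * G₁) * D = 0 := by rw [Matrix.sub_mul, Matrix.one_mul, hDGD, sub_self]
    have h2 := congrArg ((1 - D * G₁)⁻¹ * ·) h1
    simpa [Matrix.nonsing_inv_mul_cancel_left _ _ hdet] using h2
  have hE1 : E₁ = (c • (E₁.submatrix id g₀ * P.adjugate)) * E₁.submatrix f₀ id := by
    rw [Matrix.smul_mul, ← hZ]
    exact sub_eq_zero.1 hD0
  change φ _ = 0
  rw [RingHom.map_det, RingHom.mapMatrix_apply, ← Matrix.submatrix_map, ← hE₁, hE1,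
    Matrix.submatrix_mul _ _ f id g Function.bijective_id]
  exact det_mul_eq_zero_of_lt _ _

/-- The left side is the form in which flatness of a cokernel appears; the right side is a locally
closed condition, given by ideals which commute with base change. -/
lemma constRank_iff_minorRank {E : Matrix m n B} {r : ℕ} : ConstRank E r ↔ MinorRank E r := by
  refine ⟨fun h => ⟨h.minors_eq_zero, ?_⟩, fun h => h.constRank⟩
  by_contra hc
  obtain ⟨p, hp, hle⟩ := Ideal.exists_le_maximal _ hc
  have hp' := hp.isPrime
  obtain ⟨-, f, g, hne⟩ := (rank_eq_iff_minors _ _).1 (h.rank_eq ⟨p, hp'⟩)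
  apply hne
  rw [Matrix.submatrix_map, ← RingHom.mapMatrix_apply, ← RingHom.map_det]
  exact Ideal.algebraMap_residueField_eq_zero.2 (hle (Ideal.subset_span ⟨f, g, rfl⟩))

lemma constRank_field_iff {K : Type} [Field K] (E : Matrix m n K) (r : ℕ) :
    ConstRank E r ↔ E.rank = r := by
  rw [constRank_iff_minorRank, minorRank_field_iff]

lemma ConstRank.eq_zero {E : Matrix m n B} (h : ConstRank E 0) : E = 0 := by
  ext i j
  have := h.minors_eq_zero (fun _ => i) fun _ => j
  change Matrix.det (n := Fin 1) _ = 0 at this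
  rw [Matrix.det_unique] at this
  simpa using this

end Minors

/-! ### Flatness of cokernels -/

section Cokernel

variable {κ ι : Type} [Fintype κ] [Fintype ι]

/-- `q` presents its target as the cokernel of the map given by the rows of `E`. -/
structure IsRowCokernel {A M : Type} [CommRing A] [AddCommGroup M] [Module A M]
    (E : Matrix κ ι A) (q : (ι → A) →ₗ[A] M) : Prop where
  surjective : Function.Surjective q
  ker_eq : LinearMap.ker q = Submodule.span A (Set.range E.row)

variable {A M : Type} [CommRing A] [AddCommGroup M] [Module A M] {E : Matrix κ ι A}
  {q : (ι → A) →ₗ[A] M}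

omit [Fintype ι] in
lemma mem_span_rows_iff (E : Matrix κ ι A) (v : ι → A) :
    v ∈ Submodule.span A (Set.range E.row) ↔ ∃ c : κ → A, Matrix.vecMul c E = v := by
  rw [Submodule.mem_span_range_iff_exists_fun]
  refine exists_congr fun c => ?_
  rw [Matrix.vecMul_eq_sum]
  rfl

lemma IsRowCokernel.baseChange (h : IsRowCokernel E q) (B : Type) [CommRing B] [Algebra A B] :
    ∃ q' : (ι → B) →ₗ[B] B ⊗[A] M, IsRowCokernel (E.map (algebraMap A B)) q' := by
  classical
  let e := TensorProduct.piScalarRight A B B ι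
  let q' : (ι → B) →ₗ[B] B ⊗[A] M := (q.baseChange B) ∘ₗ (e.symm : (ι → B) →ₗ[B] B ⊗[A] (ι → A))
  let g : (κ → A) →ₗ[A] (ι → A) := E.vecMulLinear
  have hex : Function.Exact g q := by
    intro v
    rw [← LinearMap.mem_ker, h.ker_eq, mem_span_rows_iff]
    rfl
  have hex' := lTensor_exact B hex h.surjective
  refine ⟨q', ⟨?_, ?_⟩⟩
  · exact (LinearMap.lTensor_surjective B h.surjective).comp e.symm.surjective
  · have heg : ∀ z : B ⊗[A] (κ → A), e (g.baseChange B z) ∈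
        Submodule.span B (Set.range (E.map (algebraMap A B)).row) := by
      intro z
      induction z with
      | zero => simp
      | add x y hx hy => rw [map_add, map_add]; exact Submodule.add_mem _ hx hy
      | tmul b c =>
        rw [LinearMap.baseChange_tmul, mem_span_rows_iff]
        refine ⟨fun i => b * algebraMap A B (c i), ?_⟩
        ext j
        simp only [e, TensorProduct.piScalarRight_apply, TensorProduct.piScalarRightHom_tmul]
        simp [g, Matrix.vecMul, dotProduct, Finset.sum_mul, Algebra.smul_def]
        exact Finset.sum_congr rfl fun _ _ => by ring
    apply le_antisymm
    · intro v hv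
      have h1 : LinearMap.lTensor B q (e.symm v) = 0 := hv
      obtain ⟨z, hz⟩ := (hex' _).1 h1
      have h2 : v = e (g.baseChange B z) := by
        rw [LinearEquiv.eq_symm_apply] at hz
        exact hz.symm
      rw [h2]; exact heg z
    · rw [Submodule.span_le]
      rintro _ ⟨i, rfl⟩
      have h1 : e.symm ((E.map (algebraMap A B)).row i) = g.baseChange B (1 ⊗ₜ Pi.single i 1) := by
        rw [LinearEquiv.symm_apply_eq, LinearMap.baseChange_tmul]
        ext j
        simp [e, g, TensorProduct.piScalarRight_apply, TensorProduct.piScalarRightHom_tmul,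
          Algebra.smul_def]
      have h2 : q' ((E.map (algebraMap A B)).row i) =
        LinearMap.lTensor B q (e.symm ((E.map (algebraMap A B)).row i)) := rfl
      rw [SetLike.mem_coe, LinearMap.mem_ker, h2, h1]
      exact (hex' _).2 ⟨_, rfl⟩

/-- A finitely presented flat module is projective. A section `s` of `q` makes each `e_i - s (q
e_i)` a combination of rows, and the coefficients form `G`. Conversely `1 - G E` kills the rows and
descends to a section. -/
lemma IsRowCokernel.flat_iff (h : IsRowCokernel E q) :
    Module.Flat A M ↔ ∃ G : Matrix ι κ A, E * G * E = E := by
  classical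
  constructor
  · intro hf
    have hfp : Module.FinitePresentation A M :=
      Module.finitePresentation_of_surjective q h.surjective
        (by rw [h.ker_eq]; exact Submodule.fg_span (Set.finite_range _))
    have hp : Module.Projective A M := Module.Flat.projective_of_finitePresentation
    obtain ⟨s, hs⟩ := Module.projective_lifting_property q LinearMap.id h.surjective
    have hs' : ∀ x, q (s x) = x := fun x => LinearMap.congr_fun hs x
    have h1 : ∀ i : ι, ∃ c : κ → A, Matrix.vecMul c E =
        Pi.single i (1 : A) - s (q (Pi.single i 1)) := fun i => by
      rw [← mem_span_rows_iff, ← h.ker_eq, LinearMap.mem_ker, map_sub, hs', sub_self]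
    choose G hG using h1
    refine ⟨Matrix.of G, ?_⟩
    have h2 : ∀ v : ι → A, Matrix.vecMul (Matrix.vecMul v (Matrix.of G)) E = v - s (q v) := by
      intro v
      have hv : v = ∑ i, v i • Pi.single i (1 : A) := by
        ext j; simp [Finset.sum_apply, Pi.single_apply]
      have : Matrix.vecMul v (Matrix.of G) = ∑ i, v i • G i := by
        rw [Matrix.vecMul_eq_sum]; rfl
      rw [this, Matrix.sum_vecMul]
      simp_rw [Matrix.smul_vecMul, hG]
      conv_rhs => rw [hv]
      simp only [map_sum, map_smul, smul_sub, Finset.sum_sub_distrib]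
    ext k j
    have h3 := congrFun (h2 (E.row k)) j
    have h4 : q (E.row k) = 0 := by
      rw [← LinearMap.mem_ker, h.ker_eq]; exact Submodule.subset_span ⟨k, rfl⟩
    rw [h4, map_zero, sub_zero] at h3
    rw [Matrix.vecMul_vecMul] at h3
    rw [Matrix.mul_assoc]
    exact h3
  · rintro ⟨G, hG⟩
    let π : (ι → A) →ₗ[A] (ι → A) := LinearMap.id - (G * E).vecMulLinear
    have hker : LinearMap.ker q ≤ LinearMap.ker π := by
      rw [h.ker_eq]
      intro v hv
      obtain ⟨c, rfl⟩ := (mem_span_rows_iff _ _).1 hv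
      simp only [π, LinearMap.mem_ker, LinearMap.sub_apply, LinearMap.id_apply,
        Matrix.vecMulLinear_apply, Matrix.vecMul_vecMul]
      rw [← Matrix.mul_assoc, hG, sub_self]
    let e := q.quotKerEquivOfSurjective h.surjective
    let s : M →ₗ[A] (ι → A) := ((LinearMap.ker q).liftQ π hker) ∘ₗ (e.symm : M →ₗ[A] _)
    have hp : Module.Projective A M := by
      refine Module.Projective.of_split s q ?_
      ext x
      obtain ⟨v, rfl⟩ := h.surjective x
      have h1 : e.symm (q v) = Submodule.Quotient.mk v := by
        rw [LinearEquiv.symm_apply_eq]; rfl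
      have h2 : s (q v) = π v := by
        simp only [s, LinearMap.comp_apply, LinearEquiv.coe_coe, h1]; rfl
      rw [LinearMap.comp_apply, h2, LinearMap.id_apply]
      simp only [π, LinearMap.sub_apply, LinearMap.id_apply, map_sub, Matrix.vecMulLinear_apply]
      rw [sub_eq_self, ← LinearMap.mem_ker, h.ker_eq, mem_span_rows_iff]
      exact ⟨Matrix.vecMul v G, by rw [Matrix.vecMul_vecMul]⟩
    exact Module.Flat.of_projective

lemma IsRowCokernel.finrank_add_rank {K V : Type} [Field K] [AddCommGroup V] [Module K V]
    {E : Matrix κ ι K} {q : (ι → K) →ₗ[K] V} (h : IsRowCokernel E q) :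
    Module.finrank K V + E.rank = Fintype.card ι := by
  rw [Matrix.rank_eq_finrank_span_row]
  have h1 := LinearMap.finrank_range_add_finrank_ker q
  rw [LinearMap.range_eq_top.2 h.surjective, finrank_top, h.ker_eq] at h1
  simpa using h1

/-- A base change of the cokernel of `E` is flat of constant rank if and only if `E` becomes a
matrix of constant rank. -/
lemma IsRowCokernel.flat_rank_iff (h : IsRowCokernel E q) (B : Type) [CommRing B] [Algebra A B]
    {r : ℕ} (hr : r ≤ Fintype.card ι) :
    (Module.Flat B (B ⊗[A] M) ∧ ∀ p : PrimeSpectrum B,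
      Module.rankAtStalk (R := B) (B ⊗[A] M) p = Fintype.card ι - r) ↔
    ConstRank (E.map (algebraMap A B)) r := by
  obtain ⟨q', hq'⟩ := h.baseChange B
  have hfin : Module.Finite B (B ⊗[A] M) := Module.Finite.of_surjective q' hq'.surjective
  have hrk : ∀ (_ : Module.Flat B (B ⊗[A] M)) (p : PrimeSpectrum B),
      Module.rankAtStalk (R := B) (B ⊗[A] M) p +
        ((E.map (algebraMap A B)).map (algebraMap B p.asIdeal.ResidueField)).rank =
          Fintype.card ι := by
    intro hf p
    rw [Module.rankAtStalk_eq]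
    obtain ⟨q'', hq''⟩ := hq'.baseChange p.asIdeal.ResidueField
    exact hq''.finrank_add_rank
  constructor
  · rintro ⟨hf, hp⟩
    refine ⟨hq'.flat_iff.1 hf, fun p => ?_⟩
    have := hrk hf p
    rw [hp p] at this
    omega
  · intro hc
    have hf := hq'.flat_iff.2 hc.regular
    refine ⟨hf, fun p => ?_⟩
    have := hrk hf p
    rw [hc.rank_eq p] at this
    omega

end Cokernel

end SQH

namespace SQH

/-! ### Sequences of parameters -/

section Parameters

variable {R : Type} [CommRing R]

/-- Multiplication by `a` is injective modulo the ideal `I`. -/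
def RegularMod (I : Ideal R) (a : R) : Prop := ∀ b, a * b ∈ I → b ∈ I

lemma RegularMod.pow {I : Ideal R} {a : R} (h : RegularMod I a) (N : ℕ) : RegularMod I (a ^ N) := by
  induction N with
  | zero => intro b hb; simpa using hb
  | succ N ih => intro b hb; exact ih b (h _ (by rwa [pow_succ', mul_assoc] at hb))

/-- Regular elements can be exchanged. -/
lemma RegularMod.exchange {I : Ideal R} {a b : R} (ha : RegularMod I a)
    (hb : RegularMod (I ⊔ Ideal.span {a}) b) : RegularMod (I ⊔ Ideal.span {b}) a := by
  intro z hz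
  obtain ⟨i, hi, y, hy, hs⟩ := Submodule.mem_sup.1 hz
  obtain ⟨u, rfl⟩ := Ideal.mem_span_singleton'.1 hy
  have h1 : u ∈ I ⊔ Ideal.span {a} := by
    apply hb
    have : b * u = a * z - i := by rw [← hs]; ring
    rw [this]
    exact Submodule.sub_mem _ (Ideal.mul_mem_right _ _
      ((le_sup_right : _ ≤ I ⊔ Ideal.span {a}) (Ideal.mem_span_singleton_self a)))
      ((le_sup_left : I ≤ _) hi)
  obtain ⟨j, hj, y', hy', rfl⟩ := Submodule.mem_sup.1 h1
  obtain ⟨v, rfl⟩ := Ideal.mem_span_singleton'.1 hy'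
  have h2 : z - v * b ∈ I := by
    apply ha
    have : a * (z - v * b) = i + j * b := by rw [mul_sub, ← hs]; ring
    rw [this]
    exact I.add_mem hi (I.mul_mem_right _ hj)
  have : z = (z - v * b) + v * b := by ring
  rw [this]
  exact Submodule.add_mem_sup h2 (Ideal.mem_span_singleton'.2 ⟨v, rfl⟩)

/-- A general linear combination of `f` is regular modulo finitely many ideals, if no element is
annihilated by all of `f`. -/
lemma exists_regularMod_combination {K : Type} [Field K] [Infinite K] [Algebra K R]
    [IsNoetherianRing R] {n : ℕ} (f : Fin n → R) {J : Type} [Finite J] (L : J → Ideal R)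
    (hL : ∀ j b, (∀ i, f i * b ∈ L j) → b ∈ L j) (V : Submodule K (Fin n → K)) (hV : V ≠ ⊤) :
    ∃ c : Fin n → K, c ∉ V ∧ ∀ j, RegularMod (L j) (∑ i, c i • f i) := by
  classical
  -- Prime avoidance with scalar coefficients: the coefficient vectors whose combination falls into
  -- an associated prime `q` form a subspace `W q`. It is proper, and over an infinite field
  -- finitely many proper subspaces, `V` included, do not cover the whole space.
  let W : Ideal R → Submodule K (Fin n → K) := fun q =>
    (q.restrictScalars K).comap (Fintype.linearCombination K f)
  have hfin : (insert V (⋃ j, W '' associatedPrimes R (R ⧸ L j))).Finite :=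
    (Set.finite_iUnion fun j => (associatedPrimes.finite R (R ⧸ L j)).image W).insert V
  have htop : ⊤ ∉ hfin.toFinset := by
    rw [Set.Finite.mem_toFinset, Set.mem_insert_iff, Set.mem_iUnion]
    rintro (h | ⟨j, q, hq, h⟩)
    · exact hV h.symm
    · obtain ⟨hqp, x, hx⟩ := isAssociatedPrime_iff.1 hq
      obtain ⟨b, rfl⟩ := Ideal.Quotient.mk_surjective x
      have h1 : ∀ i, f i ∈ q := by
        intro i
        have : (Pi.single i 1 : Fin n → K) ∈ W q := by rw [h]; trivial
        simpa [W] using this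
      have h2 : ∀ a : R, a ∈ q ↔ a * b ∈ L j := by
        intro a
        rw [hx, Submodule.mem_colon_singleton, Submodule.mem_bot, ← Ideal.Quotient.mk_eq_mk,
          ← Submodule.Quotient.mk_smul]
        exact Submodule.Quotient.mk_eq_zero _
      have h3 : b ∈ L j := hL j b fun i => (h2 _).1 (h1 i)
      exact hqp.ne_top ((Ideal.eq_top_iff_one _).2 ((h2 1).2 (by rwa [one_mul])))
  have := Subspace.biUnion_ne_univ_of_top_notMem htop
  obtain ⟨c, hc⟩ := (Set.ne_univ_iff_exists_notMem _).1 this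
  simp only [Set.mem_iUnion, not_exists] at hc
  refine ⟨c, hc V (by simp), fun j b hb => ?_⟩
  by_contra hbL
  have hz : (∑ i, c i • f i) ∈ ⋃ p ∈ associatedPrimes R (R ⧸ L j), (p : Set R) := by
    rw [biUnion_associatedPrimes_eq_zero_divisors]
    refine ⟨Ideal.Quotient.mk _ b, fun h => hbL (Ideal.Quotient.eq_zero_iff_mem.1 h), ?_⟩
    rw [← Ideal.Quotient.mk_eq_mk, ← Submodule.Quotient.mk_smul]
    exact (Submodule.Quotient.mk_eq_zero _).2 hb
  simp only [Set.mem_iUnion] at hz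
  obtain ⟨q, hq, hm⟩ := hz
  refine hc (W q) ?_ ?_
  · rw [Set.Finite.mem_toFinset, Set.mem_insert_iff, Set.mem_iUnion]
    exact Or.inr ⟨j, q, hq, rfl⟩
  · simpa [W, Fintype.linearCombination_apply] using hm

/-- The ideal `(g_a, a < i; x_b, j ≤ b < n)`. -/
def mixedIdeal (n : ℕ) (g x : ℕ → R) (i j : ℕ) : Ideal R :=
  Ideal.span ({z | ∃ a < i, z = g a} ∪ {z | ∃ b, j ≤ b ∧ b < n ∧ z = x b})

variable {n : ℕ} {g g' x : ℕ → R} {i j : ℕ}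

lemma mixedIdeal_congr (h : ∀ a < i, g a = g' a) : mixedIdeal n g x i j = mixedIdeal n g' x i j := by
  unfold mixedIdeal
  congr 2
  ext z
  exact exists_congr fun a => and_congr_right fun ha => by rw [h a ha]

lemma mixedIdeal_succ_left : mixedIdeal n g x (i + 1) j = mixedIdeal n g x i j ⊔ Ideal.span {g i} := by
  unfold mixedIdeal
  rw [← Ideal.span_union]
  congr 1
  ext z
  simp only [Set.mem_union, Set.mem_ofPred_eq, Set.mem_singleton_iff, Nat.lt_succ_iff_lt_or_eq]
  constructor
  · rintro (⟨a, ha | rfl, rfl⟩ | h)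
    · exact Or.inl (Or.inl ⟨a, ha, rfl⟩)
    · exact Or.inr rfl
    · exact Or.inl (Or.inr h)
  · rintro ((⟨a, ha, rfl⟩ | h) | rfl)
    · exact Or.inl ⟨a, Or.inl ha, rfl⟩
    · exact Or.inr h
    · exact Or.inl ⟨i, Or.inr rfl, rfl⟩

lemma mixedIdeal_of_lt (hj : j < n) :
    mixedIdeal n g x i j = mixedIdeal n g x i (j + 1) ⊔ Ideal.span {x j} := by
  unfold mixedIdeal
  rw [← Ideal.span_union]
  congr 1
  ext z
  simp only [Set.mem_union, Set.mem_ofPred_eq, Set.mem_singleton_iff]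
  constructor
  · rintro (h | ⟨b, hb, hbn, rfl⟩)
    · exact Or.inl (Or.inl h)
    · rcases hb.eq_or_lt with rfl | hb
      · exact Or.inr rfl
      · exact Or.inl (Or.inr ⟨b, hb, hbn, rfl⟩)
  · rintro ((h | ⟨b, hb, hbn, rfl⟩) | rfl)
    · exact Or.inl h
    · exact Or.inr ⟨b, by omega, hbn, rfl⟩
    · exact Or.inr ⟨j, le_rfl, hj, rfl⟩

lemma left_mem_mixedIdeal {a : ℕ} (ha : a < i) : g a ∈ mixedIdeal n g x i j :=
  Ideal.subset_span (Or.inl ⟨a, ha, rfl⟩)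

lemma right_mem_mixedIdeal {b : ℕ} (hb : j ≤ b) (hn : b < n) : x b ∈ mixedIdeal n g x i j :=
  Ideal.subset_span (Or.inr ⟨b, hb, hn, rfl⟩)

/-- A sequence `g` which is regular and which can be exchanged step by step with `x`. -/
structure ExchangeSeq (n : ℕ) (g x : ℕ → R) (i : ℕ) : Prop where
  left : ∀ a < i, ∀ j, a < j → j ≤ n → RegularMod (mixedIdeal n g x a j) (g a)
  right : ∀ a ≤ i, ∀ j, a ≤ j → j < n → RegularMod (mixedIdeal n g x a (j + 1)) (x j)

/-- The new `g i` is a general combination of the `f l`. It is regular modulo each ideal in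
question, because the last eliminated `x` is regular there and one of its powers lies in `(f)`, so
no nonzero class is killed by all `f l`. Regularity of the remaining `x j` is then inherited by
exchange. -/
lemma exists_exchangeSeq {K : Type} [Field K] [Infinite K] [Algebra K R] [IsNoetherianRing R]
    (f : Fin n → R) (x : ℕ → R) {N : ℕ}
    (hx : ∀ j < n, RegularMod (Ideal.span {z | ∃ b, j < b ∧ b < n ∧ z = x b}) (x j))
    (hN : ∀ j < n, x j ^ N ∈ Ideal.span (Set.range f)) (i : ℕ) (hi : i ≤ n) :
    ∃ c : ℕ → Fin n → K, LinearIndependent K (fun a : Fin i => c a) ∧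
      ExchangeSeq n (fun a => ∑ l, c a l • f l) x i := by
  induction i with
  | zero =>
    refine ⟨fun _ => 0, linearIndependent_empty_type, ⟨fun a ha => by omega, ?_⟩⟩
    intro a ha j _ hj
    obtain rfl : a = 0 := by omega
    convert hx j hj using 1
    unfold mixedIdeal
    congr 1
    ext z
    simp
  | succ i ih =>
    obtain ⟨c, hc, hs⟩ := ih (by omega)
    set g : ℕ → R := fun a => ∑ l, c a l • f l with hg
    have hL : ∀ (j : {j : Fin (n + 1) // i < j.val}) (b : R),
        (∀ l, f l * b ∈ mixedIdeal n g x i j.1.val) → b ∈ mixedIdeal n g x i j.1.val := by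
      rintro ⟨⟨j, hj⟩, hij⟩ b hb
      simp only at hij hb ⊢
      obtain ⟨j, rfl⟩ : ∃ j', j = j' + 1 := ⟨j - 1, by omega⟩
      refine (hs.right i le_rfl j (by omega) (by omega)).pow N b ?_
      have : ∀ z ∈ Ideal.span (Set.range f), z * b ∈ mixedIdeal n g x i (j + 1) := by
        intro z hz
        induction hz using Submodule.span_induction with
        | mem z hz => obtain ⟨l, rfl⟩ := hz; exact hb l
        | zero => simp
        | add y z _ _ hy hz => rw [add_mul]; exact Ideal.add_mem _ hy hz
        | smul a z _ hz => rw [smul_eq_mul, mul_assoc]; exact Ideal.mul_mem_left _ _ hz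
      exact this _ (hN j (by omega))
    -- Avoiding the span of the previous coefficient vectors keeps the transition matrix from `f` to
    -- `g` invertible.
    have hV : Submodule.span K (Set.range fun a : Fin i => c a) ≠ ⊤ := by
      intro h
      have h1 := finrank_span_eq_card hc
      rw [h, finrank_top] at h1
      simp at h1
      omega
    obtain ⟨v, hv, hreg⟩ := exists_regularMod_combination f _ hL _ hV
    refine ⟨Function.update c i v, ?_, ?_⟩
    · rw [linearIndependent_finSucc']
      have e : ∀ a : Fin i, Function.update c i v a = c a := fun a =>
        Function.update_of_ne (by have := a.2; omega) _ _
      have e' : (Fin.init fun a : Fin (i + 1) => Function.update c i v a) =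
          fun a : Fin i => c a := funext e
      rw [e']
      exact ⟨hc, by simpa using hv⟩
    · set g' : ℕ → R := fun a => ∑ l, Function.update c i v a l • f l with hg'
      have hgi : g' i = ∑ l, v l • f l := by simp [hg']
      have hga : ∀ a < i, g a = g' a := fun a ha => by
        simp only [hg, hg', Function.update_of_ne (show a ≠ i by omega)]
      have hm : ∀ a ≤ i, ∀ j, mixedIdeal n g' x a j = mixedIdeal n g x a j := fun a ha j =>
        (mixedIdeal_congr fun b hb => hga b (by omega)).symm
      have hleft : ∀ j, i < j → j ≤ n → RegularMod (mixedIdeal n g' x i j) (g' i) := by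
        intro j hj hjn
        rw [hm i le_rfl, hgi]
        exact hreg ⟨⟨j, by omega⟩, hj⟩
      constructor
      · intro a ha j haj hj
        rcases Nat.lt_succ_iff_lt_or_eq.1 ha with ha | rfl
        · rw [hm a ha.le, ← hga a ha]
          exact hs.left a ha j haj hj
        · exact hleft j haj hj
      · intro a ha j haj hj
        rcases Nat.le_succ_iff.1 ha with ha | rfl
        · rw [hm a ha]
          exact hs.right a ha j haj hj
        · rw [mixedIdeal_succ_left]
          apply RegularMod.exchange
          · rw [hm i le_rfl]
            exact hs.right i le_rfl j (by omega) hj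
          · rw [← mixedIdeal_of_lt hj]
            exact hleft j (by omega) hj.le

/-- The syzygies of a regular sequence are generated by the Koszul relations. -/
lemma exists_koszul_nat (g : ℕ → R) (i : ℕ)
    (h : ∀ a < i, RegularMod (Ideal.span {z | ∃ b < a, z = g b}) (g a)) (a : ℕ → R)
    (ha : ∑ l ∈ Finset.range i, a l * g l = 0) :
    ∃ b : ℕ → ℕ → R, (∀ l m, b l m = - b m l) ∧
      ∀ l < i, a l = ∑ m ∈ Finset.range i, b l m * g m := by
  induction i generalizing a with
  | zero => exact ⟨fun _ _ => 0, by simp, by simp⟩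
  | succ i ih =>
    rw [Finset.sum_range_succ] at ha
    have h1 : a i ∈ Ideal.span {z | ∃ b < i, z = g b} := by
      apply h i (by omega)
      have : g i * a i = - ∑ l ∈ Finset.range i, a l * g l := by linear_combination ha
      rw [this]
      refine neg_mem (Ideal.sum_mem _ fun l hl => Ideal.mul_mem_left _ _ (Ideal.subset_span ?_))
      exact ⟨l, Finset.mem_range.1 hl, rfl⟩
    have h2 : ∃ e : ℕ → R, a i = ∑ l ∈ Finset.range i, e l * g l := by
      clear ha
      generalize a i = z at h1
      induction h1 using Submodule.span_induction with
      | mem z hz =>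
        obtain ⟨b, hb, rfl⟩ := hz
        refine ⟨Pi.single b 1, ?_⟩
        rw [Finset.sum_eq_single_of_mem b (Finset.mem_range.2 hb)]
        · simp
        · intro l _ hl; simp [hl]
      | zero => exact ⟨0, by simp⟩
      | add y z _ _ hy hz =>
        obtain ⟨e, rfl⟩ := hy
        obtain ⟨e', rfl⟩ := hz
        exact ⟨e + e', by simp [add_mul, Finset.sum_add_distrib]⟩
      | smul c z _ hz =>
        obtain ⟨e, rfl⟩ := hz
        exact ⟨c • e, by simp [Finset.mul_sum, mul_assoc]⟩
    obtain ⟨e, he⟩ := h2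
    obtain ⟨b, hb, hb'⟩ := ih (fun a ha => h a (by omega)) (fun l => a l + e l * g i) (by
      rw [he] at ha
      simp only [add_mul, Finset.sum_add_distrib]
      rw [← ha, Finset.sum_mul]
      congr 1
      exact Finset.sum_congr rfl fun _ _ => by ring)
    -- The skew matrix for the corrected syzygy `a l + e l * g i` is bordered by the coefficients
    -- `e` of `a i`.
    refine ⟨fun l m => if l = i then (if m = i then 0 else e m) else
      (if m = i then - e l else b l m), ?_, ?_⟩
    · intro l m
      by_cases hl : l = i <;> by_cases hm : m = i <;> simp [hl, hm, hb l m]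
    · intro l hl
      rw [Finset.sum_range_succ]
      rcases Nat.lt_succ_iff_lt_or_eq.1 hl with hl | rfl
      · have e1 := hb' l hl
        have e2 : ∑ m ∈ Finset.range i, (if l = i then (if m = i then 0 else e m) else
            (if m = i then - e l else b l m)) * g m = ∑ m ∈ Finset.range i, b l m * g m := by
          refine Finset.sum_congr rfl fun m hm => ?_
          have := Finset.mem_range.1 hm
          rw [if_neg (by omega), if_neg (by omega)]
        change a l = ∑ m ∈ Finset.range i, (if l = i then (if m = i then 0 else e m) else
            (if m = i then - e l else b l m)) * g m + _
        rw [e2, ← e1]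
        simp only [if_neg (show l ≠ i by omega), if_true]
        ring
      · simp only [if_true, zero_mul, add_zero]
        rw [he]
        refine Finset.sum_congr rfl fun m hm => ?_
        have := Finset.mem_range.1 hm
        rw [if_neg (by omega)]

/-- The leading principal minors of an infinite matrix. -/
def leadingMinor (μ : ℕ → ℕ → R) (i : ℕ) : R :=
  (Matrix.of fun a b : Fin i => μ a b).det

/-- Cramer's rule for the leading block: modulo the ideal the block maps `x` to `g`, the entries `g
a` with `a < i` vanish, and the last cofactor is the previous leading minor. -/
lemma cramer_mixedIdeal {μ : ℕ → ℕ → R}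
    (hg : ∀ a < n, g a = ∑ b ∈ Finset.range n, μ a b * x b) (hi : i < n) :
    x i * leadingMinor μ (i + 1) - g i * leadingMinor μ i ∈ mixedIdeal n g x i (i + 1) := by
  set I := mixedIdeal n g x i (i + 1) with hI
  set N : Matrix (Fin (i + 1)) (Fin (i + 1)) R := Matrix.of fun a b => μ a b with hN
  let v : Fin (i + 1) → R := fun b => x b
  have h1 : ∀ a : Fin (i + 1), N.mulVec v a - g a ∈ I := by
    intro a
    have e1 : N.mulVec v a = ∑ b ∈ Finset.range (i + 1), μ a b * x b := by
      rw [← Fin.sum_univ_eq_sum_range fun b => μ a b * x b]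
      rfl
    have e2 := Finset.sum_range_add_sum_Ico (fun b => μ a b * x b) (show i + 1 ≤ n by omega)
    rw [e1, hg a (by omega), ← e2, sub_add_cancel_left]
    refine neg_mem (Ideal.sum_mem _ fun b hb => Ideal.mul_mem_left _ _ ?_)
    rw [Finset.mem_Ico] at hb
    exact right_mem_mixedIdeal hb.1 hb.2
  have h2 : N.det * x i = ∑ a, N.adjugate (Fin.last i) a * N.mulVec v a := by
    have e : (N.adjugate * N).mulVec v = N.det • v := by
      rw [Matrix.adjugate_mul, Matrix.smul_mulVec, Matrix.one_mulVec]
    have := congrFun e (Fin.last i)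
    rw [← Matrix.mulVec_mulVec, Pi.smul_apply, smul_eq_mul] at this
    exact this.symm
  have h3 : N.adjugate (Fin.last i) (Fin.last i) = leadingMinor μ i := by
    rw [Matrix.adjugate_fin_succ_eq_det_submatrix, Fin.succAbove_last]
    simp only [← two_mul, Even.neg_pow (even_two_mul _), one_pow, one_mul]
    rfl
  have h4 : x i * leadingMinor μ (i + 1) - g i * leadingMinor μ i =
      ∑ a : Fin i, N.adjugate (Fin.last i) a.castSucc * N.mulVec v a.castSucc +
        N.adjugate (Fin.last i) (Fin.last i) * (N.mulVec v (Fin.last i) - g i) := by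
    have : leadingMinor μ (i + 1) = N.det := rfl
    rw [this, mul_comm, h2, Fin.sum_univ_castSucc, ← h3]
    ring
  rw [h4]
  refine I.add_mem (Ideal.sum_mem _ fun a _ => Ideal.mul_mem_left _ _ ?_)
    (Ideal.mul_mem_left _ _ (h1 (Fin.last i)))
  have := I.add_mem (h1 a.castSucc) (left_mem_mixedIdeal (n := n) (x := x) (j := i + 1) a.2)
  simpa using this

/-- Socles in a sequence of exchanges. -/
lemma socle_mixedIdeal {μ : ℕ → ℕ → R}
    (hg : ∀ a < n, g a = ∑ b ∈ Finset.range n, μ a b * x b) (hs : ExchangeSeq n g x n)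
    (h1 : (1 : R) ∉ mixedIdeal n g x 0 0) (i : ℕ) (hi : i ≤ n) :
    leadingMinor μ i ∉ mixedIdeal n g x i i ∧
      ∀ a, (∀ l < n, x l * a ∈ mixedIdeal n g x i i) →
        ∃ c, a - c * leadingMinor μ i ∈ mixedIdeal n g x i i := by
  induction i with
  | zero =>
    have : leadingMinor μ 0 = 1 := by simp [leadingMinor]
    rw [this]
    exact ⟨h1, fun a _ => ⟨a, by simp⟩⟩
  | succ i ih =>
    obtain ⟨ih1, ih2⟩ := ih (by omega)
    have hi' : i < n := by omega
    set I := mixedIdeal n g x i (i + 1) with hI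
    have e1 : mixedIdeal n g x (i + 1) (i + 1) = I ⊔ Ideal.span {g i} := mixedIdeal_succ_left
    have e2 : mixedIdeal n g x i i = I ⊔ Ideal.span {x i} := mixedIdeal_of_lt hi'
    have hgr : RegularMod I (g i) := hs.left i hi' (i + 1) (by omega) (by omega)
    have hxr : RegularMod I (x i) := hs.right i hi'.le i le_rfl hi'
    have hcr := cramer_mixedIdeal hg hi'
    rw [← hI] at hcr
    rw [e1]
    rw [e2] at ih1 ih2
    set D := leadingMinor μ (i + 1)
    set D₀ := leadingMinor μ i
    have hmem : ∀ {a b : R}, a ∈ I ⊔ Ideal.span {b} ↔ ∃ c, a - b * c ∈ I := by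
      intro a b
      rw [Submodule.mem_sup]
      constructor
      · rintro ⟨y, hy, z, hz, rfl⟩
        obtain ⟨c, rfl⟩ := Ideal.mem_span_singleton.1 hz
        exact ⟨c, by simpa using hy⟩
      · rintro ⟨c, hc⟩
        exact ⟨_, hc, b * c, Ideal.mem_span_singleton.2 ⟨c, rfl⟩, by ring⟩
    -- With `x i * D ≡ g i * D₀` modulo `I` and both `x i` and `g i` regular modulo `I`, elements
    -- `a` and `b` with `x i * a ≡ g i * b` correspond to each other. In this way statements modulo
    -- `I + (x i)` about `D₀` become statements modulo `I + (g i)` about `D`.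
    constructor
    · intro hD
      obtain ⟨c, hc⟩ := hmem.1 hD
      apply ih1
      rw [hmem]
      refine ⟨c, hgr _ ?_⟩
      have : g i * (D₀ - x i * c) = x i * (D - g i * c) - (x i * D - g i * D₀) := by ring
      rw [this]
      exact I.sub_mem (I.mul_mem_left _ hc) hcr
    · intro a ha
      obtain ⟨b, hb⟩ := hmem.1 (ha i hi')
      have hb' : ∀ l < n, x l * b ∈ I ⊔ Ideal.span {x i} := by
        intro l hl
        obtain ⟨c, hc⟩ := hmem.1 (ha l hl)
        rw [hmem]
        refine ⟨c, hgr _ ?_⟩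
        have : g i * (x l * b - x i * c) = x i * (x l * a - g i * c) -
          x l * (x i * a - g i * b) := by ring
        rw [this]
        exact I.sub_mem (I.mul_mem_left _ hc) (I.mul_mem_left _ hb)
      obtain ⟨c, hc⟩ := ih2 b hb'
      obtain ⟨e, he⟩ := hmem.1 hc
      refine ⟨c, ?_⟩
      rw [hmem]
      refine ⟨e, hxr _ ?_⟩
      have : x i * (a - c * D - g i * e) = (x i * a - g i * b) +
        g i * (b - c * D₀ - x i * e) - c * (x i * D - g i * D₀) := by ring
      rw [this]
      exact I.sub_mem (I.add_mem hb (I.mul_mem_left _ he)) (I.mul_mem_left _ hcr)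

end Parameters

/-! ### Koszul syzygies and the socle of a complete intersection -/

section CompleteIntersection

variable {R : Type} [CommRing R] {n : ℕ}

/-- The structure of a complete intersection: the syzygies of `f` are the Koszul relations, and
the socle of `R / (f)` is generated by the determinant which expresses `f` by `x`. -/
structure IsCompleteIntersection (f x : Fin n → R) (M : Matrix (Fin n) (Fin n) R) : Prop where
  koszul : ∀ a : Fin n → R, ∑ i, a i * f i = 0 →
    ∃ b : Fin n → Fin n → R, (∀ i j, b i j = - b j i) ∧ ∀ i, a i = ∑ j, b i j * f j
  det_notMem : M.det ∉ Ideal.span (Set.range f)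
  socle : ∀ a, (∀ j, x j * a ∈ Ideal.span (Set.range f)) →
    ∃ c, a - c * M.det ∈ Ideal.span (Set.range f)

/-- A general invertible change of generators over `K` turns `f` into a sequence `g` that can be
exchanged for `x` one element at a time. Regularity of `g` gives the Koszul relations. The socle is
followed from `R / (x)`, where 1 generates it, to `R / (g) = R / (f)`, where the full determinant
does; the change of generators costs only the unit `det U`. -/
theorem isCompleteIntersection (K : Type) [Field K] [Infinite K] [Algebra K R] [IsNoetherianRing R]
    (f x : Fin n → R) (M : Matrix (Fin n) (Fin n) R)
    (hM : ∀ i, f i = ∑ j, M i j * x j) {N : ℕ}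
    (hx : ∀ j, RegularMod (Ideal.span {z | ∃ b, j < b ∧ z = x b}) (x j))
    (hx1 : (1 : R) ∉ Ideal.span (Set.range x))
    (hN : ∀ j, x j ^ N ∈ Ideal.span (Set.range f)) : IsCompleteIntersection f x M := by
  classical
  let x' : ℕ → R := fun b => if h : b < n then x ⟨b, h⟩ else 0
  have hx'v : ∀ b : Fin n, x' b = x b := fun b => by simp [x']
  obtain ⟨c, hc, hs⟩ := exists_exchangeSeq (K := K) f x' (N := N) (by
      intro j hj
      have e : {z | ∃ b, j < b ∧ b < n ∧ z = x' b} = {z | ∃ b, (⟨j, hj⟩ : Fin n) < b ∧ z = x b} := by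
        ext z
        constructor
        · rintro ⟨b, hb, hbn, rfl⟩
          exact ⟨⟨b, hbn⟩, hb, by simp [x', hbn]⟩
        · rintro ⟨b, hb, rfl⟩
          exact ⟨b, hb, b.2, (hx'v b).symm⟩
      rw [e]
      have := hx ⟨j, hj⟩
      rwa [← hx'v] at this) (by
      intro j hj
      have := hN ⟨j, hj⟩
      rwa [← hx'v] at this) n le_rfl
  set g : ℕ → R := fun a => ∑ l, c a l • f l with hg
  let U : Matrix (Fin n) (Fin n) K := Matrix.of fun a l => c a l
  have hU : IsUnit U.det := by
    rw [← Matrix.isUnit_iff_isUnit_det]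
    exact Matrix.linearIndependent_rows_iff_isUnit.1 hc
  set φ : K →+* R := algebraMap K R
  let V : Matrix (Fin n) (Fin n) R := U.map φ
  let W : Matrix (Fin n) (Fin n) R := U⁻¹.map φ
  have hWV : W * V = 1 := by
    rw [← Matrix.map_mul, Matrix.nonsing_inv_mul _ hU]
    simp
  have hgV : ∀ a : Fin n, g a = V.mulVec f a := by
    intro a
    simp [hg, V, U, Matrix.mulVec, dotProduct, Algebra.smul_def, φ]
  have hfW : ∀ a : Fin n, f a = ∑ b, W a b * g b := by
    intro a
    have : W.mulVec (V.mulVec f) = f := by rw [Matrix.mulVec_mulVec, hWV, Matrix.one_mulVec]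
    conv_lhs => rw [← this]
    simp [Matrix.mulVec, dotProduct, hgV]
  have hmix : mixedIdeal n g x' n n = Ideal.span (Set.range f) := by
    apply le_antisymm
    · refine Ideal.span_le.2 ?_
      rintro _ (⟨a, -, rfl⟩ | ⟨b, hb, hb', rfl⟩)
      · refine Ideal.sum_mem _ fun l _ => ?_
        rw [Algebra.smul_def]
        exact Ideal.mul_mem_left _ _ (Ideal.subset_span ⟨l, rfl⟩)
      · omega
    · refine Ideal.span_le.2 ?_
      rintro _ ⟨a, rfl⟩
      rw [hfW a]
      exact Ideal.sum_mem _ fun b _ => Ideal.mul_mem_left _ _ (left_mem_mixedIdeal b.2)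
  have hmix0 : mixedIdeal n g x' 0 0 = Ideal.span (Set.range x) := by
    unfold mixedIdeal
    congr 1
    ext z
    constructor
    · rintro (⟨a, ha, -⟩ | ⟨b, -, hb', rfl⟩)
      · omega
      · exact ⟨⟨b, hb'⟩, by simp [x', hb']⟩
    · rintro ⟨b, rfl⟩
      exact Or.inr ⟨b, Nat.zero_le _, b.2, (hx'v b).symm⟩
  let μ : ℕ → ℕ → R := fun a b => if h : a < n ∧ b < n then (V * M) ⟨a, h.1⟩ ⟨b, h.2⟩ else 0
  have hμ : ∀ a < n, g a = ∑ b ∈ Finset.range n, μ a b * x' b := by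
    intro a ha
    have h1 : g a = ∑ b : Fin n, (V * M) ⟨a, ha⟩ b * x b := by
      have : f = M.mulVec x := funext hM
      have h2 := hgV ⟨a, ha⟩
      rw [this, Matrix.mulVec_mulVec] at h2
      exact h2
    rw [h1, ← Fin.sum_univ_eq_sum_range fun b => μ a b * x' b]
    refine Finset.sum_congr rfl fun b _ => ?_
    rw [hx'v]
    simp [μ, ha]
  have hdet : leadingMinor μ n = φ U.det * M.det := by
    have : (Matrix.of fun a b : Fin n => μ a b) = V * M := by
      ext a b; simp [μ]
    rw [leadingMinor, this, Matrix.det_mul, RingHom.map_det]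
    rfl
  obtain ⟨hd, hso⟩ := socle_mixedIdeal hμ hs (by rwa [hmix0]) n le_rfl
  rw [hmix, hdet] at hd
  constructor
  · intro a ha
    let a' : ℕ → R := fun l => if h : l < n then (W.transpose.mulVec a) ⟨l, h⟩ else 0
    have ha'v : ∀ l : Fin n, a' l = W.transpose.mulVec a l := fun l => by simp [a']
    obtain ⟨b, hb, hb'⟩ := exists_koszul_nat g n (fun l hl => by
        have := hs.left l hl n hl le_rfl
        convert this using 1
        unfold mixedIdeal
        congr 1
        ext z
        constructor
        · exact fun h => Or.inl h
        · rintro (h | ⟨b, hb, hb', -⟩)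
          · exact h
          · omega) a' (by
        rw [← Fin.sum_univ_eq_sum_range fun l => a' l * g l]
        simp_rw [ha'v]
        rw [← ha]
        simp_rw [hfW, Matrix.mulVec, dotProduct, Finset.sum_mul, Finset.mul_sum]
        rw [Finset.sum_comm]
        refine Finset.sum_congr rfl fun i _ => Finset.sum_congr rfl fun j _ => ?_
        simp; ring)
    let b' : Matrix (Fin n) (Fin n) R := Matrix.of fun i j => b i j
    have hb1 : W.transpose.mulVec a = b'.mulVec (V.mulVec f) := by
      ext l
      rw [← ha'v, hb' l l.2, ← Fin.sum_univ_eq_sum_range fun m => b l m * g m]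
      simp [Matrix.mulVec, dotProduct, b', hgV]
    have hb2 : a = (V.transpose * b' * V).mulVec f := by
      have : V.transpose.mulVec (W.transpose.mulVec a) = a := by
        rw [Matrix.mulVec_mulVec, ← Matrix.transpose_mul, hWV]; simp
      rw [← this, hb1]
      simp only [Matrix.mulVec_mulVec, Matrix.mul_assoc]
    refine ⟨fun i j => (V.transpose * b' * V) i j, fun i j => ?_, fun i => ?_⟩
    · have e1 : b'.transpose = - b' := by
        ext i j; exact hb j i
      have e2 : (V.transpose * b' * V).transpose = -(V.transpose * b' * V) := by
        rw [Matrix.transpose_mul, Matrix.transpose_mul, e1]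
        simp [Matrix.mul_assoc]
      have := congrFun (congrFun e2 j) i
      simpa using this
    · exact congrFun hb2 i
  · intro h
    exact hd (Ideal.mul_mem_left _ _ h)
  · intro a ha
    rw [hmix] at hso
    obtain ⟨c, hc⟩ := hso a fun l hl => by
      have := ha ⟨l, hl⟩
      rwa [← hx'v] at this
    refine ⟨c * φ U.det, ?_⟩
    rw [mul_assoc, ← hdet]
    exact hc

end CompleteIntersection

end SQH

namespace SQH

/-! ### The ring of convergent power series -/

section Convergent

variable {n : ℕ}

-- `U` is the coefficient family of `1 / (1 - b)` with `b = ∑ β_α x^α`. As in a geometric series of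
-- ratio 1/2, its total mass is at most 2.
open Finset.HasAntidiagonal in
lemma exists_geometric_majorant (β : (Fin n →₀ ℕ) → ℝ) (h0 : ∀ α, 0 ≤ β α) (hz : β 0 = 0)
    (hs : ∀ s : Finset (Fin n →₀ ℕ), ∑ α ∈ s, β α ≤ 1 / 2) :
    ∃ U : (Fin n →₀ ℕ) → ℝ, (∀ α, 0 ≤ U α) ∧ Summable U ∧
      ∀ α, U α = (if α = 0 then 1 else 0) + ∑ p ∈ antidiagonal α, β p.1 * U p.2 := by
  classical
  let b : MvPowerSeries (Fin n) ℝ := β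
  have hb : ∀ α, MvPowerSeries.coeff α b = β α := fun α => rfl
  let V : MvPowerSeries (Fin n) ℝ := MvPowerSeries.invOfUnit (1 - b) 1
  have hc : MvPowerSeries.constantCoeff (1 - b) = ((1 : ℝˣ) : ℝ) := by
    rw [map_sub, ← MvPowerSeries.coeff_zero_eq_constantCoeff_apply b, hb, hz]; simp
  have hV : V = 1 + b * V := by
    have := MvPowerSeries.mul_invOfUnit (1 - b) 1 hc
    change (1 - b) * V = 1 at this
    linear_combination this
  let U : (Fin n →₀ ℕ) → ℝ := fun α => MvPowerSeries.coeff α V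
  have hU : ∀ α, U α = (if α = 0 then 1 else 0) + ∑ p ∈ antidiagonal α, β p.1 * U p.2 := by
    intro α
    have := congrArg (MvPowerSeries.coeff α) hV
    rwa [map_add, MvPowerSeries.coeff_one, MvPowerSeries.coeff_mul] at this
  have hU0 : ∀ α, 0 ≤ U α := by
    intro α
    induction α using WellFoundedLT.induction with
    | ind α ih =>
      rw [hU]
      refine add_nonneg (by split_ifs <;> norm_num) (Finset.sum_nonneg fun p hp => ?_)
      rw [mem_antidiagonal] at hp
      by_cases h : p.1 = 0
      · rw [h, hz, zero_mul]
      · refine mul_nonneg (h0 _) (ih _ ?_)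
        rw [← hp]
        exact lt_add_of_pos_left _ (pos_iff_ne_zero.2 h)
  refine ⟨U, hU0, ?_, hU⟩
  -- The finite set is enlarged to a box `Iic γ`. Boxes are closed under taking summands, so the
  -- recursion gives mass ≤ 1 + mass / 2.
  refine summable_of_sum_le (c := 2) hU0 fun s => ?_
  let γ : Fin n →₀ ℕ := s.sup id
  have hsub : s ⊆ Finset.Iic γ := fun α hα => Finset.mem_Iic.2 (Finset.le_sup (f := id) hα)
  refine (Finset.sum_le_sum_of_subset_of_nonneg hsub fun α _ _ => hU0 α).trans ?_
  set T := Finset.Iic γ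
  have h1 : ∑ α ∈ T, (if α = (0 : Fin n →₀ ℕ) then (1 : ℝ) else 0) ≤ 1 := by
    rw [Finset.sum_ite_eq']
    split_ifs <;> norm_num
  have h2 : ∑ α ∈ T, ∑ p ∈ antidiagonal α, β p.1 * U p.2 ≤ (∑ α ∈ T, β α) * ∑ α ∈ T, U α := by
    rw [Finset.sum_mul_sum, ← Finset.sum_product']
    rw [Finset.sum_sigma']
    have hinj : Set.InjOn (fun x : (_ : Fin n →₀ ℕ) × ((Fin n →₀ ℕ) × (Fin n →₀ ℕ)) => x.2)
        (T.sigma fun α => antidiagonal α) := by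
      rintro ⟨a, p⟩ hp ⟨a', p'⟩ hp' h
      simp only [Finset.coe_sigma, Set.mem_sigma_iff, Finset.mem_coe, mem_antidiagonal] at hp hp' h
      obtain rfl := hp.2
      obtain rfl := hp'.2
      subst h
      rfl
    rw [← Finset.sum_image (f := fun p : (Fin n →₀ ℕ) × (Fin n →₀ ℕ) => β p.1 * U p.2) hinj]
    refine Finset.sum_le_sum_of_subset_of_nonneg ?_ fun p _ _ => mul_nonneg (h0 _) (hU0 _)
    intro p hp
    obtain ⟨⟨a, p⟩, hq, rfl⟩ := Finset.mem_image.1 hp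
    simp only [Finset.mem_sigma, mem_antidiagonal] at hq
    obtain ⟨ha, rfl⟩ := hq
    rw [Finset.mem_Iic] at ha
    rw [Finset.mem_product, Finset.mem_Iic, Finset.mem_Iic]
    exact ⟨le_self_add.trans ha, le_add_self.trans ha⟩
  have h3 : ∑ α ∈ T, U α = ∑ α ∈ T, (if α = (0 : Fin n →₀ ℕ) then (1 : ℝ) else 0) +
      ∑ α ∈ T, ∑ p ∈ antidiagonal α, β p.1 * U p.2 := by
    rw [← Finset.sum_add_distrib]
    exact Finset.sum_congr rfl fun α _ => hU α
  have h4 : 0 ≤ ∑ α ∈ T, U α := Finset.sum_nonneg fun α _ => hU0 α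
  have h5 := mul_le_mul_of_nonneg_right (hs T) h4
  linarith

variable {A : Type} [CommRing A] [EvalPoints A]

-- The coefficients of the inverse satisfy the recursion of a geometric majorant. Since `g` has no
-- constant term, shrinking the radius makes its total mass as small as needed.
open Finset.HasAntidiagonal in
lemma IsConvergent.of_mul_eq_one {g u : MvPowerSeries (Fin n) A} (hg : IsConvergent g)
    (h0 : MvPowerSeries.coeff 0 g = 0) (hu : (1 + g) * u = 1) : IsConvergent u := by
  classical
  intro R
  obtain ⟨r, hr, b, hb, H⟩ := hg R
  set S := ∑' α, |b α| with hS
  have hS0 : 0 ≤ S := tsum_nonneg fun α => abs_nonneg _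
  -- Every nonconstant coefficient gains at least one factor `l`, so the mass becomes at most `l * S
  -- ≤ 1/2`; the summand 1 avoids division by zero.
  set l : ℝ := 1 / (2 * (S + 1)) with hl
  have hl0 : 0 < l := by positivity
  have hl1 : l ≤ 1 := by
    rw [hl, div_le_one (by positivity)]; linarith
  let β : (Fin n →₀ ℕ) → ℝ := fun α => if α = 0 then 0 else l * |b α|
  have hβle : ∀ α, β α ≤ l * |b α| := fun α => by
    simp only [β]; split_ifs
    · positivity
    · exact le_rfl
  obtain ⟨U, hU0, hUs, hU⟩ := exists_geometric_majorant β
    (fun α => by simp only [β]; split_ifs <;> positivity) (by simp [β]) (fun s => by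
      calc ∑ α ∈ s, β α ≤ ∑ α ∈ s, l * |b α| := Finset.sum_le_sum fun α _ => hβle α
        _ = l * ∑ α ∈ s, |b α| := by rw [Finset.mul_sum]
        _ ≤ l * S := by
          gcongr
          exact hb.abs.sum_le_tsum _ fun α _ => abs_nonneg _
        _ ≤ l * (S + 1) := by gcongr; linarith
        _ = 1 / 2 := by rw [hl]; field_simp)
  refine ⟨l * r, by positivity, U, hUs, ?_⟩
  intro α φ hφ
  have hgb : ∀ α, ‖φ (MvPowerSeries.coeff α g)‖ * (l * r) ^ α.degree ≤ β α := by
    intro α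
    by_cases hα : α = 0
    · subst hα; simp [h0, β]
    · have hd : 1 ≤ α.degree := Nat.one_le_iff_ne_zero.2 fun h => hα ((Finsupp.degree_eq_zero_iff _).1 h)
      simp only [β, if_neg hα]
      calc ‖φ (MvPowerSeries.coeff α g)‖ * (l * r) ^ α.degree
          = l ^ α.degree * (‖φ (MvPowerSeries.coeff α g)‖ * r ^ α.degree) := by
            rw [mul_pow]; ring
        _ ≤ l ^ 1 * |b α| := by
          refine mul_le_mul (pow_le_pow_of_le_one hl0.le hl1 hd)
            ((H α φ hφ).trans (le_abs_self _)) (by positivity) (by positivity)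
        _ = l * |b α| := by rw [pow_one]
  have hu' : ∀ α, MvPowerSeries.coeff α u = (if α = 0 then 1 else 0) -
      ∑ p ∈ antidiagonal α, MvPowerSeries.coeff p.1 g * MvPowerSeries.coeff p.2 u := by
    intro α
    have e : u = 1 - g * u := by linear_combination hu
    conv_lhs => rw [e]
    rw [map_sub, MvPowerSeries.coeff_one, MvPowerSeries.coeff_mul]
  induction α using WellFoundedLT.induction with
  | ind α ih =>
    rw [hu' α, map_sub, map_sum]
    have hρ : 0 ≤ (l * r) ^ α.degree := by positivity
    refine (mul_le_mul_of_nonneg_right ((norm_sub_le _ _).trans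
      (add_le_add le_rfl (norm_sum_le _ _))) hρ).trans ?_
    rw [add_mul, Finset.sum_mul, hU]
    refine add_le_add ?_ (Finset.sum_le_sum fun p hp => ?_)
    · by_cases hα : α = 0
      · subst hα; simp
      · simp [hα]
    · rw [mem_antidiagonal] at hp
      by_cases h : p.1 = 0
      · rw [h, h0]; simp [β]
      · have hlt : p.2 < α := by
          rw [← hp]; exact lt_add_of_pos_left _ (pos_iff_ne_zero.2 h)
        have h1 := ih p.2 hlt
        have h2 := hgb p.1
        have hd : α.degree = p.1.degree + p.2.degree := by rw [← hp, map_add]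
        rw [map_mul, norm_mul, hd, pow_add, mul_mul_mul_comm]
        exact mul_le_mul h2 h1 (by positivity) (by simp only [β]; split_ifs <;> positivity)

lemma IsConvergent.of_coeff {g h : MvPowerSeries (Fin n) A} (hg : IsConvergent g)
    (H : ∀ α, MvPowerSeries.coeff α h = MvPowerSeries.coeff α g ∨ MvPowerSeries.coeff α h = 0) :
    IsConvergent h := by
  intro R
  obtain ⟨r, hr, b, hb, hH⟩ := hg R
  refine ⟨r, hr, fun α => |b α|, hb.abs, fun α φ hφ => ?_⟩
  rcases H α with h1 | h1
  · rw [h1]; exact (hH α φ hφ).trans (le_abs_self _)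
  · rw [h1]; simp

lemma IsConvergent.of_X_mul {h : MvPowerSeries (Fin n) A} {i : Fin n}
    (hg : IsConvergent (MvPowerSeries.X i * h)) : IsConvergent h := by
  intro R
  obtain ⟨r, hr, b, hb, hH⟩ := hg R
  refine ⟨r, hr, fun α => r⁻¹ * b (Finsupp.single i 1 + α), ?_, fun α φ hφ => ?_⟩
  · exact (hb.comp_injective (add_right_injective (Finsupp.single i 1))).mul_left _
  · have := hH (Finsupp.single i 1 + α) φ hφ
    rw [MvPowerSeries.X_def, MvPowerSeries.coeff_add_monomial_mul, one_mul, map_add,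
      Finsupp.degree_single, pow_add, pow_one] at this
    rw [le_inv_mul_iff₀ hr]
    linarith

lemma toSeries_injective : Function.Injective (Conv.toSeries (n := n) (A := A)) :=
  Subtype.val_injective

/-- The ideal `(x_1, …, x_n)` of `A{x}`. -/
abbrev convVars (n : ℕ) (A : Type) [CommRing A] [EvalPoints A] : Ideal (Conv n A) :=
  Ideal.span (Set.range fun i => toConv n A (MvPolynomial.X i))

lemma toSeries_toConv (p : MvPolynomial (Fin n) A) :
    Conv.toSeries (toConv n A p) = (p : MvPowerSeries (Fin n) A) := by
  have : (Conv.toSeries (n := n) (A := A)).comp (toConv n A) =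
      MvPolynomial.coeToMvPowerSeries.algHom A := by
    apply MvPolynomial.algHom_ext
    intro i
    have h1 : toConv n A (MvPolynomial.X i) =
        (⟨MvPowerSeries.X i, isConvergent_X i⟩ : convSubalgebra n A) := MvPolynomial.aeval_X _ _
    have h2 : MvPolynomial.coeToMvPowerSeries.algHom A (MvPolynomial.X i : MvPolynomial (Fin n) A) =
        MvPowerSeries.X i := by simp
    rw [AlgHom.comp_apply, h1, h2]
    rfl
  have h := AlgHom.congr_fun this p
  simpa using h

lemma coeff_toSeries_toConv (p : MvPolynomial (Fin n) A) (α : Fin n →₀ ℕ) :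
    MvPowerSeries.coeff α (Conv.toSeries (toConv n A p)) = MvPolynomial.coeff α p := by
  rw [toSeries_toConv, MvPolynomial.coeff_coe]

lemma toSeries_algebraMap (a : A) :
    Conv.toSeries (algebraMap A (Conv n A) a) = MvPowerSeries.C a := by
  rw [AlgHom.commutes]; rfl

/-- The monomials are sorted by the first variable that occurs in them. The part belonging to `x_i`
is divisible by `x_i`, and neither the sorting nor the division destroys convergence. -/
lemma mem_convVars_of_coeff_zero {g : Conv n A} (h0 : MvPowerSeries.coeff 0 (Conv.toSeries g) = 0) :
    g ∈ convVars n A := by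
  classical
  set G := Conv.toSeries g with hG
  have hGc : IsConvergent G := g.2
  let P : Fin n → MvPowerSeries (Fin n) A := fun i α =>
    if α i ≠ 0 ∧ ∀ j < i, α j = 0 then MvPowerSeries.coeff α G else 0
  have hP : ∀ i α, MvPowerSeries.coeff α (P i) =
      if α i ≠ 0 ∧ ∀ j < i, α j = 0 then MvPowerSeries.coeff α G else 0 := fun _ _ => rfl
  have hdvd : ∀ i, (MvPowerSeries.X i : MvPowerSeries (Fin n) A) ∣ P i := by
    intro i
    rw [MvPowerSeries.X_dvd_iff]
    intro α hα
    rw [hP, if_neg]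
    exact fun h => h.1 hα
  choose Q hQ using hdvd
  have hPc : ∀ i, IsConvergent (P i) := fun i => hGc.of_coeff fun α => by
    rw [hP]; split_ifs <;> simp
  have hQc : ∀ i, IsConvergent (Q i) := fun i => by
    have := hPc i
    rw [hQ i] at this
    exact this.of_X_mul
  have hsum : G = ∑ i, P i := by
    ext α
    rw [map_sum]
    by_cases hα : α = 0
    · subst hα
      rw [h0]
      refine (Finset.sum_eq_zero fun i _ => ?_).symm
      rw [hP, if_neg]; simp
    · have hne : (Finset.univ.filter fun i => α i ≠ 0).Nonempty := by
        by_contra h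
        rw [Finset.not_nonempty_iff_eq_empty, Finset.filter_eq_empty_iff] at h
        exact hα (Finsupp.ext fun i => by simpa using h (Finset.mem_univ i))
      set i := (Finset.univ.filter fun i => α i ≠ 0).min' hne
      have hi := (Finset.mem_filter.1 (Finset.min'_mem _ hne)).2
      have hmin : ∀ j < i, α j = 0 := by
        intro j hj
        by_contra hc
        exact absurd (Finset.min'_le _ j (Finset.mem_filter.2 ⟨Finset.mem_univ _, hc⟩)) (not_le.2 hj)
      rw [Finset.sum_eq_single_of_mem i (Finset.mem_univ _), hP, if_pos ⟨hi, hmin⟩]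
      intro j _ hji
      rw [hP, if_neg]
      rintro ⟨h1, h2⟩
      rcases lt_or_gt_of_ne hji with h | h
      · exact h1 (hmin j h)
      · exact hi (h2 i h)
  let q : Fin n → Conv n A := fun i => ⟨Q i, hQc i⟩
  have hg : g = ∑ i, toConv n A (MvPolynomial.X i) * q i := by
    apply toSeries_injective
    rw [map_sum, ← hG, hsum]
    refine Finset.sum_congr rfl fun i _ => ?_
    rw [map_mul, toSeries_toConv, MvPolynomial.coe_X, hQ i]
    rfl
  rw [hg]
  exact Ideal.sum_mem _ fun i _ => Ideal.mul_mem_right _ _ (Ideal.subset_span ⟨i, rfl⟩)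

lemma coeff_zero_of_mem_convVars {g : Conv n A} (h : g ∈ convVars n A) :
    MvPowerSeries.coeff 0 (Conv.toSeries g) = 0 := by
  let φ : Conv n A →+* A := (MvPowerSeries.constantCoeff (σ := Fin n) (R := A)).comp
    (Conv.toSeries (n := n) (A := A)).toRingHom
  have : convVars n A ≤ RingHom.ker φ := by
    rw [Ideal.span_le]
    rintro _ ⟨i, rfl⟩
    change MvPowerSeries.constantCoeff (Conv.toSeries _) = 0
    rw [toSeries_toConv, MvPolynomial.coe_X, MvPowerSeries.constantCoeff_X]
  exact this h

lemma sub_algebraMap_mem_convVars (g : Conv n A) :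
    g - algebraMap A _ (MvPowerSeries.coeff 0 (Conv.toSeries g)) ∈ convVars n A := by
  apply mem_convVars_of_coeff_zero
  rw [map_sub, map_sub, toSeries_algebraMap, MvPowerSeries.coeff_zero_C, sub_self]

/-- Inverses of convergent series with constant term 1 converge. This is what makes Nakayama's lemma
applicable to `A{x}`, for every base `A`. -/
lemma convVars_le_jacobson : convVars n A ≤ Ideal.jacobson ⊥ := by
  intro g hg
  rw [Ideal.mem_jacobson_bot]
  intro y
  have hgy : g * y ∈ convVars n A := Ideal.mul_mem_right _ _ hg
  have h0 := coeff_zero_of_mem_convVars hgy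
  set G := Conv.toSeries (g * y) with hG
  let u := MvPowerSeries.invOfUnit (1 + G) 1
  have hu : (1 + G) * u = 1 := by
    apply MvPowerSeries.mul_invOfUnit
    rw [map_add, ← MvPowerSeries.coeff_zero_eq_constantCoeff_apply G, h0]
    simp
  have huc : IsConvergent u := IsConvergent.of_mul_eq_one (g * y).2 h0 hu
  let U : Conv n A := ⟨u, huc⟩
  refine IsUnit.of_mul_eq_one U ?_
  apply toSeries_injective
  rw [map_mul, map_add, map_one, ← hG, add_comm]
  exact hu

/-- Every convergent power series is a polynomial modulo a given power of `(x)`. -/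
lemma exists_toConv_sub_mem (N : ℕ) (g : Conv n A) :
    ∃ p : MvPolynomial (Fin n) A, g - toConv n A p ∈ convVars n A ^ N := by
  have key : ∀ N, ∀ g ∈ convVars n A ^ N,
      ∃ p : MvPolynomial (Fin n) A, g - toConv n A p ∈ convVars n A ^ (N + 1) := by
    intro N g hg
    have hmap : convVars n A ^ N = Ideal.map (toConv n A)
        (Ideal.span (Set.range MvPolynomial.X) ^ N) := by
      rw [Ideal.map_pow, Ideal.map_span, ← Set.range_comp]
      rfl
    rw [hmap, Ideal.map] at hg
    induction hg using Submodule.span_induction with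
    | mem x hx =>
      obtain ⟨p, -, rfl⟩ := hx
      exact ⟨p, by simp⟩
    | zero => exact ⟨0, by simp⟩
    | add x y _ _ hx hy =>
      obtain ⟨p, hp⟩ := hx
      obtain ⟨q, hq⟩ := hy
      refine ⟨p + q, ?_⟩
      rw [map_add, add_sub_add_comm]
      exact Ideal.add_mem _ hp hq
    | smul a x hx hp =>
      obtain ⟨p, hp⟩ := hp
      change x ∈ Ideal.map (toConv n A) _ at hx
      rw [← hmap] at hx
      set c := MvPowerSeries.coeff 0 (Conv.toSeries a)
      refine ⟨MvPolynomial.C c * p, ?_⟩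
      have h1 : toConv n A (MvPolynomial.C c) = algebraMap A _ c := (toConv n A).commutes c
      have : a • x - toConv n A (MvPolynomial.C c * p) =
          (a - algebraMap A _ c) * x + algebraMap A _ c * (x - toConv n A p) := by
        rw [map_mul, h1, smul_eq_mul]; ring
      rw [this]
      refine Ideal.add_mem _ ?_ (Ideal.mul_mem_left _ _ hp)
      rw [pow_succ']
      exact Ideal.mul_mem_mul (sub_algebraMap_mem_convVars a) hx
  induction N with
  | zero => exact ⟨0, by simp⟩
  | succ N ih =>
    obtain ⟨p, hp⟩ := ih
    obtain ⟨q, hq⟩ := key N _ hp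
    exact ⟨p + q, by rwa [map_add, ← sub_sub]⟩

end Convergent

end SQH

namespace SQH

/-! ### The filtration by order -/

section Order

open MvPolynomial

variable {n : ℕ} {A : Type} [CommRing A] {w : Fin n → ℕ}

variable (A w) in
/-- The ideal of all polynomials all of whose monomials have weight at least `N`. -/
def ordIdeal (N : ℕ) : Ideal (MvPolynomial (Fin n) A) where
  carrier := {p | ∀ β, Finsupp.weight w β < N → coeff β p = 0}
  zero_mem' := by intro β _; simp
  add_mem' := by
    intro p q hp hq β hβ
    rw [coeff_add, hp β hβ, hq β hβ, add_zero]
  smul_mem' := by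
    classical
    intro c p hp β hβ
    rw [smul_eq_mul, coeff_mul]
    refine Finset.sum_eq_zero fun x hx => ?_
    rw [Finset.HasAntidiagonal.mem_antidiagonal] at hx
    rw [hp x.2, mul_zero]
    have : Finsupp.weight w x.1 + Finsupp.weight w x.2 = Finsupp.weight w β := by
      rw [← hx, map_add]
    omega

lemma ordIdeal_zero : ordIdeal A w 0 = ⊤ := by
  rw [eq_top_iff]; intro p _ β hβ; omega

lemma ordIdeal_anti {M N : ℕ} (h : M ≤ N) : ordIdeal A w N ≤ ordIdeal A w M :=
  fun _ hp β hβ => hp β (by omega)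

lemma monomial_mem_ordIdeal {N : ℕ} {β : Fin n →₀ ℕ} (h : N ≤ Finsupp.weight w β) (a : A) :
    monomial β a ∈ ordIdeal A w N := by
  classical
  intro γ hγ
  rw [coeff_monomial, if_neg]
  rintro rfl
  omega

lemma mul_mem_ordIdeal {M N : ℕ} {p q : MvPolynomial (Fin n) A} (hp : p ∈ ordIdeal A w M)
    (hq : q ∈ ordIdeal A w N) : p * q ∈ ordIdeal A w (M + N) := by
  classical
  intro β hβ
  rw [coeff_mul]
  refine Finset.sum_eq_zero fun x hx => ?_
  rw [Finset.HasAntidiagonal.mem_antidiagonal] at hx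
  have : Finsupp.weight w x.1 + Finsupp.weight w x.2 = Finsupp.weight w β := by
    rw [← hx, map_add]
  by_cases h : Finsupp.weight w x.1 < M
  · rw [hp _ h, zero_mul]
  · rw [hq x.2 (by omega), mul_zero]

lemma coeff_pderiv' (i : Fin n) (p : MvPolynomial (Fin n) A) (β : Fin n →₀ ℕ) :
    coeff β (pderiv i p) = coeff (β + Finsupp.single i 1) p * ((β i + 1 : ℕ) : A) := by
  classical
  induction p using MvPolynomial.induction_on' with
  | monomial γ a =>
    rw [pderiv_monomial, coeff_monomial, coeff_monomial]
    by_cases h : γ = β + Finsupp.single i 1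
    · subst h; simp
    · rw [if_neg h]
      by_cases hγ : γ i = 0
      · simp [hγ]
      · rw [if_neg]
        · simp
        · intro h'
          apply h
          rw [← h']
          ext j
          by_cases hj : i = j
          · subst hj; simp; omega
          · simp [hj]
  | add p q hp hq => rw [map_add, coeff_add, hp, hq, coeff_add, add_mul]

lemma pderiv_mem_ordIdeal {M N : ℕ} {p : MvPolynomial (Fin n) A} (hp : p ∈ ordIdeal A w N)
    (i : Fin n) (h : M + w i ≤ N) : pderiv i p ∈ ordIdeal A w M := by
  intro β hβ
  rw [coeff_pderiv', hp, zero_mul]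
  rw [map_add, Finsupp.weight_single, one_smul]
  omega

lemma ordIdeal_le_iff {N : ℕ} {I : Ideal (MvPolynomial (Fin n) A)} :
    ordIdeal A w N ≤ I ↔ ∀ β, N ≤ Finsupp.weight w β → monomial β (1 : A) ∈ I := by
  constructor
  · exact fun h β hβ => h (monomial_mem_ordIdeal hβ 1)
  · intro h p hp
    rw [p.as_sum]
    refine Ideal.sum_mem _ fun β hβ => ?_
    have : monomial β (coeff β p) = C (coeff β p) * monomial β 1 := by
      rw [C_mul_monomial, mul_one]
    rw [this]
    refine Ideal.mul_mem_left _ _ (h β ?_)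
    by_contra hc
    exact (mem_support_iff.1 hβ) (hp β (by omega))

lemma _root_.MvPolynomial.IsWeightedHomogeneous.mem_ordIdeal {e N : ℕ} {p : MvPolynomial (Fin n) A}
    (hp : p.IsWeightedHomogeneous w e) (h : N ≤ e) : p ∈ ordIdeal A w N := by
  intro β hβ
  by_contra hc
  have := hp hc
  omega

lemma map_mem_ordIdeal {A' : Type} [CommRing A'] (φ : A →+* A') {N : ℕ}
    {p : MvPolynomial (Fin n) A} (hp : p ∈ ordIdeal A w N) : map φ p ∈ ordIdeal A' w N := by
  intro β hβ
  rw [coeff_map, hp β hβ, map_zero]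

/-- The component of weight `e`. -/
abbrev wcomp (w : Fin n → ℕ) (e : ℕ) (p : MvPolynomial (Fin n) A) : MvPolynomial (Fin n) A :=
  weightedHomogeneousComponent w e p

lemma coeff_wcomp (e : ℕ) (p : MvPolynomial (Fin n) A) (β : Fin n →₀ ℕ) :
    coeff β (wcomp w e p) = if Finsupp.weight w β = e then coeff β p else 0 := by
  classical
  exact coeff_weightedHomogeneousComponent ..

lemma sub_wcomp_mem_ordIdeal {N : ℕ} {p : MvPolynomial (Fin n) A} (hp : p ∈ ordIdeal A w N) :
    p - wcomp w N p ∈ ordIdeal A w (N + 1) := by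
  intro β hβ
  rw [coeff_sub, coeff_wcomp]
  split_ifs with h
  · rw [sub_self]
  · rw [hp β (by omega), sub_zero]

lemma wcomp_eq_zero_of_mem_ordIdeal {N e : ℕ} (h : e < N) {p : MvPolynomial (Fin n) A}
    (hp : p ∈ ordIdeal A w N) : wcomp w e p = 0 := by
  ext β
  rw [coeff_wcomp, coeff_zero]
  split_ifs with h'
  · exact hp β (by omega)
  · rfl

lemma wcomp_of_isWeightedHomogeneous {e : ℕ} {p : MvPolynomial (Fin n) A}
    (hp : p.IsWeightedHomogeneous w e) (e' : ℕ) : wcomp w e' p = if e = e' then p else 0 := by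
  ext β
  rw [coeff_wcomp]
  by_cases h : coeff β p = 0
  · split_ifs <;> simp [h]
  · rw [hp h]; split_ifs <;> simp

lemma wcomp_mul {e e' m : ℕ} (h : e' + m = e) (a : MvPolynomial (Fin n) A)
    {q : MvPolynomial (Fin n) A} (hq : q.IsWeightedHomogeneous w m) :
    wcomp w e (a * q) = wcomp w e' a * q := by
  classical
  ext β
  have e0 : (if Finsupp.weight w β = e then
        ∑ x ∈ Finset.HasAntidiagonal.antidiagonal β, coeff x.1 a * coeff x.2 q else 0) =
      ∑ x ∈ Finset.HasAntidiagonal.antidiagonal β,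
        if Finsupp.weight w β = e then coeff x.1 a * coeff x.2 q else 0 := by
    split_ifs <;> simp
  rw [coeff_wcomp, coeff_mul, coeff_mul, e0]
  refine Finset.sum_congr rfl fun x hx => ?_
  rw [Finset.HasAntidiagonal.mem_antidiagonal] at hx
  have : Finsupp.weight w x.1 + Finsupp.weight w x.2 = Finsupp.weight w β := by
    rw [← hx, map_add]
  rw [coeff_wcomp]
  by_cases h0 : coeff x.2 q = 0
  · simp [h0]
  · have := hq h0
    by_cases h1 : Finsupp.weight w β = e
    · rw [if_pos h1, if_pos (by omega)]
    · rw [if_neg h1, if_neg (by omega), zero_mul]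

lemma wcomp_mul_of_lt {e m : ℕ} (h : e < m) (a : MvPolynomial (Fin n) A)
    {q : MvPolynomial (Fin n) A} (hq : q.IsWeightedHomogeneous w m) :
    wcomp w e (a * q) = 0 :=
  wcomp_eq_zero_of_mem_ordIdeal h (Ideal.mul_mem_left _ _ (hq.mem_ordIdeal le_rfl))

lemma wcomp_isWeightedHomogeneous (e : ℕ) (p : MvPolynomial (Fin n) A) :
    (wcomp w e p).IsWeightedHomogeneous w e :=
  weightedHomogeneousComponent_isWeightedHomogeneous e p

variable [EvalPoints A]

lemma degIdeal_eq_map (N : ℕ) : degIdeal A w (N : ℚ) = (ordIdeal A w N).map (toConv n A) := by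
  apply le_antisymm
  · refine Ideal.span_le.2 ?_
    rintro _ ⟨p, e, he, hp, rfl⟩
    exact Ideal.mem_map_of_mem _ (hp.mem_ordIdeal (by exact_mod_cast he))
  · rw [Ideal.map_le_iff_le_comap, ordIdeal_le_iff]
    intro β hβ
    exact Ideal.subset_span ⟨_, _, by exact_mod_cast hβ, isWeightedHomogeneous_monomial w β 1 rfl, rfl⟩

lemma coeff_eq_zero_of_mem_map_ordIdeal {N : ℕ} {g : Conv n A}
    (hg : g ∈ (ordIdeal A w N).map (toConv n A)) (β : Fin n →₀ ℕ) (hβ : Finsupp.weight w β < N) :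
    MvPowerSeries.coeff β (Conv.toSeries g) = 0 := by
  classical
  induction hg using Submodule.span_induction generalizing β with
  | mem x hx =>
    obtain ⟨p, hp, rfl⟩ := hx
    rw [coeff_toSeries_toConv]
    exact hp β hβ
  | zero => simp
  | add x y _ _ hx hy => rw [map_add, map_add, hx β hβ, hy β hβ, add_zero]
  | smul a x _ hx =>
    rw [smul_eq_mul, map_mul, MvPowerSeries.coeff_mul]
    refine Finset.sum_eq_zero fun y hy => ?_
    rw [Finset.HasAntidiagonal.mem_antidiagonal] at hy
    have : Finsupp.weight w y.1 + Finsupp.weight w y.2 = Finsupp.weight w β := by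
      rw [← hy, map_add]
    rw [hx y.2 (by omega), mul_zero]

lemma mem_ordIdeal_of_toConv_mem {N : ℕ} {p : MvPolynomial (Fin n) A}
    (hp : toConv n A p ∈ (ordIdeal A w N).map (toConv n A)) : p ∈ ordIdeal A w N := by
  intro β hβ
  rw [← coeff_toSeries_toConv]
  exact coeff_eq_zero_of_mem_map_ordIdeal hp β hβ

lemma convVars_pow_le (hw : ∀ i, 0 < w i) (N : ℕ) :
    convVars n A ^ N ≤ (ordIdeal A w N).map (toConv n A) := by
  have h1 : convVars n A ^ N = Ideal.map (toConv n A) (Ideal.span (Set.range X) ^ N) := by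
    rw [Ideal.map_pow, Ideal.map_span, ← Set.range_comp]
    rfl
  rw [h1]
  refine Ideal.map_mono ?_
  induction N with
  | zero => rw [ordIdeal_zero]; exact le_top
  | succ N ih =>
    rw [pow_succ', Ideal.mul_le]
    intro p hp q hq
    rw [add_comm]
    refine mul_mem_ordIdeal ?_ (ih (by rw [Ideal.map_pow, Ideal.map_span, ← Set.range_comp]; rfl) hq)
    refine (Ideal.span_le.2 ?_ : Ideal.span (Set.range X) ≤ ordIdeal A w 1) hp
    rintro _ ⟨i, rfl⟩
    refine monomial_mem_ordIdeal ?_ 1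
    rw [Finsupp.weight_single, one_smul]
    exact hw i

lemma exists_toConv_sub_mem_ordIdeal (hw : ∀ i, 0 < w i) (N : ℕ) (g : Conv n A) :
    ∃ p : MvPolynomial (Fin n) A, g - toConv n A p ∈ (ordIdeal A w N).map (toConv n A) := by
  obtain ⟨p, hp⟩ := exists_toConv_sub_mem N g
  exact ⟨p, convVars_pow_le hw N hp⟩

/-- Modulo high order, membership in an ideal generated by polynomials can be tested in the
polynomial ring. -/
lemma mem_sup_ordIdeal_of_toConv_mem (hw : ∀ i, 0 < w i) {N : ℕ}
    {K : Ideal (MvPolynomial (Fin n) A)} {p : MvPolynomial (Fin n) A}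
    (hp : toConv n A p ∈ K.map (toConv n A) ⊔ (ordIdeal A w N).map (toConv n A)) :
    p ∈ K ⊔ ordIdeal A w N := by
  -- Power series coefficients are replaced by polynomials, with an error of order `N`.
  have key : ∀ g ∈ K.map (toConv n A), ∃ q ∈ K, g - toConv n A q ∈
      (ordIdeal A w N).map (toConv n A) := by
    intro g hg
    induction hg using Submodule.span_induction with
    | mem x hx =>
      obtain ⟨q, hq, rfl⟩ := hx
      exact ⟨q, hq, by simp⟩
    | zero => exact ⟨0, K.zero_mem, by simp⟩
    | add x y _ _ hx hy =>
      obtain ⟨p, hp, hp'⟩ := hx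
      obtain ⟨q, hq, hq'⟩ := hy
      refine ⟨p + q, K.add_mem hp hq, ?_⟩
      rw [map_add, add_sub_add_comm]
      exact Ideal.add_mem _ hp' hq'
    | smul a x _ hx =>
      obtain ⟨q, hq, hq'⟩ := hx
      obtain ⟨p, hp⟩ := exists_toConv_sub_mem_ordIdeal hw N a
      refine ⟨p * q, K.mul_mem_left _ hq, ?_⟩
      have : a • x - toConv n A (p * q) =
          a * (x - toConv n A q) + (a - toConv n A p) * toConv n A q := by
        rw [map_mul, smul_eq_mul]; ring
      rw [this]
      exact Ideal.add_mem _ (Ideal.mul_mem_left _ _ hq') (Ideal.mul_mem_right _ _ hp)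
  obtain ⟨g, hg, o, ho, hgo⟩ := Submodule.mem_sup.1 hp
  obtain ⟨q, hq, hq'⟩ := key g hg
  have h1 : p - q ∈ ordIdeal A w N := by
    apply mem_ordIdeal_of_toConv_mem
    have : toConv n A (p - q) = (g - toConv n A q) + o := by
      rw [map_sub, ← hgo]; ring
    rw [this]
    exact Ideal.add_mem _ hq' ho
  have : p = q + (p - q) := by ring
  rw [this]
  exact Submodule.add_mem_sup hq h1

lemma jacobianIdeal_eq_map (g : MvPolynomial (Fin n) A) :
    jacobianIdeal g = (Ideal.span (Set.range fun i => pderiv i g)).map (toConv n A) := by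
  rw [Ideal.map_span, ← Set.range_comp]
  rfl

end Order

end SQH

/-! ### The Milnor algebra of f₀: passage to polynomials, Hessian and socle -/

namespace SQH

open MvPolynomial

lemma det_isWeightedHomogeneous {ι τ R : Type} [Fintype ι] [DecidableEq ι] [CommRing R]
    {v : τ → ℤ} {E : Matrix ι ι (MvPolynomial τ R)} {r s : ι → ℤ}
    (h : ∀ i j, (E i j).IsWeightedHomogeneous v (r i + s j)) :
    E.det.IsWeightedHomogeneous v (∑ i, r i + ∑ i, s i) := by
  rw [Matrix.det_apply, ← mem_weightedHomogeneousSubmodule]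
  refine Submodule.sum_mem _ fun g _ => ?_
  rw [Units.smul_def]
  refine zsmul_mem ?_ _
  rw [mem_weightedHomogeneousSubmodule]
  have h1 := IsWeightedHomogeneous.prod Finset.univ (fun i => E (g i) i) (fun i => r (g i) + s i)
    (w := v) (fun i _ => h (g i) i)
  rwa [Finset.sum_add_distrib, Equiv.sum_comp g r] at h1

namespace Setup

variable {n k : ℕ} (D : Setup n k)

/-- The partial derivatives of `f₀`. -/
def jac (i : Fin n) : MvPolynomial (Fin n) ℂ := pderiv i D.f₀

/-- The ideal of the polynomial ring generated by the partial derivatives of `f₀`. -/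
def J : Ideal (MvPolynomial (Fin n) ℂ) := Ideal.span (Set.range D.jac)

lemma jacobianIdeal_f₀ : jacobianIdeal D.f₀ = D.J.map (toConv n ℂ) := jacobianIdeal_eq_map _

lemma jac_mem (i : Fin n) : D.jac i ∈ D.J := Ideal.subset_span ⟨i, rfl⟩

lemma coeff_jac_ne_zero {i : Fin n} {β : Fin n →₀ ℕ} (h : coeff β (D.jac i) ≠ 0) :
    Finsupp.weight D.w β + D.w i = D.d := by
  rw [jac, coeff_pderiv'] at h
  have := D.f₀_quasihomogeneous (left_ne_zero_of_mul h)
  rwa [map_add, Finsupp.weight_single, one_smul] at this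

lemma jac_isWeightedHomogeneous {i : Fin n} {e : ℕ} (he : e + D.w i = D.d) :
    (D.jac i).IsWeightedHomogeneous D.w e := by
  intro β hβ
  have := D.coeff_jac_ne_zero hβ
  omega

lemma jac_eq_zero {i : Fin n} (he : D.d < D.w i) : D.jac i = 0 := by
  ext β
  by_contra h
  have := D.coeff_jac_ne_zero (i := i) (β := β) (by simpa using h)
  omega

lemma mem_J_iff {p : MvPolynomial (Fin n) ℂ} :
    p ∈ D.J ↔ ∃ a : Fin n → MvPolynomial (Fin n) ℂ, ∑ i, a i * D.jac i = p :=
  Ideal.mem_span_range_iff_exists_fun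

/-- The component of weight `e` of an element of the Jacobian ideal, with homogeneous
coefficients. -/
lemma exists_wcomp_eq {p : MvPolynomial (Fin n) ℂ} (hp : p ∈ D.J) (e : ℕ) :
    ∃ a : Fin n → MvPolynomial (Fin n) ℂ, wcomp D.w e p = ∑ i, a i * D.jac i ∧
      ∀ i β, coeff β (a i) ≠ 0 → Finsupp.weight D.w β + D.d = e + D.w i := by
  obtain ⟨a, rfl⟩ := D.mem_J_iff.1 hp
  refine ⟨fun i => if D.w i ≤ D.d ∧ D.d ≤ e + D.w i then wcomp D.w (e + D.w i - D.d) (a i) else 0,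
    ?_, ?_⟩
  · rw [wcomp, map_sum]
    refine Finset.sum_congr rfl fun i _ => ?_
    beta_reduce
    by_cases h1 : D.w i ≤ D.d
    · have hj := D.jac_isWeightedHomogeneous (i := i) (e := D.d - D.w i) (by omega)
      by_cases h2 : D.d ≤ e + D.w i
      · rw [if_pos ⟨h1, h2⟩]
        exact wcomp_mul (by omega) _ hj
      · rw [if_neg (by omega), zero_mul]
        exact wcomp_mul_of_lt (by omega) _ hj
    · rw [D.jac_eq_zero (by omega), mul_zero, mul_zero, map_zero]
  · intro i β hβ
    dsimp only at hβ
    split_ifs at hβ with h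
    · rw [coeff_wcomp] at hβ
      split_ifs at hβ with h'
      · omega
      · exact absurd rfl hβ
    · exact absurd (coeff_zero β) hβ

lemma wcomp_mem_J {p : MvPolynomial (Fin n) ℂ} (hp : p ∈ D.J) (e : ℕ) :
    wcomp D.w e p ∈ D.J := by
  obtain ⟨a, ha, _⟩ := D.exists_wcomp_eq hp e
  exact D.mem_J_iff.2 ⟨a, ha.symm⟩

lemma mem_J_of_mem_sup {p : MvPolynomial (Fin n) ℂ} {e N : ℕ} (hp : p.IsWeightedHomogeneous D.w e)
    (he : e < N) (h : p ∈ D.J ⊔ ordIdeal ℂ D.w N) : p ∈ D.J := by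
  obtain ⟨q, hq, o, ho, rfl⟩ := Submodule.mem_sup.1 h
  have h1 := wcomp_of_isWeightedHomogeneous hp e
  rw [if_pos rfl, wcomp, map_add] at h1
  rw [← h1]
  have h2 : weightedHomogeneousComponent D.w e o = 0 := wcomp_eq_zero_of_mem_ordIdeal he ho
  rw [h2, add_zero]
  exact D.wcomp_mem_J hq e

open Classical in
instance : Module.Finite ℂ (Conv n ℂ ⧸ jacobianIdeal D.f₀) :=
  ⟨⟨Finset.univ.image fun α : D.B =>
    Ideal.Quotient.mk (jacobianIdeal D.f₀) (toConv n ℂ (monomial α.1 1)), by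
      rw [Finset.coe_image, Finset.coe_univ, Set.image_univ]; exact D.B_span⟩⟩

/-- The Milnor algebra is finite-dimensional, hence Artinian, and the variables lie in its nilpotent
Jacobson radical. -/
lemma exists_convVars_pow_le : ∃ N, convVars n ℂ ^ N ≤ jacobianIdeal D.f₀ := by
  have : IsArtinianRing (Conv n ℂ ⧸ jacobianIdeal D.f₀) := IsArtinianRing.of_finite ℂ _
  obtain ⟨N, hN⟩ := IsArtinianRing.isNilpotent_jacobson_bot (R := Conv n ℂ ⧸ jacobianIdeal D.f₀)
  refine ⟨N, ?_⟩
  have h1 : (convVars n ℂ).map (Ideal.Quotient.mk (jacobianIdeal D.f₀)) ≤ Ideal.jacobson ⊥ := by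
    rw [Ideal.map_le_iff_le_comap]
    intro g hg
    rw [Ideal.mem_comap, Ideal.mem_jacobson_bot]
    intro y
    obtain ⟨y, rfl⟩ := Ideal.Quotient.mk_surjective y
    rw [← map_mul, ← map_one (Ideal.Quotient.mk (jacobianIdeal D.f₀)), ← map_add]
    exact (Ideal.mem_jacobson_bot.1 (convVars_le_jacobson hg) y).map _
  have h2 := Ideal.pow_right_mono h1 N
  rw [hN, ← Ideal.map_pow, Ideal.zero_eq_bot, le_bot_iff, Ideal.map_eq_bot_iff_le_ker,
    Ideal.mk_ker] at h2
  exact h2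

/-- A power of a variable is homogeneous, so membership modulo terms of higher order is membership
in the homogeneous polynomial ideal itself. -/
lemma exists_X_pow_mem : ∃ N, ∀ i, (X i : MvPolynomial (Fin n) ℂ) ^ N ∈ D.J := by
  obtain ⟨N, hN⟩ := D.exists_convVars_pow_le
  refine ⟨N, fun i => ?_⟩
  refine D.mem_J_of_mem_sup ((isWeightedHomogeneous_X ℂ D.w i).pow N) (Nat.lt_succ_self _) ?_
  apply mem_sup_ordIdeal_of_toConv_mem D.w_pos
  refine Ideal.mem_sup_left ?_
  rw [← jacobianIdeal_f₀, map_pow]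
  exact hN (Ideal.pow_mem_pow (Ideal.subset_span (Set.mem_range_self i)) N)

lemma exists_ordIdeal_le : ∃ M, ordIdeal ℂ D.w M ≤ D.J := by
  obtain ⟨N, hN⟩ := D.exists_X_pow_mem
  refine ⟨∑ i, N * D.w i + 1, ordIdeal_le_iff.2 fun β hβ => ?_⟩
  have : ∃ i, N ≤ β i := by
    by_contra! h
    have h1 : Finsupp.weight D.w β ≤ ∑ i, N * D.w i := by
      rw [Finsupp.weight_apply, Finsupp.sum_fintype _ _ (by simp)]
      exact Finset.sum_le_sum fun i _ => Nat.mul_le_mul_right _ (h i).le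
    omega
  obtain ⟨i, hi⟩ := this
  have : (monomial β (1 : ℂ)) = monomial (β - Finsupp.single i N) 1 * X i ^ N := by
    rw [X_pow_eq_monomial, monomial_mul, one_mul, tsub_add_cancel_of_le]
    rwa [Finsupp.single_le_iff]
  rw [this]
  exact Ideal.mul_mem_left _ _ (hN i)

/-- All polynomials of sufficiently high order lie in `J`, so nothing is lost in passing to
convergent series. Thus the hypotheses on the monomial basis become statements about polynomials. -/
lemma mem_J_iff_toConv {p : MvPolynomial (Fin n) ℂ} :
    p ∈ D.J ↔ toConv n ℂ p ∈ jacobianIdeal D.f₀ := by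
  rw [jacobianIdeal_f₀]
  refine ⟨fun h => Ideal.mem_map_of_mem _ h, fun h => ?_⟩
  obtain ⟨M, hM⟩ := D.exists_ordIdeal_le
  have := mem_sup_ordIdeal_of_toConv_mem (N := M) D.w_pos (Ideal.mem_sup_left h)
  rwa [sup_eq_left.2 hM] at this

lemma mk_sum_B (c : D.B → ℂ) :
    ∑ α, c α • Ideal.Quotient.mk (jacobianIdeal D.f₀) (toConv n ℂ (monomial α.1 1)) =
      Ideal.Quotient.mk (jacobianIdeal D.f₀) (toConv n ℂ (∑ α : D.B, monomial α.1 (c α))) := by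
  rw [map_sum, map_sum]
  refine Finset.sum_congr rfl fun α _ => ?_
  have : (monomial α.1 (c α) : MvPolynomial (Fin n) ℂ) = c α • monomial α.1 1 := by
    rw [smul_monomial, smul_eq_mul, mul_one]
  rw [this, map_smul]
  rfl

lemma B_independent (c : D.B → ℂ) (h : ∑ α : D.B, monomial α.1 (c α) ∈ D.J) : c = 0 := by
  have h1 := Fintype.linearIndependent_iff.1 D.B_linearIndependent c
  rw [D.mk_sum_B, Ideal.Quotient.eq_zero_iff_mem, ← mem_J_iff_toConv] at h1
  exact funext (h1 h)

lemma B_generates (p : MvPolynomial (Fin n) ℂ) :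
    ∃ c : D.B → ℂ, p - ∑ α : D.B, monomial α.1 (c α) ∈ D.J := by
  have h1 : Ideal.Quotient.mk (jacobianIdeal D.f₀) (toConv n ℂ p) ∈ Submodule.span ℂ
      (Set.range fun α : D.B => Ideal.Quotient.mk (jacobianIdeal D.f₀)
        (toConv n ℂ (monomial α.1 1))) := by
    rw [D.B_span]; trivial
  obtain ⟨c, hc⟩ := (Submodule.mem_span_range_iff_exists_fun ℂ).1 h1
  refine ⟨c, ?_⟩
  rw [D.mk_sum_B] at hc
  rw [mem_J_iff_toConv, map_sub, ← Ideal.Quotient.eq, hc]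

lemma monomial_notMem {α : Fin n →₀ ℕ} (hα : α ∈ D.B) : monomial α (1 : ℂ) ∉ D.J := by
  classical
  intro h
  have := D.B_independent (Pi.single ⟨α, hα⟩ 1) (by
    rw [Finset.sum_eq_single ⟨α, hα⟩]
    · simpa using h
    · intro b _ hb
      rw [Pi.single_eq_of_ne hb, monomial_zero]
    · intro h; exact absurd (Finset.mem_univ _) h)
  have := congrFun this ⟨α, hα⟩
  simp at this

/-- Reduction of a monomial to the basis, with homogeneous coefficients. -/
lemma exists_monomial_eq (β : Fin n →₀ ℕ) :
    ∃ (c : D.B → ℂ) (a : Fin n → MvPolynomial (Fin n) ℂ),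
      monomial β 1 = ∑ α : D.B, monomial α.1 (c α) + ∑ i, a i * D.jac i ∧
      (∀ α : D.B, c α ≠ 0 → Finsupp.weight D.w α.1 = Finsupp.weight D.w β) ∧
      ∀ i γ, coeff γ (a i) ≠ 0 → Finsupp.weight D.w γ + D.d = Finsupp.weight D.w β + D.w i := by
  obtain ⟨c, hc⟩ := D.B_generates (monomial β 1)
  obtain ⟨a, ha, ha'⟩ := D.exists_wcomp_eq hc (Finsupp.weight D.w β)
  refine ⟨fun α => if Finsupp.weight D.w α.1 = Finsupp.weight D.w β then c α else 0, a, ?_, ?_, ha'⟩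
  · rw [← ha, wcomp, map_sub, map_sum]
    have h1 := wcomp_of_isWeightedHomogeneous (isWeightedHomogeneous_monomial D.w β (1 : ℂ) rfl)
      (Finsupp.weight D.w β)
    rw [if_pos rfl] at h1
    rw [← wcomp, h1]
    have h2 : ∀ α : D.B, monomial α.1 (if Finsupp.weight D.w α.1 = Finsupp.weight D.w β
        then c α else 0) = weightedHomogeneousComponent D.w (Finsupp.weight D.w β)
        (monomial α.1 (c α)) := by
      intro α
      have h1 := wcomp_of_isWeightedHomogeneous
        (isWeightedHomogeneous_monomial D.w α.1 (c α) rfl) (Finsupp.weight D.w β)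
      rw [wcomp] at h1
      rw [h1]
      split_ifs <;> simp
    simp_rw [h2]
    ring
  · intro α hα
    by_contra h
    exact hα (if_neg h)

/-- The matrix which expresses the partial derivatives of `f₀` by the variables. -/
def jacMatrix : Matrix (Fin n) (Fin n) (MvPolynomial (Fin n) ℂ) := Matrix.of fun i j =>
  if D.w i < D.d then C ((D.w j : ℂ) / ((D.d - D.w i : ℕ) : ℂ)) * pderiv j (D.jac i) else 0

/-- The Hessian of `f₀`, up to a constant factor. -/
def hess : MvPolynomial (Fin n) ℂ := D.jacMatrix.det

section NeZero

variable [NeZero k]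

lemma one_notMem_J : (1 : MvPolynomial (Fin n) ℂ) ∉ D.J := by
  intro h
  have hB := ((D.m_range (D.m 0)).1 ⟨0, rfl⟩).1
  refine D.monomial_notMem hB ?_
  rw [(Ideal.eq_top_iff_one _).2 h]
  trivial

/-- Euler's formula for the partial derivative, which is homogeneous of degree `d - w_i`. -/
lemma jac_eq_sum (i : Fin n) : D.jac i = ∑ j, D.jacMatrix i j * X j := by
  by_cases h : D.w i < D.d
  · have h1 := (D.jac_isWeightedHomogeneous (i := i) (e := D.d - D.w i)
      (by omega)).sum_weight_X_mul_pderiv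
    have h0 : ((D.d - D.w i : ℕ) : ℂ) ≠ 0 := by
      rw [Nat.cast_ne_zero]; omega
    have h2 : ∑ j, D.jacMatrix i j * X j =
        C (((D.d - D.w i : ℕ) : ℂ)⁻¹) * ∑ j, D.w j • (X j * pderiv j (D.jac i)) := by
      rw [Finset.mul_sum]
      refine Finset.sum_congr rfl fun j _ => ?_
      rw [jacMatrix, Matrix.of_apply, if_pos h, div_eq_mul_inv, map_mul, nsmul_eq_mul, map_natCast]
      ring
    rw [h2, h1, nsmul_eq_mul, ← mul_assoc, ← map_natCast (C : ℂ →+* MvPolynomial (Fin n) ℂ),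
      ← map_mul, inv_mul_cancel₀ h0, map_one, one_mul]
  -- For `w_i ≥ d` the derivative is constant; a nonzero constant would make `J` the unit ideal,
  -- contrary to the existence of an upper monomial.
  · have h1 : D.jac i = 0 := by
      rcases Nat.lt_or_ge D.d (D.w i) with h' | h'
      · exact D.jac_eq_zero h'
      · have hd : D.d = D.w i := by omega
        have h2 : D.jac i = C (coeff 0 (D.jac i)) := by
          ext β
          rw [coeff_C]
          split_ifs with hβ
          · rw [hβ]
          · by_contra hc
            have := D.coeff_jac_ne_zero hc
            have h0 : Finsupp.weight D.w β = 0 := by omega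
            apply hβ
            symm
            ext j
            by_contra hj
            have := Finsupp.le_weight D.w (s := j) (by have := D.w_pos j; omega) β
            simp at hj; omega
        by_contra hc
        apply D.one_notMem_J
        have h3 : coeff 0 (D.jac i) ≠ 0 := by
          intro h4; rw [h4, map_zero] at h2; exact hc h2
        have h4 : (1 : MvPolynomial (Fin n) ℂ) = C (coeff 0 (D.jac i))⁻¹ * D.jac i := by
          rw [h2, coeff_C, if_pos rfl, ← map_mul, inv_mul_cancel₀ h3, map_one]
        rw [h4]
        exact Ideal.mul_mem_left _ _ (D.jac_mem i)
    rw [h1]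
    symm
    refine Finset.sum_eq_zero fun j _ => ?_
    rw [jacMatrix, Matrix.of_apply, if_neg h, zero_mul]

/-- Besides Euler's formula only two facts are used: the variables form a regular sequence, and
powers of them lie in `J`. -/
lemma isCompleteIntersection_jac : IsCompleteIntersection D.jac X D.jacMatrix := by
  obtain ⟨N, hN⟩ := D.exists_X_pow_mem
  refine isCompleteIntersection ℂ D.jac X D.jacMatrix D.jac_eq_sum (N := N) ?_ ?_ hN
  · intro j b hb
    have e : {z : MvPolynomial (Fin n) ℂ | ∃ b, j < b ∧ z = X b} = X '' {b | j < b} := by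
      ext z
      constructor
      · rintro ⟨b, hb, rfl⟩; exact ⟨b, hb, rfl⟩
      · rintro ⟨b, hb, rfl⟩; exact ⟨b, hb, rfl⟩
    rw [e, mem_ideal_span_X_image] at hb ⊢
    intro β hβ
    have := hb (Finsupp.single j 1 + β) (by
      rw [mem_support_iff, coeff_X_mul]; exact mem_support_iff.1 hβ)
    obtain ⟨i, hi, hi'⟩ := this
    refine ⟨i, hi, ?_⟩
    have hne : j ≠ i := (ne_of_lt hi)
    simpa [Finsupp.single_apply, hne] using hi'
  · intro h
    rw [← Set.image_univ, mem_ideal_span_X_image] at h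
    obtain ⟨i, _, hi⟩ := h 0 (by rw [mem_support_iff]; simp)
    simp at hi

/-- Otherwise the matrix would have a zero row, and its determinant 0 would lie in `J`. -/
lemma w_lt_d (i : Fin n) : D.w i < D.d := by
  by_contra h
  apply D.isCompleteIntersection_jac.det_notMem
  rw [Matrix.det_eq_zero_of_row_eq_zero i]
  · exact Ideal.zero_mem _
  · intro j
    rw [jacMatrix, Matrix.of_apply, if_neg h]

lemma hess_notMem : D.hess ∉ D.J := D.isCompleteIntersection_jac.det_notMem

lemma X_mul_hess_mem (j : Fin n) : X j * D.hess ∈ D.J := by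
  have h1 : D.jacMatrix.adjugate.mulVec D.jac = D.hess • X := by
    have : D.jac = D.jacMatrix.mulVec X := funext fun i => D.jac_eq_sum i
    rw [this, Matrix.mulVec_mulVec, Matrix.adjugate_mul, Matrix.smul_mulVec, Matrix.one_mulVec]
    rfl
  have h2 := congrFun h1 j
  rw [Pi.smul_apply, smul_eq_mul, mul_comm] at h2
  rw [← h2]
  rw [Matrix.mulVec, dotProduct]
  exact Ideal.sum_mem _ fun i _ => Ideal.mul_mem_left _ _ (D.jac_mem i)

lemma mul_hess_sub_mem (c : MvPolynomial (Fin n) ℂ) :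
    c * D.hess - C (coeff 0 c) * D.hess ∈ D.J := by
  rw [← sub_mul]
  have h : c - C (coeff 0 c) ∈ Ideal.span (X '' Set.univ) := by
    rw [mem_ideal_span_X_image]
    intro β hβ
    by_contra! hc
    have : β = 0 := by ext i; exact hc i trivial
    rw [mem_support_iff, this, coeff_sub, coeff_C, if_pos rfl, sub_self] at hβ
    exact hβ rfl
  generalize c - C (coeff 0 c) = b at h
  induction h using Submodule.span_induction with
  | mem x hx => obtain ⟨j, _, rfl⟩ := hx; exact D.X_mul_hess_mem j
  | zero => rw [zero_mul]; exact Ideal.zero_mem _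
  | add x y _ _ hx hy => rw [add_mul]; exact Ideal.add_mem _ hx hy
  | smul a x _ hx => rw [smul_eq_mul, mul_assoc]; exact Ideal.mul_mem_left _ _ hx

/-- Every nonzero element of the Milnor algebra has a multiple which generates the socle. -/
lemma exists_mul_monomial_sub_mem {p : MvPolynomial (Fin n) ℂ} (hp : p ∉ D.J) :
    ∃ (γ : Fin n →₀ ℕ) (c : ℂ), c ≠ 0 ∧ p * monomial γ 1 - C c * D.hess ∈ D.J := by
  classical
  obtain ⟨M, hM⟩ := D.exists_ordIdeal_le
  have hP : ∃ e, ∃ γ : Fin n →₀ ℕ, p * monomial γ 1 ∉ D.J ∧ Finsupp.weight D.w γ = e :=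
    ⟨_, 0, by simpa using hp, rfl⟩
  have hb : ∀ e, (∃ γ : Fin n →₀ ℕ, p * monomial γ 1 ∉ D.J ∧ Finsupp.weight D.w γ = e) → e ≤ M := by
    rintro _ ⟨γ, hγ, rfl⟩
    by_contra h
    exact hγ (Ideal.mul_mem_left _ _ (hM (monomial_mem_ordIdeal (by omega) 1)))
  obtain ⟨e₀, he₀⟩ := hP
  -- A monomial multiple of `p` outside `J` of the largest possible weight is annihilated by all
  -- variables modulo `J`, that is, it lies in the socle.
  obtain ⟨γ, hγ, hγe⟩ := Nat.findGreatest_spec (P := fun e => ∃ γ : Fin n →₀ ℕ,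
    p * monomial γ 1 ∉ D.J ∧ Finsupp.weight D.w γ = e) (hb e₀ he₀) he₀
  obtain ⟨c, hc⟩ := D.isCompleteIntersection_jac.socle (p * monomial γ 1) (by
    intro j
    by_contra hj
    have h1 : X j * (p * monomial γ (1 : ℂ)) = p * monomial (Finsupp.single j 1 + γ) 1 := by
      rw [X, mul_left_comm, monomial_mul, one_mul]
    rw [h1] at hj
    have h2 := Nat.le_findGreatest (P := fun e => ∃ γ : Fin n →₀ ℕ,
      p * monomial γ 1 ∉ D.J ∧ Finsupp.weight D.w γ = e) (hb _ ⟨_, hj, rfl⟩) ⟨_, hj, rfl⟩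
    rw [map_add, Finsupp.weight_single, one_smul, ← hγe] at h2
    have := D.w_pos j
    omega)
  have h3 : p * monomial γ 1 - C (coeff 0 c) * D.hess ∈ D.J := by
    have := Ideal.add_mem _ hc (D.mul_hess_sub_mem c)
    rw [show D.jacMatrix.det = D.hess from rfl] at this
    rwa [sub_add_sub_cancel] at this
  refine ⟨γ, coeff 0 c, ?_, h3⟩
  intro h0
  rw [h0, map_zero, zero_mul, sub_zero] at h3
  exact hγ h3

/-- The weight of the socle of the Milnor algebra. -/
def soc : ℕ := ((n : ℤ) * D.d - 2 * ∑ i, (D.w i : ℤ)).toNat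

lemma weight_intCast (w : Fin n → ℕ) (β : Fin n →₀ ℕ) :
    Finsupp.weight (fun i => (w i : ℤ)) β = (Finsupp.weight w β : ℕ) := by
  rw [Finsupp.weight_apply, Finsupp.weight_apply, Finsupp.sum_fintype _ _ (by simp),
    Finsupp.sum_fintype _ _ (by simp)]
  push_cast
  simp

lemma hess_isWeightedHomogeneous_int : D.hess.IsWeightedHomogeneous (fun i => (D.w i : ℤ))
    ((n : ℤ) * D.d - 2 * ∑ i, (D.w i : ℤ)) := by
  have := det_isWeightedHomogeneous (E := D.jacMatrix) (v := fun i => (D.w i : ℤ))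
    (r := fun i => (D.d : ℤ) - D.w i) (s := fun i => -(D.w i : ℤ)) (by
    intro i j β hβ
    rw [jacMatrix, Matrix.of_apply, if_pos (D.w_lt_d i), coeff_C_mul, coeff_pderiv'] at hβ
    have := D.coeff_jac_ne_zero (left_ne_zero_of_mul (right_ne_zero_of_mul hβ))
    rw [map_add, Finsupp.weight_single, one_smul] at this
    rw [weight_intCast]
    omega)
  have e : ∑ i, ((D.d : ℤ) - D.w i) + ∑ i, -(D.w i : ℤ) =
      (n : ℤ) * D.d - 2 * ∑ i, (D.w i : ℤ) := by
    rw [Finset.sum_sub_distrib, Finset.sum_neg_distrib]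
    simp
    ring
  rwa [e] at this

/-- The truncation in `soc` is harmless: the Hessian is nonzero, so the integer on the right is the
weight of one of its monomials. -/
lemma soc_eq : (D.soc : ℤ) = (n : ℤ) * D.d - 2 * ∑ i, (D.w i : ℤ) := by
  rw [soc, Int.toNat_of_nonneg]
  have h : D.hess ≠ 0 := fun h => D.hess_notMem (by rw [h]; exact Ideal.zero_mem _)
  obtain ⟨β, hβ⟩ := MvPolynomial.ne_zero_iff.1 h
  have := D.hess_isWeightedHomogeneous_int hβ
  rw [weight_intCast] at this
  omega

lemma hess_isWeightedHomogeneous : D.hess.IsWeightedHomogeneous D.w D.soc := by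
  intro β hβ
  have := D.hess_isWeightedHomogeneous_int hβ
  rw [weight_intCast, ← soc_eq] at this
  exact_mod_cast this

lemma C_mul_hess_notMem {c : ℂ} (hc : c ≠ 0) : C c * D.hess ∉ D.J := by
  intro h
  apply D.hess_notMem
  have := Ideal.mul_mem_left _ (C c⁻¹) h
  rwa [← mul_assoc, ← map_mul, inv_mul_cancel₀ hc, map_one, one_mul] at this

/-- For a homogeneous `p`, the multiple generating the socle has the weight of the socle. -/
lemma weight_add_eq_soc {p : MvPolynomial (Fin n) ℂ} {e : ℕ} (hp : p.IsWeightedHomogeneous D.w e)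
    {γ : Fin n →₀ ℕ} {c : ℂ} (hc : c ≠ 0) (h : p * monomial γ 1 - C c * D.hess ∈ D.J) :
    e + Finsupp.weight D.w γ = D.soc := by
  by_contra hne
  apply D.C_mul_hess_notMem hc
  have h1 := D.wcomp_mem_J h D.soc
  rw [wcomp, map_sub] at h1
  have h2 := wcomp_of_isWeightedHomogeneous
    (hp.mul (isWeightedHomogeneous_monomial D.w γ (1 : ℂ) rfl)) D.soc
  rw [if_neg hne] at h2
  have h3 := wcomp_of_isWeightedHomogeneous
    ((isWeightedHomogeneous_C D.w c).mul D.hess_isWeightedHomogeneous) D.soc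
  rw [if_pos (by simp)] at h3
  rw [← wcomp, ← wcomp, h2, h3, zero_sub] at h1
  exact neg_mem_iff.1 h1

lemma ordIdeal_soc_le : ordIdeal ℂ D.w (D.soc + 1) ≤ D.J := by
  refine ordIdeal_le_iff.2 fun β hβ => ?_
  by_contra h
  obtain ⟨γ, c, hc, h1⟩ := D.exists_mul_monomial_sub_mem h
  have := D.weight_add_eq_soc (isWeightedHomogeneous_monomial D.w β (1 : ℂ) rfl) hc h1
  omega

lemma weight_le_soc {α : Fin n →₀ ℕ} (hα : α ∈ D.B) : Finsupp.weight D.w α ≤ D.soc := by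
  by_contra h
  exact D.monomial_notMem hα (D.ordIdeal_soc_le (monomial_mem_ordIdeal (by omega) 1))

/-- The basis monomials of maximal weight generate the socle. -/
lemma exists_monomial_sub_hess_mem {α : Fin n →₀ ℕ} (hα : α ∈ D.B)
    (h : Finsupp.weight D.w α = D.soc) :
    ∃ c : ℂ, c ≠ 0 ∧ monomial α 1 - C c * D.hess ∈ D.J := by
  obtain ⟨γ, c, hc, h3⟩ := D.exists_mul_monomial_sub_mem (D.monomial_notMem hα)
  have h4 := D.weight_add_eq_soc (isWeightedHomogeneous_monomial D.w α (1 : ℂ) rfl) hc h3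
  have h5 : γ = 0 := by
    ext j
    by_contra hj
    have := Finsupp.le_weight D.w (s := j) (by have := D.w_pos j; omega) γ
    simp at hj; omega
  rw [h5] at h3
  exact ⟨c, hc, by simpa using h3⟩

/-- Both monomials are nonzero multiples of the Hessian modulo `J`; if they were different, the
basis would be linearly dependent. -/
lemma eq_of_weight_eq_soc {α β : Fin n →₀ ℕ} (hα : α ∈ D.B) (hβ : β ∈ D.B)
    (h1 : Finsupp.weight D.w α = D.soc) (h2 : Finsupp.weight D.w β = D.soc) : α = β := by
  classical
  by_contra hne
  obtain ⟨c, hc, h3⟩ := D.exists_monomial_sub_hess_mem hα h1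
  obtain ⟨c', hc', h4⟩ := D.exists_monomial_sub_hess_mem hβ h2
  have h5 : monomial α c' - monomial β c ∈ D.J := by
    have h6 : monomial α c' - monomial β c = C c' * (monomial α 1 - C c * D.hess)
        - C c * (monomial β 1 - C c' * D.hess) := by
      have e1 : monomial α c' = C c' * monomial α 1 := by rw [C_mul_monomial, mul_one]
      have e2 : monomial β c = C c * monomial β 1 := by rw [C_mul_monomial, mul_one]
      rw [e1, e2]; ring
    rw [h6]
    exact Ideal.sub_mem _ (Ideal.mul_mem_left _ _ h3) (Ideal.mul_mem_left _ _ h4)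
  have h7 := D.B_independent (Pi.single ⟨α, hα⟩ c' - Pi.single ⟨β, hβ⟩ c) (by
    convert h5 using 1
    simp only [Pi.sub_apply, map_sub, Finset.sum_sub_distrib]
    congr 1
    · rw [Finset.sum_eq_single ⟨α, hα⟩]
      · simp
      · intro b _ hb; rw [Pi.single_eq_of_ne hb, monomial_zero]
      · intro h; exact absurd (Finset.mem_univ _) h
    · rw [Finset.sum_eq_single ⟨β, hβ⟩]
      · simp
      · intro b _ hb; rw [Pi.single_eq_of_ne hb, monomial_zero]
      · intro h; exact absurd (Finset.mem_univ _) h)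
  have h8 := congrFun h7 ⟨α, hα⟩
  rw [Pi.sub_apply, Pi.single_eq_same, Pi.single_eq_of_ne (by simpa using hne)] at h8
  simp [hc'] at h8

lemma exists_weight_eq_soc : ∃ α ∈ D.B, Finsupp.weight D.w α = D.soc := by
  obtain ⟨c, hc⟩ := D.B_generates D.hess
  by_contra! h
  apply D.hess_notMem
  have h1 := D.wcomp_mem_J hc D.soc
  rw [wcomp, map_sub, map_sum, Finset.sum_eq_zero, sub_zero] at h1
  · have h3 := wcomp_of_isWeightedHomogeneous D.hess_isWeightedHomogeneous D.soc
    rw [if_pos rfl, wcomp] at h3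
    rwa [h3] at h1
  · intro α _
    have h3 := wcomp_of_isWeightedHomogeneous (isWeightedHomogeneous_monomial D.w α.1 (c α) rfl)
      D.soc
    rwa [if_neg (h _ α.2)] at h3

lemma m_mem (j : Fin k) : D.m j ∈ D.B := ((D.m_range _).1 ⟨j, rfl⟩).1

lemma d_lt_weight_m (j : Fin k) : D.d < Finsupp.weight D.w (D.m j) := ((D.m_range _).1 ⟨j, rfl⟩).2

lemma d_lt_soc : D.d < D.soc := (D.d_lt_weight_m 0).trans_le (D.weight_le_soc (D.m_mem 0))

lemma weight_m_last : Finsupp.weight D.w (D.m (Fin.rev 0)) = D.soc := by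
  obtain ⟨α, hα, hw⟩ := D.exists_weight_eq_soc
  obtain ⟨j, rfl⟩ := (D.m_range α).2 ⟨hα, hw ▸ D.d_lt_soc⟩
  refine le_antisymm (D.weight_le_soc (D.m_mem _)) ?_
  rw [← hw]
  refine D.m_last _ _ ?_
  rw [Fin.val_rev]
  have := NeZero.pos k
  simp; omega

lemma wmin_le (i : Fin n) : D.wmin ≤ D.w i := ciInf_le (OrderBot.bddBelow _) i

lemma n_pos (D : Setup n k) : 0 < n := by
  by_contra h
  obtain rfl : n = 0 := by omega
  have h1 := D.soc_eq
  have h2 := D.d_lt_soc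
  simp at h1
  omega

lemma wmin_pos : 0 < D.wmin := by
  have : Nonempty (Fin n) := ⟨⟨0, D.n_pos⟩⟩
  obtain ⟨i, hi⟩ := Nat.sInf_mem (Set.range_nonempty D.w)
  have : D.wmin = D.w i := hi.symm
  rw [this]
  exact D.w_pos i

/-- Some multiple of `m_j` by a nonconstant monomial generates the socle, and such a monomial has
weight at least `w`. This gap is the reason why all generators of 𝓛 except the Euler field have
degree at least `w`. -/
lemma weight_m_add_wmin_le {j : Fin k} (hj : j ≠ Fin.rev 0) :
    Finsupp.weight D.w (D.m j) + D.wmin ≤ D.soc := by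
  obtain ⟨γ, c, hc, h1⟩ := D.exists_mul_monomial_sub_mem (D.monomial_notMem (D.m_mem j))
  have h2 := D.weight_add_eq_soc (isWeightedHomogeneous_monomial D.w (D.m j) (1 : ℂ) rfl) hc h1
  have h3 : γ ≠ 0 := by
    rintro rfl
    apply hj
    apply D.m_injective
    exact D.eq_of_weight_eq_soc (D.m_mem _) (D.m_mem _) (by simpa using h2) D.weight_m_last
  obtain ⟨i, hi⟩ : ∃ i, γ i ≠ 0 := by
    by_contra! h
    exact h3 (Finsupp.ext h)
  have h4 := Finsupp.le_weight_of_ne_zero' D.w hi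
  have h5 := D.wmin_le i
  omega

lemma s_eq : (D.s : ℤ) = ((D.soc : ℤ) - D.d) / D.wmin := by
  have h1 : ((n : ℤ) - 1) * D.d - 2 * ∑ i, (D.w i : ℤ) = (D.soc : ℤ) - D.d := by
    rw [soc_eq]; ring
  rw [s, h1, Int.toNat_of_nonneg]
  have := D.d_lt_soc
  exact Int.ediv_nonneg (by omega) (by omega)

end NeZero

end Setup

end SQH

/-! ### Independence of the basis monomials modulo the partial derivatives of F_t -/

namespace SQH

open MvPolynomial

section Coefficientwise

variable {n : ℕ} {A : Type} [CommRing A] [Algebra ℂ A]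

/-- Apply an additive map to all coefficients of a polynomial. -/
def coeffwise {A' : Type} [CommRing A'] (ε : A →+ A') :
    MvPolynomial (Fin n) A →+ MvPolynomial (Fin n) A' where
  toFun p := ∑ β ∈ p.support, monomial β (ε (coeff β p))
  map_zero' := by simp
  map_add' p q := by
    classical
    have key : ∀ r : MvPolynomial (Fin n) A, ∀ β,
        coeff β (∑ β ∈ r.support, monomial β (ε (coeff β r))) = ε (coeff β r) := by
      intro r β
      rw [coeff_sum]
      simp only [coeff_monomial]
      rw [Finset.sum_ite_eq']
      split_ifs with h
      · rfl
      · rw [notMem_support_iff.1 h, map_zero]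
    ext β
    rw [key, coeff_add, coeff_add, key, key, map_add]

lemma coeff_coeffwise {A' : Type} [CommRing A'] (ε : A →+ A') (p : MvPolynomial (Fin n) A)
    (β : Fin n →₀ ℕ) : coeff β (coeffwise ε p) = ε (coeff β p) := by
  classical
  change coeff β (∑ β ∈ p.support, monomial β (ε (coeff β p))) = _
  rw [coeff_sum]
  simp only [coeff_monomial]
  rw [Finset.sum_ite_eq']
  split_ifs with h
  · rfl
  · rw [notMem_support_iff.1 h, map_zero]

lemma coeffwise_monomial {A' : Type} [CommRing A'] (ε : A →+ A') (β : Fin n →₀ ℕ) (a : A) :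
    coeffwise ε (monomial β a) = monomial β (ε a) := by
  classical
  ext γ
  rw [coeff_coeffwise, coeff_monomial, coeff_monomial]
  split_ifs <;> simp

lemma coeffwise_mul_map (ε : A →ₗ[ℂ] ℂ) (p : MvPolynomial (Fin n) A)
    (q : MvPolynomial (Fin n) ℂ) :
    coeffwise (ε : A →+ ℂ) (p * map (algebraMap ℂ A) q) = coeffwise (ε : A →+ ℂ) p * q := by
  classical
  ext β
  rw [coeff_coeffwise, coeff_mul, coeff_mul, map_sum]
  refine Finset.sum_congr rfl fun x _ => ?_
  rw [coeff_map, coeff_coeffwise, mul_comm (coeff x.1 p), ← Algebra.smul_def]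
  exact (map_smul ε _ _).trans (mul_comm _ _)

/-- Koszul relations are preserved by extension of scalars. -/
lemma exists_koszul_map {f : Fin n → MvPolynomial (Fin n) ℂ}
    (hf : ∀ a : Fin n → MvPolynomial (Fin n) ℂ, ∑ i, a i * f i = 0 →
      ∃ b : Fin n → Fin n → MvPolynomial (Fin n) ℂ, (∀ i j, b i j = - b j i) ∧
        ∀ i, a i = ∑ j, b i j * f j)
    (a : Fin n → MvPolynomial (Fin n) A) (ha : ∑ i, a i * map (algebraMap ℂ A) (f i) = 0) :
    ∃ b : Fin n → Fin n → MvPolynomial (Fin n) A, (∀ i j, b i j = - b j i) ∧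
      ∀ i, a i = ∑ j, b i j * map (algebraMap ℂ A) (f j) := by
  classical
  -- A relation over `A` is split into its coordinates over ℂ with respect to this basis. Only the
  -- finitely many coordinates in `S` occur in the coefficients of `a`.
  let e := Module.Free.chooseBasis ℂ A
  have h1 : ∀ l, ∃ b : Fin n → Fin n → MvPolynomial (Fin n) ℂ, (∀ i j, b i j = - b j i) ∧
      ∀ i, coeffwise (e.coord l : A →+ ℂ) (a i) = ∑ j, b i j * f j := by
    intro l
    apply hf
    have h2 := congrArg (coeffwise (e.coord l : A →+ ℂ)) ha
    rw [map_sum, map_zero] at h2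
    simp only [coeffwise_mul_map] at h2
    exact h2
  choose b hb hb' using h1
  let S : Finset (Module.Free.ChooseBasisIndex ℂ A) := Finset.univ.biUnion fun i =>
    (a i).support.biUnion fun β => (e.repr (coeff β (a i))).support
  refine ⟨fun i j => ∑ l ∈ S, C (e l) * map (algebraMap ℂ A) (b l i j), ?_, ?_⟩
  · intro i j
    rw [← Finset.sum_neg_distrib]
    refine Finset.sum_congr rfl fun l _ => ?_
    rw [hb l i j, map_neg, mul_neg]
  · intro i
    have h3 : ∑ j, (∑ l ∈ S, C (e l) * map (algebraMap ℂ A) (b l i j)) *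
        map (algebraMap ℂ A) (f j) =
        ∑ l ∈ S, C (e l) * map (algebraMap ℂ A) (coeffwise (e.coord l : A →+ ℂ) (a i)) := by
      simp only [Finset.sum_mul, hb', map_sum, map_mul, Finset.mul_sum]
      rw [Finset.sum_comm]
      simp only [mul_assoc]
    rw [h3]
    ext β
    rw [coeff_sum]
    simp only [coeff_C_mul, coeff_map, coeff_coeffwise]
    have h4 := e.linearCombination_repr (coeff β (a i))
    rw [Finsupp.linearCombination_apply, Finsupp.sum] at h4
    conv_lhs => rw [← h4]
    have h5 : (e.repr (coeff β (a i))).support ⊆ S := by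
      by_cases hβ : β ∈ (a i).support
      · intro l hl
        exact Finset.mem_biUnion.2 ⟨i, Finset.mem_univ _, Finset.mem_biUnion.2 ⟨β, hβ, hl⟩⟩
      · rw [notMem_support_iff.1 hβ]; simp
    rw [Finset.sum_subset h5]
    · refine Finset.sum_congr rfl fun l _ => ?_
      rw [Algebra.smul_def, mul_comm]
      rfl
    · intro l _ hl
      rw [Finsupp.notMem_support_iff.1 hl, zero_smul]

end Coefficientwise

namespace Setup

variable {n k : ℕ} (D : Setup n k) {A : Type} [CommRing A] [Algebra ℂ A]

/-- The polynomial `F_t` for a point `t` with values in an algebra `A`. -/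
def FA (t : Fin k → A) : MvPolynomial (Fin n) A :=
  map (algebraMap ℂ A) D.f₀ + ∑ i, monomial (D.m i) (t i)

/-- The partial derivatives of `F_t`. -/
def gA (t : Fin k → A) (i : Fin n) : MvPolynomial (Fin n) A := pderiv i (D.FA t)

/-- The Jacobian ideal of `F_t` in the polynomial ring. -/
def JA (t : Fin k → A) : Ideal (MvPolynomial (Fin n) A) := Ideal.span (Set.range (D.gA t))

variable (t : Fin k → A)

lemma gA_mem (i : Fin n) : D.gA t i ∈ D.JA t := Ideal.subset_span ⟨i, rfl⟩

lemma mem_JA_iff {p : MvPolynomial (Fin n) A} :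
    p ∈ D.JA t ↔ ∃ a : Fin n → MvPolynomial (Fin n) A, ∑ i, a i * D.gA t i = p :=
  Ideal.mem_span_range_iff_exists_fun

lemma gA_eq (i : Fin n) : D.gA t i = map (algebraMap ℂ A) (D.jac i) +
    ∑ j, C (t j) * map (algebraMap ℂ A) (pderiv i (monomial (D.m j) 1)) := by
  rw [gA, FA, map_add, pderiv_map, map_sum, jac]
  congr 1
  refine Finset.sum_congr rfl fun j _ => ?_
  have : monomial (D.m j) (t j) = C (t j) * map (algebraMap ℂ A) (monomial (D.m j) 1) := by
    rw [map_monomial, map_one, C_mul_monomial, mul_one]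
  rw [this, pderiv_C_mul, pderiv_map]

lemma FA_map {A' : Type} [CommRing A'] [Algebra ℂ A'] (φ : A →ₐ[ℂ] A') :
    map (φ : A →+* A') (D.FA t) = D.FA (fun i => φ (t i)) := by
  rw [FA, map_add, MvPolynomial.map_map, map_sum, FA]
  congr 1
  · congr 1
    exact congrArg _ φ.comp_algebraMap
  · exact Finset.sum_congr rfl fun j _ => map_monomial _ _ _

lemma gA_map {A' : Type} [CommRing A'] [Algebra ℂ A'] (φ : A →ₐ[ℂ] A') (i : Fin n) :
    map (φ : A →+* A') (D.gA t i) = D.gA (fun i => φ (t i)) i := by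
  rw [gA, ← pderiv_map, FA_map, gA]

lemma map_mem_JA {A' : Type} [CommRing A'] [Algebra ℂ A'] (φ : A →ₐ[ℂ] A')
    {p : MvPolynomial (Fin n) A} (hp : p ∈ D.JA t) :
    map (φ : A →+* A') p ∈ D.JA fun i => φ (t i) := by
  obtain ⟨a, rfl⟩ := (D.mem_JA_iff t).1 hp
  rw [map_sum]
  refine Ideal.sum_mem _ fun i _ => ?_
  rw [map_mul, gA_map]
  exact Ideal.mul_mem_left _ _ (D.gA_mem _ i)

lemma map_mem_JA_sup {A' : Type} [CommRing A'] [Algebra ℂ A'] (φ : A →ₐ[ℂ] A') {N : ℕ}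
    {p : MvPolynomial (Fin n) A} (hp : p ∈ D.JA t ⊔ ordIdeal A D.w N) :
    map (φ : A →+* A') p ∈ (D.JA fun i => φ (t i)) ⊔ ordIdeal A' D.w N := by
  obtain ⟨q, hq, o, ho, rfl⟩ := Submodule.mem_sup.1 hp
  rw [map_add]
  exact Submodule.add_mem_sup (D.map_mem_JA t φ hq) (map_mem_ordIdeal _ ho)

lemma F_eq_FA : D.F = D.FA (X : Fin k → Aneg k) := rfl

lemma Fat_eq_FA (t : Fin k → ℂ) : D.Fat t = D.FA t := by
  rw [Fat, F_eq_FA]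
  have := D.FA_map (X : Fin k → Aneg k) (aeval t)
  simp only [aeval_X] at this
  rw [← this]
  rfl

lemma FA_zero : D.FA (0 : Fin k → ℂ) = D.f₀ := by
  rw [FA, Algebra.algebraMap_self, MvPolynomial.map_id]
  simp

lemma JA_zero : D.JA (0 : Fin k → ℂ) = D.J := by
  have h : D.gA (0 : Fin k → ℂ) = D.jac := by
    funext i
    rw [gA, FA_zero, jac]
  rw [JA, J, h]

lemma jacobianIdeal_FA [EvalPoints A] : jacobianIdeal (D.FA t) = (D.JA t).map (toConv n A) :=
  jacobianIdeal_eq_map _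

section NeZero

variable [NeZero k]

lemma gA_sub_mem (i : Fin n) :
    D.gA t i - map (algebraMap ℂ A) (D.jac i) ∈ ordIdeal A D.w (D.d - D.w i + 1) := by
  rw [gA_eq, add_sub_cancel_left]
  refine Ideal.sum_mem _ fun j _ => Ideal.mul_mem_left _ _ (map_mem_ordIdeal _ ?_)
  refine pderiv_mem_ordIdeal (N := D.d + 1) (monomial_mem_ordIdeal (D.d_lt_weight_m j) 1) i ?_
  have := D.w_lt_d i
  omega

lemma map_jac_isWeightedHomogeneous (i : Fin n) :
    (map (algebraMap ℂ A) (D.jac i)).IsWeightedHomogeneous D.w (D.d - D.w i) := by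
  intro β hβ
  rw [coeff_map] at hβ
  have h1 : coeff β (D.jac i) ≠ 0 := fun h => hβ (by rw [h, map_zero])
  have := D.coeff_jac_ne_zero h1
  omega

/-- The order of the summands in a representation by the partial derivatives can be chosen as
large as the order of the sum. -/
lemma exists_order_le {p : MvPolynomial (Fin n) A} (hp : p ∈ D.JA t) {e : ℕ}
    (he : p ∈ ordIdeal A D.w e) : ∃ a : Fin n → MvPolynomial (Fin n) A,
      ∑ i, a i * D.gA t i = p ∧ ∀ i, a i ∈ ordIdeal A D.w (e + D.w i - D.d) := by
  induction e with
  | zero =>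
    obtain ⟨a, ha⟩ := (D.mem_JA_iff t).1 hp
    refine ⟨a, ha, fun i => ?_⟩
    have := D.w_lt_d i
    rw [show 0 + D.w i - D.d = 0 by omega, ordIdeal_zero]
    trivial
  | succ e ih =>
    obtain ⟨a, ha, ha'⟩ := ih (ordIdeal_anti (Nat.le_succ e) he)
    let fA : Fin n → MvPolynomial (Fin n) A := fun i => map (algebraMap ℂ A) (D.jac i)
    let b : Fin n → MvPolynomial (Fin n) A := fun i =>
      if D.d ≤ e + D.w i then wcomp D.w (e + D.w i - D.d) (a i) else 0
    have hb : ∀ i, a i - b i ∈ ordIdeal A D.w (e + 1 + D.w i - D.d) := by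
      intro i
      simp only [b]
      split_ifs with h
      · rw [show e + 1 + D.w i - D.d = e + D.w i - D.d + 1 by omega]
        exact sub_wcomp_mem_ordIdeal (ha' i)
      · rw [show e + 1 + D.w i - D.d = 0 by omega, ordIdeal_zero]
        trivial
    have hw1 : ∀ i, wcomp D.w e (a i * D.gA t i) = b i * fA i := by
      intro i
      have h1 : a i * D.gA t i = a i * fA i + a i * (D.gA t i - fA i) := by ring
      have h2 : a i * (D.gA t i - fA i) ∈ ordIdeal A D.w (e + 1) := by
        refine ordIdeal_anti ?_ (mul_mem_ordIdeal (ha' i) (D.gA_sub_mem t i))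
        have := D.w_lt_d i
        omega
      have h3 := wcomp_eq_zero_of_mem_ordIdeal (Nat.lt_succ_self e) h2
      rw [wcomp] at h3
      rw [h1, wcomp, map_add, h3, add_zero]
      have := D.w_lt_d i
      simp only [b]
      split_ifs with h
      · exact wcomp_mul (by omega) _ (D.map_jac_isWeightedHomogeneous i)
      · rw [zero_mul]
        exact wcomp_mul_of_lt (by omega) _ (D.map_jac_isWeightedHomogeneous i)
    -- The leading parts `b` form a syzygy of the partial derivatives of f₀, because the sum has no
    -- term of weight `e`. It is therefore a combination of Koszul relations.
    have hsyz : ∑ i, b i * fA i = 0 := by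
      simp only [← hw1]
      rw [← map_sum, ha]
      exact wcomp_eq_zero_of_mem_ordIdeal (Nat.lt_succ_self e) he
    obtain ⟨c, hc, hc'⟩ := exists_koszul_map D.isCompleteIntersection_jac.koszul b hsyz
    -- Only the component of the right degree is kept, so that the correction has no terms of too
    -- low order.
    let c' : Fin n → Fin n → MvPolynomial (Fin n) A := fun i j =>
      if 2 * D.d ≤ e + D.w i + D.w j then wcomp D.w (e + D.w i + D.w j - 2 * D.d) (c i j) else 0
    have hc1 : ∀ i j, c' i j = - c' j i := by
      intro i j
      simp only [c']
      rw [show e + D.w j + D.w i = e + D.w i + D.w j by ring, hc i j]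
      split_ifs
      · rw [wcomp, map_neg]
      · rw [neg_zero]
    have hc2 : ∀ i, b i = ∑ j, c' i j * fA j := by
      intro i
      by_cases h : D.d ≤ e + D.w i
      · have h1 : b i = wcomp D.w (e + D.w i - D.d) (b i) := by
          have h2 : (b i).IsWeightedHomogeneous D.w (e + D.w i - D.d) := by
            simp only [b, if_pos h]
            exact wcomp_isWeightedHomogeneous _ _
          rw [wcomp_of_isWeightedHomogeneous h2, if_pos rfl]
        rw [h1, hc' i, wcomp, map_sum]
        refine Finset.sum_congr rfl fun j _ => ?_
        have := D.w_lt_d j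
        simp only [c']
        split_ifs with h'
        · exact wcomp_mul (by omega) _ (D.map_jac_isWeightedHomogeneous j)
        · rw [zero_mul]
          exact wcomp_mul_of_lt (by omega) _ (D.map_jac_isWeightedHomogeneous j)
      · have h1 : b i = 0 := if_neg h
        rw [h1]
        symm
        refine Finset.sum_eq_zero fun j _ => ?_
        have := D.w_lt_d j
        simp only [c']
        rw [if_neg (by omega), zero_mul]
    have hc3 : ∀ i j, c' i j ∈ ordIdeal A D.w (e + D.w i + D.w j - 2 * D.d) := by
      intro i j
      simp only [c']
      split_ifs
      · exact (wcomp_isWeightedHomogeneous _ _).mem_ordIdeal le_rfl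
      · exact Ideal.zero_mem _
    have hc4 : ∀ i j, ¬ 2 * D.d ≤ e + D.w i + D.w j → c' i j = 0 := fun i j h => if_neg h
    -- The Koszul relation for f₀ is replaced by the one for F_t with the same coefficients. It
    -- leaves the sum unchanged, cancels the leading parts and introduces only terms of higher
    -- order.
    refine ⟨fun i => a i - ∑ j, c' i j * D.gA t j, ?_, ?_⟩
    · have h1 : ∑ i, (∑ j, c' i j * D.gA t j) * D.gA t i = 0 := by
        have h2 : ∑ i, (∑ j, c' i j * D.gA t j) * D.gA t i =
            - ∑ i, (∑ j, c' i j * D.gA t j) * D.gA t i := by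
          conv_lhs => 
            simp only [Finset.sum_mul]
            rw [Finset.sum_comm]
          rw [← Finset.sum_neg_distrib]
          refine Finset.sum_congr rfl fun i _ => ?_
          rw [Finset.sum_mul, ← Finset.sum_neg_distrib]
          refine Finset.sum_congr rfl fun j _ => ?_
          rw [hc1 j i]
          ring
        have h3 : (2 : MvPolynomial (Fin n) A) *
            ∑ i, (∑ j, c' i j * D.gA t j) * D.gA t i = 0 := by
          rw [two_mul]
          nth_rewrite 1 [h2]
          rw [neg_add_cancel]
        have h4 : (C (algebraMap ℂ A 2⁻¹) : MvPolynomial (Fin n) A) * 2 = 1 := by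
          rw [← map_ofNat (C : A →+* MvPolynomial (Fin n) A) 2, ← map_mul,
            ← map_ofNat (algebraMap ℂ A) 2, ← map_mul]
          norm_num
        rw [← one_mul (∑ i, _ * _), ← h4, mul_assoc, h3, mul_zero]
      simp only [sub_mul, Finset.sum_sub_distrib]
      rw [h1, ha, sub_zero]
    · intro i
      have h1 : a i - ∑ j, c' i j * D.gA t j =
          (a i - b i) - ∑ j, c' i j * (D.gA t j - fA j) := by
        simp only [mul_sub, Finset.sum_sub_distrib]
        rw [← hc2 i]
        ring
      beta_reduce
      rw [h1]
      refine Ideal.sub_mem _ (hb i) (Ideal.sum_mem _ fun j _ => ?_)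
      by_cases h : 2 * D.d ≤ e + D.w i + D.w j
      · refine ordIdeal_anti ?_ (mul_mem_ordIdeal (hc3 i j) (D.gA_sub_mem t j))
        have := D.w_lt_d j
        omega
      · rw [hc4 i j h, zero_mul]
        exact Ideal.zero_mem _

/-- Every ℂ-linear functional on `A` reduces the relation to one over ℂ. -/
lemma B_independent_map (c : D.B → A) (a : Fin n → MvPolynomial (Fin n) A)
    (h : ∑ α : D.B, monomial α.1 (c α) = ∑ i, a i * map (algebraMap ℂ A) (D.jac i)) : c = 0 := by
  ext α
  rw [Pi.zero_apply, ← Module.forall_dual_apply_eq_zero_iff ℂ]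
  intro ε
  have h1 := congrArg (coeffwise (ε : A →+ ℂ)) h
  simp only [map_sum, coeffwise_mul_map, coeffwise_monomial] at h1
  exact congrFun (D.B_independent (fun α => ε (c α)) (D.mem_J_iff.2 ⟨_, h1.symm⟩)) α

/-- The basis monomials of weight less than `N` are independent modulo the Jacobian ideal of
`F_t` and terms of order `N`. -/
lemma independent_modulo {N : ℕ} (c : D.B → A)
    (h : ∑ α : D.B, monomial α.1 (c α) ∈ D.JA t ⊔ ordIdeal A D.w N)
    (α : D.B) (hα : Finsupp.weight D.w α.1 < N) : c α = 0 := by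
  classical
  obtain ⟨q, hq, o, ho, hqo⟩ := Submodule.mem_sup.1 h
  -- Induction on the weight: once the coefficients of weight `< e` vanish, the sum has order `e`. A
  -- representation by the derivatives of F_t then has summands of order at least `e`, and its
  -- leading part is a relation modulo the derivatives of f₀.
  have key : ∀ e ≤ N, ∀ α : D.B, Finsupp.weight D.w α.1 < e → c α = 0 := by
    intro e
    induction e with
    | zero => intro _ α h; omega
    | succ e ih =>
      intro he
      have ih := ih (by omega)
      have h1 : ∑ α : D.B, monomial α.1 (c α) ∈ ordIdeal A D.w e := by
        refine Ideal.sum_mem _ fun α _ => ?_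
        by_cases hα : Finsupp.weight D.w α.1 < e
        · rw [ih α hα, monomial_zero]; exact Ideal.zero_mem _
        · exact monomial_mem_ordIdeal (by omega) _
      have hqe : q ∈ ordIdeal A D.w e := by
        have : q = ∑ α : D.B, monomial α.1 (c α) - o := by rw [← hqo]; ring
        rw [this]
        exact Ideal.sub_mem _ h1 (ordIdeal_anti (by omega) ho)
      obtain ⟨a, ha, ha'⟩ := D.exists_order_le t hq hqe
      have h2 : wcomp D.w e q = ∑ i, (if D.d ≤ e + D.w i then
          wcomp D.w (e + D.w i - D.d) (a i) else 0) * map (algebraMap ℂ A) (D.jac i) := by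
        rw [← ha, wcomp, map_sum]
        refine Finset.sum_congr rfl fun i _ => ?_
        have hi := D.w_lt_d i
        have h3 : a i * D.gA t i = a i * map (algebraMap ℂ A) (D.jac i) +
          a i * (D.gA t i - map (algebraMap ℂ A) (D.jac i)) := by ring
        have h4 : a i * (D.gA t i - map (algebraMap ℂ A) (D.jac i)) ∈ ordIdeal A D.w (e + 1) :=
          ordIdeal_anti (by omega) (mul_mem_ordIdeal (ha' i) (D.gA_sub_mem t i))
        have h5 := wcomp_eq_zero_of_mem_ordIdeal (Nat.lt_succ_self e) h4
        rw [wcomp] at h5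
        rw [h3, map_add, h5, add_zero]
        split_ifs with h
        · exact wcomp_mul (by omega) _ (D.map_jac_isWeightedHomogeneous i)
        · rw [zero_mul]
          exact wcomp_mul_of_lt (by omega) _ (D.map_jac_isWeightedHomogeneous i)
      have h3 : wcomp D.w e (∑ α : D.B, monomial α.1 (c α)) = wcomp D.w e q := by
        have h5 := wcomp_eq_zero_of_mem_ordIdeal (show e < N by omega) ho
        rw [wcomp] at h5
        rw [← hqo, wcomp, map_add, h5, add_zero]
      have h4 : wcomp D.w e (∑ α : D.B, monomial α.1 (c α)) =
          ∑ α : D.B, monomial α.1 (if Finsupp.weight D.w α.1 = e then c α else 0) := by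
        rw [wcomp, map_sum]
        refine Finset.sum_congr rfl fun α _ => ?_
        rw [← wcomp, wcomp_of_isWeightedHomogeneous
          (isWeightedHomogeneous_monomial D.w α.1 (c α) rfl) e]
        split_ifs <;> simp
      have h5 := D.B_independent_map _ _ (h4.symm.trans (h3.trans h2))
      intro α hα
      by_cases hα' : Finsupp.weight D.w α.1 < e
      · exact ih α hα'
      · have := congrFun h5 α
        simpa [show Finsupp.weight D.w α.1 = e by omega] using this
  exact key N le_rfl α hα

end NeZero

end Setup

end SQH

/-! ### Reduction to the basis monomials, with control of the degrees -/

namespace SQH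

open MvPolynomial

namespace Setup

variable {n k : ℕ} (D : Setup n k)

lemma wt_neg (j : Fin k) : D.wt j < 0 := by
  have := ((D.m_range (D.m j)).1 ⟨j, rfl⟩).2
  rw [wt]; omega

lemma weight_wt_nonpos (β : Fin k →₀ ℕ) : Finsupp.weight D.wt β ≤ 0 := by
  rw [Finsupp.weight_apply, Finsupp.sum_fintype _ _ (by simp)]
  refine Finset.sum_nonpos fun j _ => ?_
  have := D.wt_neg j
  rw [nsmul_eq_mul]
  exact mul_nonpos_of_nonneg_of_nonpos (by positivity) this.le

lemma eq_zero_of_isWeightedHomogeneous_pos {a : Aneg k} {e : ℤ}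
    (ha : a.IsWeightedHomogeneous D.wt e) (he : 0 < e) : a = 0 := by
  ext β
  by_contra h
  have h1 := ha (d := β) (by simpa using h)
  have := D.weight_wt_nonpos β
  omega

lemma eq_C_of_isWeightedHomogeneous_zero {a : Aneg k} (ha : a.IsWeightedHomogeneous D.wt 0) :
    a = C (coeff 0 a) := by
  ext β
  rw [coeff_C]
  split_ifs with h
  · rw [h]
  · by_contra hc
    have h1 := ha hc
    obtain ⟨j, hj⟩ : ∃ j, β j ≠ 0 := by
      by_contra! h'
      exact h (Finsupp.ext fun j => (h' j).symm)
    rw [Finsupp.weight_apply, Finsupp.sum_fintype _ _ (by simp)] at h1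
    have h2 : ∑ i, β i • D.wt i < ∑ i : Fin k, 0 := by
      refine Finset.sum_lt_sum (fun i _ => ?_) ⟨j, Finset.mem_univ _, ?_⟩
      · rw [nsmul_eq_mul]
        exact mul_nonpos_of_nonneg_of_nonpos (by positivity) (D.wt_neg i).le
      · rw [nsmul_eq_mul]
        exact mul_neg_of_pos_of_neg (by positivity) (D.wt_neg j)
    rw [h1] at h2
    simp at h2

/-- The polynomial `p` is congruent modulo `I` to a combination of the basis monomials, of total
degree `e`. -/
def IsReducible (I : Ideal (MvPolynomial (Fin n) (Aneg k))) (e : ℤ)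
    (p : MvPolynomial (Fin n) (Aneg k)) : Prop :=
  ∃ c : D.B → Aneg k,
    (∀ α, (c α).IsWeightedHomogeneous D.wt (e - (Finsupp.weight D.w α.1 : ℕ))) ∧
    p - ∑ α : D.B, monomial α.1 (c α) ∈ I

variable {D} in
lemma IsReducible.of_mem {I : Ideal (MvPolynomial (Fin n) (Aneg k))} {e : ℤ}
    {p : MvPolynomial (Fin n) (Aneg k)} (h : p ∈ I) : D.IsReducible I e p :=
  ⟨0, fun _ => isWeightedHomogeneous_zero _ _ _, by simpa using h⟩

variable {D} in
lemma IsReducible.add {I : Ideal (MvPolynomial (Fin n) (Aneg k))} {e : ℤ}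
    {p q : MvPolynomial (Fin n) (Aneg k)} (hp : D.IsReducible I e p) (hq : D.IsReducible I e q) :
    D.IsReducible I e (p + q) := by
  obtain ⟨c, hc, hc'⟩ := hp
  obtain ⟨b, hb, hb'⟩ := hq
  refine ⟨c + b, fun α => (hc α).add (hb α), ?_⟩
  simp only [Pi.add_apply, map_add, Finset.sum_add_distrib]
  rw [add_sub_add_comm]
  exact Ideal.add_mem _ hc' hb'

variable {D} in
lemma IsReducible.sub {I : Ideal (MvPolynomial (Fin n) (Aneg k))} {e : ℤ}
    {p q : MvPolynomial (Fin n) (Aneg k)} (hp : D.IsReducible I e p) (hq : D.IsReducible I e q) :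
    D.IsReducible I e (p - q) := by
  obtain ⟨c, hc, hc'⟩ := hp
  obtain ⟨b, hb, hb'⟩ := hq
  refine ⟨c - b, fun α => (hc α).sub (hb α), ?_⟩
  simp only [Pi.sub_apply, map_sub, Finset.sum_sub_distrib]
  rw [sub_sub_sub_comm]
  exact Ideal.sub_mem _ hc' hb'

variable {D} in
lemma IsReducible.sum {ι : Type} {I : Ideal (MvPolynomial (Fin n) (Aneg k))} {e : ℤ} (s : Finset ι)
    {p : ι → MvPolynomial (Fin n) (Aneg k)} (hp : ∀ i ∈ s, D.IsReducible I e (p i)) :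
    D.IsReducible I e (∑ i ∈ s, p i) := by
  classical
  induction s using Finset.induction_on with
  | empty => exact IsReducible.of_mem (by simp)
  | insert a s ha ih =>
    rw [Finset.sum_insert ha]
    exact (hp a (Finset.mem_insert_self _ _)).add
      (ih fun i hi => hp i (Finset.mem_insert_of_mem hi))

variable {D} in
lemma IsReducible.C_mul {I : Ideal (MvPolynomial (Fin n) (Aneg k))} {e e' e'' : ℤ}
    {p : MvPolynomial (Fin n) (Aneg k)} (hp : D.IsReducible I e p) {a : Aneg k}
    (ha : a.IsWeightedHomogeneous D.wt e') (he : e' + e = e'') :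
    D.IsReducible I e'' (C a * p) := by
  obtain ⟨c, hc, hc'⟩ := hp
  refine ⟨fun α => a * c α, fun α => ?_, ?_⟩
  · have := ha.mul (hc α)
    rwa [show e' + (e - (Finsupp.weight D.w α.1 : ℕ)) = e'' - (Finsupp.weight D.w α.1 : ℕ) by
      omega] at this
  · have : C a * p - ∑ α : D.B, monomial α.1 (a * c α) =
        C a * (p - ∑ α : D.B, monomial α.1 (c α)) := by
      rw [mul_sub, Finset.mul_sum]
      simp only [C_mul_monomial]
    rw [this]
    exact Ideal.mul_mem_left _ _ hc'

/-- After a homogeneous reduction modulo the derivatives of f₀, these are replaced by the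
derivatives of F. The errors have coefficient `t_j` and an `x`-weight increased by `-deg t_j > 0`,
so the total degree is kept and the recursion ends at weight `N`. The parameter `e₀` lets the same
argument serve the Jacobian ideal and its product with `(x)`. -/
lemma isReducible_monomial {I : Ideal (MvPolynomial (Fin n) (Aneg k))} {N e₀ : ℕ}
    (hN : ordIdeal (Aneg k) D.w N ≤ I)
    (hg : ∀ i γ, e₀ + D.w i ≤ Finsupp.weight D.w γ + D.d → monomial γ (1 : Aneg k) * D.gA X i ∈ I)
    (β : Fin n →₀ ℕ) (hβ : e₀ ≤ Finsupp.weight D.w β) :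
    D.IsReducible I (Finsupp.weight D.w β : ℕ) (monomial β 1) := by
  classical
  induction hr : N - Finsupp.weight D.w β using Nat.strong_induction_on generalizing β with
  | _ r ih =>
    subst hr
    rcases Nat.lt_or_ge (Finsupp.weight D.w β) N with hlt | hge
    swap
    · exact IsReducible.of_mem (hN (monomial_mem_ordIdeal hge 1))
    obtain ⟨c, a, heq, hc, ha⟩ := D.exists_monomial_eq β
    let φ : MvPolynomial (Fin n) ℂ →+* MvPolynomial (Fin n) (Aneg k) := map (algebraMap ℂ (Aneg k))
    let q : Fin k → MvPolynomial (Fin n) ℂ := fun j => ∑ i, a i * pderiv i (monomial (D.m j) 1)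
    have h1 : (monomial β 1 : MvPolynomial (Fin n) (Aneg k)) =
        ∑ α : D.B, monomial α.1 (C (c α)) + ∑ i, φ (a i) * D.gA X i -
          ∑ j, C (X j) * φ (q j) := by
      have h2 := congrArg φ heq
      have h3 : φ (monomial β 1) = monomial β 1 := by simp only [φ, map_monomial, map_one]
      rw [h3, map_add, map_sum, map_sum] at h2
      have h4 : ∀ i, φ (a i * D.jac i) = φ (a i) * D.gA X i -
          ∑ j, C (X j) * φ (a i * pderiv i (monomial (D.m j) 1)) := by
        intro i
        rw [gA_eq, mul_add, map_mul, Finset.mul_sum]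
        have : ∑ j, C (X j) * φ (a i * pderiv i (monomial (D.m j) 1)) =
            ∑ j, φ (a i) * (C (X j) * φ (pderiv i (monomial (D.m j) 1))) := by
          refine Finset.sum_congr rfl fun j _ => ?_
          rw [map_mul]; ring
        rw [this]
        simp only [φ]
        ring
      simp only [h4, Finset.sum_sub_distrib] at h2
      rw [h2, Finset.sum_comm]
      have h5 : ∑ j, C (X j) * φ (q j) =
          ∑ j, ∑ i, C (X j) * φ (a i * pderiv i (monomial (D.m j) 1)) := by
        refine Finset.sum_congr rfl fun j _ => ?_
        rw [map_sum, Finset.mul_sum]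
      rw [h5]
      have h6 : ∀ α : D.B, φ (monomial α.1 (c α)) = monomial α.1 (C (c α)) := fun α =>
        map_monomial _ _ _
      simp only [h6]
      ring
    have hq : ∀ j γ, coeff γ (q j) ≠ 0 →
        (Finsupp.weight D.w γ : ℤ) = Finsupp.weight D.w β - D.wt j := by
      intro j
      have h2 : (q j).IsWeightedHomogeneous (fun i => (D.w i : ℤ))
          ((Finsupp.weight D.w β : ℕ) - D.wt j) := by
        rw [← mem_weightedHomogeneousSubmodule]
        refine Submodule.sum_mem _ fun i _ => ?_
        rw [mem_weightedHomogeneousSubmodule]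
        have h3 : (a i).IsWeightedHomogeneous (fun i => (D.w i : ℤ))
            ((Finsupp.weight D.w β : ℕ) + D.w i - D.d) := by
          intro γ hγ
          have := ha i γ hγ
          rw [weight_intCast]
          omega
        have h4 : (pderiv i (monomial (D.m j) (1 : ℂ))).IsWeightedHomogeneous
            (fun i => (D.w i : ℤ)) ((Finsupp.weight D.w (D.m j) : ℕ) - D.w i) := by
          refine (isWeightedHomogeneous_monomial (fun i => (D.w i : ℤ)) (D.m j) (1 : ℂ)
            (weight_intCast _ _)).pderiv ?_
          ring
        have h5 := h3.mul h4
        rwa [show ((Finsupp.weight D.w β : ℕ) + D.w i - D.d : ℤ) +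
          ((Finsupp.weight D.w (D.m j) : ℕ) - D.w i) = (Finsupp.weight D.w β : ℕ) - D.wt j by
            rw [wt]; ring] at h5
      intro γ hγ
      have := h2 hγ
      rwa [weight_intCast] at this
    rw [h1]
    refine IsReducible.sub (IsReducible.add ?_ ?_) ?_
    · refine ⟨fun α => C (c α), fun α => ?_, by simp⟩
      beta_reduce
      by_cases h0 : c α = 0
      · rw [h0, map_zero]; exact isWeightedHomogeneous_zero _ _ _
      · rw [hc α h0, sub_self]
        exact isWeightedHomogeneous_C _ _
    · refine IsReducible.of_mem (Ideal.sum_mem _ fun i _ => ?_)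
      rw [(a i).as_sum, map_sum, Finset.sum_mul]
      refine Ideal.sum_mem _ fun γ hγ => ?_
      have h2 : φ (monomial γ (coeff γ (a i))) * D.gA X i =
          C (C (coeff γ (a i))) * (monomial γ 1 * D.gA X i) := by
        simp only [φ]
        rw [map_monomial, ← mul_assoc, C_mul_monomial, mul_one]
        rfl
      rw [h2]
      refine Ideal.mul_mem_left _ _ (hg i γ ?_)
      have := ha i γ (mem_support_iff.1 hγ)
      omega
    · refine IsReducible.sum _ fun j _ => ?_
      have h2 : D.IsReducible I ((Finsupp.weight D.w β : ℕ) - D.wt j) (φ (q j)) := by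
        rw [(q j).as_sum, map_sum]
        refine IsReducible.sum _ fun γ hγ => ?_
        have h3 : φ (monomial γ (coeff γ (q j))) = C (C (coeff γ (q j))) * monomial γ 1 := by
          simp only [φ]
          rw [map_monomial, C_mul_monomial, mul_one]
          rfl
        rw [mem_support_iff] at hγ
        have h4 := hq j γ hγ
        have h5 := D.wt_neg j
        rw [h3]
        refine (ih _ ?_ γ ?_ rfl).C_mul (e' := 0) (isWeightedHomogeneous_C _ _) ?_
        · omega
        · omega
        · omega
      exact h2.C_mul (isWeightedHomogeneous_X ℂ D.wt j) (by ring)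

section Relative

variable {A : Type} [CommRing A] [Algebra ℂ A] (t : Fin k → A)

/-- The product of the ideal of the variables and the Jacobian ideal of `F_t`. -/
def XJ : Ideal (MvPolynomial (Fin n) A) := Ideal.span (Set.range X) * D.JA t

lemma XJ_le_JA : D.XJ t ≤ D.JA t := Ideal.mul_le_right

lemma map_mem_XJ_sup {A' : Type} [CommRing A'] [Algebra ℂ A'] (φ : A →ₐ[ℂ] A') {N : ℕ}
    {p : MvPolynomial (Fin n) A} (hp : p ∈ D.XJ t ⊔ ordIdeal A D.w N) :
    map (φ : A →+* A') p ∈ (D.XJ fun i => φ (t i)) ⊔ ordIdeal A' D.w N := by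
  obtain ⟨q, hq, o, ho, rfl⟩ := Submodule.mem_sup.1 hp
  rw [map_add]
  refine Submodule.add_mem_sup ?_ (map_mem_ordIdeal _ ho)
  refine (Ideal.mul_le.2 ?_ : D.XJ t ≤ Ideal.comap (map (φ : A →+* A')) (D.XJ fun i => φ (t i))) hq
  intro a ha b hb
  rw [Ideal.mem_comap, map_mul]
  refine Ideal.mul_mem_mul ?_ (D.map_mem_JA t φ hb)
  refine (Ideal.span_le.2 ?_ : Ideal.span (Set.range X) ≤
    Ideal.comap (MvPolynomial.map (φ : A →+* A')) (Ideal.span (Set.range X))) ha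
  rintro _ ⟨i, rfl⟩
  rw [SetLike.mem_coe, Ideal.mem_comap, map_X]
  exact Ideal.subset_span ⟨i, rfl⟩

lemma monomial_mem_span_X {R : Type} [CommRing R] {γ : Fin n →₀ ℕ} (hγ : γ ≠ 0) (a : R) :
    monomial γ a ∈ Ideal.span (Set.range (X : Fin n → MvPolynomial (Fin n) R)) := by
  rw [← Set.image_univ, mem_ideal_span_X_image]
  intro β hβ
  classical
  have : β = γ := by
    by_contra h
    rw [mem_support_iff, coeff_monomial, if_neg (Ne.symm h)] at hβ
    exact hβ rfl
  rw [this]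
  by_contra! h
  exact hγ (Finsupp.ext fun i => h i trivial)

lemma isReducible_JA (N : ℕ) (β : Fin n →₀ ℕ) :
    D.IsReducible (D.JA X ⊔ ordIdeal (Aneg k) D.w N) (Finsupp.weight D.w β : ℕ) (monomial β 1) :=
  D.isReducible_monomial (e₀ := 0) le_sup_right
    (fun i _ _ => Ideal.mem_sup_left (Ideal.mul_mem_left _ _ (D.gA_mem _ i))) β (Nat.zero_le _)

/-- For a monomial of weight at least `d` the multipliers of the derivatives have weight at least
`w_i > 0`; so they contain a variable. -/
lemma isReducible_XJ (N : ℕ) (β : Fin n →₀ ℕ) (hβ : D.d ≤ Finsupp.weight D.w β) :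
    D.IsReducible (D.XJ X ⊔ ordIdeal (Aneg k) D.w N) (Finsupp.weight D.w β : ℕ) (monomial β 1) := by
  refine D.isReducible_monomial (e₀ := D.d) le_sup_right (fun i γ h => ?_) β hβ
  refine Ideal.mem_sup_left (Ideal.mul_mem_mul (monomial_mem_span_X ?_ 1) (D.gA_mem _ i))
  rintro rfl
  have := D.w_pos i
  rw [map_zero] at h
  omega

/-- Extension of scalars along the point `t` of the universal family. -/
lemma exists_sub_sum_mem (N : ℕ) (p : MvPolynomial (Fin n) A) :
    ∃ c : D.B → A, p - ∑ α : D.B, monomial α.1 (c α) ∈ D.JA t ⊔ ordIdeal A D.w N := by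
  induction p using MvPolynomial.induction_on' with
  | monomial β a =>
    obtain ⟨c, _, hc⟩ := D.isReducible_JA N β
    have h := D.map_mem_JA_sup _ (aeval t : Aneg k →ₐ[ℂ] A) hc
    simp only [aeval_X, map_sub, map_sum, map_monomial, map_one] at h
    refine ⟨fun α => a * aeval t (c α), ?_⟩
    have h1 := Ideal.mul_mem_left _ (C a) h
    rw [mul_sub, C_mul_monomial, mul_one, Finset.mul_sum] at h1
    simp only [C_mul_monomial] at h1
    exact h1
  | add p q hp hq =>
    obtain ⟨c, hc⟩ := hp
    obtain ⟨b, hb⟩ := hq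
    refine ⟨c + b, ?_⟩
    simp only [Pi.add_apply, map_add, Finset.sum_add_distrib]
    rw [add_sub_add_comm]
    exact Ideal.add_mem _ hc hb

section NeZero

variable [NeZero k]

lemma sum_B_eq_sum_m (c : D.B → A) (hc : ∀ α, c α ≠ 0 → D.d < Finsupp.weight D.w α.1) :
    ∑ α : D.B, monomial α.1 (c α) = ∑ j, monomial (D.m j) (c ⟨D.m j, D.m_mem j⟩) := by
  symm
  refine Fintype.sum_of_injective (fun j => (⟨D.m j, D.m_mem j⟩ : D.B)) ?_ _ _ ?_ ?_
  · intro i j h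
    exact D.m_injective (congrArg Subtype.val h)
  · intro α hα
    by_cases h : c α = 0
    · rw [h, monomial_zero]
    · obtain ⟨j, hj⟩ := (D.m_range α.1).2 ⟨α.2, hc α h⟩
      exact absurd ⟨j, Subtype.ext hj⟩ hα
  · intro j; rfl

/-- A coefficient at a basis monomial of weight `≤ d` would be a polynomial in `t` of positive
degree, and there is none but 0. Only the upper monomials remain. -/
lemma exists_sub_sum_m_mem (N : ℕ) {p : MvPolynomial (Fin n) A}
    (hp : p ∈ ordIdeal A D.w (D.d + 1)) :
    ∃ v : Fin k → A, p - ∑ j, monomial (D.m j) (v j) ∈ D.XJ t ⊔ ordIdeal A D.w N := by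
  have key : ∀ β, D.d + 1 ≤ Finsupp.weight D.w β → ∃ v : Fin k → A,
      monomial β 1 - ∑ j, monomial (D.m j) (v j) ∈ D.XJ t ⊔ ordIdeal A D.w N := by
    intro β hβ
    obtain ⟨c, hc', hc⟩ := D.isReducible_XJ N β (by omega)
    rw [D.sum_B_eq_sum_m] at hc
    · have h := D.map_mem_XJ_sup _ (aeval t : Aneg k →ₐ[ℂ] A) hc
      simp only [aeval_X, map_sub, map_sum, map_monomial, map_one] at h
      exact ⟨_, h⟩
    · intro α hα
      by_contra hlt
      exact hα (D.eq_zero_of_isWeightedHomogeneous_pos (hc' α) (by omega))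
  choose! v hv using key
  refine ⟨fun j => ∑ β ∈ p.support, coeff β p * v β j, ?_⟩
  have h1 : p - ∑ j, monomial (D.m j) (∑ β ∈ p.support, coeff β p * v β j) =
      ∑ β ∈ p.support, C (coeff β p) * (monomial β 1 - ∑ j, monomial (D.m j) (v β j)) := by
    simp only [mul_sub, Finset.sum_sub_distrib, C_mul_monomial, mul_one, Finset.mul_sum, map_sum]
    rw [Finset.sum_comm, ← p.as_sum]
  rw [h1]
  refine Ideal.sum_mem _ fun β hβ => Ideal.mul_mem_left _ _ (hv β ?_)
  by_contra h
  exact (mem_support_iff.1 hβ) (hp β (by omega))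

/-- Euler's formula for `F_t`. -/
lemma euler_FA : (D.d : MvPolynomial (Fin n) A) * D.FA t =
    ∑ i, (D.w i : MvPolynomial (Fin n) A) * (X i * D.gA t i) +
      ∑ j, monomial (D.m j) ((D.wt j : A) * t j) := by
  have h0 : (map (algebraMap ℂ A) D.f₀).IsWeightedHomogeneous D.w D.d := by
    intro β hβ
    rw [coeff_map] at hβ
    exact D.f₀_quasihomogeneous (fun h => hβ (by rw [h, map_zero]))
  have h1 := h0.sum_weight_X_mul_pderiv
  have h2 : ∀ j, _ := fun j => (isWeightedHomogeneous_monomial D.w (D.m j) (t j)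
    rfl).sum_weight_X_mul_pderiv
  have h3 : ∀ i, (D.w i : MvPolynomial (Fin n) A) * (X i * D.gA t i) =
      D.w i • (X i * pderiv i (map (algebraMap ℂ A) D.f₀)) +
        ∑ j, D.w i • (X i * pderiv i (monomial (D.m j) (t j))) := by
    intro i
    rw [gA, FA, map_add, map_sum, mul_add, mul_add, Finset.mul_sum, Finset.mul_sum]
    simp only [nsmul_eq_mul]
  simp only [h3]
  rw [Finset.sum_add_distrib, h1, Finset.sum_comm]
  simp only [h2]
  rw [FA, mul_add, Finset.mul_sum, nsmul_eq_mul, add_assoc, ← Finset.sum_add_distrib]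
  congr 1
  refine Finset.sum_congr rfl fun j _ => ?_
  rw [wt, nsmul_eq_mul, Int.cast_sub, sub_mul, map_sub]
  have h4 : ∀ m : ℕ, monomial (D.m j) ((m : A) * t j) =
      (m : MvPolynomial (Fin n) A) * monomial (D.m j) (t j) := by
    intro m
    rw [← map_natCast (C : A →+* MvPolynomial (Fin n) A), C_mul_monomial]
  simp only [Int.cast_natCast, h4]
  ring

lemma isUnit_d : IsUnit (D.d : A) := by
  have h0 : (D.d : ℂ) ≠ 0 := by
    have := D.w_lt_d ⟨0, D.n_pos⟩
    rw [Nat.cast_ne_zero]; omega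
  have := (isUnit_iff_ne_zero.2 h0).map (algebraMap ℂ A)
  rwa [map_natCast] at this

lemma X_mul_gA_mem (g : MvPolynomial (Fin n) A) (i : Fin n) :
    g * (X i * D.gA t i) ∈ D.XJ t :=
  Ideal.mul_mem_left _ _ (Ideal.mul_mem_mul (Ideal.subset_span ⟨i, rfl⟩) (D.gA_mem t i))

/-- Multiples of `F_t` are congruent to combinations of the upper monomials. -/
lemma exists_mul_FA_sub_mem (N : ℕ) (g : MvPolynomial (Fin n) A) :
    ∃ v : Fin k → A, g * D.FA t - ∑ j, monomial (D.m j) (v j) ∈ D.XJ t ⊔ ordIdeal A D.w N := by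
  obtain ⟨u, hu⟩ := D.isUnit_d (A := A)
  -- By Euler's formula `d F_t` is congruent to `∑ deg(t_j) t_j m_j`, all of whose terms have weight
  -- greater than `d`; this persists after multiplication by `g`.
  obtain ⟨v, hv⟩ := D.exists_sub_sum_m_mem t N
    (p := g * ∑ j, monomial (D.m j) ((D.wt j : A) * t j)) (by
    refine Ideal.mul_mem_left _ _ (Ideal.sum_mem _ fun j _ => ?_)
    exact monomial_mem_ordIdeal (D.d_lt_weight_m j) _)
  refine ⟨fun j => (↑u⁻¹ : A) * v j, ?_⟩
  have h1 : (C (↑u⁻¹ : A) : MvPolynomial (Fin n) A) * (D.d : MvPolynomial (Fin n) A) = 1 := by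
    rw [← map_natCast (C : A →+* MvPolynomial (Fin n) A), ← map_mul, ← hu, Units.inv_mul, map_one]
  have h2 : g * D.FA t - ∑ j, monomial (D.m j) ((↑u⁻¹ : A) * v j) =
      C (↑u⁻¹ : A) * (g * ∑ i, (D.w i : MvPolynomial (Fin n) A) * (X i * D.gA t i)) +
      C (↑u⁻¹ : A) * (g * ∑ j, monomial (D.m j) ((D.wt j : A) * t j) -
        ∑ j, monomial (D.m j) (v j)) := by
    have h3 : ∑ j, monomial (D.m j) ((↑u⁻¹ : A) * v j) =
        C (↑u⁻¹ : A) * ∑ j, monomial (D.m j) (v j) := by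
      rw [Finset.mul_sum]
      simp only [C_mul_monomial]
    rw [h3]
    linear_combination (- g * D.FA t) * h1 + C (↑u⁻¹ : A) * g * D.euler_FA t
  rw [h2]
  refine Ideal.add_mem _ (Ideal.mul_mem_left _ _ (Ideal.mem_sup_left ?_)) (Ideal.mul_mem_left _ _ hv)
  rw [Finset.mul_sum]
  refine Ideal.sum_mem _ fun i _ => ?_
  rw [← mul_assoc]
  exact D.X_mul_gA_mem t _ i

/-- Beyond the socle weight a monomial reduces to 0 modulo the derivatives of f₀. Since its weight
exceeds `d`, the multipliers have no constant term, and replacing the derivatives by those of F_t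
changes only terms of higher order. -/
lemma ordIdeal_le_XJ_sup_succ {N : ℕ} (hN : D.soc < N) :
    ordIdeal A D.w N ≤ D.XJ t ⊔ ordIdeal A D.w (N + 1) := by
  refine ordIdeal_le_iff.2 fun β hβ => ?_
  rcases Nat.lt_or_ge N (Finsupp.weight D.w β) with h | h
  · exact Ideal.mem_sup_right (monomial_mem_ordIdeal h 1)
  obtain ⟨c, a, heq, hc, ha⟩ := D.exists_monomial_eq β
  have h1 : ∀ α : D.B, c α = 0 := by
    intro α
    by_contra h0
    have h1 := hc α h0
    have h2 := D.weight_le_soc α.2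
    omega
  simp only [h1, monomial_zero, Finset.sum_const_zero, zero_add] at heq
  have h2 := congrArg (map (algebraMap ℂ A)) heq
  rw [map_monomial, map_one, map_sum] at h2
  have h3 : monomial β (1 : A) = ∑ i, map (algebraMap ℂ A) (a i) * D.gA t i -
      ∑ i, map (algebraMap ℂ A) (a i) * (D.gA t i - map (algebraMap ℂ A) (D.jac i)) := by
    rw [h2, ← Finset.sum_sub_distrib]
    refine Finset.sum_congr rfl fun i _ => ?_
    rw [map_mul]; ring
  have hsd := D.d_lt_soc
  rw [h3]
  refine Ideal.sub_mem _ (Ideal.mem_sup_left (Ideal.sum_mem _ fun i _ => ?_))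
    (Ideal.mem_sup_right (Ideal.sum_mem _ fun i _ => ?_))
  · refine Ideal.mul_mem_mul ?_ (D.gA_mem t i)
    rw [(a i).as_sum, map_sum]
    refine Ideal.sum_mem _ fun γ hγ => ?_
    rw [map_monomial]
    refine monomial_mem_span_X ?_ _
    rintro rfl
    have := ha i 0 (mem_support_iff.1 hγ)
    rw [map_zero] at this
    omega
  · have h4 : map (algebraMap ℂ A) (a i) ∈ ordIdeal A D.w (N + D.w i - D.d) := by
      refine map_mem_ordIdeal _ fun γ hγ => ?_
      by_contra h0
      have := ha i γ h0
      omega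
    have := D.w_lt_d i
    exact ordIdeal_anti (by omega) (mul_mem_ordIdeal h4 (D.gA_sub_mem t i))

lemma ordIdeal_le_XJ_sup {N : ℕ} (hN : D.soc < N) (M : ℕ) :
    ordIdeal A D.w N ≤ D.XJ t ⊔ ordIdeal A D.w (N + M) := by
  induction M with
  | zero => exact le_sup_right
  | succ M ih =>
    refine ih.trans (sup_le le_sup_left ?_)
    exact D.ordIdeal_le_XJ_sup_succ t (by omega)

lemma ordIdeal_le_span_mul (N : ℕ) :
    ordIdeal A D.w (N + D.d) ≤ Ideal.span (Set.range X) * ordIdeal A D.w N := by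
  refine ordIdeal_le_iff.2 fun β hβ => ?_
  have hn := D.w_lt_d ⟨0, D.n_pos⟩
  obtain ⟨i, hi⟩ : ∃ i, β i ≠ 0 := by
    by_contra! h
    have : β = 0 := Finsupp.ext h
    rw [this, map_zero] at hβ
    omega
  have h1 : Finsupp.single i 1 + (β - Finsupp.single i 1) = β := by
    rw [add_tsub_cancel_of_le]
    rw [Finsupp.single_le_iff]
    omega
  have h2 : monomial β (1 : A) = X i * monomial (β - Finsupp.single i 1) 1 := by
    rw [X, monomial_mul, h1, one_mul]
  rw [h2]
  refine Ideal.mul_mem_mul (Ideal.subset_span ⟨i, rfl⟩) (monomial_mem_ordIdeal ?_ 1)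
  have h3 := congrArg (Finsupp.weight D.w) h1
  rw [map_add, Finsupp.weight_single, one_smul] at h3
  have := D.w_lt_d i
  omega

/-- High order terms belong to `(x)(∂F_t/∂x)`. -/
lemma map_ordIdeal_le [EvalPoints A] [IsNoetherianRing A] :
    (ordIdeal A D.w (D.soc + 1)).map (toConv n A) ≤ (D.XJ t).map (toConv n A) := by
  -- The hypothesis of Nakayama's lemma: modulo `(x)(∂F_t/∂x)`, terms of order beyond the socle can
  -- be pushed up until a variable splits off.
  have h1 : ordIdeal A D.w (D.soc + 1) ≤
      D.XJ t ⊔ Ideal.span (Set.range X) * ordIdeal A D.w (D.soc + 1) :=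
    (D.ordIdeal_le_XJ_sup t (Nat.lt_succ_self _) D.d).trans
      (sup_le_sup_left (D.ordIdeal_le_span_mul _) _)
  have h2 := Ideal.map_mono (f := toConv n A) h1
  rw [Ideal.map_sup, Ideal.map_mul, Ideal.map_span, ← Set.range_comp] at h2
  refine Submodule.le_of_le_smul_of_le_jacobson_bot ?_ convVars_le_jacobson h2
  exact Ideal.FG.map (IsNoetherian.noetherian (ordIdeal A D.w (D.soc + 1))) _

end NeZero

end Relative

end Setup

end SQH

/-! ### Freeness of the Milnor algebra of F_t and coordinates on it -/

namespace SQH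

open MvPolynomial

namespace Setup

variable {n k : ℕ} (D : Setup n k)

section Relative

variable {A : Type} [CommRing A] [Algebra ℂ A] (t : Fin k → A)

/-- A combination of the basis monomials. -/
def basisPoly : (D.B → A) →ₗ[A] MvPolynomial (Fin n) A :=
  ∑ α : D.B, monomial α.1 ∘ₗ LinearMap.proj α

lemma basisPoly_apply (c : D.B → A) : D.basisPoly c = ∑ α : D.B, monomial α.1 (c α) := by
  simp [basisPoly]

/-- A combination of the upper monomials. -/
def upperPoly : (Fin k → A) →ₗ[A] MvPolynomial (Fin n) A :=
  ∑ j, monomial (D.m j) ∘ₗ LinearMap.proj j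

lemma upperPoly_apply (v : Fin k → A) : D.upperPoly v = ∑ j, monomial (D.m j) (v j) := by
  simp [upperPoly]

lemma map_upperPoly {A' : Type} [CommRing A'] [Algebra ℂ A'] (φ : A →+* A') (v : Fin k → A) :
    map φ (D.upperPoly v) = D.upperPoly (φ ∘ v) := by
  rw [upperPoly_apply, upperPoly_apply, map_sum]
  exact Finset.sum_congr rfl fun j _ => map_monomial _ _ _

section NeZero

variable [NeZero k]

/-- The ideal of the Milnor algebra of `F_t` in the polynomial ring. -/
def K : Ideal (MvPolynomial (Fin n) A) := D.JA t ⊔ ordIdeal A D.w (D.soc + 1)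

lemma K_le (N : ℕ) : D.K t ≤ D.JA t ⊔ ordIdeal A D.w N := by
  refine sup_le le_sup_left ?_
  rcases Nat.le_or_ge N (D.soc + 1) with h | h
  · exact (ordIdeal_anti h).trans le_sup_right
  · have := D.ordIdeal_le_XJ_sup t (Nat.lt_succ_self D.soc) (N - (D.soc + 1))
    rw [show D.soc.succ + (N - (D.soc + 1)) = N by omega] at this
    exact this.trans (sup_le_sup_right (D.XJ_le_JA t) _)

lemma XJ_sup_le_K : D.XJ t ⊔ ordIdeal A D.w (D.soc + 1) ≤ D.K t :=
  sup_le_sup_right (D.XJ_le_JA t) _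

lemma map_mem_K {A' : Type} [CommRing A'] [Algebra ℂ A'] (φ : A →ₐ[ℂ] A')
    {p : MvPolynomial (Fin n) A} (hp : p ∈ D.K t) :
    map (φ : A →+* A') p ∈ D.K fun i => φ (t i) := D.map_mem_JA_sup t φ hp

lemma K_zero : D.K (0 : Fin k → ℂ) = D.J := by
  rw [K, JA_zero]
  exact sup_eq_left.2 D.ordIdeal_soc_le

lemma basisPoly_mem_K {c : D.B → A} (h : D.basisPoly c ∈ D.K t) : c = 0 := by
  ext α
  rw [basisPoly_apply] at h
  exact D.independent_modulo t c h α (Nat.lt_succ_of_le (D.weight_le_soc α.2))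

lemma upperPoly_eq_basisPoly (v : Fin k → A) :
    D.upperPoly v = D.basisPoly fun α => ∑ j, if D.m j = α.1 then v j else 0 := by
  classical
  rw [basisPoly_apply, upperPoly_apply, D.sum_B_eq_sum_m]
  · refine Finset.sum_congr rfl fun j _ => ?_
    congr 1
    simp [D.m_injective.eq_iff]
  · intro α hα
    obtain ⟨j, _, hj⟩ := Finset.exists_ne_zero_of_sum_ne_zero hα
    rw [← (ite_ne_right_iff.1 hj).1]
    exact D.d_lt_weight_m j

lemma upperPoly_mem_K {v : Fin k → A} (h : D.upperPoly v ∈ D.K t) : v = 0 := by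
  classical
  rw [upperPoly_eq_basisPoly] at h
  have h1 := D.basisPoly_mem_K t h
  ext j
  have h2 := congrFun h1 ⟨D.m j, D.m_mem j⟩
  simpa [D.m_injective.eq_iff] using h2

/-- The Milnor algebra of F_t is free over `A` on the basis chosen for f₀: reduction gives
generation, comparison of leading parts gives independence. -/
lemma bijective_mkQ_basisPoly : Function.Bijective
    (((D.K t).restrictScalars A).mkQ ∘ₗ D.basisPoly) := by
  constructor
  · rw [← LinearMap.ker_eq_bot, LinearMap.ker_eq_bot']
    intro c hc
    rw [LinearMap.comp_apply, Submodule.mkQ_apply, Submodule.Quotient.mk_eq_zero] at hc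
    exact D.basisPoly_mem_K t hc
  · intro q
    obtain ⟨p, rfl⟩ := Submodule.mkQ_surjective _ q
    obtain ⟨c, hc⟩ := D.exists_sub_sum_mem t (D.soc + 1) p
    refine ⟨c, ?_⟩
    rw [LinearMap.comp_apply, Submodule.mkQ_apply, Submodule.mkQ_apply, eq_comm,
      Submodule.Quotient.eq, basisPoly_apply]
    exact hc

/-- The coordinates of a polynomial in the Milnor algebra of `F_t`. -/
def red : MvPolynomial (Fin n) A →ₗ[A] (D.B → A) :=
  (LinearEquiv.ofBijective _ (D.bijective_mkQ_basisPoly t)).symm.toLinearMap ∘ₗ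
    ((D.K t).restrictScalars A).mkQ

lemma sub_basisPoly_red_mem (p : MvPolynomial (Fin n) A) : p - D.basisPoly (D.red t p) ∈ D.K t := by
  have h := (LinearEquiv.ofBijective _ (D.bijective_mkQ_basisPoly t)).apply_symm_apply
    (((D.K t).restrictScalars A).mkQ p)
  have h1 : ((D.K t).restrictScalars A).mkQ (D.basisPoly (D.red t p)) =
    ((D.K t).restrictScalars A).mkQ p := h
  rw [Submodule.mkQ_apply, Submodule.mkQ_apply, eq_comm, Submodule.Quotient.eq] at h1
  exact h1

lemma red_eq {p : MvPolynomial (Fin n) A} {c : D.B → A} (h : p - D.basisPoly c ∈ D.K t) :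
    D.red t p = c := by
  have h1 := D.basisPoly_mem_K t (c := c - D.red t p) (by
    have := Ideal.sub_mem _ (D.sub_basisPoly_red_mem t p) h
    rwa [sub_sub_sub_cancel_left, ← map_sub] at this)
  exact (sub_eq_zero.1 h1).symm

lemma red_congr {p q : MvPolynomial (Fin n) A} (h : p - q ∈ D.K t) : D.red t p = D.red t q := by
  apply D.red_eq t
  have := Ideal.add_mem _ h (D.sub_basisPoly_red_mem t q)
  rwa [sub_add_sub_cancel] at this

lemma red_basisPoly (c : D.B → A) : D.red t (D.basisPoly c) = c :=
  D.red_eq t (by rw [sub_self]; exact Ideal.zero_mem _)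

lemma red_map {A' : Type} [CommRing A'] [Algebra ℂ A'] (φ : A →ₐ[ℂ] A')
    (p : MvPolynomial (Fin n) A) (α : D.B) :
    D.red (fun i => φ (t i)) (map (φ : A →+* A') p) α = φ (D.red t p α) := by
  have h := D.map_mem_K t φ (D.sub_basisPoly_red_mem t p)
  rw [map_sub, basisPoly_apply, map_sum] at h
  simp only [map_monomial] at h
  have h1 := D.red_eq (fun i => φ (t i)) (c := fun α => φ (D.red t p α)) (by
    rw [basisPoly_apply]; exact h)
  rw [h1]

lemma basisPoly_single (α : D.B) [DecidableEq D.B] :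
    D.basisPoly (Pi.single α (1 : A)) = monomial α.1 1 := by
  rw [basisPoly_apply, Finset.sum_eq_single α]
  · rw [Pi.single_eq_same]
  · intro b _ hb
    rw [Pi.single_eq_of_ne hb, monomial_zero]
  · intro h; exact absurd (Finset.mem_univ _) h

lemma red_mul (p q : MvPolynomial (Fin n) A) :
    D.red t (p * q) = ∑ α : D.B, D.red t p α • D.red t (monomial α.1 1 * q) := by
  have h1 : D.red t (p * q) = D.red t (D.basisPoly (D.red t p) * q) := by
    apply D.red_congr
    rw [← sub_mul]
    exact Ideal.mul_mem_right _ _ (D.sub_basisPoly_red_mem t p)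
  rw [h1, basisPoly_apply, Finset.sum_mul, map_sum]
  refine Finset.sum_congr rfl fun α _ => ?_
  rw [← map_smul]
  congr 1
  rw [smul_eq_C_mul, ← mul_assoc, C_mul_monomial, mul_one]

/-- The coefficients of `g F_t` at the monomials which are not upper vanish. -/
lemma exists_mul_FA_sub_upperPoly_mem (g : MvPolynomial (Fin n) A) :
    ∃ v : Fin k → A, g * D.FA t - D.upperPoly v ∈ D.XJ t ⊔ ordIdeal A D.w (D.soc + 1) := by
  obtain ⟨v, hv⟩ := D.exists_mul_FA_sub_mem t (D.soc + 1) g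
  exact ⟨v, by rwa [upperPoly_apply]⟩

end NeZero

end Relative

/-! ### The kernel of the Kodaira–Spencer map as the relations among the upper monomials -/

section KodairaSpencer

variable [NeZero k]

lemma ksIdeal_eq_map : D.ksIdeal =
    (Ideal.span {D.F} ⊔ D.XJ (X : Fin k → Aneg k)).map (toConv n (Aneg k)) := by
  rw [ksIdeal, F_eq_FA, jacobianIdeal_FA, Ideal.map_sup, XJ, Ideal.map_mul, Ideal.map_span,
    Ideal.map_span, Set.image_singleton, ← Set.range_comp]
  rfl

lemma kodairaSpencer_apply (δ : Derivation ℂ (Aneg k) (Aneg k)) :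
    D.kodairaSpencer δ = Ideal.Quotient.mk D.ksIdeal
      (toConv n (Aneg k) (D.upperPoly fun j => δ (X j))) := by
  rw [upperPoly_apply, map_sum, map_sum]
  change ∑ j, δ (X j) • Ideal.Quotient.mk D.ksIdeal (D.mono j) = _
  refine Finset.sum_congr rfl fun j _ => ?_
  have : monomial (D.m j) (δ (X j)) = δ (X j) • monomial (D.m j) (1 : Aneg k) := by
    rw [smul_monomial, smul_eq_mul, mul_one]
  rw [this, map_smul]
  rfl

/-- The kernel of the Kodaira–Spencer map can be computed in the polynomial ring. -/
lemma mem_calL_iff (δ : Derivation ℂ (Aneg k) (Aneg k)) :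
    δ ∈ D.calL ↔ ∃ g, (D.upperPoly fun j => δ (X j)) - g * D.F ∈ D.K (X : Fin k → Aneg k) := by
  rw [calL, LinearMap.mem_ker, kodairaSpencer_apply, Ideal.Quotient.eq_zero_iff_mem, ksIdeal_eq_map]
  constructor
  · intro h
    have h1 := mem_sup_ordIdeal_of_toConv_mem (N := D.soc + 1) D.w_pos (Ideal.mem_sup_left h)
    rw [sup_assoc] at h1
    obtain ⟨a, ha, b, hb, hab⟩ := Submodule.mem_sup.1 h1
    obtain ⟨g, rfl⟩ := Ideal.mem_span_singleton'.1 ha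
    refine ⟨g, ?_⟩
    rw [← hab, add_sub_cancel_left]
    exact D.XJ_sup_le_K _ hb
  · rintro ⟨g, hg⟩
    -- The reduction of `g F` modulo the smaller ideal `(x)(∂F/∂x)` also ends in upper monomials.
    -- Uniqueness of the coordinates identifies it with `δ`, so the factor `(x)` imposes no further
    -- condition.
    obtain ⟨v, hv⟩ := D.exists_mul_FA_sub_upperPoly_mem (X : Fin k → Aneg k) g
    have h1 : (fun j => δ (X j)) = v := by
      rw [← sub_eq_zero]
      apply D.upperPoly_mem_K (X : Fin k → Aneg k)
      rw [map_sub]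
      have := Ideal.add_mem _ hg (D.XJ_sup_le_K _ hv)
      rwa [F_eq_FA, sub_add_sub_cancel] at this
    rw [h1]
    have h2 : D.upperPoly v = g * D.F - (g * D.FA X - D.upperPoly v) := by
      rw [F_eq_FA]; ring
    rw [h2, map_sub]
    refine Ideal.sub_mem _ (Ideal.mem_map_of_mem _ (Ideal.mem_sup_left
      (Ideal.mul_mem_left _ _ (Ideal.mem_span_singleton_self _)))) ?_
    have h3 := Ideal.mem_map_of_mem (toConv n (Aneg k)) hv
    rw [Ideal.map_sup, sup_eq_left.2 (D.map_ordIdeal_le _)] at h3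
    exact Ideal.map_mono le_sup_right h3

/-- The rows of `E` generate the relations of the Tjurina algebra of `F_t` between the upper
monomials. -/
structure IsRelationMatrix {A : Type} [CommRing A] [Algebra ℂ A] (t : Fin k → A)
    (E : Matrix (Fin k) (Fin k) A) : Prop where
  row_mem : ∀ l, ∃ g, D.upperPoly (E.row l) - g * D.FA t ∈ D.K t
  exists_vecMul : ∀ g, ∃ u, g * D.FA t - D.upperPoly (Matrix.vecMul u E) ∈ D.K t

lemma derivation_eq_mk (δ : Derivation ℂ (Aneg k) (Aneg k)) :
    δ = mkDerivation ℂ fun j => δ (X j) := by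
  ext j
  rw [mkDerivation_X]

lemma sum_smul_rowVF (h : Matrix (Fin k) (Fin k) (Aneg k)) (u : Fin k → Aneg k) :
    ∑ l, u l • rowVF h l = mkDerivation ℂ (Matrix.vecMul u h) := by
  refine derivation_ext fun j => ?_
  rw [mkDerivation_X, ← Derivation.coeFnAddMonoidHom_apply, map_sum, Finset.sum_apply]
  change _ = ∑ l, u l * h l j
  refine Finset.sum_congr rfl fun l _ => ?_
  rw [Derivation.coeFnAddMonoidHom_apply, Derivation.smul_apply, rowVF, mkDerivation_X, smul_eq_mul]

/-- The coordinate vectors of the multiples of F are precisely the coefficient vectors of 𝓛, and the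
rows of `h` generate these. -/
lemma isRelationMatrix_X {h : Matrix (Fin k) (Fin k) (Aneg k)}
    (hg : Submodule.span (Aneg k) (Set.range (rowVF h)) = D.calL) :
    D.IsRelationMatrix (X : Fin k → Aneg k) h := by
  constructor
  · intro l
    have h1 : rowVF h l ∈ D.calL := by
      rw [← hg]; exact Submodule.subset_span ⟨l, rfl⟩
    obtain ⟨g, hg⟩ := (D.mem_calL_iff _).1 h1
    refine ⟨g, ?_⟩
    simp only [rowVF, mkDerivation_X] at hg
    exact hg
  · intro g
    obtain ⟨v, hv⟩ := D.exists_mul_FA_sub_upperPoly_mem (X : Fin k → Aneg k) g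
    have hv := D.XJ_sup_le_K _ hv
    have h1 : mkDerivation ℂ v ∈ D.calL := by
      refine (D.mem_calL_iff _).2 ⟨g, ?_⟩
      simp only [mkDerivation_X]
      have := neg_mem hv
      rwa [neg_sub] at this
    rw [← hg] at h1
    obtain ⟨u, hu⟩ := (Submodule.mem_span_range_iff_exists_fun _).1 h1
    refine ⟨u, ?_⟩
    have h2 : Matrix.vecMul u h = v := by
      rw [sum_smul_rowVF] at hu
      ext1 j
      have := congrArg (fun δ : Derivation ℂ (Aneg k) (Aneg k) => δ (X j)) hu
      simpa only [mkDerivation_X] using this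
    rwa [h2]

/-- By linearity it suffices to consider monomial multiples of F_t, and these are specializations of
multiples of F. -/
lemma IsRelationMatrix.map {D : Setup n k} {h : Matrix (Fin k) (Fin k) (Aneg k)}
    (hh : D.IsRelationMatrix (X : Fin k → Aneg k) h) {A : Type} [CommRing A] [Algebra ℂ A]
    (t : Fin k → A) : D.IsRelationMatrix t (h.map (aeval t)) := by
  have ht : (fun i => (aeval t : Aneg k →ₐ[ℂ] A) (X i)) = t := by simp
  constructor
  · intro l
    obtain ⟨g, hg⟩ := hh.row_mem l
    have h1 := D.map_mem_K _ (aeval t : Aneg k →ₐ[ℂ] A) hg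
    rw [map_sub, map_mul, FA_map, map_upperPoly, ht] at h1
    exact ⟨_, h1⟩
  · have key : ∀ γ, ∃ u : Fin k → A, monomial γ 1 * D.FA t -
        D.upperPoly (Matrix.vecMul u (h.map (aeval t))) ∈ D.K t := by
      intro γ
      obtain ⟨u, hu⟩ := hh.exists_vecMul (monomial γ 1)
      have h1 := D.map_mem_K _ (aeval t : Aneg k →ₐ[ℂ] A) hu
      rw [map_sub, map_mul, FA_map, map_upperPoly, ht, map_monomial, map_one] at h1
      refine ⟨fun l => aeval t (u l), ?_⟩
      convert h1 using 3
      ext j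
      simp [Matrix.vecMul, dotProduct, map_sum]
    choose u hu using key
    intro g
    refine ⟨∑ γ ∈ g.support, coeff γ g • u γ, ?_⟩
    have h1 : g * D.FA t - D.upperPoly (Matrix.vecMul (∑ γ ∈ g.support, coeff γ g • u γ)
        (h.map (aeval t))) = ∑ γ ∈ g.support, C (coeff γ g) * (monomial γ 1 * D.FA t -
          D.upperPoly (Matrix.vecMul (u γ) (h.map (aeval t)))) := by
      rw [Matrix.sum_vecMul, map_sum]
      simp only [Matrix.smul_vecMul, map_smul, smul_eq_C_mul, mul_sub, Finset.sum_sub_distrib]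
      congr 1
      simp only [← mul_assoc, C_mul_monomial, mul_one]
      rw [← Finset.sum_mul, ← g.as_sum]
    rw [h1]
    exact Ideal.sum_mem _ fun γ _ => Ideal.mul_mem_left _ _ (hu γ)

end KodairaSpencer

/-! ### Presentation of the truncated Tjurina algebras -/

section Presentation

variable [NeZero k] {A : Type} [CommRing A] [Algebra ℂ A] (t : Fin k → A)

/-- The basis monomials of weight less than `N`. -/
abbrev lowB (N : ℕ) : Type := {α : D.B // Finsupp.weight D.w α.1 < N}

open Classical in
/-- The inclusion of the upper monomials into the basis monomials of weight less than `N`. -/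
def upperIncl (A : Type) [CommRing A] (N : ℕ) : Matrix (Fin k) (D.lowB N) A :=
  Matrix.of fun j α => if D.m j = α.1.1 then 1 else 0

open Classical in
lemma sum_lowB (N : ℕ) (c : D.B → A) : D.basisPoly c - ∑ α : D.lowB N, monomial α.1.1 (c α.1) ∈
    ordIdeal A D.w N := by
  have h : ∑ α : D.lowB N, monomial α.1.1 (c α.1) = D.basisPoly fun α : D.B =>
      if Finsupp.weight D.w α.1 < N then c α else 0 := by
    rw [basisPoly_apply]
    refine Fintype.sum_of_injective (fun α : D.lowB N => α.1) Subtype.val_injective _ _ ?_ ?_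
    · intro α hα
      rw [if_neg, monomial_zero]
      exact fun h => hα ⟨⟨α, h⟩, rfl⟩
    · intro α
      rw [if_pos α.2]
  rw [h, ← map_sub, basisPoly_apply]
  refine Ideal.sum_mem _ fun α _ => ?_
  rw [Pi.sub_apply]
  split_ifs with h
  · rw [sub_self, monomial_zero]; exact Ideal.zero_mem _
  · exact monomial_mem_ordIdeal (by omega) _

lemma upperPoly_sub_mem (N : ℕ) (v : Fin k → A) :
    D.upperPoly v - ∑ α : D.lowB N, monomial α.1.1 (Matrix.vecMul v (D.upperIncl A N) α) ∈
      ordIdeal A D.w N := by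
  classical
  have h1 := D.sum_lowB N fun α : D.B => ∑ j, if D.m j = α.1 then v j else 0
  rw [← upperPoly_eq_basisPoly] at h1
  have h2 : ∀ α : D.lowB N, Matrix.vecMul v (D.upperIncl A N) α =
      ∑ j, if D.m j = α.1.1 then v j else 0 := by
    intro α
    simp [upperIncl, Matrix.vecMul, dotProduct]
  simp only [h2]
  exact h1

lemma lowB_independent {N : ℕ} {c : D.lowB N → A}
    (h : ∑ α, monomial α.1.1 (c α) ∈ D.JA t ⊔ ordIdeal A D.w N) : c = 0 := by
  classical
  ext α
  let c' : D.B → A := fun α => if h : Finsupp.weight D.w α.1 < N then c ⟨α, h⟩ else 0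
  have h1 := D.sum_lowB N c'
  have h2 : ∀ α : D.lowB N, c' α.1 = c α := fun α => dif_pos α.2
  simp only [h2] at h1
  have h3 := Ideal.add_mem _ (Ideal.mem_sup_right h1 : _ ∈ D.JA t ⊔ ordIdeal A D.w N) h
  rw [sub_add_cancel, basisPoly_apply] at h3
  rw [← h2 α]
  exact D.independent_modulo t c' h3 α.1 α.2

variable [EvalPoints A]

/-- The truncated Tjurina ideal of `F_t`. -/
def tjIdeal (N : ℕ) : Ideal (Conv n A) :=
  Ideal.span {toConv n A (D.FA t)} ⊔ jacobianIdeal (D.FA t) ⊔ degIdeal A D.w (N : ℚ)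

lemma toConv_mem_tjIdeal_iff {N : ℕ} {p : MvPolynomial (Fin n) A} :
    toConv n A p ∈ D.tjIdeal t N ↔ ∃ g, p - g * D.FA t ∈ D.JA t ⊔ ordIdeal A D.w N := by
  have h0 : D.tjIdeal t N = (Ideal.span {D.FA t} ⊔ D.JA t).map (toConv n A) ⊔
      (ordIdeal A D.w N).map (toConv n A) := by
    rw [tjIdeal, degIdeal_eq_map, jacobianIdeal_FA, Ideal.map_sup, Ideal.map_span,
      Set.image_singleton]
  rw [h0]
  constructor
  · intro h
    have h1 := mem_sup_ordIdeal_of_toConv_mem D.w_pos h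
    rw [sup_assoc] at h1
    obtain ⟨a, ha, b, hb, rfl⟩ := Submodule.mem_sup.1 h1
    obtain ⟨g, rfl⟩ := Ideal.mem_span_singleton'.1 ha
    exact ⟨g, by rwa [add_sub_cancel_left]⟩
  · rintro ⟨g, hg⟩
    rw [← Ideal.map_sup, sup_assoc]
    apply Ideal.mem_map_of_mem
    have : p = g * D.FA t + (p - g * D.FA t) := by ring
    rw [this]
    exact Submodule.add_mem_sup (Ideal.mul_mem_left _ _ (Ideal.mem_span_singleton_self _)) hg

/-- The generators of the truncated Tjurina algebra. -/
def tjGen (N : ℕ) : (D.lowB N → A) →ₗ[A] (Conv n A ⧸ D.tjIdeal t N) :=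
  ((D.tjIdeal t N).mkQ.restrictScalars A) ∘ₗ (toConv n A).toLinearMap ∘ₗ
    ∑ α : D.lowB N, monomial α.1.1 ∘ₗ LinearMap.proj α

lemma tjGen_apply (N : ℕ) (c : D.lowB N → A) : D.tjGen t N c =
    Ideal.Quotient.mk (D.tjIdeal t N) (toConv n A (∑ α, monomial α.1.1 (c α))) := by
  simp only [tjGen, LinearMap.comp_apply, LinearMap.sum_apply, LinearMap.proj_apply]
  rfl

/-- Modulo terms of order `N` the Milnor algebra of F_t is free on the basis monomials of weight `<
N`, and the multiples of F_t form the row module of `E`. Truncation only removes the columns of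
upper monomials of weight `≥ N`. -/
theorem isRowCokernel_tjGen {E : Matrix (Fin k) (Fin k) A} (hE : D.IsRelationMatrix t E) (N : ℕ) :
    IsRowCokernel (E * D.upperIncl A N) (D.tjGen t N) := by
  constructor
  · intro q
    obtain ⟨g, rfl⟩ := Ideal.Quotient.mk_surjective q
    obtain ⟨p, hp⟩ := exists_toConv_sub_mem_ordIdeal D.w_pos N g
    obtain ⟨c, hc⟩ := D.exists_sub_sum_mem t N p
    rw [← basisPoly_apply] at hc
    refine ⟨fun α => c α.1, ?_⟩
    rw [tjGen_apply, eq_comm, Ideal.Quotient.eq]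
    have h1 : p - ∑ α : D.lowB N, monomial α.1.1 (c α.1) ∈ D.JA t ⊔ ordIdeal A D.w N := by
      have := Ideal.add_mem _ hc (Ideal.mem_sup_right (D.sum_lowB N c))
      rwa [sub_add_sub_cancel] at this
    have h2 : toConv n A (p - ∑ α : D.lowB N, monomial α.1.1 (c α.1)) ∈ D.tjIdeal t N :=
      (D.toConv_mem_tjIdeal_iff t).2 ⟨0, by simpa using h1⟩
    have h3 : g - toConv n A p ∈ D.tjIdeal t N := by
      rw [← degIdeal_eq_map] at hp
      exact Ideal.mem_sup_right hp
    have := Ideal.add_mem _ h3 h2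
    rwa [map_sub, sub_add_sub_cancel] at this
  · ext c
    rw [LinearMap.mem_ker, tjGen_apply, Ideal.Quotient.eq_zero_iff_mem, toConv_mem_tjIdeal_iff,
      mem_span_rows_iff]
    constructor
    · rintro ⟨g, hg⟩
      obtain ⟨u, hu⟩ := hE.exists_vecMul g
      refine ⟨u, ?_⟩
      have h1 := Ideal.add_mem _ (Ideal.add_mem _ hg (D.K_le t N hu))
        (Ideal.mem_sup_right (D.upperPoly_sub_mem N (Matrix.vecMul u E)))
      rw [sub_add_sub_cancel, sub_add_sub_cancel, Matrix.vecMul_vecMul,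
        ← Finset.sum_sub_distrib] at h1
      simp only [← map_sub] at h1
      have h2 := D.lowB_independent t (c := c - Matrix.vecMul u (E * D.upperIncl A N)) h1
      exact (sub_eq_zero.1 h2).symm
    · rintro ⟨u, rfl⟩
      choose g hg using hE.row_mem
      refine ⟨∑ l, C (u l) * g l, ?_⟩
      have h1 : D.upperPoly (Matrix.vecMul u E) - (∑ l, C (u l) * g l) * D.FA t ∈ D.K t := by
        have h2 : D.upperPoly (Matrix.vecMul u E) - (∑ l, C (u l) * g l) * D.FA t =
            ∑ l, C (u l) * (D.upperPoly (E.row l) - g l * D.FA t) := by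
          have h3 : Matrix.vecMul u E = ∑ l, u l • E.row l := by
            ext j
            simp [Matrix.vecMul, dotProduct]
          rw [h3, map_sum, Finset.sum_mul, ← Finset.sum_sub_distrib]
          refine Finset.sum_congr rfl fun l _ => ?_
          rw [map_smul, smul_eq_C_mul]
          ring
        rw [h2]
        exact Ideal.sum_mem _ fun l _ => Ideal.mul_mem_left _ _ (hg l)
      have h4 := Ideal.sub_mem _ (D.K_le t N h1)
        (Ideal.mem_sup_right (D.upperPoly_sub_mem N (Matrix.vecMul u E)))
      rw [Matrix.vecMul_vecMul] at h4
      convert h4 using 1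
      ring

end Presentation

end Setup

end SQH

/-! ### The socle pairing and the existence of a symmetric system -/

namespace SQH

open MvPolynomial

/-- An entry of the adjugate is the determinant with one row replaced by a unit vector. That row
counts as homogeneous once its row degree is chosen to be `- s i`. -/
lemma adjugate_isWeightedHomogeneous {ι τ R : Type} [Fintype ι] [DecidableEq ι] [CommRing R]
    {v : τ → ℤ} {E : Matrix ι ι (MvPolynomial τ R)} {r s : ι → ℤ}
    (h : ∀ i j, (E i j).IsWeightedHomogeneous v (r i + s j)) (i j : ι) :
    (E.adjugate i j).IsWeightedHomogeneous v (∑ a, r a + ∑ a, s a - r j - s i) := by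
  rw [Matrix.adjugate_apply]
  have h1 := det_isWeightedHomogeneous (E := E.updateRow j (Pi.single i 1)) (v := v)
    (r := Function.update r j (- s i)) (s := s) (by
    intro a b
    by_cases ha : a = j
    · subst ha
      rw [Matrix.updateRow_self, Function.update_self]
      by_cases hb : b = i
      · subst hb
        rw [Pi.single_eq_same, neg_add_cancel]
        exact isWeightedHomogeneous_one _ _
      · rw [Pi.single_eq_of_ne hb]
        exact isWeightedHomogeneous_zero _ _ _
    · rw [Matrix.updateRow_ne ha, Function.update_of_ne ha]
      exact h a b)
  rw [Finset.sum_update_of_mem (Finset.mem_univ j)] at h1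
  have h2 := Finset.sum_sdiff (Finset.subset_univ {j}) (f := r)
  rw [Finset.sum_singleton] at h2
  rwa [show - s i + ∑ x ∈ Finset.univ \ {j}, r x + ∑ a, s a =
    ∑ a, r a + ∑ a, s a - r j - s i by rw [← h2]; ring] at h1

namespace Setup

variable {n k : ℕ} (D : Setup n k)

/-- The polynomial `p` is homogeneous of total degree `e` in `x` and `t`. -/
def Bihom (e : ℤ) (p : MvPolynomial (Fin n) (Aneg k)) : Prop :=
  ∀ β, (coeff β p).IsWeightedHomogeneous D.wt (e - (Finsupp.weight D.w β : ℕ))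

variable {D}

lemma Bihom.add {e : ℤ} {p q : MvPolynomial (Fin n) (Aneg k)} (hp : D.Bihom e p)
    (hq : D.Bihom e q) : D.Bihom e (p + q) := fun β => by
  rw [coeff_add]; exact (hp β).add (hq β)

lemma Bihom.sum {ι : Type} {e : ℤ} (s : Finset ι) {p : ι → MvPolynomial (Fin n) (Aneg k)}
    (hp : ∀ i ∈ s, D.Bihom e (p i)) : D.Bihom e (∑ i ∈ s, p i) := fun β => by
  rw [coeff_sum, ← mem_weightedHomogeneousSubmodule]
  exact Submodule.sum_mem _ fun i hi => (mem_weightedHomogeneousSubmodule ..).2 (hp i hi β)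

lemma bihom_monomial {e : ℤ} {β : Fin n →₀ ℕ} {a : Aneg k}
    (ha : a.IsWeightedHomogeneous D.wt (e - (Finsupp.weight D.w β : ℕ))) :
    D.Bihom e (monomial β a) := fun γ => by
  classical
  rw [coeff_monomial]
  split_ifs with h
  · rw [← h]; exact ha
  · exact isWeightedHomogeneous_zero _ _ _

lemma Bihom.mul {e e' : ℤ} {p q : MvPolynomial (Fin n) (Aneg k)} (hp : D.Bihom e p)
    (hq : D.Bihom e' q) : D.Bihom (e + e') (p * q) := fun β => by
  classical
  rw [coeff_mul, ← mem_weightedHomogeneousSubmodule]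
  refine Submodule.sum_mem _ fun x hx => (mem_weightedHomogeneousSubmodule ..).2 ?_
  rw [Finset.HasAntidiagonal.mem_antidiagonal] at hx
  have h1 := (hp x.1).mul (hq x.2)
  rw [← hx, map_add]
  push_cast
  convert h1 using 1
  ring

variable (D)

lemma bihom_F : D.Bihom D.d D.F := by
  refine Bihom.add (fun β => ?_) (Bihom.sum _ fun j _ => bihom_monomial ?_)
  · rw [coeff_map]
    by_cases h : coeff β D.f₀ = 0
    · rw [h, map_zero]; exact isWeightedHomogeneous_zero _ _ _
    · rw [D.f₀_quasihomogeneous h, sub_self]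
      exact isWeightedHomogeneous_C _ _
  · exact isWeightedHomogeneous_X ℂ D.wt j

section NeZero

variable [NeZero k]

/-- The upper monomials as elements of the basis. -/
def mB (j : Fin k) : D.B := ⟨D.m j, D.m_mem j⟩

lemma red_isWeightedHomogeneous {e : ℤ} {p : MvPolynomial (Fin n) (Aneg k)} (hp : D.Bihom e p)
    (α : D.B) : (D.red X p α).IsWeightedHomogeneous D.wt (e - (Finsupp.weight D.w α.1 : ℕ)) := by
  have h1 : D.red X p α = ∑ β ∈ p.support, coeff β p * D.red X (monomial β 1) α := by
    conv_lhs => rw [p.as_sum, map_sum, Finset.sum_apply]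
    refine Finset.sum_congr rfl fun β _ => ?_
    have : monomial β (coeff β p) = coeff β p • monomial β (1 : Aneg k) := by
      rw [smul_monomial, smul_eq_mul, mul_one]
    rw [this, map_smul, Pi.smul_apply, smul_eq_mul]
  rw [h1, ← mem_weightedHomogeneousSubmodule]
  refine Submodule.sum_mem _ fun β _ => (mem_weightedHomogeneousSubmodule ..).2 ?_
  obtain ⟨c, hc, hc'⟩ := D.isReducible_JA (D.soc + 1) β
  rw [← basisPoly_apply] at hc'
  rw [D.red_eq X hc']
  have h2 := (hp β).mul (hc α)
  rwa [sub_add_sub_cancel] at h2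

section Functional

variable {A : Type} [CommRing A] [Algebra ℂ A] (t : Fin k → A)

/-- The coefficient of the monomial which generates the socle. -/
def socForm : MvPolynomial (Fin n) A →ₗ[A] A :=
  LinearMap.proj (D.mB (Fin.rev 0)) ∘ₗ D.red t

/-- The matrix of the pairing on the Milnor algebra of `F_t`. -/
def gram : Matrix D.B D.B A :=
  Matrix.of fun α β => D.socForm t (monomial α.1 1 * monomial β.1 1)

lemma socForm_congr {p q : MvPolynomial (Fin n) A} (h : p - q ∈ D.K t) :
    D.socForm t p = D.socForm t q := congrFun (D.red_congr t h) _

lemma socForm_mul (p q : MvPolynomial (Fin n) A) :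
    D.socForm t (p * q) = ∑ α : D.B, D.red t p α * D.socForm t (monomial α.1 1 * q) := by
  have := congrFun (D.red_mul t p q) (D.mB (Fin.rev 0))
  rw [Finset.sum_apply] at this
  exact this

/-- The coefficients of a multiple of `F_t` at the upper monomials. -/
lemma mul_FA_sub_upperPoly_red_mem (g : MvPolynomial (Fin n) A) :
    g * D.FA t - D.upperPoly (fun j => D.red t (g * D.FA t) (D.mB j)) ∈ D.K t := by
  classical
  obtain ⟨v, hv⟩ := D.exists_mul_FA_sub_upperPoly_mem t g
  have hv := D.XJ_sup_le_K t hv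
  have h1 : (fun j => D.red t (g * D.FA t) (D.mB j)) = v := by
    ext j
    rw [D.red_congr t hv, upperPoly_eq_basisPoly, red_basisPoly]
    simp [mB, D.m_injective.eq_iff]
  rwa [h1]

lemma red_upperPoly (v : Fin k → A) (j : Fin k) : D.red t (D.upperPoly v) (D.mB j) = v j := by
  classical
  rw [upperPoly_eq_basisPoly, red_basisPoly]
  simp [mB, D.m_injective.eq_iff]

end Functional

/-- A kernel vector would be a nonzero element of the Milnor algebra of f₀ all of whose multiples
have socle coefficient 0. But some multiple generates the socle, where the form does not vanish. -/
lemma det_gram_zero_ne_zero : (D.gram (0 : Fin k → ℂ)).det ≠ 0 := by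
  classical
  intro h0
  obtain ⟨v, hv, hv0⟩ := Matrix.exists_vecMul_eq_zero_iff.2 h0
  have h1 : D.basisPoly v ∉ D.J := by
    intro h
    rw [← K_zero] at h
    exact hv (D.basisPoly_mem_K _ h)
  obtain ⟨γ, c, hc, h2⟩ := D.exists_mul_monomial_sub_mem h1
  obtain ⟨c', hc', h3⟩ := D.exists_monomial_sub_hess_mem (D.m_mem (Fin.rev 0)) D.weight_m_last
  rw [← K_zero] at h2 h3
  have h4 : D.socForm 0 (D.basisPoly v * monomial γ 1) = 0 := by
    rw [mul_comm, socForm_mul]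
    refine Finset.sum_eq_zero fun β _ => ?_
    have h5 := congrFun hv0 β
    have h6 : D.socForm 0 (monomial β.1 1 * D.basisPoly v) = Matrix.vecMul v (D.gram 0) β := by
      rw [basisPoly_apply, Finset.mul_sum, map_sum]
      change _ = ∑ α, v α * D.socForm 0 (monomial α.1 1 * monomial β.1 1)
      refine Finset.sum_congr rfl fun α _ => ?_
      have : monomial β.1 1 * monomial α.1 (v α) = v α • (monomial α.1 1 * monomial β.1 1) := by
        rw [mul_comm, ← smul_mul_assoc, smul_monomial, smul_eq_mul, mul_one]
      rw [this, map_smul, smul_eq_mul]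
    rw [h6, h5, Pi.zero_apply, mul_zero]
  have h7 : c * D.socForm 0 D.hess = 0 := by
    rw [← smul_eq_mul, ← map_smul, smul_eq_C_mul, ← D.socForm_congr 0 h2, h4]
  have h8 : c' * D.socForm 0 D.hess = 1 := by
    rw [← smul_eq_mul, ← map_smul, smul_eq_C_mul, ← D.socForm_congr 0 h3]
    change D.red 0 (monomial (D.mB (Fin.rev 0)).1 1) (D.mB (Fin.rev 0)) = 1
    rw [← basisPoly_single, red_basisPoly, Pi.single_eq_same]
  rcases mul_eq_zero.1 h7 with h | h
  · exact hc h
  · rw [h, mul_zero] at h8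
    exact zero_ne_one h8

lemma gram_isWeightedHomogeneous (α β : D.B) :
    (D.gram (X : Fin k → Aneg k) α β).IsWeightedHomogeneous D.wt
      (((Finsupp.weight D.w α.1 : ℕ) - D.soc : ℤ) + (Finsupp.weight D.w β.1 : ℕ)) := by
  have h1 : D.Bihom ((Finsupp.weight D.w α.1 : ℕ) + (Finsupp.weight D.w β.1 : ℕ))
      (monomial α.1 1 * monomial β.1 1) := by
    refine Bihom.mul (bihom_monomial ?_) (bihom_monomial ?_)
    all_goals
      rw [sub_self]
      exact isWeightedHomogeneous_one _ _
  have h2 := D.red_isWeightedHomogeneous h1 (D.mB (Fin.rev 0))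
  rw [mB, weight_m_last] at h2
  rwa [show ((Finsupp.weight D.w α.1 : ℕ) + (Finsupp.weight D.w β.1 : ℕ) - D.soc : ℤ) =
    ((Finsupp.weight D.w α.1 : ℕ) - D.soc : ℤ) + (Finsupp.weight D.w β.1 : ℕ) by ring] at h2

lemma gram_map_zero : (D.gram (X : Fin k → Aneg k)).map (aeval (0 : Fin k → ℂ)) = D.gram 0 := by
  ext α β
  rw [Matrix.map_apply, gram, gram, Matrix.of_apply, Matrix.of_apply]
  have h := D.red_map (X : Fin k → Aneg k) (aeval (0 : Fin k → ℂ))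
    (monomial α.1 1 * monomial β.1 1) (D.mB (Fin.rev 0))
  have h0 : (fun i => (aeval (0 : Fin k → ℂ) : Aneg k →ₐ[ℂ] ℂ) (X i)) = 0 := by
    ext i; simp
  rw [h0, map_mul, map_monomial, map_monomial, map_one] at h
  exact h.symm

/-- The inverse of the Gram matrix has homogeneous entries. -/
lemma exists_gram_inverse : ∃ Gi : Matrix D.B D.B (Aneg k), Gi * D.gram X = 1 ∧
    ∀ α β, (Gi α β).IsWeightedHomogeneous D.wt
      ((D.soc : ℤ) - (Finsupp.weight D.w α.1 : ℕ) - (Finsupp.weight D.w β.1 : ℕ)) := by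
  classical
  have h1 := det_isWeightedHomogeneous (fun α β => D.gram_isWeightedHomogeneous α β)
  have h2 : coeff 0 (D.gram (X : Fin k → Aneg k)).det ≠ 0 := by
    have h3 : aeval (0 : Fin k → ℂ) (D.gram (X : Fin k → Aneg k)).det ≠ 0 := by
      rw [AlgHom.map_det, AlgHom.mapMatrix_apply, gram_map_zero]
      exact D.det_gram_zero_ne_zero
    rwa [aeval_zero, Algebra.algebraMap_self, RingHom.id_apply, constantCoeff_eq] at h3
  -- The determinant is homogeneous and has a nonzero constant term, so its degree is 0 and it is a
  -- constant: invertibility at t = 0 implies invertibility over A_-.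
  have h3 := h1 h2
  rw [map_zero] at h3
  rw [← h3] at h1
  have h4 := D.eq_C_of_isWeightedHomogeneous_zero h1
  set u := coeff 0 (D.gram (X : Fin k → Aneg k)).det
  refine ⟨(C u⁻¹ : Aneg k) • (D.gram X).adjugate, ?_, ?_⟩
  · rw [Matrix.smul_mul, Matrix.adjugate_mul, h4, smul_smul, ← map_mul, inv_mul_cancel₀ h2, map_one,
      one_smul]
  · intro α β
    rw [Matrix.smul_apply, smul_eq_mul]
    have h5 := (isWeightedHomogeneous_C D.wt u⁻¹).mul
      (adjugate_isWeightedHomogeneous (fun α β => D.gram_isWeightedHomogeneous α β) α β)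
    rw [← h3] at h5
    convert h5 using 1
    ring

/-- Homogeneous polynomials which represent the coordinates on the Milnor algebra by the pairing. -/
lemma exists_dual_polys : ∃ P : Fin k → MvPolynomial (Fin n) (Aneg k),
    (∀ i, D.Bihom ((D.soc : ℤ) - (Finsupp.weight D.w (D.m i.rev) : ℕ)) (P i)) ∧
    ∀ i q, D.socForm X (P i * q) = (D.d : Aneg k) * D.red X q (D.mB i.rev) := by
  classical
  obtain ⟨Gi, hGi, hGi'⟩ := D.exists_gram_inverse
  -- The row of the inverse Gram matrix is the dual basis element. The factor `d` absorbs the one in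
  -- Euler's formula, so that the first vector field is the Euler field itself and not a multiple of
  -- it.
  refine ⟨fun i => ∑ β : D.B, monomial β.1 ((D.d : Aneg k) * Gi (D.mB i.rev) β), ?_, ?_⟩
  · intro i
    refine Bihom.sum _ fun β _ => bihom_monomial ?_
    rw [← nsmul_eq_mul, ← mem_weightedHomogeneousSubmodule]
    exact nsmul_mem ((mem_weightedHomogeneousSubmodule ..).2 (hGi' (D.mB i.rev) β)) _
  · intro i q
    have h1 : ∀ β : D.B, D.socForm X (monomial β.1 1 * q) =
        ∑ α : D.B, D.gram X β α * D.red X q α := by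
      intro β
      rw [mul_comm, socForm_mul]
      refine Finset.sum_congr rfl fun α _ => ?_
      rw [mul_comm, mul_comm (monomial α.1 (1 : Aneg k))]
      rfl
    have h2 : D.socForm X ((∑ β : D.B, monomial β.1 ((D.d : Aneg k) * Gi (D.mB i.rev) β)) * q) =
        ∑ β : D.B, ((D.d : Aneg k) * Gi (D.mB i.rev) β) * D.socForm X (monomial β.1 1 * q) := by
      rw [Finset.sum_mul, map_sum]
      refine Finset.sum_congr rfl fun β _ => ?_
      rw [← smul_eq_mul ((D.d : Aneg k) * _), ← map_smul, ← smul_mul_assoc, smul_monomial,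
        smul_eq_mul, mul_one]
    rw [h2]
    simp only [h1, mul_assoc, ← Finset.mul_sum]
    congr 1
    simp only [Finset.mul_sum]
    rw [Finset.sum_comm]
    simp only [← mul_assoc, ← Finset.sum_mul]
    have h3 : ∀ α, ∑ β, Gi (D.mB i.rev) β * D.gram X β α = if D.mB i.rev = α then 1 else 0 := by
      intro α
      have := congrFun (congrFun hGi (D.mB i.rev)) α
      rw [Matrix.mul_apply, Matrix.one_apply] at this
      exact this
    simp only [h3]
    simp

-- With `ℓ` the socle coefficient and `P` the dual elements, `d h_ij = ℓ(P_{rev j} P_i F)`, which is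
-- symmetric under the exchange of `i` and `rev j`. The same formula, with a general multiple `g` in
-- place of `P_i`, shows that the rows generate 𝓛.
set_option maxHeartbeats 1000000 in
theorem exists_isSymmetricSystem : ∃ N ν h, D.IsSymmetricSystem N ν h := by
  classical
  obtain ⟨P, hP, hP'⟩ := D.exists_dual_polys
  let h : Matrix (Fin k) (Fin k) (Aneg k) := Matrix.of fun i j => D.red X (P i * D.F) (D.mB j)
  have hd : (D.d : Aneg k) ≠ 0 := (D.isUnit_d (A := Aneg k)).ne_zero
  have hmem : ∀ i, P i * D.F - D.upperPoly (h.row i) ∈ D.K (X : Fin k → Aneg k) := fun i =>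
    D.mul_FA_sub_upperPoly_red_mem (X : Fin k → Aneg k) (P i)
  have hsymm : ∀ i j, h i j = h j.rev i.rev := by
    intro i j
    apply mul_left_cancel₀ hd
    have h1 := hP' j.rev (P i * D.F)
    have h2 := hP' i (P j.rev * D.F)
    rw [Fin.rev_rev] at h1
    change (D.d : Aneg k) * D.red X (P i * D.F) (D.mB j) =
      D.d * D.red X (P j.rev * D.F) (D.mB i.rev)
    rw [← h1, ← h2, mul_left_comm]
  have hK : (D.K (X : Fin k → Aneg k)).map (toConv n (Aneg k)) ≤ jacobianIdeal D.F := by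
    rw [F_eq_FA, jacobianIdeal_FA, K, Ideal.map_sup]
    exact sup_le le_rfl ((D.map_ordIdeal_le _).trans (Ideal.map_mono (D.XJ_le_JA _)))
  refine ⟨fun i => toConv n (Aneg k) (P i),
    fun i => (D.soc : ℤ) - (Finsupp.weight D.w (D.m i.rev) : ℕ), h, ?_, ?_, hsymm, ?_, ?_, ?_⟩
  · intro i α
    rw [coeff_toSeries_toConv]
    exact hP i α
  · intro i
    have h1 := hK (Ideal.mem_map_of_mem (toConv n (Aneg k)) (hmem i))
    rw [map_sub, map_mul, ← Ideal.Quotient.eq] at h1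
    rw [h1, upperPoly_apply, map_sum, map_sum]
    refine Finset.sum_congr rfl fun j _ => ?_
    have : monomial (D.m j) (h.row i j) = h i j • monomial (D.m j) (1 : Aneg k) := by
      rw [smul_monomial, smul_eq_mul, mul_one]
      rfl
    rw [this, map_smul]
    rfl
  · intro i j
    rw [rowVF, mkDerivation_X]
    have h1 := D.red_isWeightedHomogeneous ((hP i).mul D.bihom_F) (D.mB j)
    rw [wt, ← add_sub_assoc]
    exact h1
  · apply le_antisymm
    · rw [Submodule.span_le]
      rintro _ ⟨i, rfl⟩
      refine (D.mem_calL_iff _).2 ⟨P i, ?_⟩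
      have := neg_mem (hmem i)
      rw [neg_sub] at this
      simp only [rowVF, mkDerivation_X]
      exact this
    · intro δ hδ
      obtain ⟨g, hg⟩ := (D.mem_calL_iff _).1 hδ
      -- Expanding `P_{rev j} F = ∑ h_{rev j, i} m_i` in `ℓ(P_{rev j} g F)` and applying the
      -- symmetry of `h` leaves these coefficients.
      let u : Fin k → Aneg k := fun l =>
        C ((D.d : ℂ)⁻¹) * D.socForm X (monomial (D.m l.rev) 1 * g)
      have hu : (fun j => δ (X j)) = Matrix.vecMul u h := by
        ext1 j
        apply mul_left_cancel₀ hd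
        have h1 : δ (X j) = D.red X (g * D.F) (D.mB j) := by
          rw [← D.red_congr X hg, red_upperPoly]
        have h2 := hP' j.rev (g * D.F)
        rw [Fin.rev_rev] at h2
        rw [h1, ← h2]
        have h3 : D.socForm X (P j.rev * (g * D.F)) = D.socForm X (D.upperPoly (h.row j.rev) * g) := by
          apply D.socForm_congr
          have := Ideal.mul_mem_right g _ (hmem j.rev)
          rw [sub_mul] at this
          convert this using 1
          ring
        have h4 : D.socForm X (D.upperPoly (h.row j.rev) * g) =
            ∑ i, h j.rev i * D.socForm X (monomial (D.m i) 1 * g) := by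
          rw [upperPoly_apply, Finset.sum_mul, map_sum]
          refine Finset.sum_congr rfl fun i _ => ?_
          rw [← smul_eq_mul (h j.rev i), ← map_smul, ← smul_mul_assoc, smul_monomial, smul_eq_mul,
            mul_one]
          rfl
        have h5 : (D.d : Aneg k) * C ((D.d : ℂ)⁻¹) = 1 := by
          rw [← map_natCast (C : ℂ →+* Aneg k), ← map_mul, mul_inv_cancel₀, map_one]
          have := D.isUnit_d (A := ℂ)
          exact this.ne_zero
        rw [h3, h4]
        change _ = D.d * ∑ l, u l * h l j
        rw [Finset.mul_sum, ← Equiv.sum_comp Fin.revPerm]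
        refine Finset.sum_congr rfl fun l _ => ?_
        rw [Fin.revPerm_apply, hsymm j.rev, Fin.rev_rev, Fin.rev_rev]
        simp only [u]
        rw [← mul_assoc, ← mul_assoc, h5, one_mul, mul_comm]
      rw [derivation_eq_mk δ, hu, ← sum_smul_rowVF]
      exact Submodule.sum_mem _ fun l _ => Submodule.smul_mem _ _ (Submodule.subset_span ⟨l, rfl⟩)
  · refine derivation_ext fun j => ?_
    -- By symmetry the first row consists of socle coefficients of `P_{rev j} F`. These are `d`
    -- times the coordinates of F, hence are given by Euler's formula.
    rw [rowVF, mkDerivation_X, mkDerivation_X, hsymm]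
    have h1 := hP' j.rev D.F
    rw [Fin.rev_rev] at h1
    change D.socForm X (P j.rev * D.F) = _
    rw [h1, ← smul_eq_mul (D.d : Aneg k), ← Pi.smul_apply, ← map_smul]
    have h2 : (D.d : Aneg k) • D.F - D.upperPoly (fun j => (D.wt j : Aneg k) * X j) ∈
        D.K (X : Fin k → Aneg k) := by
      have h3 := D.euler_FA (X : Fin k → Aneg k)
      have h4 : (D.d : Aneg k) • D.F = (D.d : MvPolynomial (Fin n) (Aneg k)) * D.FA X := by
        rw [smul_eq_C_mul, map_natCast]; rfl
      rw [h4, h3, upperPoly_apply, add_sub_cancel_right]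
      refine Ideal.mem_sup_left (Ideal.sum_mem _ fun i _ => ?_)
      exact Ideal.mul_mem_left _ _ (Ideal.mul_mem_left _ _ (D.gA_mem _ i))
    rw [D.red_congr X h2, red_upperPoly]

end NeZero

end Setup

end SQH

namespace SQH

open MvPolynomial

/-! ### Truncation of polynomials with respect to integer weights -/

section Truncation

variable {k : ℕ} (v : Fin k → ℤ)

open Classical in
/-- The sum of the terms of weight at least `c`. -/
def trunc (c : ℤ) (p : MvPolynomial (Fin k) ℂ) : MvPolynomial (Fin k) ℂ :=
  ∑ β ∈ p.support, if c ≤ Finsupp.weight v β then monomial β (coeff β p) else 0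

variable {v}

lemma coeff_trunc (c : ℤ) (p : MvPolynomial (Fin k) ℂ) (β : Fin k →₀ ℕ) :
    coeff β (trunc v c p) = if c ≤ Finsupp.weight v β then coeff β p else 0 := by
  classical
  rw [trunc, coeff_sum]
  have h : ∀ γ ∈ p.support, coeff β (if c ≤ Finsupp.weight v γ then monomial γ (coeff γ p) else 0) =
      if γ = β then (if c ≤ Finsupp.weight v β then coeff β p else 0) else 0 := by
    intro γ _
    by_cases h1 : γ = β
    · subst h1
      rw [if_pos rfl]
      split_ifs <;> simp
    · rw [if_neg h1]
      split_ifs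
      · rw [coeff_monomial, if_neg h1]
      · rw [coeff_zero]
  rw [Finset.sum_congr rfl h, Finset.sum_ite_eq']
  split_ifs with h1 h2 h2
  · rfl
  · rfl
  · exact (notMem_support_iff.1 h1).symm
  · rfl

lemma trunc_sum {ι : Type} (s : Finset ι) (c : ℤ) (p : ι → MvPolynomial (Fin k) ℂ) :
    trunc v c (∑ i ∈ s, p i) = ∑ i ∈ s, trunc v c (p i) := by
  ext β
  rw [coeff_trunc, coeff_sum, coeff_sum]
  simp only [coeff_trunc]
  split_ifs <;> simp

lemma trunc_mul {c e c' : ℤ} (h : c + e = c') (p : MvPolynomial (Fin k) ℂ)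
    {q : MvPolynomial (Fin k) ℂ} (hq : q.IsWeightedHomogeneous v e) :
    trunc v c' (p * q) = trunc v c p * q := by
  classical
  ext β
  have e0 : (if c' ≤ Finsupp.weight v β then
        ∑ x ∈ Finset.HasAntidiagonal.antidiagonal β, coeff x.1 p * coeff x.2 q else 0) =
      ∑ x ∈ Finset.HasAntidiagonal.antidiagonal β,
        if c' ≤ Finsupp.weight v β then coeff x.1 p * coeff x.2 q else 0 := by
    split_ifs <;> simp
  rw [coeff_trunc, coeff_mul, coeff_mul, e0]
  refine Finset.sum_congr rfl fun x hx => ?_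
  rw [Finset.HasAntidiagonal.mem_antidiagonal] at hx
  have : Finsupp.weight v x.1 + Finsupp.weight v x.2 = Finsupp.weight v β := by
    rw [← hx, map_add]
  rw [coeff_trunc]
  by_cases h0 : coeff x.2 q = 0
  · simp [h0]
  · have := hq h0
    by_cases h1 : c' ≤ Finsupp.weight v β
    · rw [if_pos h1, if_pos (by omega)]
    · rw [if_neg h1, if_neg (by omega), zero_mul]

variable (v) in
/-- The polynomials all of whose monomials have weight at least `c`. -/
def weightGE (c : ℤ) : Submodule ℂ (MvPolynomial (Fin k) ℂ) where
  carrier := {p | ∀ β, coeff β p ≠ 0 → c ≤ Finsupp.weight v β}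
  zero_mem' := fun β h => absurd (coeff_zero β) h
  add_mem' := by
    intro p q hp hq β h
    by_cases h0 : coeff β p = 0
    · refine hq β fun h1 => h ?_
      rw [coeff_add, h0, h1, add_zero]
    · exact hp β h0
  smul_mem' := by
    intro c p hp β h
    refine hp β fun h0 => h ?_
    rw [coeff_smul, h0, smul_zero]

lemma trunc_eq_self {c : ℤ} {p : MvPolynomial (Fin k) ℂ} (hp : p ∈ weightGE v c) :
    trunc v c p = p := by
  ext β
  rw [coeff_trunc]
  split_ifs with h
  · rfl
  · by_contra h'
    exact h (hp β (Ne.symm h'))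

lemma mul_mem_weightGE {c c' : ℤ} {p q : MvPolynomial (Fin k) ℂ} (hp : p ∈ weightGE v c)
    (hq : q ∈ weightGE v c') : p * q ∈ weightGE v (c + c') := by
  classical
  intro β hβ
  rw [coeff_mul] at hβ
  obtain ⟨x, hx, hx'⟩ := Finset.exists_ne_zero_of_sum_ne_zero hβ
  rw [Finset.HasAntidiagonal.mem_antidiagonal] at hx
  rw [← hx, map_add]
  exact add_le_add (hp _ (left_ne_zero_of_mul hx')) (hq _ (right_ne_zero_of_mul hx'))

lemma weightGE_anti {c c' : ℤ} (h : c ≤ c') : weightGE v c' ≤ weightGE v c :=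
  fun _ hp β hβ => h.trans (hp β hβ)

lemma pderiv_mem_weightGE {c : ℤ} {p : MvPolynomial (Fin k) ℂ} (hp : p ∈ weightGE v c)
    (j : Fin k) : pderiv j p ∈ weightGE v (c - v j) := by
  intro β hβ
  rw [coeff_pderiv'] at hβ
  have := hp _ (left_ne_zero_of_mul hβ)
  rw [map_add, Finsupp.weight_single, one_smul] at this
  omega

lemma derivation_eq_sum (δ : Derivation ℂ (MvPolynomial (Fin k) ℂ) (MvPolynomial (Fin k) ℂ))
    (p : MvPolynomial (Fin k) ℂ) : δ p = ∑ j, pderiv j p * δ (X j) := by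
  classical
  have h : δ = ∑ j, δ (X j) • pderiv j := by
    refine derivation_ext fun i => ?_
    rw [← Derivation.coeFnAddMonoidHom_apply (∑ j, _), map_sum, Finset.sum_apply,
      Finset.sum_eq_single i]
    · rw [Derivation.coeFnAddMonoidHom_apply, Derivation.smul_apply, pderiv_X_self, smul_eq_mul,
        mul_one]
    · intro j _ hj
      rw [Derivation.coeFnAddMonoidHom_apply, Derivation.smul_apply, pderiv_X_of_ne hj.symm,
        smul_zero]
    · intro h; exact absurd (Finset.mem_univ _) h
  conv_lhs => rw [h]
  rw [← Derivation.coeFnAddMonoidHom_apply (∑ j, _), map_sum, Finset.sum_apply]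
  refine Finset.sum_congr rfl fun j _ => ?_
  rw [Derivation.coeFnAddMonoidHom_apply, Derivation.smul_apply, smul_eq_mul, mul_comm]

lemma derivation_mem_weightGE {c e : ℤ}
    {δ : Derivation ℂ (MvPolynomial (Fin k) ℂ) (MvPolynomial (Fin k) ℂ)}
    (hδ : ∀ j, δ (X j) ∈ weightGE v (e + v j)) {p : MvPolynomial (Fin k) ℂ}
    (hp : p ∈ weightGE v c) : δ p ∈ weightGE v (c + e) := by
  rw [derivation_eq_sum]
  refine Submodule.sum_mem _ fun j _ => ?_
  have := mul_mem_weightGE (pderiv_mem_weightGE hp j) (hδ j)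
  rwa [show c - v j + (e + v j) = c + e by ring] at this

lemma IsWeightedHomogeneous.mem_weightGE {c e : ℤ} {p : MvPolynomial (Fin k) ℂ}
    (hp : p.IsWeightedHomogeneous v e) (h : c ≤ e) : p ∈ weightGE v c := fun β hβ => by
  rw [hp hβ]; exact h

/-- All variables have weight at most -1, so a lower bound `c` for the weight bounds every exponent
by `-c`. -/
lemma finite_weightGE (hv : ∀ j, v j < 0) (c : ℤ) : Module.Finite ℂ (weightGE v c) := by
  classical
  let b : Fin k →₀ ℕ := Finsupp.equivFunOnFinite.symm fun _ => (-c).toNat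
  have hb : ∀ β : Fin k →₀ ℕ, c ≤ Finsupp.weight v β → β ∈ Set.Icc 0 b := by
    intro β hβ
    refine ⟨zero_le, fun j => ?_⟩
    have h1 : Finsupp.weight v β ≤ β j • v j := by
      rw [Finsupp.weight_apply, Finsupp.sum_fintype _ _ (by simp), ← Finset.add_sum_erase _ _
        (Finset.mem_univ j)]
      have : ∑ i ∈ Finset.univ.erase j, β i • v i ≤ 0 := by
        refine Finset.sum_nonpos fun i _ => ?_
        rw [nsmul_eq_mul]
        exact mul_nonpos_of_nonneg_of_nonpos (by positivity) (hv i).le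
      omega
    have h2 : β j • v j ≤ - (β j : ℤ) := by
      rw [nsmul_eq_mul]
      nlinarith [hv j, Int.natCast_nonneg (β j)]
    change β j ≤ (-c).toNat
    omega
  let f : weightGE v c →ₗ[ℂ] (Set.Icc 0 b → ℂ) :=
    LinearMap.pi fun β => (lcoeff ℂ β.1) ∘ₗ (weightGE v c).subtype
  have : Finite (Set.Icc 0 b) := (Set.finite_Icc 0 b).to_subtype
  refine Module.Finite.of_injective f ?_
  rw [← LinearMap.ker_eq_bot, LinearMap.ker_eq_bot']
  rintro ⟨p, hp⟩ h
  apply Subtype.ext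
  change p = 0
  ext β
  rw [coeff_zero]
  by_contra h0
  exact h0 (congrFun h ⟨β, hb β (hp β h0)⟩)

end Truncation

namespace Setup

variable {n k : ℕ} (D : Setup n k)

/-! ### The Lie algebra `𝓛` -/

section Bracket

/-- The extension of a derivation of the coefficients. -/
def coeffDer (δ : Derivation ℂ (Aneg k) (Aneg k)) :
    MvPolynomial (Fin n) (Aneg k) →+ MvPolynomial (Fin n) (Aneg k) :=
  coeffwise (δ : Aneg k →ₗ[ℂ] Aneg k).toAddMonoidHom

variable (δ ε : Derivation ℂ (Aneg k) (Aneg k))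

lemma coeff_coeffDer (p : MvPolynomial (Fin n) (Aneg k)) (β : Fin n →₀ ℕ) :
    coeff β (coeffDer δ p) = δ (coeff β p) := coeff_coeffwise _ _ _

lemma coeffDer_mul (p q : MvPolynomial (Fin n) (Aneg k)) :
    coeffDer δ (p * q) = coeffDer δ p * q + p * coeffDer δ q := by
  classical
  ext1 β
  rw [coeff_coeffDer, coeff_add, coeff_mul, coeff_mul, coeff_mul, map_sum,
    ← Finset.sum_add_distrib]
  refine Finset.sum_congr rfl fun x _ => ?_
  rw [coeff_coeffDer, coeff_coeffDer, Derivation.leibniz, smul_eq_mul, smul_eq_mul]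
  ring

lemma coeffDer_pderiv (i : Fin n) (p : MvPolynomial (Fin n) (Aneg k)) :
    coeffDer δ (pderiv i p) = pderiv i (coeffDer δ p) := by
  ext1 β
  rw [coeff_coeffDer, coeff_pderiv', coeff_pderiv', coeff_coeffDer, Derivation.leibniz,
    Derivation.map_natCast, smul_zero, zero_add, smul_eq_mul, mul_comm]

lemma coeffDer_mem_ordIdeal {w : Fin n → ℕ} {N : ℕ} {p : MvPolynomial (Fin n) (Aneg k)}
    (hp : p ∈ ordIdeal (Aneg k) w N) : coeffDer δ p ∈ ordIdeal (Aneg k) w N := fun β hβ => by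
  rw [coeff_coeffDer, hp β hβ, map_zero]

lemma coeffDer_upperPoly (v : Fin k → Aneg k) :
    coeffDer δ (D.upperPoly v) = D.upperPoly fun j => δ (v j) := by
  rw [upperPoly_apply, upperPoly_apply, map_sum]
  exact Finset.sum_congr rfl fun j _ => coeffwise_monomial _ _ _

lemma coeffDer_F : coeffDer δ D.F = D.upperPoly fun j => δ (X j) := by
  have h1 : coeffDer δ (map C D.f₀ : MvPolynomial (Fin n) (Aneg k)) = 0 := by
    ext1 β
    rw [coeff_coeffDer, coeff_map, derivation_C, coeff_zero]
  rw [F, map_add, h1, zero_add, ← D.coeffDer_upperPoly, upperPoly_apply]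

lemma pderiv_pderiv_comm {R : Type} [CommRing R] (i j : Fin n) (p : MvPolynomial (Fin n) R) :
    pderiv i (pderiv j p) = pderiv j (pderiv i p) := by
  classical
  ext1 β
  simp only [coeff_pderiv']
  by_cases h : i = j
  · rw [h]
  · simp only [Finsupp.add_apply, Finsupp.single_apply, if_neg h, if_neg (Ne.symm h), add_zero]
    rw [add_right_comm]
    ring

variable [NeZero k]

/-- The Tjurina ideal of the family in the polynomial ring, modulo terms of high order. -/
def tjurinaPoly : Ideal (MvPolynomial (Fin n) (Aneg k)) := Ideal.span {D.F} ⊔ D.K X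

variable {D} in
lemma mem_calL_iff_mem (δ : Derivation ℂ (Aneg k) (Aneg k)) :
    δ ∈ D.calL ↔ (D.upperPoly fun j => δ (X j)) ∈ D.tjurinaPoly := by
  rw [mem_calL_iff, tjurinaPoly]
  constructor
  · rintro ⟨g, hg⟩
    have : (D.upperPoly fun j => δ (X j)) = g * D.F + ((D.upperPoly fun j => δ (X j)) - g * D.F) := by
      ring
    rw [this]
    exact Submodule.add_mem_sup (Ideal.mul_mem_left _ _ (Ideal.mem_span_singleton_self _)) hg
  · intro h
    obtain ⟨a, ha, b, hb, hab⟩ := Submodule.mem_sup.1 h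
    obtain ⟨g, rfl⟩ := Ideal.mem_span_singleton'.1 ha
    exact ⟨g, by rwa [← hab, add_sub_cancel_left]⟩

lemma exists_eq_of_mem_calL {δ : Derivation ℂ (Aneg k) (Aneg k)} (hδ : δ ∈ D.calL) (N : ℕ) :
    ∃ (g : MvPolynomial (Fin n) (Aneg k)) (a : Fin n → MvPolynomial (Fin n) (Aneg k))
      (o : MvPolynomial (Fin n) (Aneg k)), (D.upperPoly fun j => δ (X j)) = g * D.F + ∑ i, a i * pderiv i D.F + o ∧
      o ∈ ordIdeal (Aneg k) D.w N := by
  obtain ⟨g, hg⟩ := (D.mem_calL_iff δ).1 hδ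
  obtain ⟨q, hq, o, ho, hqo⟩ := Submodule.mem_sup.1 (D.K_le X N hg)
  obtain ⟨a, ha⟩ := (D.mem_JA_iff X).1 hq
  refine ⟨g, a, o, ?_, ho⟩
  have : (D.upperPoly fun j => δ (X j)) = g * D.F + (q + o) := by rw [hqo]; ring
  rw [this, ← ha, add_assoc]
  rfl

lemma F_mul_mem (g : MvPolynomial (Fin n) (Aneg k)) : g * D.F ∈ D.tjurinaPoly :=
  Ideal.mem_sup_left (Ideal.mul_mem_left _ _ (Ideal.mem_span_singleton_self _))

lemma mul_pderiv_F_mem (g : MvPolynomial (Fin n) (Aneg k)) (i : Fin n) :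
    g * pderiv i D.F ∈ D.tjurinaPoly :=
  Ideal.mem_sup_right (Ideal.mem_sup_left (Ideal.mul_mem_left _ _ (D.gA_mem X i)))

/-- Applying δ to `ε F = g' F + ∑ b_i ∂_i F` and inserting `∂_i (δ F) ≡ ∑ a_j ∂_i ∂_j F` expresses
`δ(ε F)`, modulo the Tjurina ideal, by second derivatives in `x`, symmetrically in δ and ε. The
order `soc + 1 + d` of the remainders leaves room for the loss of `w_i < d` by one differentiation.
-/
lemma coeffDer_sub_mem {δ ε : Derivation ℂ (Aneg k) (Aneg k)}
    {g g' o o' : MvPolynomial (Fin n) (Aneg k)} {a b : Fin n → MvPolynomial (Fin n) (Aneg k)}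
    (hδ : δ ∈ D.calL)
    (h : (D.upperPoly fun j => δ (X j)) = g * D.F + ∑ i, a i * pderiv i D.F + o)
    (h' : (D.upperPoly fun j => ε (X j)) = g' * D.F + ∑ i, b i * pderiv i D.F + o')
    (ho : o ∈ ordIdeal (Aneg k) D.w (D.soc + 1 + D.d))
    (ho' : o' ∈ ordIdeal (Aneg k) D.w (D.soc + 1 + D.d)) :
    coeffDer δ (D.upperPoly fun j => ε (X j)) -
      ∑ i, ∑ j, b i * a j * pderiv i (pderiv j D.F) ∈ D.tjurinaPoly := by
  have hord : ∀ q, q ∈ ordIdeal (Aneg k) D.w (D.soc + 1) → q ∈ D.tjurinaPoly := fun q hq =>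
    Ideal.mem_sup_right (Ideal.mem_sup_right hq)
  have h1 : ∀ i, pderiv i (D.upperPoly fun j => δ (X j)) -
      ∑ j, a j * pderiv i (pderiv j D.F) ∈ D.tjurinaPoly := by
    intro i
    have e : pderiv i (D.upperPoly fun j => δ (X j)) - ∑ j, a j * pderiv i (pderiv j D.F) =
        pderiv i g * D.F + g * pderiv i D.F + ∑ j, pderiv i (a j) * pderiv j D.F + pderiv i o := by
      rw [h, map_add, map_add, pderiv_mul, map_sum]
      simp only [pderiv_mul, Finset.sum_add_distrib]
      ring
    rw [e]
    refine Ideal.add_mem _ (Ideal.add_mem _ (Ideal.add_mem _ (D.F_mul_mem _)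
      (D.mul_pderiv_F_mem _ _)) (Ideal.sum_mem _ fun j _ => D.mul_pderiv_F_mem _ _)) (hord _ ?_)
    refine pderiv_mem_ordIdeal ho i ?_
    have := D.w_lt_d i
    omega
  have h2 : coeffDer δ (D.upperPoly fun j => ε (X j)) -
      ∑ i, ∑ j, b i * a j * pderiv i (pderiv j D.F) =
      coeffDer δ g' * D.F + g' * (D.upperPoly fun j => δ (X j)) +
        ∑ i, coeffDer δ (b i) * pderiv i D.F +
        ∑ i, b i * (pderiv i (D.upperPoly fun j => δ (X j)) - ∑ j, a j * pderiv i (pderiv j D.F)) +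
        coeffDer δ o' := by
    rw [h', map_add, map_add, coeffDer_mul, map_sum, coeffDer_F]
    simp only [coeffDer_mul, coeffDer_pderiv, coeffDer_F, Finset.sum_add_distrib, mul_sub,
      Finset.sum_sub_distrib, Finset.mul_sum, mul_assoc]
    ring
  rw [h2]
  refine Ideal.add_mem _ (Ideal.add_mem _ (Ideal.add_mem _ (Ideal.add_mem _ (D.F_mul_mem _)
    (Ideal.mul_mem_left _ _ ((mem_calL_iff_mem δ).1 hδ)))
    (Ideal.sum_mem _ fun j _ => D.mul_pderiv_F_mem _ _))
    (Ideal.sum_mem _ fun i _ => Ideal.mul_mem_left _ _ (h1 i)))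
    (hord _ (coeffDer_mem_ordIdeal δ (ordIdeal_anti (by omega) ho')))

/-- The second derivatives cancel in `δ(ε F) - ε(δ F)`. The result is needed because `Z_i(L_+)` is
defined as a generated Lie algebra and has to stay inside 𝓛. -/
theorem lie_mem_calL {δ ε : Derivation ℂ (Aneg k) (Aneg k)} (hδ : δ ∈ D.calL) (hε : ε ∈ D.calL) :
    ⁅δ, ε⁆ ∈ D.calL := by
  obtain ⟨g, a, o, h, ho⟩ := D.exists_eq_of_mem_calL hδ (D.soc + 1 + D.d)
  obtain ⟨g', b, o', h', ho'⟩ := D.exists_eq_of_mem_calL hε (D.soc + 1 + D.d)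
  have h1 := D.coeffDer_sub_mem hδ h h' ho ho'
  have h2 := D.coeffDer_sub_mem hε h' h ho' ho
  have h3 : ∑ i, ∑ j, a i * b j * pderiv i (pderiv j D.F) =
      ∑ i, ∑ j, b i * a j * pderiv i (pderiv j D.F) := by
    rw [Finset.sum_comm]
    refine Finset.sum_congr rfl fun i _ => Finset.sum_congr rfl fun j _ => ?_
    rw [pderiv_pderiv_comm]
    ring
  rw [h3] at h2
  have h4 := Ideal.sub_mem _ h1 h2
  rw [sub_sub_sub_cancel_right, coeffDer_upperPoly, coeffDer_upperPoly, ← map_sub] at h4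
  rw [mem_calL_iff_mem]
  convert h4 using 2
  ext1 j
  rw [Derivation.commutator_apply]
  rfl

end Bracket

/-! ### The filtration of 𝓛 by degree -/

section Graded

variable [NeZero k]

/-- The vector fields in `𝓛` of degree at least `c`. -/
def calLGE (c : ℤ) : Submodule ℂ (Derivation ℂ (Aneg k) (Aneg k)) where
  carrier := {δ | δ ∈ D.calL ∧ ∀ j, δ (X j) ∈ weightGE D.wt (c + D.wt j)}
  zero_mem' := ⟨D.calL.zero_mem, fun j => by rw [Derivation.zero_apply]; exact Submodule.zero_mem _⟩
  add_mem' := by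
    rintro δ ε ⟨h₁, h₂⟩ ⟨h₃, h₄⟩
    exact ⟨D.calL.add_mem h₁ h₃, fun j => Submodule.add_mem _ (h₂ j) (h₄ j)⟩
  smul_mem' := by
    rintro c δ ⟨h₁, h₂⟩
    refine ⟨?_, fun j => Submodule.smul_mem _ c (h₂ j)⟩
    have h := D.calL.smul_mem (C c) h₁
    have e : (C c : Aneg k) • δ = c • δ := by
      refine derivation_ext fun j => ?_
      rw [Derivation.smul_apply, Derivation.smul_apply, MvPolynomial.smul_eq_C_mul, smul_eq_mul]
    rwa [e] at h

lemma Lplus_eq : D.Lplus = D.calLGE D.wmin := rfl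

/-- The vector fields in `𝓛` of degree at least `c` form a Lie algebra, if `0 ≤ c`. -/
def calLGELie (c : ℤ) (hc : 0 ≤ c) : LieSubalgebra ℂ (Derivation ℂ (Aneg k) (Aneg k)) where
  __ := D.calLGE c
  lie_mem' := by
    rintro δ ε ⟨h₁, h₂⟩ ⟨h₃, h₄⟩
    refine ⟨D.lie_mem_calL h₁ h₃, fun j => ?_⟩
    rw [Derivation.commutator_apply]
    refine Submodule.sub_mem _ (weightGE_anti ?_ (derivation_mem_weightGE h₂ (h₄ j)))
      (weightGE_anti ?_ (derivation_mem_weightGE h₄ (h₂ j)))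
    all_goals omega

/-- A vector field is determined by its values on the coordinates, which lie in finite-dimensional
spaces because the weights are negative and bounded below. -/
instance finite_calLGE (c : ℤ) : Module.Finite ℂ (D.calLGE c) := by
  have : ∀ j, Module.Finite ℂ (weightGE D.wt (c + D.wt j)) := fun j => finite_weightGE D.wt_neg _
  let f : D.calLGE c →ₗ[ℂ] ((j : Fin k) → weightGE D.wt (c + D.wt j)) :=
    LinearMap.pi fun j =>
      { toFun := fun δ => ⟨δ.1 (X j), δ.2.2 j⟩
        map_add' := fun _ _ => rfl
        map_smul' := fun _ _ => rfl }
  refine Module.Finite.of_injective f ?_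
  intro δ ε h
  apply Subtype.ext
  refine derivation_ext fun j => ?_
  exact congrArg Subtype.val (congrFun h j)

end Graded

end Setup

end SQH

namespace SQH

open MvPolynomial

/-! ### Coordinate projections -/

section Projection

variable {k : ℕ} (A : Type) [CommRing A]

open Classical in
/-- The projection onto the coordinates in `Q`. -/
def coordProj (Q : Fin k → Prop) : Matrix (Fin k) (Fin k) A :=
  Matrix.diagonal fun j => if Q j then 1 else 0

variable {A}

open Classical in
lemma mul_coordProj_apply {ι : Type} (E : Matrix ι (Fin k) A) (Q : Fin k → Prop) (i : ι)
    (j : Fin k) : (E * coordProj A Q) i j = if Q j then E i j else 0 := by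
  rw [coordProj, Matrix.mul_diagonal]
  split_ifs <;> simp

open Classical in
lemma coordProj_mul_apply {ι : Type} (E : Matrix (Fin k) ι A) (P : Fin k → Prop) (i : Fin k)
    (j : ι) : (coordProj A P * E) i j = if P i then E i j else 0 := by
  rw [coordProj, Matrix.diagonal_mul]
  split_ifs <;> simp

open Classical in
lemma map_coordProj {A' : Type} [CommRing A'] (φ : A →+* A') (Q : Fin k → Prop) :
    (coordProj A Q).map φ = coordProj A' Q := by
  rw [coordProj, coordProj, Matrix.diagonal_map (map_zero φ)]
  refine congrArg Matrix.diagonal (funext fun j => ?_)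
  split_ifs <;> simp

end Projection

/-! ### The modules `Hom_ℂ(W, A_-) / A_- d(S)` -/

section HomMod

variable {k : ℕ} (W : Submodule ℂ (Derivation ℂ (Aneg k) (Aneg k))) [Module.Finite ℂ W]

instance free_vectorFields (W : Submodule ℂ (Derivation ℂ (Aneg k) (Aneg k))) : Module.Free ℂ W :=
  Module.Free.of_divisionRing ℂ W

/-- The coefficients of the vector fields of a basis of `W`. -/
def vfMatrix : Matrix (Fin (Module.finrank ℂ W)) (Fin k) (Aneg k) :=
  Matrix.of fun i j => (Module.finBasis ℂ W i).1 (X j)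

lemma diff_eq_sum (a : Aneg k) : diff W a = ∑ j, pderiv j a • diff W (X j) := by
  ext1 δ
  change δ.1 a = (∑ j, pderiv j a • diff W (X j)) δ
  rw [LinearMap.sum_apply, derivation_eq_sum δ.1 a]
  rfl

/-- By the chain rule `da = ∑ ∂_j a · dt_j`, so a module of differentials is generated by coordinate
differentials as soon as `S` contains these coordinates and depends on no others. -/
lemma span_diff_eq {S : Set (Aneg k)} {Q : Fin k → Prop} (h₁ : ∀ j, Q j → X j ∈ S)
    (h₂ : ∀ a ∈ S, ∀ j, ¬ Q j → pderiv j a = 0) :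
    Submodule.span (Aneg k) (diff W '' S) =
      Submodule.span (Aneg k) {f | ∃ j, Q j ∧ f = diff W (X j)} := by
  apply le_antisymm
  · rw [Submodule.span_le]
    rintro _ ⟨a, ha, rfl⟩
    rw [diff_eq_sum]
    refine Submodule.sum_mem _ fun j _ => ?_
    by_cases hj : Q j
    · exact Submodule.smul_mem _ _ (Submodule.subset_span ⟨j, hj, rfl⟩)
    · rw [h₂ a ha j hj, zero_smul]; exact Submodule.zero_mem _
  · refine Submodule.span_mono ?_
    rintro _ ⟨j, hj, rfl⟩
    exact ⟨X j, h₁ j hj, rfl⟩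

/-- The generators of the module `Hom_ℂ(W, A_-) / A_- d(S)` given by a basis of `W`. -/
def homModGen (S : Set (Aneg k)) :
    (Fin (Module.finrank ℂ W) → Aneg k) →ₗ[Aneg k] homMod W S :=
  (Submodule.span (Aneg k) (diff W '' S)).mkQ ∘ₗ
    ((Module.finBasis ℂ W).constr (Aneg k)).toLinearMap

/-- A basis of the finite-dimensional space `W` makes `Hom_ℂ(W, A_-)` free, and the relation `dt_j`
becomes the `j`-th column of the coefficient matrix of this basis. -/
lemma isRowCokernel_homModGen {S : Set (Aneg k)} {Q : Fin k → Prop} (h₁ : ∀ j, Q j → X j ∈ S)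
    (h₂ : ∀ a ∈ S, ∀ j, ¬ Q j → pderiv j a = 0) :
    IsRowCokernel (vfMatrix W * coordProj (Aneg k) Q).transpose (homModGen W S) := by
  classical
  constructor
  · exact (Submodule.mkQ_surjective _).comp (LinearEquiv.surjective _)
  · have h0 : LinearMap.ker (homModGen W S) = (Submodule.span (Aneg k) (diff W '' S)).comap
        ((Module.finBasis ℂ W).constr (Aneg k)).toLinearMap := by
      ext c
      rw [LinearMap.mem_ker, Submodule.mem_comap]
      exact Submodule.Quotient.mk_eq_zero _
    have h3 : ∀ j, ((Module.finBasis ℂ W).constr (Aneg k)) ((vfMatrix W).transpose.row j) =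
        diff W (X j) := by
      intro j
      refine (Module.finBasis ℂ W).ext fun i => ?_
      rw [Module.Basis.constr_basis]
      rfl
    have h4 : ∀ j, (vfMatrix W * coordProj (Aneg k) Q).transpose.row j =
        if Q j then (vfMatrix W).transpose.row j else 0 := by
      intro j
      ext1 i
      change (vfMatrix W * coordProj (Aneg k) Q) i j = _
      rw [mul_coordProj_apply]
      split_ifs <;> rfl
    rw [h0, span_diff_eq W h₁ h₂]
    apply le_antisymm
    · intro c hc
      rw [Submodule.mem_comap] at hc
      have h5 : Submodule.span (Aneg k) {f | ∃ j, Q j ∧ f = diff W (X j)} ≤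
          (Submodule.span (Aneg k) (Set.range
            (vfMatrix W * coordProj (Aneg k) Q).transpose.row)).comap
            ((Module.finBasis ℂ W).constr (Aneg k)).symm.toLinearMap := by
        rw [Submodule.span_le]
        rintro _ ⟨j, hj, rfl⟩
        rw [← h3]
        change ((Module.finBasis ℂ W).constr (Aneg k)).symm
          (((Module.finBasis ℂ W).constr (Aneg k)) ((vfMatrix W).transpose.row j)) ∈
          Submodule.span (Aneg k) (Set.range (vfMatrix W * coordProj (Aneg k) Q).transpose.row)
        rw [LinearEquiv.symm_apply_apply]
        refine Submodule.subset_span ⟨j, ?_⟩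
        rw [h4, if_pos hj]
      have h6 := h5 hc
      rw [Submodule.mem_comap] at h6
      change ((Module.finBasis ℂ W).constr (Aneg k)).symm (((Module.finBasis ℂ W).constr (Aneg k)) c)
        ∈ _ at h6
      rwa [LinearEquiv.symm_apply_apply] at h6
    · rw [Submodule.span_le]
      rintro _ ⟨j, rfl⟩
      rw [h4]
      split_ifs with hj
      · rw [SetLike.mem_coe, Submodule.mem_comap]
        change ((Module.finBasis ℂ W).constr (Aneg k)) ((vfMatrix W).transpose.row j) ∈ _
        rw [h3]
        exact Submodule.subset_span ⟨j, hj, rfl⟩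
      · exact Submodule.zero_mem _

/-- The vector fields in `W` generate the same module as the rows of `h` in `P`. -/
structure RowsGenerate (h : Matrix (Fin k) (Fin k) (Aneg k)) (P : Fin k → Prop) : Prop where
  row_mem : ∀ l, P l → Setup.rowVF h l ∈ W
  exists_vecMul : ∀ δ ∈ W, ∃ u : Fin k → Aneg k, (∀ l, ¬ P l → u l = 0) ∧
    (fun j => δ (X j)) = Matrix.vecMul u h

variable {W}

/-- A ℂ-basis of `W` and the rows in `P` span the same A_- module. Their numbers differ in general,
hence two factorizations instead of an invertible matrix. -/
lemma RowsGenerate.exists_mul {h : Matrix (Fin k) (Fin k) (Aneg k)} {P : Fin k → Prop}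
    (hW : RowsGenerate W h P) :
    (∃ C : Matrix (Fin (Module.finrank ℂ W)) (Fin k) (Aneg k), vfMatrix W = C * (coordProj (Aneg k) P * h)) ∧
      ∃ C' : Matrix (Fin k) (Fin (Module.finrank ℂ W)) (Aneg k), coordProj (Aneg k) P * h = C' * vfMatrix W := by
  classical
  constructor
  · choose u hu hu' using fun i => hW.exists_vecMul _ (Module.finBasis ℂ W i).2
    refine ⟨Matrix.of u, ?_⟩
    ext1 i j
    have h1 := congrFun (hu' i) j
    rw [Matrix.mul_apply]
    change (Module.finBasis ℂ W i).1 (X j) = _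
    rw [h1]
    change ∑ l, u i l * h l j = _
    refine Finset.sum_congr rfl fun l _ => ?_
    rw [coordProj_mul_apply, Matrix.of_apply]
    split_ifs with hl
    · rfl
    · rw [hu i l hl, zero_mul, mul_zero]
  · refine ⟨Matrix.of fun l i => if hl : P l then
      C ((Module.finBasis ℂ W).repr ⟨_, hW.row_mem l hl⟩ i) else 0, ?_⟩
    ext1 l j
    rw [coordProj_mul_apply, Matrix.mul_apply]
    simp only [Matrix.of_apply]
    split_ifs with hl
    · have h1 := (Module.finBasis ℂ W).sum_repr ⟨_, hW.row_mem l hl⟩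
      have h2 := congrArg (fun δ : W => diff W (X j) δ) h1
      rw [map_sum] at h2
      simp only [map_smul] at h2
      have h3 : h l j = diff W (X j) ⟨_, hW.row_mem l hl⟩ := by
        change h l j = (Setup.rowVF h l) (X j)
        rw [Setup.rowVF, mkDerivation_X]
      rw [h3, ← h2]
      refine Finset.sum_congr rfl fun i _ => ?_
      rw [smul_eq_C_mul]
      rfl
    · simp

/-- The flattening condition for `Hom_ℂ(W, A_-) / A_- d(S)`. -/
theorem RowsGenerate.flat_rank_iff {h : Matrix (Fin k) (Fin k) (Aneg k)} {P : Fin k → Prop}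
    (hW : RowsGenerate W h P) {S : Set (Aneg k)} {Q : Fin k → Prop} (h₁ : ∀ j, Q j → X j ∈ S)
    (h₂ : ∀ a ∈ S, ∀ j, ¬ Q j → pderiv j a = 0) (B : Type) [CommRing B] [Algebra (Aneg k) B] {r : ℕ}
    (hr : r ≤ Module.finrank ℂ W) :
    (Module.Flat B (B ⊗[Aneg k] homMod W S) ∧ ∀ p : PrimeSpectrum B,
      Module.rankAtStalk (R := B) (B ⊗[Aneg k] homMod W S) p = Module.finrank ℂ W - r) ↔
    ConstRank (coordProj B P * h.map (algebraMap (Aneg k) B) * coordProj B Q) r := by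
  have h0 := (isRowCokernel_homModGen W h₁ h₂).flat_rank_iff B (r := r) (by simpa using hr)
  rw [Fintype.card_fin] at h0
  rw [h0, Matrix.transpose_map, constRank_transpose_iff]
  obtain ⟨⟨C, hC⟩, ⟨C', hC'⟩⟩ := hW.exists_mul
  have e : coordProj B P * h.map (algebraMap (Aneg k) B) * coordProj B Q =
      ((coordProj (Aneg k) P * h) * coordProj (Aneg k) Q).map (algebraMap (Aneg k) B) := by
    rw [Matrix.map_mul, Matrix.map_mul, map_coordProj, map_coordProj]
  rw [e]
  refine constRank_iff_of_rows (C := C.map (algebraMap (Aneg k) B))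
    (C' := C'.map (algebraMap (Aneg k) B)) ?_ ?_
  · rw [← Matrix.map_mul, ← Matrix.mul_assoc, ← hC]
  · rw [← Matrix.map_mul, ← Matrix.mul_assoc, ← hC']

/-- The rank of a specialization of the rows of `h` is at most the dimension of `W`. -/
lemma RowsGenerate.rank_le {h : Matrix (Fin k) (Fin k) (Aneg k)} {P : Fin k → Prop}
    (hW : RowsGenerate W h P) {L : Type} [Field L] (φ : Aneg k →+* L) (Q : Fin k → Prop) :
    (coordProj L P * h.map φ * coordProj L Q).rank ≤ Module.finrank ℂ W := by
  obtain ⟨_, ⟨C', hC'⟩⟩ := hW.exists_mul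
  have e : coordProj L P * h.map φ * coordProj L Q =
      C'.map φ * ((vfMatrix W).map φ * coordProj L Q) := by
    rw [← Matrix.mul_assoc, ← Matrix.map_mul, ← hC', Matrix.map_mul, map_coordProj]
  rw [e]
  refine (Matrix.rank_mul_le_right _ _).trans ((Matrix.rank_le_card_height _).trans ?_)
  simp

end HomMod

/-! ### Rows of `h` generating `L_+` and `Z_i(L_+)` -/

namespace Setup

variable {n k : ℕ} (D : Setup n k)

/-- A monomial containing `t_j` has degree at most `deg t_j`, since the other variables have
negative degree as well. -/
lemma pderiv_eq_zero_of_mem_Fil {i : ℤ} {a : Aneg k} (ha : a ∈ D.Fil i) (j : Fin k)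
    (hj : ¬ -(i + 1) * (D.wmin : ℤ) < D.wt j) : pderiv j a = 0 := by
  induction ha using Submodule.span_induction with
  | mem p hp =>
    obtain ⟨e, he, hp⟩ := hp
    ext β
    rw [coeff_zero]
    by_contra h0
    rw [coeff_pderiv'] at h0
    have h1 := hp (left_ne_zero_of_mul h0)
    rw [map_add, Finsupp.weight_single, one_smul] at h1
    have := D.weight_wt_nonpos β
    omega
  | zero => rw [map_zero]
  | add p q _ _ hp hq => rw [map_add, hp, hq, add_zero]
  | smul c p _ hp => rw [Derivation.map_smul, hp, smul_zero]

lemma X_mem_Fil_iff {i : ℤ} {j : Fin k} :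
    (X j : Aneg k) ∈ D.Fil i ↔ -(i + 1) * (D.wmin : ℤ) < D.wt j := by
  constructor
  · intro h
    by_contra hj
    have := D.pderiv_eq_zero_of_mem_Fil h j hj
    rw [pderiv_X_self] at this
    exact one_ne_zero this
  · intro h
    exact Submodule.subset_span ⟨_, h, isWeightedHomogeneous_X ℂ D.wt j⟩

section NeZero

variable [NeZero k]

lemma wt_last : D.wt (Fin.rev 0) = (D.d : ℤ) - D.soc := by
  rw [wt, weight_m_last]

lemma wt_last_add_le {j : Fin k} (hj : j ≠ Fin.rev 0) : D.wt (Fin.rev 0) + D.wmin ≤ D.wt j := by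
  have := D.weight_m_add_wmin_le hj
  rw [wt_last, wt]
  omega

lemma s_mul_le : (D.s : ℤ) * D.wmin ≤ - D.wt (Fin.rev 0) := by
  rw [s_eq, wt_last, neg_sub]
  exact Int.ediv_mul_le _ (by have := D.wmin_pos; omega)

lemma lt_s_succ_mul : - D.wt (Fin.rev 0) < ((D.s : ℤ) + 1) * D.wmin := by
  rw [s_eq, wt_last, neg_sub]
  exact Int.lt_ediv_add_one_mul_self _ (by have := D.wmin_pos; omega)

lemma lt_wt_of_ne {j : Fin k} (hj : j ≠ Fin.rev 0) : -((D.s : ℤ) * D.wmin) < D.wt j := by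
  have h1 := D.wt_last_add_le hj
  have h2 := D.lt_s_succ_mul
  rw [add_mul, one_mul] at h2
  omega

lemma f₀_mem_J : D.f₀ ∈ D.J := by
  obtain ⟨u, hu⟩ := D.isUnit_d (A := MvPolynomial (Fin n) ℂ)
  have h3 := D.euler_FA (0 : Fin k → ℂ)
  simp only [Pi.zero_apply, mul_zero, monomial_zero, Finset.sum_const_zero, add_zero] at h3
  rw [FA_zero] at h3
  have h4 : (D.d : MvPolynomial (Fin n) ℂ) * D.f₀ ∈ D.J := by
    rw [h3, ← JA_zero]
    refine Ideal.sum_mem _ fun i _ => ?_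
    exact Ideal.mul_mem_left _ _ (Ideal.mul_mem_left _ _ (D.gA_mem _ i))
  rw [← hu] at h4
  have h5 := Ideal.mul_mem_left _ (↑u⁻¹ : MvPolynomial (Fin n) ℂ) h4
  rwa [← mul_assoc, Units.inv_mul, one_mul] at h5

/-- The vector fields in `𝓛` vanish at the origin. -/
lemma coeff_zero_of_mem_calL {δ : Derivation ℂ (Aneg k) (Aneg k)} (hδ : δ ∈ D.calL) (j : Fin k) :
    coeff 0 (δ (X j)) = 0 := by
  obtain ⟨g, hg⟩ := (D.mem_calL_iff δ).1 hδ
  have h1 := D.map_mem_K _ (aeval (0 : Fin k → ℂ) : Aneg k →ₐ[ℂ] ℂ) hg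
  have h0 : (fun i => (aeval (0 : Fin k → ℂ) : Aneg k →ₐ[ℂ] ℂ) (X i)) = 0 := by
    ext i; simp
  rw [map_sub, map_mul, F_eq_FA, FA_map, map_upperPoly, h0] at h1
  have h2 : D.FA (0 : Fin k → ℂ) ∈ D.K (0 : Fin k → ℂ) := by
    rw [K_zero, FA_zero]
    exact D.f₀_mem_J
  have h3 := Ideal.add_mem _ h1 (Ideal.mul_mem_left _ (MvPolynomial.map
    ((aeval (0 : Fin k → ℂ) : Aneg k →ₐ[ℂ] ℂ) : Aneg k →+* ℂ) g) h2)
  rw [sub_add_cancel] at h3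
  have h4 := congrFun (D.upperPoly_mem_K _ h3) j
  change (aeval (0 : Fin k → ℂ) : Aneg k →ₐ[ℂ] ℂ) (δ (X j)) = 0 at h4
  rwa [aeval_zero, Algebra.algebraMap_self, RingHom.id_apply, constantCoeff_eq] at h4

variable {D} {N : Fin k → Conv n (Aneg k)} {ν : Fin k → ℤ} {h : Matrix (Fin k) (Fin k) (Aneg k)}

namespace IsSymmetricSystem

variable (hS : D.IsSymmetricSystem N ν h)

include hS

lemma euler_row (j : Fin k) : h 0 j = (D.wt j : Aneg k) * X j := by
  have h1 := congrArg (fun δ : Derivation ℂ (Aneg k) (Aneg k) => δ (X j)) hS.euler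
  simpa only [rowVF, mkDerivation_X] using h1

lemma isWeightedHomogeneous (l j : Fin k) :
    (h l j).IsWeightedHomogeneous D.wt (ν l + D.wt j) := by
  have := hS.homogVF l j
  rwa [rowVF, mkDerivation_X] at this

lemma row_mem_calL (l : Fin k) : rowVF h l ∈ D.calL := by
  rw [← hS.generate]; exact Submodule.subset_span ⟨l, rfl⟩

lemma coeff_zero_eq (l j : Fin k) : coeff 0 (h l j) = 0 := by
  have := D.coeff_zero_of_mem_calL (hS.row_mem_calL l) j
  rwa [rowVF, mkDerivation_X] at this

/-- By symmetry the last entry of row `l` is the entry `rev l` of the Euler row, a nonzero multiple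
of a single variable; its degree determines `ν l`. -/
lemma nu_eq (l : Fin k) : ν l = D.wt l.rev - D.wt (Fin.rev 0) := by
  have h1 := hS.isWeightedHomogeneous l (Fin.rev 0)
  rw [hS.symmetric, Fin.rev_rev, hS.euler_row] at h1
  have h2 := h1 (d := Finsupp.single l.rev 1) (by
    rw [← map_intCast (C : ℂ →+* Aneg k), coeff_C_mul, coeff_X, if_pos rfl, mul_one]
    have := D.wt_neg l.rev
    exact_mod_cast this.ne)
  rw [Finsupp.weight_single, one_smul] at h2
  omega

lemma wmin_le_nu {l : Fin k} (hl : l ≠ 0) : (D.wmin : ℤ) ≤ ν l := by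
  have := D.wt_last_add_le (j := l.rev) (fun h => hl (Fin.rev_injective h))
  rw [hS.nu_eq]
  omega

lemma rowVF_mem {c : ℤ} {l : Fin k} (hl : c ≤ ν l) : rowVF h l ∈ D.calLGE c := by
  refine ⟨hS.row_mem_calL l, fun j => ?_⟩
  rw [rowVF, mkDerivation_X]
  exact IsWeightedHomogeneous.mem_weightGE (hS.isWeightedHomogeneous l j) (by omega)

lemma exists_vecMul_eq {δ : Derivation ℂ (Aneg k) (Aneg k)} (hδ : δ ∈ D.calL) :
    ∃ u, (fun j => δ (X j)) = Matrix.vecMul u h := by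
  rw [← hS.generate] at hδ
  obtain ⟨u, hu⟩ := (Submodule.mem_span_range_iff_exists_fun _).1 hδ
  refine ⟨u, ?_⟩
  rw [sum_smul_rowVF] at hu
  ext1 j
  rw [← hu, mkDerivation_X]

/-- Truncating the `l`-th coefficient to weights `≥ c - ν l` does not affect a combination of order
`≥ c`. For `ν l < c` nothing survives, because no polynomial in `t` has terms of positive weight. -/
lemma exists_vecMul_eq_of_mem_calLGE {c : ℤ} {δ : Derivation ℂ (Aneg k) (Aneg k)}
    (hδ : δ ∈ D.calLGE c) :
    ∃ u, (∀ l, ν l < c → u l = 0) ∧ (fun j => δ (X j)) = Matrix.vecMul u h := by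
  obtain ⟨u, hu⟩ := hS.exists_vecMul_eq hδ.1
  refine ⟨fun l => trunc D.wt (c - ν l) (u l), fun l hl => ?_, ?_⟩
  · ext β
    rw [coeff_trunc, if_neg, coeff_zero]
    have := D.weight_wt_nonpos β
    omega
  · ext1 j
    have h1 := trunc_eq_self (hδ.2 j)
    rw [← h1, congrFun hu j]
    change trunc D.wt (c + D.wt j) (∑ l, u l * h l j) = ∑ l, _ * h l j
    rw [trunc_sum]
    refine Finset.sum_congr rfl fun l _ => ?_
    exact trunc_mul (by ring) _ (hS.isWeightedHomogeneous l j)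

/-- The Euler field has degree 0, and all other rows have degree at least `w`. -/
lemma rowsGenerate_Lplus : RowsGenerate D.Lplus h (· ≠ 0) := by
  rw [Lplus_eq]
  refine ⟨fun l hl => hS.rowVF_mem (hS.wmin_le_nu hl), fun δ hδ => ?_⟩
  obtain ⟨u, hu, hu'⟩ := hS.exists_vecMul_eq_of_mem_calLGE hδ
  refine ⟨u, fun l hl => hu l ?_, hu'⟩
  rw [not_not] at hl
  rw [hS.nu_eq, hl, sub_self]
  exact_mod_cast D.wmin_pos

/-- By the formula for `ν`, the condition on `t_{rev j}` says that `ν j` exceeds `-(s - i + 1)w -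
deg t_k`, where `t_k` is the last variable; between integers this gives the `+ 1`. The bound is
nonnegative, so the fields of at least this degree form a Lie algebra, which contains the generated
one. -/
lemma Z_le {i : ℕ} (hi : 0 < i) :
    D.Z ν i ≤ D.calLGE (-((D.s : ℤ) - i + 1) * D.wmin - D.wt (Fin.rev 0) + 1) := by
  have hc : (0 : ℤ) ≤ -((D.s : ℤ) - i + 1) * D.wmin - D.wt (Fin.rev 0) + 1 := by
    have h1 := D.s_mul_le
    have h2 : (0 : ℤ) ≤ ((i : ℤ) - 1) * D.wmin := mul_nonneg (by omega) (by positivity)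
    nlinarith
  have h1 : LieSubalgebra.lieSpan ℂ (Derivation ℂ (Aneg k) (Aneg k))
      {δ | δ ∈ D.Lplus ∧ ∃ e : ℤ, D.HomogVF δ e ∧
        ∃ j : Fin k, (MvPolynomial.X j.rev : Aneg k) ∈ D.Fil ((D.s : ℤ) - i) ∧ ν j ≤ e} ≤
      D.calLGELie _ hc := by
    rw [LieSubalgebra.lieSpan_le]
    rintro δ ⟨hδ, e, he, j, hj, hje⟩
    refine ⟨hδ.1, fun l => ?_⟩
    refine IsWeightedHomogeneous.mem_weightGE (he l) ?_
    rw [X_mem_Fil_iff] at hj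
    rw [hS.nu_eq] at hje
    omega
  exact h1

lemma finite_Z {i : ℕ} (hi : 0 < i) : Module.Finite ℂ (D.Z ν i) :=
  haveI := isNoetherian_of_isNoetherianRing_of_finite ℂ
    (D.calLGE (-((D.s : ℤ) - i + 1) * D.wmin - D.wt (Fin.rev 0) + 1))
  Module.Finite.of_injective _ (Submodule.inclusion_injective (hS.Z_le hi))

/-- The rows of admissible degree are themselves among the Lie generators, while brackets give
nothing outside the degree filtration. So the generated Lie algebra has the same A_- span as these
rows. -/
lemma rowsGenerate_Z {i : ℕ} (hi : 0 < i) [Module.Finite ℂ (D.Z ν i)] :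
    RowsGenerate (D.Z ν i) h fun l => -((D.s : ℤ) - i + 1) * D.wmin < D.wt l.rev := by
  constructor
  · intro l hl
    apply LieSubalgebra.subset_lieSpan
    refine ⟨?_, ν l, hS.homogVF l, l, D.X_mem_Fil_iff.2 hl, le_rfl⟩
    rw [Lplus_eq]
    refine hS.rowVF_mem (hS.wmin_le_nu ?_)
    rintro rfl
    have h1 := D.s_mul_le
    have h2 : (0 : ℤ) ≤ ((i : ℤ) - 1) * D.wmin := mul_nonneg (by omega) (by positivity)
    nlinarith
  · intro δ hδ
    obtain ⟨u, hu, hu'⟩ := hS.exists_vecMul_eq_of_mem_calLGE (hS.Z_le hi hδ)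
    refine ⟨u, fun l hl => hu l ?_, hu'⟩
    rw [hS.nu_eq]
    omega

end IsSymmetricSystem

end NeZero

end Setup

end SQH

/-! ### Jump matrices and the truncated Tjurina algebras -/

namespace SQH

open MvPolynomial

namespace Setup

variable {n k : ℕ} (D : Setup n k)

/-- The variables `t_j` of weight greater than `-(i+1)w`. -/
def Level (i : ℤ) (j : Fin k) : Prop := -(i + 1) * (D.wmin : ℤ) < D.wt j

/-- The specialization of `h` with all columns outside of level `i` replaced by zero. -/
def jumpMatrix (h : Matrix (Fin k) (Fin k) (Aneg k)) {B : Type} [CommRing B] (φ : Aneg k →+* B)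
    (i : ℤ) : Matrix (Fin k) (Fin k) B :=
  h.map φ * coordProj B (D.Level i)

lemma jumpMatrix_map (h : Matrix (Fin k) (Fin k) (Aneg k)) {B B' : Type} [CommRing B] [CommRing B']
    (φ : Aneg k →+* B) (ψ : B →+* B') (i : ℤ) :
    (D.jumpMatrix h φ i).map ψ = D.jumpMatrix h (ψ.comp φ) i := by
  rw [jumpMatrix, Matrix.map_mul, map_coordProj, Matrix.map_map]
  rfl

open Classical in
lemma jumpMatrix_apply (h : Matrix (Fin k) (Fin k) (Aneg k)) {B : Type} [CommRing B]
    (φ : Aneg k →+* B) (i : ℤ) (l j : Fin k) :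
    D.jumpMatrix h φ i l j = if D.Level i j then φ (h l j) else 0 :=
  mul_coordProj_apply _ _ _ _

/-- The truncation degree which belongs to the index `d/w + i + 1`. -/
def truncDeg (i : ℕ) : ℕ := D.d + (i + 1) * D.wmin

section NeZero

variable [NeZero k]

lemma idx_mul (i : Fin (D.s + 1)) : D.idx i * D.wmin = (D.truncDeg i : ℚ) := by
  have h : (D.wmin : ℚ) ≠ 0 := by exact_mod_cast D.wmin_pos.ne'
  rw [idx, truncDeg, add_mul, div_mul_cancel₀ _ h]
  push_cast
  rfl

lemma weight_m_lt_iff (i : ℕ) (j : Fin k) :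
    Finsupp.weight D.w (D.m j) < D.truncDeg i ↔ D.Level i j := by
  rw [Level, wt, truncDeg]
  have : -((i : ℤ) + 1) * D.wmin = -(((i + 1) * D.wmin : ℕ) : ℤ) := by push_cast; ring
  rw [this]
  omega

lemma coordProj_mul_upperIncl (A : Type) [CommRing A] (i : ℕ) :
    D.upperIncl A (D.truncDeg i) = coordProj A (D.Level i) * D.upperIncl A (D.truncDeg i) := by
  classical
  ext1 j α
  rw [coordProj_mul_apply]
  split_ifs with h
  · rfl
  · rw [upperIncl, Matrix.of_apply, if_neg]
    intro h'
    have := α.2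
    rw [← h', weight_m_lt_iff] at this
    exact h this

lemma upperIncl_mul_transpose (A : Type) [CommRing A] (i : ℕ) :
    D.upperIncl A (D.truncDeg i) * (D.upperIncl A (D.truncDeg i)).transpose =
      coordProj A (D.Level i) := by
  classical
  ext1 j l
  rw [Matrix.mul_apply, coordProj, Matrix.diagonal_apply]
  simp only [upperIncl, Matrix.of_apply, Matrix.transpose_apply]
  by_cases hjl : j = l
  · subst hjl
    rw [if_pos rfl]
    split_ifs with hj
    · have hj' := (D.weight_m_lt_iff i j).2 hj
      rw [Finset.sum_eq_single (⟨⟨D.m j, D.m_mem j⟩, hj'⟩ : D.lowB (D.truncDeg i))]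
      · simp
      · intro α _ hα
        rw [if_neg, zero_mul]
        intro h
        exact hα (Subtype.ext (Subtype.ext h.symm))
      · intro h; exact absurd (Finset.mem_univ _) h
    · refine Finset.sum_eq_zero fun α _ => ?_
      rw [if_neg, zero_mul]
      intro h
      have := α.2
      rw [← h, weight_m_lt_iff] at this
      exact hj this
  · rw [if_neg hjl]
    refine Finset.sum_eq_zero fun α _ => ?_
    by_cases h1 : D.m j = α.1.1
    · rw [if_neg (c := D.m l = α.1.1), mul_zero]
      intro h2
      exact hjl (D.m_injective (h1.trans h2.symm))
    · rw [if_neg h1, zero_mul]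

/-- Adding zero columns for basis monomials that are not upper, and replacing deleted columns by
zero, does not change the column module. -/
lemma constRank_upperIncl_iff {B : Type} [CommRing B] (E : Matrix (Fin k) (Fin k) B) (i r : ℕ) :
    ConstRank (E * D.upperIncl B (D.truncDeg i)) r ↔ ConstRank (E * coordProj B (D.Level i)) r := by
  refine constRank_iff_of_cols (C := D.upperIncl B (D.truncDeg i))
    (C' := (D.upperIncl B (D.truncDeg i)).transpose) ?_ ?_
  · rw [Matrix.mul_assoc, ← coordProj_mul_upperIncl]
  · rw [Matrix.mul_assoc, upperIncl_mul_transpose]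

lemma map_upperIncl {A B : Type} [CommRing A] [CommRing B] (φ : A →+* B) (N : ℕ) :
    (D.upperIncl A N).map φ = D.upperIncl B N := by
  classical
  ext1 j α
  rw [Matrix.map_apply]
  simp only [upperIncl, Matrix.of_apply]
  split_ifs <;> simp

lemma tau_eq (i : Fin (D.s + 1)) (t : Fin k → ℂ) :
    D.tau (D.idx i) t = Module.finrank ℂ (Conv n ℂ ⧸ D.tjIdeal t (D.truncDeg i)) := by
  rw [tau, H, idx_mul, Fat_eq_FA, tjIdeal]

lemma T_eq (i : Fin (D.s + 1)) : D.T (D.idx i) =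
    ModuleCat.of (Aneg k) (Conv n (Aneg k) ⧸ D.tjIdeal (X : Fin k → Aneg k) (D.truncDeg i)) := by
  rw [T, H, idx_mul, F_eq_FA, tjIdeal]

lemma mu_eq_tau (i : Fin (D.s + 1)) : D.mu (D.idx i) = D.tau (D.idx i) 0 := by
  have h : Ideal.span {toConv n ℂ D.f₀} ⊔ jacobianIdeal D.f₀ = jacobianIdeal D.f₀ := by
    rw [sup_eq_right, Ideal.span_singleton_le_iff_mem, jacobianIdeal_f₀]
    exact Ideal.mem_map_of_mem _ D.f₀_mem_J
  rw [mu, tau, Fat_eq_FA, FA_zero, h]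

variable {D} {N : Fin k → Conv n (Aneg k)} {ν : Fin k → ℤ} {h : Matrix (Fin k) (Fin k) (Aneg k)}

namespace IsSymmetricSystem

variable (hS : D.IsSymmetricSystem N ν h)

include hS

lemma isRelationMatrix : D.IsRelationMatrix (X : Fin k → Aneg k) h :=
  D.isRelationMatrix_X hS.generate

lemma tau_add_rank (i : Fin (D.s + 1)) (t : Fin k → ℂ) :
    D.tau (D.idx i) t + (D.jumpMatrix h (eval t) i).rank =
      Fintype.card (D.lowB (D.truncDeg i)) := by
  have h1 := (D.isRowCokernel_tjGen t (hS.isRelationMatrix.map t) (D.truncDeg i)).finrank_add_rank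
  rw [tau_eq, ← h1]
  congr 1
  have h2 := (D.constRank_upperIncl_iff (h.map (aeval t)) i
    (h.map (aeval t) * D.upperIncl ℂ (D.truncDeg i)).rank).1 ((constRank_field_iff _ _).2 rfl)
  rw [← (constRank_field_iff _ _).1 h2]
  rfl

lemma map_eval_zero : h.map (eval (0 : Fin k → ℂ)) = 0 := by
  ext1 l j
  rw [Matrix.map_apply, eval_zero, constantCoeff_eq]
  exact hS.coeff_zero_eq l j

lemma mu_eq_card (i : Fin (D.s + 1)) :
    D.mu (D.idx i) = Fintype.card (D.lowB (D.truncDeg i)) := by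
  rw [mu_eq_tau, ← hS.tau_add_rank i 0, jumpMatrix, hS.map_eval_zero, Matrix.zero_mul,
    Matrix.rank_zero, add_zero]

lemma hasJump_iff (t : Fin k → ℂ) (r : Fin (D.s + 1) → ℕ) :
    D.HasJump t r ↔ ∀ i : Fin (D.s + 1), (D.jumpMatrix h (eval t) i).rank = r i := by
  refine forall_congr' fun i => ?_
  have := hS.tau_add_rank i t
  rw [hS.mu_eq_card]
  omega

lemma T_flat_rank_iff (i : Fin (D.s + 1)) (B : Type) [CommRing B] [Algebra (Aneg k) B] {r : ℕ}
    (hr : r ≤ D.mu (D.idx i)) :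
    (Module.Flat B (B ⊗[Aneg k] D.T (D.idx i)) ∧ ∀ p : PrimeSpectrum B,
      Module.rankAtStalk (R := B) (B ⊗[Aneg k] D.T (D.idx i)) p = D.mu (D.idx i) - r) ↔
    ConstRank (D.jumpMatrix h (algebraMap (Aneg k) B) i) r := by
  rw [hS.mu_eq_card] at hr ⊢
  rw [T_eq]
  refine ((D.isRowCokernel_tjGen (X : Fin k → Aneg k) hS.isRelationMatrix
    (D.truncDeg i)).flat_rank_iff B hr).trans ?_
  rw [Matrix.map_mul, map_upperIncl, constRank_upperIncl_iff]
  rfl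

end IsSymmetricSystem

end NeZero

end Setup

end SQH

/-! ### Comparison of the two systems of rank conditions -/

namespace SQH

open MvPolynomial

namespace Setup

variable {n k : ℕ} (D : Setup n k)

section NeZero

variable [NeZero k]

variable {D}

lemma Level.mono {i i' : ℤ} (hi : i ≤ i') {j : Fin k} (h : D.Level i j) : D.Level i' j := by
  rw [Level] at *
  have : (i + 1) * (D.wmin : ℤ) ≤ (i' + 1) * D.wmin :=
    mul_le_mul_of_nonneg_right (by omega) (by positivity)
  rw [neg_mul] at *
  omega

variable (D)

lemma not_level_neg_one (j : Fin k) : ¬ D.Level (-1) j := by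
  rw [Level]
  have := D.wt_neg j
  norm_num
  omega

lemma level_s (j : Fin k) : D.Level D.s j := by
  rw [Level, neg_mul]
  have h2 := D.lt_s_succ_mul
  by_cases hj : j = Fin.rev 0
  · subst hj; omega
  · have h1 := D.wt_last_add_le hj
    omega

lemma level_pred_s_iff (j : Fin k) : D.Level ((D.s : ℤ) - 1) j ↔ j ≠ Fin.rev 0 := by
  rw [Level, sub_add_cancel, neg_mul]
  constructor
  · rintro h rfl
    have := D.s_mul_le
    omega
  · exact fun h => D.lt_wt_of_ne h

lemma jumpMatrix_of_le (h : Matrix (Fin k) (Fin k) (Aneg k)) {B : Type} [CommRing B]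
    (φ : Aneg k →+* B) {i : ℤ} (hi : (D.s : ℤ) ≤ i) : D.jumpMatrix h φ i = D.jumpMatrix h φ D.s := by
  classical
  ext1 l j
  rw [jumpMatrix_apply, jumpMatrix_apply, if_pos ((D.level_s j).mono hi), if_pos (D.level_s j)]

lemma jumpMatrix_mul_coordProj (h : Matrix (Fin k) (Fin k) (Aneg k)) {B : Type} [CommRing B]
    (φ : Aneg k →+* B) {i i' : ℤ} (hi : i ≤ i') :
    D.jumpMatrix h φ i = D.jumpMatrix h φ i' * coordProj B (D.Level i) := by
  classical
  ext1 l j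
  rw [mul_coordProj_apply, jumpMatrix_apply, jumpMatrix_apply]
  split_ifs with h1 h2
  · rfl
  · exact absurd (h1.mono hi) h2
  · rfl

lemma isUnit_map_wt {B : Type} [CommRing B] (φ : Aneg k →+* B) (j : Fin k) :
    IsUnit (φ (D.wt j : Aneg k)) := by
  have h : IsUnit ((D.wt j : ℂ)) := by
    rw [isUnit_iff_ne_zero]
    exact_mod_cast (D.wt_neg j).ne
  have := h.map (φ.comp (C : ℂ →+* Aneg k))
  simpa using this

/-- The conditions on the ranks at the point `φ` which define the stratum of `r`. -/
def InStratum (h : Matrix (Fin k) (Fin k) (Aneg k)) {B : Type} [CommRing B] (φ : Aneg k →+* B)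
    (r : Fin (D.s + 1) → ℕ) : Prop :=
  ∀ i : Fin (D.s + 1), ConstRank (D.jumpMatrix h φ i) (r i)

/-- The entry of `r` at the index `i`, or the last one. -/
def entry (r : Fin (D.s + 1) → ℕ) (i : ℕ) : ℕ := r ⟨min i D.s, by omega⟩

lemma entry_val (r : Fin (D.s + 1) → ℕ) (i : Fin (D.s + 1)) : D.entry r i = r i := by
  rw [entry]
  congr 1
  ext
  simp only
  omega

/-- The conditions on the ranks of the modules `Hom(L_+, A_-) / A_- dF^i(A_-)` and
`Hom(Z_j(L_+), A_-) / π_j(A_- dA_-)`. -/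
structure InHomStratum (h : Matrix (Fin k) (Fin k) (Aneg k)) {B : Type} [CommRing B]
    (φ : Aneg k →+* B) (r : Fin (D.s + 1) → ℕ) : Prop where
  lplus : ∀ i : ℕ, ConstRank ((D.jumpMatrix h φ (i + 1 : ℕ)).updateRow 0 0) (D.entry r (i + 1) - 1)
  z : ∀ i : Fin D.s, ConstRank (D.jumpMatrix h φ i) (D.entry r i)

variable {D} {N : Fin k → Conv n (Aneg k)} {ν : Fin k → ℤ} {h : Matrix (Fin k) (Fin k) (Aneg k)}

namespace IsSymmetricSystem

variable (hS : D.IsSymmetricSystem N ν h) {B : Type} [CommRing B] {φ : Aneg k →+* B}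

include hS

/-- Row `l ≠ 0` has degree at least `w`, and its entries have no constant term. So each monomial of
an entry in a column of level `i` contains a variable of degree larger by at least `w`, that is, of
level `i - 1`. -/
lemma map_eq_zero {i : ℤ} (hφ : ∀ j, D.Level (i - 1) j → φ (X j) = 0) {l j : Fin k} (hl : l ≠ 0)
    (hj : D.Level i j) : φ (h l j) = 0 := by
  rw [(h l j).as_sum, map_sum]
  refine Finset.sum_eq_zero fun β hβ => ?_
  rw [mem_support_iff] at hβ
  have hβ0 : β ≠ 0 := by
    rintro rfl
    exact hβ (hS.coeff_zero_eq l j)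
  obtain ⟨j', hj'⟩ := Finsupp.support_nonempty_iff.2 hβ0
  have e : β = Finsupp.single j' 1 + (β - Finsupp.single j' 1) := by
    rw [add_tsub_cancel_of_le]
    exact Finsupp.single_le_iff.2 (Nat.one_le_iff_ne_zero.2 (Finsupp.mem_support_iff.1 hj'))
  have h1 := hS.isWeightedHomogeneous l j hβ
  have h2 := hS.wmin_le_nu hl
  have h3 := D.weight_wt_nonpos (β - Finsupp.single j' 1)
  rw [e, map_add, Finsupp.weight_single, one_smul] at h1
  have h4 : D.Level (i - 1) j' := by
    rw [Level, neg_mul, add_mul] at *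
    rw [sub_mul]
    omega
  have e2 : monomial β (coeff β (h l j)) =
      X j' * monomial (β - Finsupp.single j' 1) (coeff β (h l j)) := by
    rw [X, monomial_mul, one_mul, ← e]
  rw [e2, map_mul, hφ j' h4, zero_mul]

lemma map_zero_row (j : Fin k) : φ (h 0 j) = φ (D.wt j : Aneg k) * φ (X j) := by
  rw [hS.euler_row, map_mul]

/-- The Euler row has the entries `deg(t_j) t_j` with invertible `deg(t_j)`, so it detects the
coordinates; once these vanish, so do the other rows. -/
lemma jumpMatrix_eq_zero_iff {i : ℤ} :
    D.jumpMatrix h φ i = 0 ↔ ∀ j, D.Level i j → φ (X j) = 0 := by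
  classical
  constructor
  · intro h0 j hj
    have h1 := congrFun (congrFun h0 0) j
    rw [jumpMatrix_apply, if_pos hj, hS.map_zero_row, Matrix.zero_apply] at h1
    exact (D.isUnit_map_wt φ j).mul_right_eq_zero.1 h1
  · intro h0
    ext1 l j
    rw [jumpMatrix_apply, Matrix.zero_apply]
    split_ifs with hj
    · by_cases hl : l = 0
      · rw [hl, hS.map_zero_row, h0 j hj, mul_zero]
      · exact hS.map_eq_zero (fun j hj => h0 j (hj.mono (by omega))) hl hj
    · rfl

lemma updateRow_eq_zero {i : ℤ} (hφ : ∀ j, D.Level (i - 1) j → φ (X j) = 0) :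
    (D.jumpMatrix h φ i).updateRow 0 0 = 0 := by
  classical
  ext1 l j
  rw [Matrix.updateRow_apply, Matrix.zero_apply]
  split_ifs with hl
  · rfl
  · rw [jumpMatrix_apply]
    split_ifs with hj
    · exact hS.map_eq_zero hφ hl hj
    · rfl

lemma constRank_zero_iff {i : ℤ} :
    ConstRank (D.jumpMatrix h φ i) 0 ↔ ∀ j, D.Level i j → φ (X j) = 0 := by
  rw [← hS.jumpMatrix_eq_zero_iff]
  exact ⟨fun h => h.eq_zero, fun h => by rw [h]; exact constRank_zero⟩

lemma constRank_of_zero {r : Fin (D.s + 1) → ℕ} {i : ℕ} (hi : i < D.s)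
    (hz : ∀ i : Fin D.s, ConstRank (D.jumpMatrix h φ i) (D.entry r i)) (hr : D.entry r i = 0) :
    ∀ j, D.Level i j → φ (X j) = 0 := by
  have := hz ⟨i, hi⟩
  simp only [hr] at this
  exact hS.constRank_zero_iff.1 this

/-- If the Euler vector field is unimodular in level `i₀` and the coordinates of smaller level
vanish, then the row of the Euler vector field can be split off. -/
lemma exists_mulVec_eq {i₀ : ℤ} (hφ : ∀ j, D.Level (i₀ - 1) j → φ (X j) = 0)
    (hc : ConstRank (D.jumpMatrix h φ i₀) 1) :
    ∃ y, ∀ i, i₀ ≤ i → (D.jumpMatrix h φ i).mulVec y = Pi.single 0 1 := by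
  classical
  -- Rank one means that the entries generate the unit ideal, and at level `i₀` only the Euler row
  -- has nonzero entries.
  have h1 := (constRank_iff_minorRank.1 hc).2
  have h2 : (1 : B) ∈ Ideal.span (Set.range fun j => D.jumpMatrix h φ i₀ 0 j) := by
    have h3 : Ideal.span {b | ∃ (f : Fin 1 → Fin k) (g : Fin 1 → Fin k),
        b = ((D.jumpMatrix h φ i₀).submatrix f g).det} ≤
        Ideal.span (Set.range fun j => D.jumpMatrix h φ i₀ 0 j) := by
      refine Ideal.span_le.2 ?_
      rintro _ ⟨f, g, rfl⟩
      rw [Matrix.det_unique, Matrix.submatrix_apply]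
      by_cases hf : f default = 0
      · rw [hf]; exact Ideal.subset_span ⟨_, rfl⟩
      · rw [jumpMatrix_apply]
        split_ifs with hg
        · rw [hS.map_eq_zero hφ hf hg]; exact Ideal.zero_mem _
        · exact Ideal.zero_mem _
    rw [h1] at h3
    exact h3 trivial
  obtain ⟨c, hc⟩ := (Ideal.mem_span_range_iff_exists_fun).1 h2
  -- The vector is supported in the columns of level `i₀`, where all matrices of higher level agree;
  -- one `y` serves for all of them.
  refine ⟨fun j => if D.Level i₀ j then c j else 0, fun i hi => ?_⟩
  ext1 l
  change ∑ j, D.jumpMatrix h φ i l j * (if D.Level i₀ j then c j else 0) = _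
  have e : ∀ j, D.jumpMatrix h φ i l j * (if D.Level i₀ j then c j else 0) =
      c j * D.jumpMatrix h φ i₀ l j := by
    intro j
    rw [jumpMatrix_apply, jumpMatrix_apply]
    by_cases hj : D.Level i₀ j
    · rw [if_pos (hj.mono hi), if_pos hj, if_pos hj, mul_comm]
    · rw [if_neg hj, if_neg hj, mul_zero, mul_zero]
  rw [Finset.sum_congr rfl fun j _ => e j]
  by_cases hl : l = 0
  · rw [hl, hc, Pi.single_eq_same]
  · rw [Pi.single_eq_of_ne hl]
    refine Finset.sum_eq_zero fun j _ => ?_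
    rw [jumpMatrix_apply]
    split_ifs with hg
    · rw [hS.map_eq_zero hφ hl hg, mul_zero]
    · rw [mul_zero]

lemma hasJump_iff_inStratum (t : Fin k → ℂ) (r : Fin (D.s + 1) → ℕ) :
    D.HasJump t r ↔ D.InStratum h (eval t) r := by
  rw [hS.hasJump_iff]
  exact forall_congr' fun i => (constRank_field_iff _ _).symm

lemma entry_mono {r : Fin (D.s + 1) → ℕ} (hr : r ∈ D.Sig) {i i' : ℕ} (hi : i ≤ i') :
    D.entry r i ≤ D.entry r i' := by
  obtain ⟨t, ht⟩ := hr
  rw [hS.hasJump_iff] at ht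
  rw [entry, entry, ← ht, ← ht, D.jumpMatrix_mul_coordProj h (eval t)
    (i := ((⟨min i D.s, by omega⟩ : Fin (D.s + 1)) : ℕ))
    (i' := ((⟨min i' D.s, by omega⟩ : Fin (D.s + 1)) : ℕ)) (by simp only; omega)]
  exact Matrix.rank_mul_le_left _ _

/-- If the ranks at the lower levels are 0, the coordinates of these levels vanish, and at level
`i₀` only the Euler row can be nonzero. -/
lemma entry_le_one {r : Fin (D.s + 1) → ℕ} (hr : r ∈ D.Sig) {i₀ : ℕ} (hi₀ : i₀ ≤ D.s)
    (h0 : ∀ i < i₀, D.entry r i = 0) : D.entry r i₀ ≤ 1 := by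
  classical
  obtain ⟨t, ht⟩ := hr
  rw [hS.hasJump_iff] at ht
  have h1 : ∀ j, D.Level ((i₀ : ℤ) - 1) j → eval t (X j) = 0 := by
    intro j hj
    rcases Nat.eq_zero_or_pos i₀ with rfl | hpos
    · exact absurd hj (by simpa using D.not_level_neg_one j)
    · have h2 := h0 (i₀ - 1) (by omega)
      have h3 := ht ⟨min (i₀ - 1) D.s, by omega⟩
      rw [show r ⟨min (i₀ - 1) D.s, by omega⟩ = 0 from h2, ← constRank_field_iff] at h3
      refine hS.constRank_zero_iff.1 h3 j ?_
      refine hj.mono ?_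
      simp only
      omega
  rw [entry, ← ht]
  have h2 : (⟨min i₀ D.s, by omega⟩ : Fin (D.s + 1)).1 = i₀ := by simp only; omega
  rw [h2]
  have h3 : D.jumpMatrix h (eval t) i₀ = Matrix.vecMulVec (Pi.single 0 1)
      (D.jumpMatrix h (eval t) i₀ 0) := by
    ext1 l j
    rw [Matrix.vecMulVec_apply]
    by_cases hl : l = 0
    · rw [hl, Pi.single_eq_same, one_mul]
    · rw [Pi.single_eq_of_ne hl, zero_mul, jumpMatrix_apply]
      split_ifs with hj
      · exact hS.map_eq_zero h1 hl hj
      · rfl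
  rw [h3]
  exact Matrix.rank_vecMulVec_le _ _

/-- The first nonzero entry equals 1. In the last place it makes the vector equal to `rOne`;
anywhere else it is visible to the modules of the Z-family. -/
lemma eq_rOne_or_exists {r : Fin (D.s + 1) → ℕ} (hr : r ∈ D.Sig) (h0 : r ≠ 0) :
    r = D.rOne ∨ ∃ i₀ < D.s, (∀ i < i₀, D.entry r i = 0) ∧ D.entry r i₀ = 1 := by
  classical
  have hex : ∃ i, D.entry r i ≠ 0 := by
    by_contra hc
    push Not at hc
    apply h0
    ext i
    rw [← D.entry_val r, hc]; rfl
  have hmin := fun i hi => not_not.1 (Nat.find_min hex (m := i) hi)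
  have hne := Nat.find_spec hex
  generalize Nat.find hex = i₀ at hmin hne
  have hle : i₀ ≤ D.s := by
    by_contra hc
    apply hne
    have := hmin D.s (by omega)
    rw [entry] at this ⊢
    rw [← this]
    congr 2
    omega
  have h1 : D.entry r i₀ = 1 := by
    have := hS.entry_le_one hr hle hmin
    omega
  rcases hle.lt_or_eq with hlt | rfl
  · exact .inr ⟨i₀, hlt, hmin, h1⟩
  · left
    ext i
    rw [rOne]
    by_cases hi : i = Fin.last D.s
    · rw [hi, Pi.single_eq_same, ← h1, ← D.entry_val r]; rfl
    · rw [Pi.single_eq_of_ne hi, ← D.entry_val r]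
      exact hmin _ (Fin.val_lt_last hi)

lemma inStratum_zero_iff : D.InStratum h φ 0 ↔ ∀ j, φ (X j) = 0 := by
  constructor
  · intro h0 j
    exact hS.constRank_zero_iff.1 (h0 (Fin.last D.s)) j (D.level_s j)
  · intro h0 i
    exact hS.constRank_zero_iff.2 fun j _ => h0 j

lemma entry_rOne {i : ℕ} (hi : i < D.s) : D.entry D.rOne i = 0 := by
  rw [entry, rOne, Pi.single_eq_of_ne]
  intro h
  have := congrArg Fin.val h
  simp only [Fin.val_last] at this
  omega

lemma map_X_eq_zero_of_z
    (hz : ∀ i : Fin D.s, ConstRank (D.jumpMatrix h φ i) (D.entry D.rOne i)) :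
    ∀ j, D.Level ((D.s : ℤ) - 1) j → φ (X j) = 0 := by
  intro j hj
  rcases Nat.eq_zero_or_pos D.s with h0 | hpos
  · rw [h0] at hj
    exact absurd hj (by simpa using D.not_level_neg_one j)
  · exact hS.constRank_of_zero (by omega : D.s - 1 < D.s) hz (hS.entry_rOne (by omega)) j
      (hj.mono (by omega))

/-- On the last axis the matrix without the Euler row is zero at every level, whether or not the
last coordinate vanishes. The Hom family thus cannot separate the origin from the punctured axis. -/
lemma inHomStratum_rOne_iff :
    D.InHomStratum h φ D.rOne ↔ ∀ j, j ≠ Fin.rev 0 → φ (X j) = 0 := by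
  constructor
  · intro h0 j hj
    exact hS.map_X_eq_zero_of_z h0.z j ((D.level_pred_s_iff j).2 hj)
  · intro h0
    have h1 : ∀ j, D.Level ((D.s : ℤ) - 1) j → φ (X j) = 0 :=
      fun j hj => h0 j ((D.level_pred_s_iff j).1 hj)
    constructor
    · intro i
      have e : D.entry D.rOne (i + 1) - 1 = 0 := by
        rw [entry, rOne, Pi.single_apply]
        split_ifs <;> rfl
      rw [e]
      by_cases hi : i + 1 ≤ D.s
      · rw [hS.updateRow_eq_zero fun j hj => h1 j (hj.mono (by push_cast; omega))]
        exact constRank_zero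
      · rw [D.jumpMatrix_of_le h φ (by push_cast; omega), hS.updateRow_eq_zero h1]
        exact constRank_zero
    · intro i
      rw [hS.entry_rOne i.2]
      exact hS.constRank_zero_iff.2 fun j hj => h1 j (hj.mono (by have := i.2; omega))

/-- On the axis the only nonzero entry is `deg(t_k) t_k`, for the last variable `t_k`, in the Euler
row at level `s`. Rank one therefore means that `t_k` is a unit. -/
lemma inStratum_rOne_iff : D.InStratum h φ D.rOne ↔
    (∀ j, j ≠ Fin.rev 0 → φ (X j) = 0) ∧ IsUnit (φ (X (Fin.rev 0))) := by
  classical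
  have hlast : ∀ {i : Fin (D.s + 1)}, i ≠ Fin.last D.s → (i : ℕ) < D.s := fun hi =>
    Fin.val_lt_last hi
  constructor
  · intro h0
    have h1 : ∀ j, D.Level ((D.s : ℤ) - 1) j → φ (X j) = 0 := by
      refine hS.map_X_eq_zero_of_z fun i => ?_
      have := h0 i.castSucc
      rwa [← D.entry_val D.rOne] at this
    refine ⟨fun j hj => h1 j ((D.level_pred_s_iff j).2 hj), ?_⟩
    have h2 := h0 (Fin.last D.s)
    rw [rOne, Pi.single_eq_same] at h2
    obtain ⟨y, hy⟩ := hS.exists_mulVec_eq h1 h2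
    have h3 := congrFun (hy D.s le_rfl) 0
    rw [Pi.single_eq_same] at h3
    change ∑ j, D.jumpMatrix h φ D.s 0 j * y j = 1 at h3
    rw [Finset.sum_eq_single (Fin.rev 0)] at h3
    · rw [jumpMatrix_apply, if_pos (D.level_s _), hS.map_zero_row] at h3
      refine IsUnit.of_mul_eq_one (φ (D.wt (Fin.rev 0) : Aneg k) * y (Fin.rev 0)) ?_
      rw [← h3]; ring
    · intro j _ hj
      rw [jumpMatrix_apply, if_pos (D.level_s _), hS.map_zero_row,
        h1 j ((D.level_pred_s_iff j).2 hj), mul_zero, zero_mul]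
    · intro h; exact absurd (Finset.mem_univ _) h
  · rintro ⟨h0, u, hu⟩ i
    have h1 : ∀ j, D.Level ((D.s : ℤ) - 1) j → φ (X j) = 0 :=
      fun j hj => h0 j ((D.level_pred_s_iff j).1 hj)
    by_cases hi : i = Fin.last D.s
    · rw [hi, rOne, Pi.single_eq_same]
      obtain ⟨v, hv⟩ := D.isUnit_map_wt φ (Fin.rev 0)
      refine (constRank_succ_iff _ 0 (Pi.single (Fin.rev 0) ((↑v⁻¹ : B) * (↑u⁻¹ : B))) ?_ 0).2 ?_
      · ext1 l
        rw [Matrix.mulVec_single]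
        change D.jumpMatrix h φ _ l (Fin.rev 0) * ((↑v⁻¹ : B) * (↑u⁻¹ : B)) = _
        rw [jumpMatrix_apply, Fin.val_last, if_pos (D.level_s _)]
        by_cases hl : l = 0
        · rw [hl, hS.map_zero_row, ← hv, ← hu, Pi.single_eq_same]
          have e1 := v.inv_mul
          have e2 := u.inv_mul
          linear_combination ((↑u⁻¹ : B) * (↑u : B)) * e1 + e2
        · rw [hS.map_eq_zero h1 hl (D.level_s _), zero_mul, Pi.single_eq_of_ne hl]
      · rw [Fin.val_last, hS.updateRow_eq_zero h1]
        exact constRank_zero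
    · rw [rOne, Pi.single_eq_of_ne hi]
      refine hS.constRank_zero_iff.2 fun j hj => h1 j (hj.mono ?_)
      have := hlast hi
      omega

/-- Away from the origin and the last axis, both families of modules define the same strata. -/
lemma inHomStratum_iff {r : Fin (D.s + 1) → ℕ} (hr : r ∈ D.Sig) {i₀ : ℕ} (hi₀ : i₀ < D.s)
    (h0 : ∀ i < i₀, D.entry r i = 0) (h1 : D.entry r i₀ = 1) :
    D.InHomStratum h φ r ↔ D.InStratum h φ r := by
  -- The Z-modules alone determine the levels below `s`, in particular `i₀`. Below `i₀` the matrices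
  -- vanish; from `i₀` on the Euler row splits off, and deleting it lowers the rank by exactly one.
  have key : (∀ i : Fin D.s, ConstRank (D.jumpMatrix h φ i) (D.entry r i)) →
      ∀ i : ℕ, (ConstRank ((D.jumpMatrix h φ i).updateRow 0 0) (D.entry r i - 1) ↔
        ConstRank (D.jumpMatrix h φ i) (D.entry r i)) ∨ (i < i₀ ∧ D.jumpMatrix h φ i = 0) := by
    intro hz i
    by_cases hi : i < i₀
    · exact .inr ⟨hi, (hS.jumpMatrix_eq_zero_iff).2
        (hS.constRank_of_zero (by omega) hz (h0 i hi))⟩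
    · left
      have h2 : ∀ j, D.Level ((i₀ : ℤ) - 1) j → φ (X j) = 0 := by
        intro j hj
        rcases Nat.eq_zero_or_pos i₀ with rfl | hpos
        · exact absurd hj (by simpa using D.not_level_neg_one j)
        · exact hS.constRank_of_zero (by omega : i₀ - 1 < D.s) hz (h0 _ (by omega)) j
            (hj.mono (by omega))
      have h3 := hz ⟨i₀, hi₀⟩
      simp only [h1] at h3
      obtain ⟨y, hy⟩ := hS.exists_mulVec_eq h2 h3
      have h4 : 1 ≤ D.entry r i := by
        rw [← h1]; exact hS.entry_mono hr (by omega)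
      have h5 := constRank_succ_iff _ 0 y (hy i (by omega)) (D.entry r i - 1)
      rw [Nat.sub_add_cancel h4] at h5
      exact h5.symm
  constructor
  · intro hh i
    rw [← D.entry_val r]
    by_cases hi : (i : ℕ) < D.s
    · exact hh.z ⟨i, hi⟩
    · rcases key hh.z i with hk | ⟨hk, -⟩
      · refine hk.1 ?_
        -- Only level `s` is missing from the Z-conditions. It comes from `Hom(L_+, A_-)/A_- dF^s`;
        -- here `i = s ≥ 1` because `i₀ < s`.
        have h2 := hh.lplus ((i : ℕ) - 1)
        have e : (i : ℕ) - 1 + 1 = i := by omega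
        rwa [e] at h2
      · omega
  · intro hh
    have hz : ∀ i : Fin D.s, ConstRank (D.jumpMatrix h φ i) (D.entry r i) := by
      intro i
      have := hh i.castSucc
      rwa [← D.entry_val r] at this
    refine ⟨fun i => ?_, hz⟩
    rcases key hz (i + 1) with hk | ⟨hk, hk'⟩
    · refine hk.2 ?_
      have h2 : ConstRank (D.jumpMatrix h φ (min (i + 1) D.s : ℕ)) (D.entry r (i + 1)) :=
        hh ⟨min (i + 1) D.s, by omega⟩
      by_cases hi : i + 1 ≤ D.s
      · rwa [min_eq_left hi] at h2
      · rw [min_eq_right (by omega)] at h2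
        rwa [D.jumpMatrix_of_le h φ (by push_cast; omega)]
    · rw [hk', h0 _ hk]
      have : (0 : Matrix (Fin k) (Fin k) B).updateRow 0 0 = 0 := by
        ext1 l j
        rw [Matrix.updateRow_apply]
        split_ifs <;> rfl
      rw [this]
      exact constRank_zero

lemma inHomStratum {r : Fin (D.s + 1) → ℕ} (hr : r ∈ D.Sig) (h0 : r ≠ 0)
    (hh : D.InStratum h φ r) : D.InHomStratum h φ r := by
  rcases hS.eq_rOne_or_exists hr h0 with rfl | ⟨i₀, hi₀, h1, h2⟩
  · exact hS.inHomStratum_rOne_iff.2 (hS.inStratum_rOne_iff.1 hh).1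
  · exact (hS.inHomStratum_iff hr hi₀ h1 h2).2 hh

end IsSymmetricSystem

end NeZero

end Setup

end SQH

/-! ### Flatness and ranks of the Hom modules -/

namespace SQH

open MvPolynomial

namespace Setup

variable {n k : ℕ} (D : Setup n k)

/-- The ranks of the modules of the family `homFamily` on the stratum of `r`. -/
def homRank (ν : Fin k → ℤ) (r : Fin (D.s + 1) → ℕ) : ℕ ⊕ Fin D.s → ℕ :=
  Sum.elim (fun i => Module.finrank ℂ D.Lplus - (D.entry r (i + 1) - 1))
    (fun j => Module.finrank ℂ (D.Z ν (j.val + 1)) - D.entry r j.rev)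

variable [NeZero k]

variable {D} {N : Fin k → Conv n (Aneg k)} {ν : Fin k → ℤ} {h : Matrix (Fin k) (Fin k) (Aneg k)}

lemma coordProj_ne_zero_mul {B : Type} [CommRing B] (E : Matrix (Fin k) (Fin k) B) :
    coordProj B (· ≠ 0) * E = E.updateRow 0 0 := by
  classical
  ext1 l j
  rw [coordProj_mul_apply, Matrix.updateRow_apply]
  by_cases hl : l = 0
  · rw [if_neg (not_not.2 hl), if_pos hl]; rfl
  · rw [if_pos hl, if_neg hl]

instance finite_Lplus : Module.Finite ℂ D.Lplus := D.finite_calLGE _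

namespace IsSymmetricSystem

variable (hS : D.IsSymmetricSystem N ν h)

include hS

/-- The symmetry of `h` turns a selection of rows into a selection of columns. The module of index
`j + 1` involves level `s - (j + 1)`, which is the value of `j.rev`. -/
lemma z_matrix_eq {B : Type} [CommRing B] (φ : Aneg k →+* B) (j : Fin D.s) :
    coordProj B (fun l => -((D.s : ℤ) - (j.val + 1 : ℕ) + 1) * D.wmin < D.wt l.rev) * h.map φ *
      coordProj B (fun _ => True) =
      (D.jumpMatrix h φ (j.rev : ℕ)).transpose.submatrix Fin.revPerm Fin.revPerm := by
  classical
  ext1 l i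
  rw [mul_coordProj_apply, if_pos trivial, coordProj_mul_apply, Matrix.submatrix_apply,
    Matrix.transpose_apply, jumpMatrix_apply, Fin.revPerm_apply, Fin.revPerm_apply, Matrix.map_apply,
    hS.symmetric]
  have e : (-((D.s : ℤ) - (j.val + 1 : ℕ) + 1) * D.wmin < D.wt l.rev) =
      D.Level (j.rev : ℕ) l.rev := by
    rw [Level, Fin.val_rev, Nat.cast_sub (by have := j.2; omega)]
  simp only [e]

lemma constRank_z_iff {B : Type} [CommRing B] (φ : Aneg k →+* B) (j : Fin D.s) (r : ℕ) :
    ConstRank (coordProj B (fun l => -((D.s : ℤ) - (j.val + 1 : ℕ) + 1) * D.wmin < D.wt l.rev) *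
      h.map φ * coordProj B (fun _ => True)) r ↔ ConstRank (D.jumpMatrix h φ (j.rev : ℕ)) r := by
  rw [hS.z_matrix_eq, constRank_submatrix_iff, constRank_transpose_iff]

/-- The vector `r` is attained at a closed point, where this number is the rank of a matrix whose
row space is spanned by `finrank L_+` vectors. The subtraction in `homRank` is therefore exact. -/
lemma entry_sub_one_le {r : Fin (D.s + 1) → ℕ} (hr : r ∈ D.Sig) (h0 : r ≠ 0) (i : ℕ) :
    D.entry r (i + 1) - 1 ≤ Module.finrank ℂ D.Lplus := by
  obtain ⟨t, ht⟩ := hr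
  have h1 := hS.hasJump_iff_inStratum t r |>.1 ht
  have h2 := (hS.inHomStratum ⟨t, ht⟩ h0 h1).lplus i
  rw [constRank_field_iff] at h2
  rw [← h2, ← coordProj_ne_zero_mul, jumpMatrix, ← Matrix.mul_assoc]
  exact hS.rowsGenerate_Lplus.rank_le _ _

lemma entry_le_finrank_Z {r : Fin (D.s + 1) → ℕ} (hr : r ∈ D.Sig) (h0 : r ≠ 0) (j : Fin D.s) :
    D.entry r j.rev ≤ Module.finrank ℂ (D.Z ν (j.val + 1)) := by
  obtain ⟨t, ht⟩ := hr
  have h1 := hS.hasJump_iff_inStratum t r |>.1 ht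
  have h2 := (hS.inHomStratum ⟨t, ht⟩ h0 h1).z j.rev
  rw [← hS.constRank_z_iff, constRank_field_iff] at h2
  rw [← h2]
  have := hS.finite_Z (Nat.succ_pos j.val)
  exact (hS.rowsGenerate_Z (Nat.succ_pos j.val)).rank_le _ _

/-- The flattening condition for the modules of the family `homFamily`. -/
theorem homFamily_flat_rank_iff {r : Fin (D.s + 1) → ℕ} (hr : r ∈ D.Sig) (h0 : r ≠ 0)
    (B : Type) [CommRing B] [Algebra (Aneg k) B] :
    (∀ i, Module.Flat B (B ⊗[Aneg k] D.homFamily ν i) ∧ ∀ p : PrimeSpectrum B,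
      Module.rankAtStalk (R := B) (B ⊗[Aneg k] D.homFamily ν i) p = D.homRank ν r i) ↔
    D.InHomStratum h (algebraMap (Aneg k) B) r := by
  have e1 : ∀ i : ℕ, (Module.Flat B (B ⊗[Aneg k] D.homFamily ν (.inl i)) ∧ ∀ p : PrimeSpectrum B,
      Module.rankAtStalk (R := B) (B ⊗[Aneg k] D.homFamily ν (.inl i)) p =
        D.homRank ν r (.inl i)) ↔
      ConstRank ((D.jumpMatrix h (algebraMap (Aneg k) B) (i + 1 : ℕ)).updateRow 0 0)
        (D.entry r (i + 1) - 1) := by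
    intro i
    have := hS.rowsGenerate_Lplus.flat_rank_iff (S := D.Fil ((i + 1 : ℕ) : ℤ))
      (Q := D.Level ((i + 1 : ℕ) : ℤ)) (fun j hj => D.X_mem_Fil_iff.2 hj)
      (fun a ha j hj => D.pderiv_eq_zero_of_mem_Fil ha j hj) B (hS.entry_sub_one_le hr h0 i)
    rw [Matrix.mul_assoc, coordProj_ne_zero_mul] at this
    exact this
  have e2 : ∀ j : Fin D.s, (Module.Flat B (B ⊗[Aneg k] D.homFamily ν (.inr j)) ∧
      ∀ p : PrimeSpectrum B, Module.rankAtStalk (R := B) (B ⊗[Aneg k] D.homFamily ν (.inr j)) p =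
        D.homRank ν r (.inr j)) ↔
      ConstRank (D.jumpMatrix h (algebraMap (Aneg k) B) (j.rev : ℕ)) (D.entry r j.rev) := by
    intro j
    have := hS.finite_Z (Nat.succ_pos j.val)
    have := (hS.rowsGenerate_Z (Nat.succ_pos j.val)).flat_rank_iff (S := Set.univ)
      (Q := fun _ => True) (fun j _ => trivial) (fun a _ j hj => absurd trivial hj) B
      (hS.entry_le_finrank_Z hr h0 j)
    exact this.trans (hS.constRank_z_iff _ _ _)
  constructor
  · intro hh
    refine ⟨fun i => (e1 i).1 (hh (.inl i)), fun i => ?_⟩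
    have := (e2 i.rev).1 (hh (.inr i.rev))
    rwa [Fin.rev_rev] at this
  · rintro ⟨h1, h2⟩ (i | j)
    · exact (e1 i).2 (h1 i)
    · exact (e2 j).2 (h2 j.rev)

/-- The entries below `s` are read off from the Z-modules. The last one comes from `dF^{s+1}`, whose
level already contains all coordinates; since `r ≠ 0` it is at least 1, so subtracting 1 loses
nothing. -/
lemma homRank_injective :
    Function.Injective fun r : (D.Sig \ {0} : Set (Fin (D.s + 1) → ℕ)) => D.homRank ν r.1 := by
  intro r r' hrr
  have hpos : ∀ r : (D.Sig \ {0} : Set (Fin (D.s + 1) → ℕ)), 1 ≤ D.entry r.1 D.s := by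
    intro r
    by_contra hc
    refine r.2.2 (Set.mem_singleton_iff.2 (funext fun i => ?_))
    have := hS.entry_mono r.2.1 (i := i) (i' := D.s) (by omega)
    rw [← D.entry_val r.1 i, Pi.zero_apply]
    omega
  ext i
  rw [← D.entry_val r.1 i, ← D.entry_val r'.1 i]
  by_cases hi : (i : ℕ) < D.s
  · have h1 := congrFun hrr (.inr (Fin.rev ⟨i, hi⟩))
    have h2 := hS.entry_le_finrank_Z r.2.1 r.2.2 (Fin.rev ⟨i, hi⟩)
    have h3 := hS.entry_le_finrank_Z r'.2.1 r'.2.2 (Fin.rev ⟨i, hi⟩)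
    simp only [homRank, Sum.elim_inr] at h1
    rw [Fin.rev_rev] at h1 h2 h3
    simp only at h1 h2 h3
    omega
  · have hs : (i : ℕ) = D.s := by omega
    have h1 := congrFun hrr (.inl D.s)
    have h2 := hS.entry_sub_one_le r.2.1 r.2.2 D.s
    have h3 := hS.entry_sub_one_le r'.2.1 r'.2.2 D.s
    simp only [homRank, Sum.elim_inl] at h1
    have h4 : ∀ r, D.entry r (D.s + 1) = D.entry r D.s := by
      intro r
      rw [entry, entry]
      congr 2
      omega
    rw [h4] at h2 h3
    rw [h4, h4] at h1
    have h5 := hpos r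
    have h6 := hpos r'
    rw [hs]
    omega

end IsSymmetricSystem

end Setup

end SQH

namespace SQH

open MvPolynomial

/-! ### Factorization through subschemes -/

section Factors

variable {A : Type} [CommRing A] {B : Type} [CommRing B]

lemma factors_spec_iff {C : Type} [CommRing C] (q : A →+* C) (φ : A →+* B) :
    Factors (Over.mk (Spec.map (CommRingCat.ofHom q))) φ ↔ ∃ ψ : C →+* B, ψ.comp q = φ := by
  constructor
  · rintro ⟨g, hg⟩
    change g ≫ Spec.map (CommRingCat.ofHom q) = _ at hg
    refine ⟨(Spec.preimage g).hom, ?_⟩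
    rw [← Spec.map_preimage g, ← Spec.map_comp] at hg
    have := congrArg CommRingCat.Hom.hom (Spec.map_injective hg)
    exact this
  · rintro ⟨ψ, rfl⟩
    refine ⟨Spec.map (CommRingCat.ofHom ψ), ?_⟩
    change _ ≫ Spec.map (CommRingCat.ofHom q) = _
    rw [← Spec.map_comp]
    rfl

lemma factors_quotient_iff (I : Ideal A) (φ : A →+* B) :
    Factors (Over.mk (Spec.map (CommRingCat.ofHom (Ideal.Quotient.mk I)))) φ ↔
      ∀ a ∈ I, φ a = 0 := by
  rw [factors_spec_iff]
  constructor
  · rintro ⟨ψ, rfl⟩ a ha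
    rw [RingHom.comp_apply, Ideal.Quotient.eq_zero_iff_mem.2 ha, map_zero]
  · intro h
    exact ⟨Ideal.Quotient.lift I φ h, Ideal.Quotient.lift_comp_mk I φ h⟩

lemma mem_range_of_factors {U : Over (Spec (CommRingCat.of A))} {p : PrimeSpectrum A}
    (h : Factors U (algebraMap A (Ideal.ResidueField p.asIdeal))) :
    (p : Spec (CommRingCat.of A)) ∈ Set.range U.hom := by
  obtain ⟨g, hg⟩ := h
  let x : Spec (CommRingCat.of (Ideal.ResidueField p.asIdeal)) :=
    (⊥ : PrimeSpectrum (Ideal.ResidueField p.asIdeal))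
  refine ⟨g x, ?_⟩
  rw [← Scheme.Hom.comp_apply, hg]
  refine PrimeSpectrum.ext ?_
  change Ideal.comap (algebraMap A (Ideal.ResidueField p.asIdeal)) ⊥ = p.asIdeal
  rw [← RingHom.ker_eq_comap_bot]
  exact Ideal.ker_algebraMap_residueField _

lemma nonempty_of_factors [Nontrivial B] {U : Over (Spec (CommRingCat.of A))} {φ : A →+* B}
    (h : Factors U φ) : Nonempty U.left := by
  obtain ⟨g, -⟩ := h
  obtain ⟨x⟩ : Nonempty (PrimeSpectrum B) := inferInstance
  exact ⟨g (x : Spec (CommRingCat.of B))⟩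

lemma exists_comp_preimage_iff {X Y Z : Scheme.{0}} (i : Z ⟶ X) (W : X.Opens) (f : Y ⟶ X) :
    (∃ g : Y ⟶ (i ⁻¹ᵁ W).toScheme, g ≫ (i ⁻¹ᵁ W).ι ≫ i = f) ↔
      (∃ g : Y ⟶ Z, g ≫ i = f) ∧ ∀ y, f y ∈ W := by
  constructor
  · rintro ⟨g, rfl⟩
    refine ⟨⟨g ≫ (i ⁻¹ᵁ W).ι, by rw [Category.assoc]⟩, fun y => ?_⟩
    rw [Scheme.Hom.comp_apply, Scheme.Hom.comp_apply]
    exact (g y).2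
  · rintro ⟨⟨g, rfl⟩, h⟩
    have hr : Set.range g ⊆ Set.range (i ⁻¹ᵁ W).ι := by
      rw [Scheme.Opens.range_ι]
      rintro _ ⟨x, rfl⟩
      have := h x
      rwa [Scheme.Hom.comp_apply] at this
    exact ⟨IsOpenImmersion.lift _ g hr, by rw [← Category.assoc, IsOpenImmersion.lift_fac]⟩

lemma isImmersion_ι_comp {X Z : Scheme.{0}} (i : Z ⟶ X) (W : X.Opens) [IsClosedImmersion i] :
    IsImmersion ((i ⁻¹ᵁ W).ι ≫ i) :=
  inferInstance

/-- The open complement of the zero locus of `J`. -/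
def openCompl (J : Ideal A) : (Spec (CommRingCat.of A)).Opens :=
  ⟨(PrimeSpectrum.zeroLocus (J : Set A))ᶜ, (PrimeSpectrum.isClosed_zeroLocus _).isOpen_compl⟩

/-- The locally closed subscheme of `Spec A` where the elements of `I` vanish and those of `J` have
no common zero. -/
def locClosedSub (I J : Ideal A) : Over (Spec (CommRingCat.of A)) :=
  Over.mk ((Spec.map (CommRingCat.ofHom (Ideal.Quotient.mk I)) ⁻¹ᵁ openCompl J).ι ≫
    Spec.map (CommRingCat.ofHom (Ideal.Quotient.mk I)))

instance isImmersion_locClosedSub (I J : Ideal A) : IsImmersion (locClosedSub I J).hom := by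
  have : IsClosedImmersion (Spec.map (CommRingCat.ofHom (Ideal.Quotient.mk I))) :=
    IsClosedImmersion.spec_of_surjective _ Ideal.Quotient.mk_surjective
  exact isImmersion_ι_comp _ _

lemma factors_locClosedSub_iff (I J : Ideal A) (φ : A →+* B) :
    Factors (locClosedSub I J) φ ↔ (∀ a ∈ I, φ a = 0) ∧ J.map φ = ⊤ := by
  refine (exists_comp_preimage_iff _ _ _).trans (and_congr (factors_quotient_iff I φ) ?_)
  constructor
  · intro h
    by_contra hc
    obtain ⟨M, hM, hle⟩ := Ideal.exists_le_maximal _ hc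
    exact h (⟨M, hM.isPrime⟩ : PrimeSpectrum B) (Ideal.map_le_iff_le_comap.1 hle)
  · intro h (x : PrimeSpectrum B) hle
    have h3 : J.map φ ≤ x.asIdeal := Ideal.map_le_iff_le_comap.2 hle
    rw [h, top_le_iff] at h3
    exact x.isPrime.ne_top h3

end Factors

/-! ### The origin and the last axis -/

section Axis

variable {k : ℕ} {B : Type} [CommRing B]

lemma factors_originSub_iff (φ : Aneg k →+* B) :
    Factors (originSub k) φ ↔ ∀ j, φ (X j) = 0 := by
  refine (factors_spec_iff _ φ).trans ⟨?_, fun h => ?_⟩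
  · rintro ⟨ψ, rfl⟩ j
    simp
  · refine ⟨φ.comp C, ringHom_ext (fun a => ?_) fun j => ?_⟩
    · simp
    · simp [h j]

instance isImmersion_originSub : IsImmersion (originSub k).hom := by
  have : IsClosedImmersion (Spec.map (CommRingCat.ofHom (eval (0 : Fin k → ℂ)))) :=
    IsClosedImmersion.spec_of_surjective _ fun a => ⟨C a, eval_C a⟩
  change IsImmersion (Spec.map (CommRingCat.ofHom (eval (0 : Fin k → ℂ))))
  infer_instance

instance isImmersion_axisSub : IsImmersion (axisSub k).hom := by
  have : IsClosedImmersion (Spec.map (CommRingCat.ofHom (Ideal.Quotient.mk (axisIdeal k)))) :=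
    IsClosedImmersion.spec_of_surjective _ Ideal.Quotient.mk_surjective
  change IsImmersion (Spec.map (CommRingCat.ofHom (Ideal.Quotient.mk (axisIdeal k))))
  infer_instance

variable [NeZero k]

lemma val_add_one_lt_iff (i : Fin k) : i.val + 1 < k ↔ i ≠ Fin.rev 0 := by
  have := i.2
  rw [Ne, Fin.ext_iff, Fin.val_rev, Fin.val_zero]
  omega

lemma forall_mem_axisIdeal_iff (φ : Aneg k →+* B) :
    (∀ a ∈ axisIdeal k, φ a = 0) ↔ ∀ j, j ≠ Fin.rev 0 → φ (X j) = 0 := by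
  constructor
  · intro h j hj
    exact h _ (Ideal.subset_span ⟨j, (val_add_one_lt_iff j).2 hj, rfl⟩)
  · intro h
    have : axisIdeal k ≤ RingHom.ker φ := by
      refine Ideal.span_le.2 ?_
      rintro _ ⟨i, hi, rfl⟩
      exact h i ((val_add_one_lt_iff i).1 hi)
    exact fun a ha => this ha

lemma factors_axisSub_iff (φ : Aneg k →+* B) :
    Factors (axisSub k) φ ↔ ∀ j, j ≠ Fin.rev 0 → φ (X j) = 0 :=
  (factors_quotient_iff _ φ).trans (forall_mem_axisIdeal_iff φ)

lemma factors_puncturedAxisSub_iff (φ : Aneg k →+* B) : Factors (puncturedAxisSub k) φ ↔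
    (∀ j, j ≠ Fin.rev 0 → φ (X j) = 0) ∧ IsUnit (φ (X (Fin.rev 0))) := by
  refine (factors_spec_iff _ φ).trans ?_
  set x := Ideal.Quotient.mk (axisIdeal k) (X (Fin.rev 0)) with hx
  have e : algebraMap (Aneg k) (Localization.Away x) =
    (algebraMap (Aneg k ⧸ axisIdeal k) (Localization.Away x)).comp
      (Ideal.Quotient.mk (axisIdeal k)) := IsScalarTower.algebraMap_eq _ _ _
  rw [e]
  constructor
  · rintro ⟨ψ, rfl⟩
    constructor
    · rw [← forall_mem_axisIdeal_iff]
      intro a ha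
      rw [RingHom.comp_apply, RingHom.comp_apply, Ideal.Quotient.eq_zero_iff_mem.2 ha, map_zero,
        map_zero]
    · rw [RingHom.comp_apply, RingHom.comp_apply]
      exact (IsLocalization.Away.algebraMap_isUnit x).map ψ
  · rintro ⟨h1, h2⟩
    rw [← forall_mem_axisIdeal_iff] at h1
    have h3 : IsUnit (Ideal.Quotient.lift (axisIdeal k) φ h1 x) := by
      rwa [hx, Ideal.Quotient.lift_mk]
    refine ⟨IsLocalization.Away.lift x h3, ?_⟩
    rw [← RingHom.comp_assoc, IsLocalization.Away.lift_comp, Ideal.Quotient.lift_comp_mk]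

instance isImmersion_puncturedAxisSub : IsImmersion (puncturedAxisSub k).hom := by
  set x := Ideal.Quotient.mk (axisIdeal k) (X (Fin.rev 0)) with hx
  have e : algebraMap (Aneg k) (Localization.Away x) =
    (algebraMap (Aneg k ⧸ axisIdeal k) (Localization.Away x)).comp
      (Ideal.Quotient.mk (axisIdeal k)) := IsScalarTower.algebraMap_eq _ _ _
  change IsImmersion (Spec.map (CommRingCat.ofHom (algebraMap (Aneg k) (Localization.Away x))))
  rw [e, CommRingCat.ofHom_comp, Spec.map_comp]
  have h1 : IsClosedImmersion (Spec.map (CommRingCat.ofHom (Ideal.Quotient.mk (axisIdeal k)))) :=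
    IsClosedImmersion.spec_of_surjective _ Ideal.Quotient.mk_surjective
  have h2 : IsOpenImmersion (Spec.map (CommRingCat.ofHom
      (algebraMap (Aneg k ⧸ axisIdeal k) (Localization.Away x)))) :=
    IsOpenImmersion.of_isLocalization x
  infer_instance

lemma ker_le_of_mem_range {A : Type} [CommRing A] {C : Type} [CommRing C]
    {q : A →+* C} {p : Spec (CommRingCat.of A)}
    (hp : p ∈ Set.range (Spec.map (CommRingCat.ofHom q))) :
    RingHom.ker q ≤ p.asIdeal := by
  obtain ⟨x, rfl⟩ := hp
  intro a ha
  change q a ∈ x.asIdeal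
  rw [RingHom.mem_ker.1 ha]
  exact Ideal.zero_mem _

/-- The last axis is the union of the punctured axis and the origin. -/
lemma range_axisSub : Set.range (axisSub k).hom =
    Set.range (puncturedAxisSub k).hom ∪ Set.range (originSub k).hom := by
  have hker : ∀ (p : PrimeSpectrum (Aneg k)) (a : Aneg k),
      algebraMap (Aneg k) (Ideal.ResidueField p.asIdeal) a = 0 ↔ a ∈ p.asIdeal :=
    fun p a => Ideal.algebraMap_residueField_eq_zero
  apply Set.Subset.antisymm
  · intro (p : PrimeSpectrum (Aneg k)) hp
    have h1 := ker_le_of_mem_range hp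
    rw [Ideal.mk_ker] at h1
    have h2 : ∀ j, j ≠ Fin.rev 0 → algebraMap (Aneg k) (Ideal.ResidueField p.asIdeal) (X j) = 0 :=
      (forall_mem_axisIdeal_iff _).1 fun a ha => (hker p a).2 (h1 ha)
    by_cases h3 : algebraMap (Aneg k) (Ideal.ResidueField p.asIdeal) (X (Fin.rev 0)) = 0
    · refine .inr (mem_range_of_factors ((factors_originSub_iff _).2 fun j => ?_))
      by_cases hj : j = Fin.rev 0
      · rw [hj, h3]
      · exact h2 j hj
    · exact .inl (mem_range_of_factors ((factors_puncturedAxisSub_iff _).2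
        ⟨h2, isUnit_iff_ne_zero.2 h3⟩))
  · rintro (p : PrimeSpectrum (Aneg k)) (hp | hp)
    · have h1 := ker_le_of_mem_range hp
      refine mem_range_of_factors ((factors_axisSub_iff _).2 fun j hj => (hker p _).2 (h1 ?_))
      have h4 := (factors_puncturedAxisSub_iff (k := k) (algebraMap (Aneg k) (Localization.Away
        (Ideal.Quotient.mk (axisIdeal k) (X (Fin.rev 0)))))).1
        ((factors_spec_iff _ _).2 ⟨RingHom.id _, RingHom.id_comp _⟩)
      exact h4.1 j hj
    · have h1 := ker_le_of_mem_range hp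
      refine mem_range_of_factors ((factors_axisSub_iff _).2 fun j hj => (hker p _).2 (h1 ?_))
      simp

end Axis

end SQH

/-! ### The strata defined by minors and the two stratifications -/

namespace SQH

open MvPolynomial

/-- The ideal generated by the minors of size `r` of `E`. -/
def minorIdeal {m m' : Type} [Fintype m] [Fintype m'] {A : Type} [CommRing A] (E : Matrix m m' A)
    (r : ℕ) : Ideal A :=
  Ideal.span {b | ∃ (f : Fin r → m) (g : Fin r → m'), b = (E.submatrix f g).det}

lemma minorIdeal_map {m m' : Type} [Fintype m] [Fintype m'] {A B : Type} [CommRing A] [CommRing B]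
    (φ : A →+* B) (E : Matrix m m' A) (r : ℕ) :
    minorIdeal (E.map φ) r = (minorIdeal E r).map φ := by
  rw [minorIdeal, minorIdeal, Ideal.map_span]
  congr 1
  have e : ∀ (f : Fin r → m) (g : Fin r → m'),
      ((E.map φ).submatrix f g).det = φ (E.submatrix f g).det := fun f g => by
    rw [RingHom.map_det]; rfl
  ext b
  constructor
  · rintro ⟨f, g, rfl⟩
    exact ⟨_, ⟨f, g, rfl⟩, (e f g).symm⟩
  · rintro ⟨_, ⟨f, g, rfl⟩, rfl⟩
    exact ⟨f, g, (e f g).symm⟩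

lemma constRank_map_iff {m m' : Type} [Fintype m] [Fintype m'] {A B : Type} [CommRing A]
    [CommRing B] (φ : A →+* B) (E : Matrix m m' A) (r : ℕ) :
    ConstRank (E.map φ) r ↔
      (∀ a ∈ minorIdeal E (r + 1), φ a = 0) ∧ (minorIdeal E r).map φ = ⊤ := by
  rw [constRank_iff_minorRank, ← minorIdeal_map]
  refine and_congr ?_ Iff.rfl
  have h : (∀ a ∈ minorIdeal E (r + 1), φ a = 0) ↔ minorIdeal (E.map φ) (r + 1) = ⊥ := by
    rw [minorIdeal_map, Ideal.map_eq_bot_iff_le_ker]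
    rfl
  rw [h, minorIdeal, Ideal.span_eq_bot]
  constructor
  · rintro h _ ⟨f, g, rfl⟩
    exact h f g
  · exact fun h f g => h _ ⟨f, g, rfl⟩

namespace Setup

variable {n k : ℕ} (D : Setup n k)

/-- The locally closed subscheme of `T_-` where the matrices `jumpMatrix h i` have rank `r i`. -/
def minorStratum (h : Matrix (Fin k) (Fin k) (Aneg k)) (r : Fin (D.s + 1) → ℕ) :
    Over (Spec (CommRingCat.of (Aneg k))) :=
  locClosedSub (⨆ i : Fin (D.s + 1), minorIdeal (D.jumpMatrix h (RingHom.id _) i) (r i + 1))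
    (∏ i : Fin (D.s + 1), minorIdeal (D.jumpMatrix h (RingHom.id _) i) (r i))

lemma factors_minorStratum_iff (h : Matrix (Fin k) (Fin k) (Aneg k)) (r : Fin (D.s + 1) → ℕ)
    {B : Type} [CommRing B] (φ : Aneg k →+* B) :
    Factors (D.minorStratum h r) φ ↔ D.InStratum h φ r := by
  have e : ∀ i : Fin (D.s + 1), D.jumpMatrix h φ i =
      (D.jumpMatrix h (RingHom.id _) i).map φ := fun i => by
    rw [jumpMatrix_map, RingHom.comp_id]
  rw [minorStratum, factors_locClosedSub_iff, InStratum]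
  simp only [e, constRank_map_iff]
  rw [forall_and]
  refine and_congr ?_ ?_
  · change (⨆ i : Fin (D.s + 1), minorIdeal (D.jumpMatrix h (RingHom.id _) i) (r i + 1)) ≤
      RingHom.ker φ ↔ _
    rw [iSup_le_iff]
    rfl
  -- A finite product of ideals is the unit ideal if and only if every factor is. One open set thus
  -- encodes all the nonvanishing conditions.
  · have hprod := map_prod (Ideal.mapHom φ)
      (fun i : Fin (D.s + 1) => minorIdeal (D.jumpMatrix h (RingHom.id _) i) (r i)) Finset.univ
    simp only [Ideal.mapHom_apply] at hprod
    rw [hprod]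
    constructor
    · intro h1 i
      rw [eq_top_iff, ← h1]
      exact Ideal.prod_le_inf.trans (Finset.inf_le (Finset.mem_univ i))
    · intro h1
      rw [← Ideal.one_eq_top]
      exact Finset.prod_eq_one fun i _ => (h1 i).trans Ideal.one_eq_top.symm

section NeZero

variable [NeZero k]

open Classical in
/-- The strata of the flattening stratification of the truncated Tjurina algebras. -/
def stratum (h : Matrix (Fin k) (Fin k) (Aneg k)) (r : Fin (D.s + 1) → ℕ) :
    Over (Spec (CommRingCat.of (Aneg k))) :=
  -- Explicit models are used for the two special vectors; they represent the same condition as the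
  -- minors, so the claimed isomorphisms become equalities.
  if r = 0 then originSub k else if r = D.rOne then puncturedAxisSub k else D.minorStratum h r

lemma rOne_ne_zero : D.rOne ≠ 0 := fun h => by
  have := congrFun h (Fin.last D.s)
  rw [rOne, Pi.single_eq_same] at this
  exact one_ne_zero this

lemma stratum_zero (h : Matrix (Fin k) (Fin k) (Aneg k)) : D.stratum h 0 = originSub k :=
  if_pos rfl

lemma stratum_rOne (h : Matrix (Fin k) (Fin k) (Aneg k)) :
    D.stratum h D.rOne = puncturedAxisSub k := by
  rw [stratum, if_neg D.rOne_ne_zero, if_pos rfl]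

instance isImmersion_stratum (h : Matrix (Fin k) (Fin k) (Aneg k)) (r : Fin (D.s + 1) → ℕ) :
    IsImmersion (D.stratum h r).hom := by
  by_cases h0 : r = 0
  · rw [h0, stratum_zero]; exact isImmersion_originSub
  · by_cases h1 : r = D.rOne
    · rw [h1, stratum_rOne]; exact isImmersion_puncturedAxisSub
    · rw [stratum, if_neg h0, if_neg h1]; exact isImmersion_locClosedSub _ _

variable {D} {N : Fin k → Conv n (Aneg k)} {ν : Fin k → ℤ} {h : Matrix (Fin k) (Fin k) (Aneg k)}

namespace IsSymmetricSystem

variable (hS : D.IsSymmetricSystem N ν h)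

include hS

lemma factors_stratum_iff (r : Fin (D.s + 1) → ℕ) {B : Type} [CommRing B] (φ : Aneg k →+* B) :
    Factors (D.stratum h r) φ ↔ D.InStratum h φ r := by
  rw [stratum]
  split_ifs with h0 h1
  · rw [h0, factors_originSub_iff, hS.inStratum_zero_iff]
  · rw [h1, factors_puncturedAxisSub_iff, hS.inStratum_rOne_iff]
  · exact D.factors_minorStratum_iff h r φ

/-- The values of the ranks at the points of `Spec A_-` are taken at closed points. -/
lemma exists_mem_Sig (p : PrimeSpectrum (Aneg k)) :
    ∃ r ∈ D.Sig, D.InStratum h (algebraMap (Aneg k) (Ideal.ResidueField p.asIdeal)) r := by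
  set φ := algebraMap (Aneg k) (Ideal.ResidueField p.asIdeal) with hφ
  have hker : ∀ a, φ a = 0 ↔ a ∈ p.asIdeal := fun a => Ideal.algebraMap_residueField_eq_zero
  let r : Fin (D.s + 1) → ℕ := fun i => (D.jumpMatrix h φ i).rank
  have hr : D.InStratum h φ r := fun i => (constRank_field_iff _ _).2 rfl
  refine ⟨r, ?_, hr⟩
  have h1 := (D.factors_minorStratum_iff h r φ).2 hr
  rw [minorStratum, factors_locClosedSub_iff] at h1
  obtain ⟨h1, h2⟩ := h1
  have h3 : ∃ b ∈ ∏ i : Fin (D.s + 1), minorIdeal (D.jumpMatrix h (RingHom.id _) i) (r i),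
      b ∉ p.asIdeal := by
    by_contra hc
    push Not at hc
    have h4 := (Ideal.map_eq_bot_iff_le_ker φ).2 fun a ha => (hker a).2 (hc a ha)
    rw [h4] at h2
    exact bot_ne_top h2
  obtain ⟨b, hb, hbp⟩ := h3
  have hp : p.asIdeal.IsPrime := p.isPrime
  -- By the Nullstellensatz a prime is the ideal of its closed points. Hence some closed point `t`
  -- of its zero set has `b ≠ 0`, and the minors show that the ranks at `t` are those at the prime.
  rw [← IsPrime.vanishingIdeal_zeroLocus (K := ℂ) p.asIdeal, mem_vanishingIdeal_iff] at hbp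
  push Not at hbp
  obtain ⟨t, ht, hbt⟩ := hbp
  refine ⟨t, ?_⟩
  rw [hS.hasJump_iff_inStratum, ← factors_minorStratum_iff, minorStratum, factors_locClosedSub_iff]
  refine ⟨fun a ha => ?_, ?_⟩
  · exact ht a ((hker a).1 (h1 a ha))
  · exact Ideal.eq_top_of_isUnit_mem _ (Ideal.mem_map_of_mem _ hb) (isUnit_iff_ne_zero.2 hbt)

lemma le_mu {r : Fin (D.s + 1) → ℕ} (hr : r ∈ D.Sig) (i : Fin (D.s + 1)) :
    r i ≤ D.mu (D.idx i) := by
  obtain ⟨t, ht⟩ := hr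
  have := ht i
  omega

lemma T_flat_iff_inStratum {r : Fin (D.s + 1) → ℕ} (hr : r ∈ D.Sig) (B : Type) [CommRing B]
    [Algebra (Aneg k) B] :
    (∀ i : Fin (D.s + 1), Module.Flat B (B ⊗[Aneg k] D.T (D.idx i)) ∧ ∀ p : PrimeSpectrum B,
      Module.rankAtStalk (R := B) (B ⊗[Aneg k] D.T (D.idx i)) p = D.mu (D.idx i) - r i) ↔
    D.InStratum h (algebraMap (Aneg k) B) r :=
  forall_congr' fun i => hS.T_flat_rank_iff i B (hS.le_mu hr i)

theorem isFlatteningStratification_stratum :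
    IsFlatteningStratification (fun r : D.Sig => D.stratum h r.1)
      (fun i : Fin (D.s + 1) => D.T (D.idx i)) (fun r i => D.mu (D.idx i) - r.1 i) where
  immersion r := D.isImmersion_stratum h r.1
  nonempty := by
    rintro ⟨r, t, ht⟩
    exact nonempty_of_factors ((hS.factors_stratum_iff r _).2 ((hS.hasJump_iff_inStratum t r).1 ht))
  cover p := by
    obtain ⟨r, hr, hr'⟩ := hS.exists_mem_Sig p
    exact ⟨⟨r, hr⟩, mem_range_of_factors ((hS.factors_stratum_iff r _).2 hr')⟩
  rk_injective r r' hrr := by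
    ext i
    have h1 := congrFun hrr i
    have h2 := hS.le_mu r.2 i
    have h3 := hS.le_mu r'.2 i
    simp only at h1
    omega
  universal r B _ _ :=
    (hS.factors_stratum_iff r.1 _).trans (hS.T_flat_iff_inStratum r.2 B).symm

lemma zero_mem_Sig : 0 ∈ D.Sig :=
  ⟨0, (hS.hasJump_iff_inStratum _ _).2 (hS.inStratum_zero_iff.2 fun j => by simp)⟩

lemma rOne_mem_Sig : D.rOne ∈ D.Sig := by
  classical
  refine ⟨Pi.single (Fin.rev 0) 1, (hS.hasJump_iff_inStratum _ _).2 (hS.inStratum_rOne_iff.2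
    ⟨fun j hj => ?_, ?_⟩)⟩
  · rw [eval_X, Pi.single_eq_of_ne hj]
  · rw [eval_X, Pi.single_eq_same]; exact isUnit_one

/-- The strata of one symmetric system, merged along the last axis, are the flattening
stratification of the modules which belong to another one. -/
theorem isFlatteningStratification_merged {N' : Fin k → Conv n (Aneg k)} {ν' : Fin k → ℤ}
    {h' : Matrix (Fin k) (Fin k) (Aneg k)} (hS' : D.IsSymmetricSystem N' ν' h') :
    IsFlatteningStratification (mergedStrata D fun r : D.Sig => D.stratum h r.1)
      (D.homFamily ν') (fun r => D.homRank ν' r.1) where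
  immersion r := by
    by_cases h1 : r.1 = D.rOne
    · rw [mergedStrata, if_pos h1]; exact isImmersion_axisSub
    · rw [mergedStrata, if_neg h1]; exact D.isImmersion_stratum h r.1
  nonempty r := by
    rw [mergedStrata]
    split_ifs
    · exact nonempty_of_factors ((factors_axisSub_iff (eval (0 : Fin k → ℂ))).2 fun j _ => by simp)
    · obtain ⟨r, ⟨t, ht⟩, -⟩ := r
      exact nonempty_of_factors ((hS.factors_stratum_iff r _).2
        ((hS.hasJump_iff_inStratum t r).1 ht))
  cover p := by
    obtain ⟨r, hr⟩ := hS.isFlatteningStratification_stratum.cover p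
    by_cases hr' : r.1 = 0 ∨ r.1 = D.rOne
    · refine ⟨⟨D.rOne, hS.rOne_mem_Sig, D.rOne_ne_zero⟩, ?_⟩
      rw [mergedStrata, if_pos rfl, range_axisSub]
      rcases hr' with h1 | h1
      · rw [h1, stratum_zero] at hr
        exact .inr hr
      · rw [h1, stratum_rOne] at hr
        exact .inl hr
    · push Not at hr'
      refine ⟨⟨r.1, r.2, hr'.1⟩, ?_⟩
      rw [mergedStrata, if_neg hr'.2]
      exact hr
  rk_injective := hS'.homRank_injective
  universal r B _ _ := by
    rw [hS'.homFamily_flat_rank_iff r.2.1 r.2.2 B, mergedStrata]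
    split_ifs with h1
    · rw [h1, factors_axisSub_iff, hS'.inHomStratum_rOne_iff]
    -- The strata come from one symmetric system and the Hom modules from another. Flatness of the
    -- modules `T`, which depends on neither, translates between them.
    · rw [hS.factors_stratum_iff, ← hS.T_flat_iff_inStratum r.2.1,
        hS'.T_flat_iff_inStratum r.2.1]
      rcases hS'.eq_rOne_or_exists r.2.1 r.2.2 with h2 | ⟨i₀, hi₀, h2, h3⟩
      · exact absurd h2 h1
      · exact (hS'.inHomStratum_iff r.2.1 hi₀ h2 h3).symm

end IsSymmetricSystem

end NeZero

end Setup

end SQH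

end

theorem lemma4p3 {n k : ℕ} [NeZero k] (D : SQH.Setup n k) :
    ∃ U : D.Sig → CategoryTheory.Over
        (AlgebraicGeometry.Spec (CommRingCat.of (SQH.Aneg k))),
      SQH.IsFlatteningStratification U (fun i : Fin (D.s + 1) => D.T (D.idx i))
          (fun r i => D.mu (D.idx i) - r.1 i) ∧
      (∀ (r : D.Sig) (t : Fin k → ℂ),
          SQH.Factors (U r) (MvPolynomial.eval t) ↔ D.HasJump t r.1) ∧
      (∃ (h0 : 0 ∈ D.Sig) (h1 : D.rOne ∈ D.Sig),
          Nonempty (U ⟨0, h0⟩ ≅ SQH.originSub k) ∧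
          Nonempty (U ⟨D.rOne, h1⟩ ≅ SQH.puncturedAxisSub k) ∧
          Set.range (SQH.axisSub k).hom =
            Set.range (U ⟨D.rOne, h1⟩).hom ∪ Set.range (U ⟨0, h0⟩).hom) ∧
      (∃ N ν h, D.IsSymmetricSystem N ν h) ∧
      (∀ N ν h, D.IsSymmetricSystem N ν h →
        ∃ rk, SQH.IsFlatteningStratification (SQH.mergedStrata D U) (D.homFamily ν) rk) := by
  obtain ⟨N₀, ν₀, h₀, hS⟩ := D.exists_isSymmetricSystem
  refine ⟨fun r => D.stratum h₀ r.1, hS.isFlatteningStratification_stratum, fun r t => ?_,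
    ⟨hS.zero_mem_Sig, hS.rOne_mem_Sig, ?_, ?_, ?_⟩, ⟨N₀, ν₀, h₀, hS⟩,
    fun N ν h hS' => ⟨_, hS.isFlatteningStratification_merged hS'⟩⟩
  · rw [hS.factors_stratum_iff, hS.hasJump_iff_inStratum]
  · exact ⟨CategoryTheory.eqToIso (D.stratum_zero h₀)⟩
  · exact ⟨CategoryTheory.eqToIso (D.stratum_rOne h₀)⟩
  · beta_reduce
    rw [SQH.range_axisSub, D.stratum_zero, D.stratum_rOne]
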